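/- **The model.** Fix an integer $M\ge 0$. Let $\{u_\tau(k)\}$, $\tau\in\{0,1,2,\dots\}$, $k\in\mathbb Z$, be i.i.d. random vectors $u_\tau(k)=(u_\tau(k,j))_{j\in\mathbb Z}$ on a probability space, with law $\mathbb P$ and expectation $\mathbb E$, that almost surely satisfy $u_\tau(k,j)\ge 0$, $u_\tau(k,j)=0$ for $|j|>M$, and $\sum_{|j|\le M}u_\tau(k,j)=1$. Given an initial height function $\sigma_0:\mathbb Z\to\mathbb R$, the random average process is defined by $$\sigma_\tau(k)=\sum_{|j|\le M}u_\tau(k,j)\,\sigma_{\tau-1}(k+j),\qquad \tau=1,2,3,\dots,\ k\in\mathbb Z .$$ **Constants.** Let $p(0,j)=\mathbb E\,u_0(0,j)$, $D=\sum_x x\,u_0(0,x)$, $V=\mathbb E D$, $b=-V$, $\sigma_D^2=\mathbb E[(D-V)^2]$, $\sigma_a^2=\sum_x(x-V)^2p(0,x)$, $$\lambda(t)=\mathbb E\Bigl[\Bigl|\sum_x u_0(0,x)e^{itx}\Bigr|^2\Bigr],\quad \bar\lambda(t)=\Bigl|\sum_x p(0,x)e^{itx}\Bigr|^2,\quad \beta=\frac1{2\pi}\int_{-\pi}^{\pi}\frac{1-\lambda(t)}{1-\bar\lambda(t)}\,dt,\quad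 \kappa=\frac{\sigma_D^2}{\beta\,\sigma_a^2}.$$ For $(s,q),(t,r)\in[0,\infty)\times\mathbb R$ let $$\Gamma_q((s,q),(t,r))=\frac\kappa2\int_{\sigma_a^2|t-s|}^{\sigma_a^2(t+s)}\frac1{\sqrt{2\pi w}}\exp\Bigl\{-\frac{(q-r)^2}{2w}\Bigr\}\,dw$$ and, with $B$ a standard one-dimensional Brownian motion under $P$, $$\begin{aligned}\Gamma_0((s,q),(t,r))&=\int_{q\vee r}^\infty P[\sigma_aB(s)>x-q]\,P[\sigma_aB(t)>x-r]\,dx\\&\quad-\Bigl\{\mathbf 1_{\{r>q\}}\int_q^r P[\sigma_aB(s)>x-q]\,P[\sigma_aB(t)\le x-r]\,dx\\&\qquad\quad+\mathbf 1_{\{q>r\}}\int_r^q P[\sigma_aB(s)\le x-q]\,P[\sigma_aB(t)>x-r]\,dx\Bigr\}\\&\quad+\int_{-\infty}^{q\wedge r}P[\sigma_aB(s)\le x-q]\,P[\sigma_aB(t)\le x-r]\,dx .\end{aligned}$$ **Theorem.** Assume that $\mathbb P\{\max_j u_0(0,j)<1\}>0$ and that $p(0,\cdot)$ has span $1$, that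 is, there are no integers $h>1$ and $x$ with $\sum_{k\in\mathbb Z}p(0,x+kh)=1$. Let $\varrho,v:\mathbb R\to\mathbb R$ be bounded functions such that for every compact interval $[a,c]$ there are $C<\infty$ and $\gamma>1/2$ with $$|\varrho(x)-\varrho(y)|+|v(x)-v(y)|\le C|x-y|^\gamma\quad\text{for all }x,y\in[a,c].$$ For each $n\in\{1,2,3,\dots\}$ let $\sigma^n_\tau$ be a random average process, driven by the weights $u_\tau(k)$, with random initial heights $\sigma_0^n$ such that $\sigma^n_0(0)=0$ and such that the increments $\eta^n_0(i)=\sigma^n_0(i)-\sigma^n_0(i-1)$, $i\in\mathbb Z$, are independent with $$E[\eta^n_0(i)]=\varrho(i/n),\qquad \mathrm{Var}[\eta^n_0(i)]=v(i/n).$$ Assume that $\sup_{n\ge 1,\,i\in\mathbb Z}E[|\eta_0^n(i)|^{2+\alpha}]<\infty$ for some $\alpha>0$, that all the $\sigma^n_0$ are defined on the same probability space as the weights, and that the family of weights is independent of the family $\{\sigma_0^n:n\ge 1\}$. Fix $\bar y\in\mathbb R$ and, for $(t,r)\in[0,\infty)\times\mathbb R$, put $$z_n(t,r)=n^{-1/4}\Bigl\{\sigma^n_{\lfloor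 nt\rfloor}\bigl(\lfloor n\bar y\rfloor+\lfloor r\sqrt n\rfloor+\lfloor ntb\rfloor\bigr)-\sigma^n_0\bigl(\lfloor n\bar y\rfloor+\lfloor r\sqrt n\rfloor\bigr)\Bigr\}.$$ Then there is a mean-zero Gaussian process $\{z(t,r):(t,r)\in[0,\infty)\times\mathbb R\}$ with covariance $$E\,z(s,q)z(t,r)=\varrho(\bar y)^2\,\Gamma_q((s,q),(t,r))+v(\bar y)\,\Gamma_0((s,q),(t,r)),$$ and the finite-dimensional distributions of $z_n$ converge weakly to those of $z$: for all $k$ and all points $(t_1,r_1),\dots,(t_k,r_k)$ in $[0,\infty)\times\mathbb R$, the random vector $(z_n(t_1,r_1),\dots,z_n(t_k,r_k))$ converges in distribution to $(z(t_1,r_1),\dots,z(t_k,r_k))$ as $n\to\infty$. -/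

import Mathlib

open MeasureTheory ProbabilityTheory Filter Topology
open scoped NNReal ENNReal

namespace RAP

noncomputable section

/-- The random weight vectors `u_τ(k) = (u_τ(k, j))_j` of a random average process of range `M`,
as random elements `u τ k : Ω → (ℤ → ℝ)`: almost surely each of them is a probability vector
supported on `{-M, ..., M}`, and the vectors are independent and identically distributed over the
space-time points `(τ, k)`. -/
structure IsEnvironment {Ω : Type*} [MeasurableSpace Ω] (μ : Measure Ω) (M : ℕ)
    (u : ℕ → ℤ → Ω → ℤ → ℝ) : Prop where
  measurable : ∀ τ k, Measurable (u τ k)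
  nonneg : ∀ τ k, ∀ᵐ ω ∂μ, ∀ j, 0 ≤ u τ k ω j
  range : ∀ τ k, ∀ᵐ ω ∂μ, ∀ j : ℤ, (M : ℤ) < |j| → u τ k ω j = 0
  sum_eq_one : ∀ τ k, ∀ᵐ ω ∂μ, ∑ j ∈ Finset.Icc (-(M : ℤ)) M, u τ k ω j = 1
  indep : iIndepFun (fun p : ℕ × ℤ => u p.1 p.2) μ
  identDistrib : ∀ τ k, IdentDistrib (u τ k) (u 0 0) μ μ

/-- The height function `σ_τ` of the random average process with weights `w τ k j` and initial
heights `s`: `σ_τ(k) = ∑_{|j| ≤ M} w_τ(k, j) σ_{τ-1}(k + j)` for `τ = 1, 2, ...`. -/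
def height (M : ℕ) (w : ℕ → ℤ → ℤ → ℝ) (s : ℤ → ℝ) : ℕ → ℤ → ℝ
  | 0, k => s k
  | τ + 1, k => ∑ j ∈ Finset.Icc (-(M : ℤ)) M, w (τ + 1) k j * height M w s τ (k + j)

/-! In the next definitions `w : Ω → ℤ → ℝ` is a single random weight vector `u_0(0, ·)`. -/

section Constants

variable {Ω : Type*} [MeasurableSpace Ω] (μ : Measure Ω) (M : ℕ) (w : Ω → ℤ → ℝ)

/-- The ellipticity condition `P{max_j u_0(0, j) < 1} > 0`. -/
def Elliptic : Prop :=
  0 < μ {ω | ∀ j ∈ Finset.Icc (-(M : ℤ)) M, w ω j < 1}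

/-- The averaged probabilities `p(0, j) = E u_0(0, j)`. -/
def avgProb (j : ℤ) : ℝ := ∫ ω, w ω j ∂μ

/-- The averaged random walk has span 1: there is no integer `h > 1` such that
`∑_k p(0, x + k h) = 1` for some `x`. -/
def SpanOne : Prop :=
  ¬ ∃ h : ℤ, 1 < h ∧ ∃ x : ℤ, ∑' k : ℤ, avgProb μ w (x + k * h) = 1

/-- The drift `D(ω) = ∑_x x u_0(0, x)`. -/
def drift (ω : Ω) : ℝ := ∑ x ∈ Finset.Icc (-(M : ℤ)) M, (x : ℝ) * w ω x

/-- The mean drift `V = E D`. -/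
def meanDrift : ℝ := ∫ ω, drift M w ω ∂μ

/-- The variance `σ_D² = E (D - V)²` of the drift. -/
def driftVar : ℝ := ∫ ω, (drift M w ω - meanDrift μ M w) ^ 2 ∂μ

/-- The variance `σ_a² = ∑_x (x - V)² p(0, x)` of the averaged walk. -/
def avgVar : ℝ :=
  ∑ x ∈ Finset.Icc (-(M : ℤ)) M, ((x : ℝ) - meanDrift μ M w) ^ 2 * avgProb μ w x

/-- The random characteristic function `φ^ω(t) = ∑_x u_0(0, x) e^{itx}`. -/
def randChar (ω : Ω) (t : ℝ) : ℂ :=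
  ∑ x ∈ Finset.Icc (-(M : ℤ)) M, (w ω x : ℂ) * Complex.exp (Complex.I * t * x)

/-- The averaged characteristic function `φ_a(t) = ∑_x p(0, x) e^{itx}`. -/
def avgChar (t : ℝ) : ℂ :=
  ∑ x ∈ Finset.Icc (-(M : ℤ)) M, (avgProb μ w x : ℂ) * Complex.exp (Complex.I * t * x)

/-- `λ(t) = E |φ^ω(t)|²`. -/
def lam (t : ℝ) : ℝ := ∫ ω, ‖randChar M w ω t‖ ^ 2 ∂μ

/-- `λ̄(t) = |φ_a(t)|²`. -/
def lamBar (t : ℝ) : ℝ := ‖avgChar μ M w t‖ ^ 2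

/-- `β = (2π)⁻¹ ∫_{-π}^{π} (1 - λ(t)) / (1 - λ̄(t)) dt`. -/
def beta : ℝ :=
  1 / (2 * Real.pi) *
    ∫ t in (-Real.pi)..Real.pi, (1 - lam μ M w t) / (1 - lamBar μ M w t)

/-- `κ = σ_D² / (β σ_a²)`. -/
def kappa : ℝ := driftVar μ M w / (beta μ M w * avgVar μ M w)

end Constants

/-- The function `Γ_q((s, q), (t, r))` with parameters `κ` and `σ_a²`. -/
def GammaQ (κ σa2 : ℝ) (a b : ℝ≥0 × ℝ) : ℝ :=
  κ / 2 * ∫ v in (σa2 * |(b.1 : ℝ) - a.1|)..(σa2 * ((b.1 : ℝ) + a.1)),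
    1 / √(2 * Real.pi * v) * Real.exp (-(1 / (2 * v)) * (a.2 - b.2) ^ 2)

/-- The law of `σ_a B(t)`, with `B` a standard Brownian motion: the centered Gaussian law with
variance `σ_a² t`, which is the point mass at `0` when `t = 0`. -/
def scaledBMLaw (σa2 : ℝ) (t : ℝ≥0) : Measure ℝ := gaussianReal 0 (σa2.toNNReal * t)

/-- `P[σ_a B(t) > y]`. -/
def probGT (σa2 : ℝ) (t : ℝ≥0) (y : ℝ) : ℝ := (scaledBMLaw σa2 t).real (Set.Ioi y)

/-- `P[σ_a B(t) ≤ y]`. -/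
def probLE (σa2 : ℝ) (t : ℝ≥0) (y : ℝ) : ℝ := (scaledBMLaw σa2 t).real (Set.Iic y)

/-- The function `Γ_0((s, q), (t, r))` with parameter `σ_a²`. -/
def Gamma0 (σa2 : ℝ) (a b : ℝ≥0 × ℝ) : ℝ :=
  (∫ x in Set.Ioi (max a.2 b.2), probGT σa2 a.1 (x - a.2) * probGT σa2 b.1 (x - b.2))
  - ((if a.2 < b.2 then
        ∫ x in a.2..b.2, probGT σa2 a.1 (x - a.2) * probLE σa2 b.1 (x - b.2) else 0)
    + (if b.2 < a.2 then
        ∫ x in b.2..a.2, probLE σa2 a.1 (x - a.2) * probGT σa2 b.1 (x - b.2) else 0))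
  + ∫ x in Set.Iio (min a.2 b.2), probLE σa2 a.1 (x - a.2) * probLE σa2 b.1 (x - b.2)

/-- Local Hölder continuity of the profiles `ϱ` and `v`: on each compact interval with some
exponent larger than `1/2`. -/
def LocallyHolder (rho v : ℝ → ℝ) : Prop :=
  ∀ a b : ℝ, ∃ C γ : ℝ, 1 / 2 < γ ∧ ∀ x ∈ Set.Icc a b, ∀ y ∈ Set.Icc a b,
    |rho x - rho y| + |v x - v y| ≤ C * |x - y| ^ γ

/-- The assumptions on the initial heights `σ^n_0`, `n = 1, 2, ...`: `σ^n_0(0) = 0`, and the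
increments `η^n_0(i) = σ^n_0(i) - σ^n_0(i - 1)` are, for each `n`, independent over `i`, with mean
`ϱ(i/n)` and variance `v(i/n)`, and have moments of some order `2 + α > 2` bounded uniformly in
`n` and `i`. -/
structure IsInitialHeights {Ω : Type*} [MeasurableSpace Ω] (μ : Measure Ω) (rho v : ℝ → ℝ)
    (s : ℕ+ → ℤ → Ω → ℝ) : Prop where
  measurable : ∀ n i, Measurable (s n i)
  zero : ∀ n, ∀ᵐ ω ∂μ, s n 0 ω = 0
  indep : ∀ n, iIndepFun (fun (i : ℤ) (ω : Ω) => s n i ω - s n (i - 1) ω) μ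
  mean : ∀ (n : ℕ+) (i : ℤ), ∫ ω, (s n i ω - s n (i - 1) ω) ∂μ = rho (i / n)
  var : ∀ (n : ℕ+) (i : ℤ), variance (fun ω => s n i ω - s n (i - 1) ω) μ = v (i / n)
  moment : ∃ α : ℝ, 0 < α ∧ ∃ C : ℝ≥0, ∀ n i,
    ∫⁻ ω, ENNReal.ofReal (|s n i ω - s n (i - 1) ω| ^ (2 + α)) ∂μ ≤ C

/-- The scaled height fluctuation
`n^{-1/4} {σ_{⌊nt⌋}(⌊n ȳ⌋ + ⌊r √n⌋ + ⌊n t b⌋) - σ_0(⌊n ȳ⌋ + ⌊r √n⌋)}` at the space-time point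
`a = (t, r)`, for the process with weights `w` and initial heights `s`. -/
def fluct (M : ℕ) (b ybar : ℝ) (n : ℕ+) (w : ℕ → ℤ → ℤ → ℝ) (s : ℤ → ℝ) (a : ℝ≥0 × ℝ) : ℝ :=
  (n : ℝ) ^ (-(1 / 4) : ℝ) *
    (height M w s ⌊(n : ℝ) * a.1⌋₊ (⌊(n : ℝ) * ybar⌋ + ⌊a.2 * √(n : ℝ)⌋ + ⌊(n : ℝ) * a.1 * b⌋)
      - s (⌊(n : ℝ) * ybar⌋ + ⌊a.2 * √(n : ℝ)⌋))

end

end RAP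

/-! Read backwards in time, the averaging rule says that a height is the quenched mean of the
initial heights at the endpoint of a random walk whose steps are drawn from the weights. Reflecting
time at a common horizon `N` puts the walks of all observation points into one environment: the walk
belonging to a height at time `τ` starts at time `N - τ`, and all of them are stopped at time `N`
(`height_eq_sum_mass`). Summation by parts then writes each height difference as a sum of initial
increments weighted by the tail sums of a signed measure, namely the quenched law minus a point mass
(`height_sub_eq_sum_tail`).

Let `G` be the linear combination of these tails coming from a test vector `θ`, and let `ε =
n^{-1/4}`. Given the weights, the increments are independent, so their moments of order `2 + α` and
the Hölder exponent above `1/2` bring the conditional characteristic function close to `exp(i ρ ε ∑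
G - v ε² ∑ G² / 2)`, with `ρ` and `v` evaluated at the macroscopic point
(`norm_prod_charFun_sub_le`). Two facts remain: `ε² ∑ G²` becomes deterministic, which gives the
`Γ₀` part, and `ε ∑ G` becomes Gaussian, which gives the `Γ_q` part. The limiting characteristic
function is the product of the two (`tendsto_integral_cexp_heights`).

Both facts rest on one law of large numbers: the quenched mean of `|X - Y|` for two walks in the
same environment, divided by `√n`, converges in `L¹` to the first absolute moment of a normal law
(`tendsto_integral_abs_pairSum_sub`). The integral of `(1 - cos ty)/(1 - cos t)` over a period
equals `2π|y|`, so this mean is an integral of quenched characteristic functions. These concentrate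
around the annealed ones, because one step of the environment adds variance of order `t²` times the
probability that two walks share a site, and such meetings number only `O(√n)`.

For `ε² ∑ G²`, the identity `min(x, y) = (x + y - |x - y|)/2` turns sums of squared tails into mean
absolute differences (`sum_tail_sq`), and `Γ₀` is the matching combination of Gaussian absolute
moments (`Gamma0_eq`).

For `ε ∑ G`, the displacement of the quenched mean is a martingale of the environment, with
quadratic variation `σ_D²` times the number of meetings. Let `a` be the potential kernel of the
symmetrized annealed walk. The conditional mean of `a(X - Y)` does not change in one step, except at
a meeting, where it gains `β`. Since `a(y) = |y|/(2σ_a²) + O(1)`, the meetings up to `N` are a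
difference of two mean absolute differences, up to a martingale of size `n^{1/4}`
(`tendsto_integral_abs_overlap_sub`). The derivative in `w` of the absolute moment of `N(d, w)` is
the Gaussian density, so the limit is `Γ_q` (`gaussAbs_sub_gaussAbs`). A martingale central limit
theorem concludes (`norm_integral_cexp_mart_sub_le`).

The covariance is positive semidefinite because the limits of the characteristic functions have
modulus at most one. A reproducing kernel Hilbert space and an isonormal process then produce the
Gaussian process, and Lévy's continuity theorem gives the convergence of the finite-dimensional
distributions. -/

set_option linter.unusedSectionVars false

namespace RAP

/-! ### Gaussian processes with a prescribed covariance. -/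

section GaussianProcess

lemma norm_exp_I_mul_sub_exp_I_mul_le (x y : ℝ) :
    ‖Complex.exp (x * Complex.I) - Complex.exp (y * Complex.I)‖ ≤ |x - y| := by
  have h : Complex.exp (x * Complex.I) - Complex.exp (y * Complex.I)
      = Complex.exp (y * Complex.I) * (Complex.exp (Complex.I * ((x - y : ℝ) : ℂ)) - 1) := by
    rw [mul_sub, ← Complex.exp_add, mul_one]
    congr 2
    push_cast; ring
  rw [h, norm_mul, Complex.norm_exp_ofReal_mul_I, one_mul]
  exact Real.norm_exp_I_mul_ofReal_sub_one_le

/-- The exponential is 1-Lipschitz on the imaginary axis and the `L¹` norm is at most the `L²` norm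
on a probability space. This passes characteristic functions through `L²`-convergent orthonormal
sums. -/
lemma norm_integral_cexp_sub_le {Ω : Type*} [MeasurableSpace Ω] {P : Measure Ω}
    [IsProbabilityMeasure P] (f g : Lp ℝ 2 P) :
    ‖(∫ x, Complex.exp (f x * Complex.I) ∂P) - ∫ x, Complex.exp (g x * Complex.I) ∂P‖
      ≤ ‖f - g‖ := by
  have hint : ∀ h : Lp ℝ 2 P, Integrable (fun x => Complex.exp (h x * Complex.I)) P := by
    intro h
    refine Integrable.of_bound (C := 1) ?_ (ae_of_all _ fun x => ?_)
    · have := (Lp.aestronglyMeasurable h).aemeasurable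
      exact (by fun_prop : AEMeasurable _ P).aestronglyMeasurable
    · rw [Complex.norm_exp_ofReal_mul_I]
  have hL1 : Integrable (fun x => (f - g : Lp ℝ 2 P) x) P :=
    (Lp.memLp (f - g)).integrable (by norm_num)
  rw [← integral_sub (hint f) (hint g)]
  calc ‖∫ x, (Complex.exp (f x * Complex.I) - Complex.exp (g x * Complex.I)) ∂P‖
      ≤ ∫ x, ‖(f - g : Lp ℝ 2 P) x‖ ∂P := by
        refine norm_integral_le_of_norm_le hL1.norm ?_
        filter_upwards [Lp.coeFn_sub f g] with x hx
        rw [hx]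
        exact norm_exp_I_mul_sub_exp_I_mul_le _ _
    _ = (eLpNorm (f - g : Lp ℝ 2 P) 1 P).toReal := by
        rw [eLpNorm_one_eq_lintegral_enorm, integral_norm_eq_lintegral_enorm hL1.1]
    _ ≤ (eLpNorm (f - g : Lp ℝ 2 P) 2 P).toReal := by
        refine ENNReal.toReal_mono (Lp.eLpNorm_ne_top _) ?_
        exact eLpNorm_le_eLpNorm_of_exponent_le (by norm_num) (Lp.aestronglyMeasurable _)
    _ = ‖f - g‖ := (Lp.norm_def _).symm

/-- Every Hilbert space carries an isonormal Gaussian process. -/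
theorem exists_isonormal (H : Type) [NormedAddCommGroup H] [InnerProductSpace ℝ H]
    [CompleteSpace H] :
    ∃ (Ω' : Type) (_ : MeasurableSpace Ω') (P : Measure Ω') (_ : IsProbabilityMeasure P)
      (Φ : H →ₗᵢ[ℝ] Lp ℝ 2 P),
      ∀ h : H, P.map (Φ h) = gaussianReal 0 (‖h‖ ^ 2).toNNReal := by
  classical
  obtain ⟨w, b, -⟩ := exists_hilbertBasis ℝ H
  -- One independent standard normal variable per vector of a Hilbert basis. These variables are
  -- orthonormal in `L²`, so the basis maps isometrically onto them.
  let P : Measure (w → ℝ) := Measure.infinitePi fun _ => gaussianReal 0 1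
  have hlaw : ∀ i : w, HasLaw (fun x : w → ℝ => x i) (gaussianReal 0 1) P := fun i =>
    ⟨(measurable_pi_apply i).aemeasurable, Measure.infinitePi_map_eval _ i⟩
  have hg : ∀ i : w, HasGaussianLaw (fun x : w → ℝ => x i) P := fun i => (hlaw i).hasGaussianLaw
  have hind : iIndepFun (fun (i : w) (x : w → ℝ) => x i) P :=
    iIndepFun_infinitePi (X := fun _ x => x) fun _ => measurable_id
  have hmem : ∀ i : w, MemLp (fun x : w → ℝ => x i) 2 P := fun i => (hg i).memLp_two
  let ξ : w → Lp ℝ 2 P := fun i => (hmem i).toLp _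
  have hmean : ∀ i : w, ∫ x : w → ℝ, x i ∂P = 0 := fun i => by
    rw [(hlaw i).integral_eq]; simp
  have hξ : Orthonormal ℝ ξ := by
    rw [orthonormal_iff_ite]
    intro i j
    rw [L2.inner_def]
    have h1 : ∫ x, inner ℝ (ξ i x) (ξ j x) ∂P = ∫ x : w → ℝ, x i * x j ∂P := by
      refine integral_congr_ae ?_
      filter_upwards [(hmem i).coeFn_toLp, (hmem j).coeFn_toLp] with x hi hj
      simp only [ξ, hi, hj]
      simp [mul_comm]
    rw [h1]
    split_ifs with hij
    · subst hij
      have hv : Var[fun x : w → ℝ => x i; P] = 1 := by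
        rw [(hlaw i).variance_eq]; simp
      rw [variance_of_integral_eq_zero (hmem i).aestronglyMeasurable.aemeasurable (hmean i)] at hv
      simpa [sq] using hv
    · have := (hind.indepFun hij).integral_fun_mul_eq_mul_integral
        (hmem i).aestronglyMeasurable (hmem j).aestronglyMeasurable
      rw [this, hmean i, zero_mul]
  let Φ : H →ₗᵢ[ℝ] Lp ℝ 2 P :=
    hξ.orthogonalFamily.linearIsometry.comp b.repr.toLinearIsometry
  refine ⟨w → ℝ, inferInstance, P, inferInstance, Φ, fun h => ?_⟩
  have hΦm : AEMeasurable (Φ h) P := (Lp.aestronglyMeasurable _).aemeasurable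
  have : IsProbabilityMeasure (P.map (Φ h)) := Measure.isProbabilityMeasure_map hΦm
  refine Measure.ext_of_charFun (funext fun t => ?_)
  rw [charFun_gaussianReal, charFun_apply_real, integral_map hΦm (by fun_prop)]
  -- The frequency `t` is absorbed into the vector, so only characteristic functions at frequency
  -- one are needed.
  have hval : (∫ x, Complex.exp (t * (Φ h x) * Complex.I) ∂P)
      = ∫ x, Complex.exp ((Φ (t • h) x : ℝ) * Complex.I) ∂P := by
    refine integral_congr_ae ?_
    rw [map_smul]
    filter_upwards [Lp.coeFn_smul t (Φ h)] with x hx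
    rw [hx]; simp
  rw [hval]
  set c := b.repr (t • h) with hc
  have hsum : HasSum (fun i => c i • ξ i) (Φ (t • h)) := by
    have h0 := hξ.orthogonalFamily.hasSum_linearIsometry c
    simp only [LinearIsometry.toSpanSingleton_apply] at h0
    exact h0
  -- The characteristic function is computed in two ways along finite partial sums: as an `L²` limit
  -- here, and by independence as `exp(-∑ cᵢ²/2)` below, where Parseval gives the limit.
  have hlim1 : Tendsto (fun s : Finset w =>
      ∫ x, Complex.exp (((∑ i ∈ s, c i • ξ i : Lp ℝ 2 P) x : ℝ) * Complex.I) ∂P) atTop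
      (𝓝 (∫ x, Complex.exp ((Φ (t • h) x : ℝ) * Complex.I) ∂P)) := by
    rw [tendsto_iff_norm_sub_tendsto_zero]
    refine squeeze_zero (fun _ => norm_nonneg _) (fun s => norm_integral_cexp_sub_le _ _) ?_
    exact tendsto_iff_norm_sub_tendsto_zero.1 hsum
  have hval2 : ∀ s : Finset w,
      (∫ x, Complex.exp (((∑ i ∈ s, c i • ξ i : Lp ℝ 2 P) x : ℝ) * Complex.I) ∂P)
        = Complex.exp (-((∑ i ∈ s, c i ^ 2 : ℝ) : ℂ) / 2) := by
    intro s
    have h1 : ((∑ i ∈ s, c i • ξ i : Lp ℝ 2 P) : (w → ℝ) → ℝ)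
        =ᵐ[P] fun x => ∑ i ∈ s, c i * x i := by
      have h2 := Lp.coeFn_fun_finsetSum s (fun i => c i • ξ i)
      have h3 : ∀ᵐ x ∂P, ∀ i ∈ s, (c i • ξ i : Lp ℝ 2 P) x = c i * x i := by
        rw [Finset.eventually_all]
        intro i _
        filter_upwards [Lp.coeFn_smul (c i) (ξ i), (hmem i).coeFn_toLp] with x hx hy
        rw [hx, Pi.smul_apply, hy, smul_eq_mul]
      filter_upwards [h2, h3] with x hx hy
      rw [hx]
      exact Finset.sum_congr rfl hy
    have h4 : (∫ x, Complex.exp (((∑ i ∈ s, c i • ξ i : Lp ℝ 2 P) x : ℝ) * Complex.I) ∂P)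
        = charFun (P.map fun x => ∑ i ∈ s, c i * x i) 1 := by
      rw [charFun_apply_real, integral_map
        (Finset.measurable_sum s fun i _ => (measurable_pi_apply i).const_mul _).aemeasurable
        (by fun_prop)]
      refine integral_congr_ae ?_
      filter_upwards [h1] with x hx
      rw [hx]; simp
    rw [h4]
    have hind2 : iIndepFun (fun (i : w) (x : w → ℝ) => c i * x i) P :=
      hind.comp (fun i y => c i * y) (fun i => by fun_prop)
    rw [(hind2.restrict s).charFun_map_fun_finsetSum_eq_prod
      (fun i _ => ((measurable_pi_apply i).const_mul _).aemeasurable), Finset.prod_apply]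
    have h6 : ∀ i : w, charFun (P.map fun x : w → ℝ => c i * x i) 1
        = Complex.exp (-((c i ^ 2 : ℝ) : ℂ) / 2) := by
      intro i
      rw [charFun_map_mul_comp (measurable_pi_apply i).aemeasurable, (hlaw i).map_eq,
        charFun_gaussianReal]
      congr 1
      simp
      ring
    simp_rw [h6]
    rw [← Complex.exp_sum]
    congr 1
    push_cast
    rw [← Finset.sum_div, Finset.sum_neg_distrib]
  have hlim2 : Tendsto (fun s : Finset w => Complex.exp (-((∑ i ∈ s, c i ^ 2 : ℝ) : ℂ) / 2)) atTop
      (𝓝 (Complex.exp (-((‖t • h‖ ^ 2 : ℝ) : ℂ) / 2))) := by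
    have hs : HasSum (fun i => c i ^ 2) (‖t • h‖ ^ 2) := by
      have := lp.hasSum_inner (𝕜 := ℝ) (G := fun _ : w => ℝ) c c
      rw [real_inner_self_eq_norm_sq, hc, LinearIsometryEquiv.norm_map] at this
      refine this.congr_fun ?_
      intro i
      rw [sq]; rfl
    have : Continuous fun y : ℝ => Complex.exp (-(y : ℂ) / 2) := by fun_prop
    exact (this.tendsto _).comp hs
  have := tendsto_nhds_unique (hlim1.congr hval2) hlim2
  rw [this, norm_smul]
  congr 1
  rw [Real.coe_toNNReal _ (by positivity), mul_pow, Real.norm_eq_abs, sq_abs]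
  push_cast
  simp
  ring

lemma norm_sum_smul_sq {H ι : Type*} [NormedAddCommGroup H] [InnerProductSpace ℝ H]
    (s : Finset ι) (θ : ι → ℝ) (v : ι → H) :
    ‖∑ i ∈ s, θ i • v i‖ ^ 2 = ∑ i ∈ s, ∑ j ∈ s, θ i * θ j * inner ℝ (v i) (v j) := by
  rw [← real_inner_self_eq_norm_sq, sum_inner]
  simp_rw [inner_sum, real_inner_smul_left, real_inner_smul_right, mul_assoc]

open scoped ComplexOrder in
/-- A positive semidefinite real kernel is the covariance of a centered Gaussian process. -/
theorem exists_gaussianProcess (T : Type) (K : T → T → ℝ) (hsymm : ∀ a b, K a b = K b a)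
    (hpsd : ∀ f : T →₀ ℝ, 0 ≤ f.sum fun a x => f.sum fun b y => x * y * K a b) :
    ∃ (Ω' : Type) (_ : MeasurableSpace Ω') (P : Measure Ω') (_ : IsProbabilityMeasure P)
      (z : T → Ω' → ℝ), IsGaussianProcess z P ∧ (∀ a, ∫ x, z a x ∂P = 0) ∧
      (∀ a b, ∫ x, z a x * z b x ∂P = K a b) ∧
      ∀ (k : ℕ) (a : Fin k → T) (θ : Fin k → ℝ),
        ∫ x, Complex.exp ((∑ i, θ i * z (a i) x : ℝ) * Complex.I) ∂P
          = Complex.exp (-((∑ i, ∑ j, θ i * θ j * K (a i) (a j) : ℝ) : ℂ) / 2) := by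
  classical
  -- Reproducing kernel Hilbert spaces are built from operator-valued kernels, so the scalar kernel
  -- becomes a multiple of the identity of `ℝ`.
  let K' : Matrix T T (ℝ →L[ℝ] ℝ) := Matrix.of fun a b => K a b • ContinuousLinearMap.id ℝ ℝ
  have hK' : K'.PosSemidef := by
    have h := (RKHS.posSemidef_tfae (K := K')).out 0 2
    refine h.mpr ⟨?_, fun f => ?_⟩
    · ext a b
      have : ContinuousLinearMap.adjoint (ContinuousLinearMap.id ℝ ℝ)
          = ContinuousLinearMap.id ℝ ℝ := ContinuousLinearMap.adjoint_id
      simp [K', hsymm a b, ContinuousLinearMap.star_eq_adjoint, this]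
    · refine (hpsd f).trans_eq ?_
      simp [K', Finsupp.sum]
      refine Finset.sum_congr rfl fun a _ => Finset.sum_congr rfl fun b _ => ?_
      rw [hsymm a b]; ring
  have : Fact K'.PosSemidef := ⟨hK'⟩
  let H := RKHS.OfKernel K'
  -- The representers have Gram matrix `K`, so the process is the isonormal process evaluated at
  -- them.
  let v : T → H := fun a => RKHS.kerFun H a (1 : ℝ)
  have hv : ∀ a b, inner ℝ (v a) (v b) = K a b := by
    intro a b
    have h := RKHS.kernel_inner H b a (1 : ℝ) (1 : ℝ)
    rw [RKHS.OfKernel.kernel_ofKernel] at h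
    rw [← h, hsymm a b]
    simp [K']
  obtain ⟨Ω', m, P, hP, Φ, hΦ⟩ := exists_isonormal H
  have hm : ∀ h : H, AEMeasurable (Φ h) P := fun h => (Lp.aestronglyMeasurable _).aemeasurable
  have hlin : ∀ (ι : Type) (s : Finset ι) (θ : ι → ℝ) (a : ι → T),
      (fun x => ∑ i ∈ s, θ i * Φ (v (a i)) x) =ᵐ[P] Φ (∑ i ∈ s, θ i • v (a i)) := by
    intro ι s θ a
    rw [map_sum]
    have h3 : ∀ᵐ x ∂P, ∀ i ∈ s, Φ (θ i • v (a i)) x = θ i * Φ (v (a i)) x := by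
      rw [Finset.eventually_all]
      intro i _
      rw [map_smul]
      filter_upwards [Lp.coeFn_smul (θ i) (Φ (v (a i)))] with x hx
      rw [hx, Pi.smul_apply, smul_eq_mul]
    filter_upwards [Lp.coeFn_fun_finsetSum s (fun i => Φ (θ i • v (a i))), h3] with x hx hy
    rw [hx]
    exact Finset.sum_congr rfl fun i hi => (hy i hi).symm
  refine ⟨Ω', m, P, hP, fun a => Φ (v a), ⟨fun I => ⟨?_⟩⟩, fun a => ?_, fun a b => ?_,
    fun k a θ => ?_⟩
  · have hmI : AEMeasurable (fun ω => I.restrict fun a => (Φ (v a)) ω) P :=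
      aemeasurable_pi_lambda _ fun i => hm _
    -- Every linear functional of the restricted process is the isonormal image of a single vector,
    -- hence normal.
    refine isGaussian_of_map_eq_gaussianReal fun L =>
      ⟨0, (‖∑ i : I, L (Pi.single i 1) • v i‖ ^ 2).toNNReal, ?_⟩
    rw [AEMeasurable.map_map_of_aemeasurable (by fun_prop) hmI]
    rw [← hΦ]
    refine Measure.map_congr ?_
    filter_upwards [hlin I Finset.univ (fun i => L (Pi.single i 1)) (fun i => i)] with x hx
    rw [← hx, Function.comp_apply]
    conv_lhs => rw [← Finset.univ_sum_single (I.restrict fun a => (Φ (v a)) x)]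
    rw [map_sum]
    refine Finset.sum_congr rfl fun i _ => ?_
    have : (Pi.single i (I.restrict (fun a => (Φ (v a)) x) i) : I → ℝ)
        = (Φ (v i)) x • Pi.single i (1 : ℝ) := by
      rw [← Pi.single_smul]; simp
    rw [this, map_smul, smul_eq_mul, mul_comm]
  · have h := integral_map (hm (v a)) (f := fun y : ℝ => y) (by fun_prop)
    rw [hΦ] at h
    rw [← h]; simp
  · rw [← hv, ← Φ.inner_map_map, L2.inner_def]
    refine integral_congr_ae (ae_of_all _ fun x => ?_)
    simp [mul_comm]
  · set h := ∑ i, θ i • v (a i) with hh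
    have h1 : ∫ x, Complex.exp ((∑ i, θ i * Φ (v (a i)) x : ℝ) * Complex.I) ∂P
        = charFun (P.map (Φ h)) 1 := by
      rw [charFun_apply_real, integral_map (hm _) (by fun_prop)]
      refine integral_congr_ae ?_
      filter_upwards [hlin (Fin k) Finset.univ θ a] with x hx
      rw [hx, ← hh, Complex.ofReal_one, one_mul]
    rw [h1, hΦ, charFun_gaussianReal, Real.coe_toNNReal _ (by positivity),
      hh, norm_sum_smul_sq]
    simp_rw [hv]
    congr 1
    simp [mul_assoc, neg_div]

end GaussianProcess
-- Absolute values through Fejér integrals, periodic and on the line.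
section FourierAbs

open Real in
lemma two_div_pi_sq_mul_sq_le_one_sub_cos {t : ℝ} (ht : |t| ≤ π) :
    2 / π ^ 2 * t ^ 2 ≤ 1 - cos t := by
  linarith [Real.cos_le_one_sub_mul_cos_sq ht]

lemma one_sub_cos_le (x : ℝ) : 1 - Real.cos x ≤ x ^ 2 / 2 := by
  linarith [Real.one_sub_sq_div_two_le_cos (x := x)]

lemma one_sub_cos_nonneg (x : ℝ) : 0 ≤ 1 - Real.cos x := by
  linarith [Real.cos_le_one x]

lemma one_sub_cos_pos {t : ℝ} (ht : |t| ≤ Real.pi) (h0 : t ≠ 0) : 0 < 1 - Real.cos t := by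
  refine lt_of_lt_of_le ?_ (two_div_pi_sq_mul_sq_le_one_sub_cos ht)
  have := Real.pi_pos
  positivity

lemma abs_le_pi_of_mem {t : ℝ} (ht : t ∈ Set.Ioc (-Real.pi) Real.pi) : |t| ≤ Real.pi :=
  abs_le.2 ⟨ht.1.le, ht.2⟩

/-- A measurable function bounded on `[-π, π]` is interval integrable there. -/
lemma intervalIntegrable_of_bound {f : ℝ → ℝ} (hf : Measurable f) (C : ℝ)
    (hC : ∀ t, |t| ≤ Real.pi → |f t| ≤ C) :
    IntervalIntegrable f volume (-Real.pi) Real.pi := by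
  rw [intervalIntegrable_iff_integrableOn_Ioc_of_le (by linarith [Real.pi_pos])]
  refine Measure.integrableOn_of_bounded (M := C) (by simp) hf.aestronglyMeasurable ?_
  rw [ae_restrict_iff' measurableSet_Ioc]
  exact ae_of_all _ fun t ht => hC t (abs_le_pi_of_mem ht)

lemma fejer_bound (y t : ℝ) (ht : |t| ≤ Real.pi) :
    |(1 - Real.cos (t * y)) / (1 - Real.cos t)| ≤ Real.pi ^ 2 / 4 * y ^ 2 := by
  have hpi := Real.pi_pos
  rcases eq_or_ne t 0 with rfl | h0
  · simp; positivity
  have h1 := one_sub_cos_pos ht h0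
  rw [abs_of_nonneg (div_nonneg (one_sub_cos_nonneg _) h1.le), div_le_iff₀ h1]
  calc 1 - Real.cos (t * y) ≤ (t * y) ^ 2 / 2 := one_sub_cos_le _
    _ = Real.pi ^ 2 / 4 * y ^ 2 * (2 / Real.pi ^ 2 * t ^ 2) := by field_simp; ring
    _ ≤ _ := mul_le_mul_of_nonneg_left (two_div_pi_sq_mul_sq_le_one_sub_cos ht) (by positivity)

lemma intervalIntegrable_fejer (y : ℝ) : IntervalIntegrable
    (fun t => (1 - Real.cos (t * y)) / (1 - Real.cos t)) volume (-Real.pi) Real.pi :=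
  intervalIntegrable_of_bound (by fun_prop) _ (fejer_bound y)

lemma integral_cos_mul_int {z : ℤ} (hz : z ≠ 0) :
    ∫ t in (-Real.pi)..Real.pi, Real.cos (t * z) = 0 := by
  have hz' : (z : ℝ) ≠ 0 := by exact_mod_cast hz
  rw [intervalIntegral.integral_comp_mul_right (fun x => Real.cos x) hz', integral_cos]
  have : Real.sin (Real.pi * z) = 0 := by rw [mul_comm]; exact Real.sin_int_mul_pi z
  simp [this]

/-- By `cos (t(n+2)) + cos (tn) = 2 cos (t(n+1)) cos t`, the second difference in `n` of the
integrands is `2 cos (t(n+1))`, which integrates to zero. The integrals are therefore affine in `n`,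
and the cases `0` and `1` fix the slope. -/
lemma integral_fejer_nat (n : ℕ) :
    ∫ t in (-Real.pi)..Real.pi, (1 - Real.cos (t * n)) / (1 - Real.cos t)
      = 2 * Real.pi * n := by
  have hpi := Real.pi_pos
  induction n using Nat.strong_induction_on with
  | _ n ih =>
    match n with
    | 0 => simp
    | 1 =>
      have : ∫ t in (-Real.pi)..Real.pi, (1 - Real.cos (t * (1 : ℕ))) / (1 - Real.cos t)
          = ∫ t in (-Real.pi)..Real.pi, (1 : ℝ) := by
        refine intervalIntegral.integral_congr_ae ?_
        have h0 : ∀ᵐ t : ℝ, t ≠ 0 := by simp [ae_iff]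
        filter_upwards [h0] with t ht hmem
        rw [Set.uIoc_of_le (by linarith)] at hmem
        rw [Nat.cast_one, mul_one, div_self (one_sub_cos_pos (abs_le_pi_of_mem hmem) ht).ne']
      rw [this]; simp; ring
    | n + 2 =>
      have e0 := ih n (by omega)
      have e1 := ih (n + 1) (by omega)
      have hc : ∫ t in (-Real.pi)..Real.pi, Real.cos (t * ((n + 1 : ℤ) : ℝ)) = 0 :=
        integral_cos_mul_int (by omega)
      have key : ∫ t in (-Real.pi)..Real.pi,
          ((1 - Real.cos (t * (n + 2 : ℕ))) / (1 - Real.cos t)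
            + (1 - Real.cos (t * n)) / (1 - Real.cos t)
            - 2 * ((1 - Real.cos (t * (n + 1 : ℕ))) / (1 - Real.cos t)))
          = ∫ t in (-Real.pi)..Real.pi, 2 * Real.cos (t * ((n + 1 : ℤ) : ℝ)) := by
        refine intervalIntegral.integral_congr_ae ?_
        have h0 : ∀ᵐ t : ℝ, t ≠ 0 := by simp [ae_iff]
        filter_upwards [h0] with t ht hmem
        rw [Set.uIoc_of_le (by linarith)] at hmem
        have h1 := (one_sub_cos_pos (abs_le_pi_of_mem hmem) ht).ne'
        have h2 : Real.cos (t * (n + 2 : ℕ)) + Real.cos (t * n)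
            = 2 * Real.cos (t * (n + 1 : ℕ)) * Real.cos t := by
          have a1 : t * (n + 2 : ℕ) = t * (n + 1 : ℕ) + t := by push_cast; ring
          have a2 : t * n = t * (n + 1 : ℕ) - t := by push_cast; ring
          rw [a1, a2, Real.cos_add, Real.cos_sub]; ring
        have h3 : ((n + 1 : ℤ) : ℝ) = ((n + 1 : ℕ) : ℝ) := by push_cast; ring
        rw [h3]
        field_simp
        linear_combination -h2
      rw [intervalIntegral.integral_sub
          ((intervalIntegrable_fejer _).add (intervalIntegrable_fejer _))
          ((intervalIntegrable_fejer _).const_mul _),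
        intervalIntegral.integral_add (intervalIntegrable_fejer _) (intervalIntegrable_fejer _),
        intervalIntegral.integral_const_mul, intervalIntegral.integral_const_mul, hc, e0, e1] at key
      push_cast at key ⊢
      linarith

lemma integral_fejer (y : ℤ) :
    ∫ t in (-Real.pi)..Real.pi, (1 - Real.cos (t * y)) / (1 - Real.cos t)
      = 2 * Real.pi * |(y : ℝ)| := by
  have h : ∀ t : ℝ, Real.cos (t * y) = Real.cos (t * (y.natAbs : ℕ)) := by
    intro t
    have h1 : ((y.natAbs : ℕ) : ℝ) = |(y : ℝ)| := by
      rw [Nat.cast_natAbs]; push_cast; rfl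
    rw [h1, ← Real.cos_abs (t * y), ← Real.cos_abs (t * |(y : ℝ)|), abs_mul, abs_mul, abs_abs]
  simp_rw [h, integral_fejer_nat]
  rw [Nat.cast_natAbs]; push_cast; rfl

/-- The truncated and rescaled Fejér denominator. -/
noncomputable def fejerKernel (r τ : ℝ) : ℝ :=
  (Set.Ioc (-(r * Real.pi)) (r * Real.pi)).indicator
    (fun τ => (r ^ 2 * (1 - Real.cos (τ / r)))⁻¹) τ

lemma measurable_fejerKernel (r : ℝ) : Measurable (fejerKernel r) :=
  Measurable.indicator (by fun_prop) measurableSet_Ioc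

lemma fejerKernel_nonneg (r τ : ℝ) : 0 ≤ fejerKernel r τ :=
  Set.indicator_nonneg (fun _ _ => inv_nonneg.2 (mul_nonneg (sq_nonneg _) (one_sub_cos_nonneg _))) _

lemma fejerKernel_le {r : ℝ} (hr : 0 < r) (τ : ℝ) :
    fejerKernel r τ ≤ Real.pi ^ 2 / 2 * (τ ^ 2)⁻¹ := by
  have hpi := Real.pi_pos
  unfold fejerKernel
  by_cases h : τ ∈ Set.Ioc (-(r * Real.pi)) (r * Real.pi)
  · rw [Set.indicator_of_mem h]
    rcases eq_or_ne τ 0 with rfl | h0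
    · simp
    have h1 : |τ / r| ≤ Real.pi := by
      rw [abs_div, abs_of_pos hr, div_le_iff₀ hr, abs_le]
      constructor <;> nlinarith [h.1, h.2]
    have h2 := two_div_pi_sq_mul_sq_le_one_sub_cos h1
    have h3 : Real.pi ^ 2 / 2 * (τ ^ 2)⁻¹ = (2 / Real.pi ^ 2 * τ ^ 2)⁻¹ := by
      field_simp
    rw [h3]
    refine inv_anti₀ (by positivity) ?_
    calc 2 / Real.pi ^ 2 * τ ^ 2 = r ^ 2 * (2 / Real.pi ^ 2 * (τ / r) ^ 2) := by field_simp
      _ ≤ _ := mul_le_mul_of_nonneg_left h2 (by positivity)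
  · rw [Set.indicator_of_notMem h]; positivity

lemma tendsto_fejerKernel {ι : Type*} {l : Filter ι} {r : ι → ℝ} (hr : Tendsto r l atTop)
    (τ : ℝ) : Tendsto (fun n => fejerKernel (r n) τ) l (𝓝 (2 * (τ ^ 2)⁻¹)) := by
  have hpi := Real.pi_pos
  -- At `0` both sides are zero, because the inverse of zero is zero.
  rcases eq_or_ne τ 0 with rfl | h0
  · have : ∀ r : ℝ, fejerKernel r 0 = 0 := by
      intro r; simp [fejerKernel, Set.indicator]
    simpa [this] using tendsto_const_nhds
  -- The fourth-order remainder of the cosine, with the constant `5/96` of `Real.cos_bound`, gives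
  -- an error of order `τ⁴/r²`.
  have h1 : Tendsto (fun n => r n ^ 2 * (1 - Real.cos (τ / r n))) l (𝓝 (τ ^ 2 / 2)) := by
    rw [tendsto_iff_norm_sub_tendsto_zero]
    have hz : Tendsto (fun n => τ ^ 4 * (5 / 96) * ((r n)⁻¹) ^ 2) l (𝓝 0) := by
      simpa using ((tendsto_inv_atTop_zero.comp hr).pow 2).const_mul (τ ^ 4 * (5 / 96))
    refine squeeze_zero' (Eventually.of_forall fun _ => norm_nonneg _) ?_ hz
    filter_upwards [hr.eventually_ge_atTop (|τ| + 1)] with n hn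
    have hrp : 0 < r n := by linarith [abs_nonneg τ]
    have hle : |τ / r n| ≤ 1 := by
      rw [abs_div, abs_of_pos hrp, div_le_one hrp]; linarith
    have hb := Real.cos_bound hle
    have e : r n ^ 2 * (1 - Real.cos (τ / r n)) - τ ^ 2 / 2
        = -(r n ^ 2 * (Real.cos (τ / r n) - (1 - (τ / r n) ^ 2 / 2))) := by
      field_simp; ring
    rw [e, norm_neg, norm_mul, Real.norm_eq_abs, Real.norm_eq_abs, abs_of_pos (by positivity)]
    calc r n ^ 2 * |Real.cos (τ / r n) - (1 - (τ / r n) ^ 2 / 2)|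
        ≤ r n ^ 2 * (|τ / r n| ^ 4 * (5 / 96)) := mul_le_mul_of_nonneg_left hb (by positivity)
      _ = τ ^ 4 * (5 / 96) * (r n)⁻¹ ^ 2 := by
        have : |τ / r n| ^ 4 = (τ / r n) ^ 4 := by
          rw [show (4 : ℕ) = 2 * 2 from rfl, pow_mul, sq_abs, ← pow_mul]
        rw [this]; field_simp
  have h2 : Tendsto (fun n => (r n ^ 2 * (1 - Real.cos (τ / r n)))⁻¹) l (𝓝 (2 * (τ ^ 2)⁻¹)) := by
    have := h1.inv₀ (by positivity)
    convert this using 2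
    field_simp
  refine h2.congr' ?_
  filter_upwards [hr.eventually_ge_atTop (|τ| + 1)] with n hn
  have hpi1 : 1 ≤ Real.pi := by linarith [Real.pi_gt_three]
  have hrp : |τ| + 1 ≤ r n * Real.pi := by nlinarith [abs_nonneg τ]
  have hmem : τ ∈ Set.Ioc (-(r n * Real.pi)) (r n * Real.pi) := by
    constructor <;> linarith [neg_abs_le τ, le_abs_self τ]
  rw [fejerKernel, Set.indicator_of_mem hmem]

/-- Rescaling of integrals against the Fejér denominator. -/
lemma integral_div_one_sub_cos (g : ℝ → ℝ) {r : ℝ} (hr : 0 < r) :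
    ∫ t in (-Real.pi)..Real.pi, g t / (1 - Real.cos t)
      = r * ∫ τ, g (τ / r) * fejerKernel r τ := by
  have hpi := Real.pi_pos
  have h1 : ∫ τ, g (τ / r) * fejerKernel r τ
      = ∫ τ in (-(r * Real.pi))..(r * Real.pi), (r ^ 2)⁻¹ * (g (τ / r) / (1 - Real.cos (τ / r))) := by
    rw [intervalIntegral.integral_of_le (by nlinarith), ← integral_indicator measurableSet_Ioc]
    refine integral_congr_ae (ae_of_all _ fun τ => ?_)
    simp only [fejerKernel, Set.indicator]
    split_ifs
    · rw [mul_inv, div_eq_mul_inv]; ring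
    · simp
  rw [h1, intervalIntegral.integral_const_mul,
    intervalIntegral.integral_comp_div (fun t => g t / (1 - Real.cos t)) hr.ne']
  rw [neg_div, mul_div_cancel_left₀ _ hr.ne', smul_eq_mul]
  field_simp

lemma integrable_min_one_inv_sq : Integrable (fun τ : ℝ => min 1 (τ ^ 2)⁻¹) := by
  have h := integrable_inv_one_add_sq.const_mul 2
  refine h.mono' (by fun_prop) (ae_of_all _ fun τ => ?_)
  rw [Real.norm_of_nonneg (by positivity)]
  have h1 : 0 < 1 + τ ^ 2 := by positivity
  rw [← div_eq_mul_inv, le_div_iff₀ h1]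
  rcases le_or_gt (τ ^ 2) 1 with h2 | h2
  · have : min 1 (τ ^ 2)⁻¹ ≤ 1 := min_le_left _ _
    nlinarith [sq_nonneg τ]
  · have h3 : min 1 (τ ^ 2)⁻¹ ≤ (τ ^ 2)⁻¹ := min_le_right _ _
    calc _ ≤ (τ ^ 2)⁻¹ * (1 + τ ^ 2) := by gcongr
      _ ≤ 2 := by
        rw [inv_mul_le_iff₀ (by linarith)]; linarith

/-- The source of all dominating functions below: a constant bound for large `τ` and a quadratic
bound near zero combine into one integrable function. -/
lemma min_mul_le_min {a b c τ : ℝ} (ha : 0 ≤ a)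
    (h1 : c ≤ a) (h2 : c ≤ b * τ ^ 2) : c * (τ ^ 2)⁻¹ ≤ max a b * min 1 (τ ^ 2)⁻¹ := by
  rcases eq_or_ne τ 0 with rfl | h0
  · simp
  have ht : 0 < τ ^ 2 := by positivity
  rw [mul_min_of_nonneg _ _ (le_max_of_le_left ha), mul_one]
  refine le_min ?_ ?_
  · rw [← div_eq_mul_inv, div_le_iff₀ ht]
    exact h2.trans (by gcongr; exact le_max_right _ _)
  · gcongr; exact h1.trans (le_max_left _ _)

lemma one_sub_cos_mul_inv_sq_le (x τ : ℝ) :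
    (1 - Real.cos (τ * x)) * (τ ^ 2)⁻¹ ≤ max 2 (x ^ 2 / 2) * min 1 (τ ^ 2)⁻¹ := by
  refine min_mul_le_min (by norm_num) ?_ ?_
  · linarith [Real.neg_one_le_cos (τ * x)]
  · refine (one_sub_cos_le _).trans_eq (by ring)

lemma integrable_one_sub_cos_mul_inv_sq (x : ℝ) :
    Integrable (fun τ : ℝ => (1 - Real.cos (τ * x)) * (τ ^ 2)⁻¹) := by
  refine (integrable_min_one_inv_sq.const_mul (max 2 (x ^ 2 / 2))).mono' (by fun_prop)
    (ae_of_all _ fun τ => ?_)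
  rw [Real.norm_of_nonneg (mul_nonneg (one_sub_cos_nonneg _) (by positivity))]
  exact one_sub_cos_mul_inv_sq_le x τ

/-- The value comes from the periodic integrals: rescaled by `n`, the Fejér integral equals `2π` for
every `n`, while the rescaled kernel tends to `2/τ²` under a uniform domination. -/
lemma integral_one_sub_cos_mul_inv_sq_one :
    ∫ τ : ℝ, (1 - Real.cos τ) * (τ ^ 2)⁻¹ = Real.pi := by
  have hpi := Real.pi_pos
  have h1 : ∀ n : ℕ, ∫ τ, (1 - Real.cos τ) * fejerKernel (n + 1 : ℕ) τ = 2 * Real.pi := by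
    intro n
    have hn : (0 : ℝ) < (n + 1 : ℕ) := by positivity
    have h := integral_div_one_sub_cos (fun t => 1 - Real.cos (t * (n + 1 : ℕ))) hn
    rw [integral_fejer_nat] at h
    have h2 : ∀ τ : ℝ, τ / (n + 1 : ℕ) * (n + 1 : ℕ) = τ := fun τ => by field_simp
    simp_rw [h2] at h
    have := mul_left_cancel₀ hn.ne' (h.symm.trans (mul_comm _ _))
    exact this
  have h2 : Tendsto (fun n : ℕ => ∫ τ, (1 - Real.cos τ) * fejerKernel (n + 1 : ℕ) τ) atTop
      (𝓝 (∫ τ, (1 - Real.cos τ) * (2 * (τ ^ 2)⁻¹))) := by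
    refine tendsto_integral_of_dominated_convergence
      (fun τ => Real.pi ^ 2 / 2 * ((1 - Real.cos (τ * 1)) * (τ ^ 2)⁻¹)) (fun n => ?_) ?_ ?_ ?_
    · exact (Measurable.mul (by fun_prop) (measurable_fejerKernel _)).aestronglyMeasurable
    · exact (integrable_one_sub_cos_mul_inv_sq 1).const_mul _
    · intro n
      refine ae_of_all _ fun τ => ?_
      rw [Real.norm_of_nonneg (mul_nonneg (one_sub_cos_nonneg _) (fejerKernel_nonneg _ _)), mul_one]
      calc _ ≤ (1 - Real.cos τ) * (Real.pi ^ 2 / 2 * (τ ^ 2)⁻¹) :=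
            mul_le_mul_of_nonneg_left (fejerKernel_le (by positivity) τ) (one_sub_cos_nonneg _)
        _ = _ := by ring
    · refine ae_of_all _ fun τ => ?_
      refine (tendsto_fejerKernel ?_ τ).const_mul _
      exact tendsto_natCast_atTop_atTop.comp (tendsto_add_atTop_nat 1)
  simp_rw [h1] at h2
  have h3 := tendsto_nhds_unique tendsto_const_nhds h2
  have h4 : ∫ τ : ℝ, (1 - Real.cos τ) * (2 * (τ ^ 2)⁻¹)
      = 2 * ∫ τ : ℝ, (1 - Real.cos τ) * (τ ^ 2)⁻¹ := by
    rw [← integral_const_mul]; congr 1; ext; ring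
  linarith

lemma integral_one_sub_cos_mul_inv_sq (x : ℝ) :
    ∫ τ : ℝ, (1 - Real.cos (τ * x)) * (τ ^ 2)⁻¹ = Real.pi * |x| := by
  rcases eq_or_ne x 0 with rfl | hx
  · simp
  have h := Measure.integral_comp_mul_right (fun τ : ℝ => (1 - Real.cos τ) * (τ ^ 2)⁻¹) x
  rw [integral_one_sub_cos_mul_inv_sq_one, smul_eq_mul] at h
  have h2 : ∀ τ : ℝ, (1 - Real.cos (τ * x)) * (τ ^ 2)⁻¹
      = x ^ 2 * ((1 - Real.cos (τ * x)) * ((τ * x) ^ 2)⁻¹) := by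
    intro τ
    rw [mul_pow, mul_inv]; field_simp
  simp_rw [h2, integral_const_mul, h]
  rw [abs_inv, ← sq_abs]
  field_simp

/-- First absolute moments from characteristic functions. -/
lemma integral_abs_eq_integral_charFun (ν : Measure ℝ) [IsProbabilityMeasure ν]
    (hν : Integrable (fun x : ℝ => x) ν) :
    Integrable (fun τ : ℝ => (1 - (charFun ν τ).re) * (τ ^ 2)⁻¹) ∧
    ∫ τ : ℝ, (1 - (charFun ν τ).re) * (τ ^ 2)⁻¹ = Real.pi * ∫ x, |x| ∂ν := by
  -- Fubini applies because the integrand is nonnegative and its integral in `τ` is `π|x|`, which is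
  -- integrable by assumption.
  have hint : Integrable (fun p : ℝ × ℝ => (1 - Real.cos (p.2 * p.1)) * (p.2 ^ 2)⁻¹)
      (ν.prod volume) := by
    rw [integrable_prod_iff (by fun_prop)]
    refine ⟨ae_of_all _ fun x => integrable_one_sub_cos_mul_inv_sq x, ?_⟩
    have : ∀ x : ℝ, ∫ τ : ℝ, ‖(1 - Real.cos (τ * x)) * (τ ^ 2)⁻¹‖ = Real.pi * |x| := by
      intro x
      rw [← integral_one_sub_cos_mul_inv_sq]
      congr 1; ext τ
      rw [Real.norm_of_nonneg (mul_nonneg (one_sub_cos_nonneg _) (by positivity))]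
    simp_rw [this]
    exact hν.abs.const_mul _
  have hre : ∀ τ : ℝ, ∫ x, (1 - Real.cos (τ * x)) * (τ ^ 2)⁻¹ ∂ν
      = (1 - (charFun ν τ).re) * (τ ^ 2)⁻¹ := by
    intro τ
    have hI : Integrable (fun x : ℝ => Complex.exp (τ * x * Complex.I)) ν := by
      refine Integrable.of_bound (C := 1) (by fun_prop) (ae_of_all _ fun x => ?_)
      rw [← Complex.ofReal_mul, Complex.norm_exp_ofReal_mul_I]
    have h1 : (charFun ν τ).re = ∫ x, Real.cos (τ * x) ∂ν := by
      have h0 : ∫ x, RCLike.re (Complex.exp (τ * x * Complex.I)) ∂ν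
          = RCLike.re (∫ x, Complex.exp (τ * x * Complex.I) ∂ν) := integral_re hI
      rw [charFun_apply_real]
      refine h0.symm.trans (integral_congr_ae (ae_of_all _ fun x => ?_))
      simp only [← Complex.ofReal_mul]
      exact Complex.exp_ofReal_mul_I_re _
    have hcos : Integrable (fun x : ℝ => Real.cos (τ * x)) ν :=
      Integrable.of_bound (C := 1) (by fun_prop) (ae_of_all _ fun x => Real.abs_cos_le_one _)
    rw [integral_mul_const, integral_sub (by simp) hcos, h1]
    simp
  refine ⟨?_, ?_⟩
  · have := hint.integral_prod_right
    simpa only [hre] using this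
  · have h := integral_integral_swap (f := fun x τ : ℝ => (1 - Real.cos (τ * x)) * (τ ^ 2)⁻¹) hint
    simp_rw [hre, integral_one_sub_cos_mul_inv_sq, integral_const_mul] at h
    exact h.symm

end FourierAbs
-- The kernels `Γ_q` and `Γ₀` as combinations of Gaussian absolute moments.
section Covariances

/-- The first absolute moment of the normal law with mean `d` and variance `w`. -/
noncomputable def gaussAbs (d w : ℝ) : ℝ := ∫ x, |x| ∂gaussianReal d w.toNNReal

lemma integrable_id_gaussianReal (d : ℝ) (w : ℝ≥0) :
    Integrable (fun x : ℝ => x) (gaussianReal d w) :=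
  (memLp_id_gaussianReal (μ := d) (v := w) 1).integrable (by norm_num)

/-- `(1 - Re φ(τ)) / τ²` for the characteristic function `φ` of the normal law. -/
noncomputable def gaussAbsIntegrand (d w τ : ℝ) : ℝ :=
  (1 - Real.cos (τ * d) * Real.exp (-(w * τ ^ 2 / 2))) * (τ ^ 2)⁻¹

lemma re_charFun_gaussianReal (d : ℝ) {w : ℝ} (hw : 0 ≤ w) (τ : ℝ) :
    (charFun (gaussianReal d w.toNNReal) τ).re
      = Real.cos (τ * d) * Real.exp (-(w * τ ^ 2 / 2)) := by
  rw [charFun_gaussianReal, Real.coe_toNNReal _ hw, Complex.exp_re]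
  have h1 : ((τ : ℂ) * d * Complex.I - w * τ ^ 2 / 2).re = -(w * τ ^ 2 / 2) := by
    have : ((τ : ℂ) * d * Complex.I - w * τ ^ 2 / 2)
        = ((τ * d : ℝ) : ℂ) * Complex.I + ((-(w * τ ^ 2 / 2) : ℝ) : ℂ) := by push_cast; ring
    rw [this]; simp [-Complex.ofReal_mul]
  have h2 : ((τ : ℂ) * d * Complex.I - w * τ ^ 2 / 2).im = τ * d := by
    have : ((τ : ℂ) * d * Complex.I - w * τ ^ 2 / 2)
        = ((τ * d : ℝ) : ℂ) * Complex.I + ((-(w * τ ^ 2 / 2) : ℝ) : ℂ) := by push_cast; ring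
    rw [this]; simp [-Complex.ofReal_mul]
  rw [h1, h2, mul_comm]

lemma integrable_gaussAbsIntegrand (d : ℝ) {w : ℝ} (hw : 0 ≤ w) :
    Integrable (gaussAbsIntegrand d w) := by
  have h := (integral_abs_eq_integral_charFun _ (integrable_id_gaussianReal d w.toNNReal)).1
  simp_rw [re_charFun_gaussianReal d hw] at h
  exact h

lemma integral_gaussAbsIntegrand (d : ℝ) {w : ℝ} (hw : 0 ≤ w) :
    ∫ τ, gaussAbsIntegrand d w τ = Real.pi * gaussAbs d w := by
  have h := (integral_abs_eq_integral_charFun _ (integrable_id_gaussianReal d w.toNNReal)).2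
  simp_rw [re_charFun_gaussianReal d hw] at h
  exact h

lemma gaussAbsIntegrand_nonneg (d : ℝ) {w : ℝ} (hw : 0 ≤ w) (τ : ℝ) :
    0 ≤ gaussAbsIntegrand d w τ := by
  refine mul_nonneg ?_ (by positivity)
  have h1 : Real.exp (-(w * τ ^ 2 / 2)) ≤ 1 := Real.exp_le_one_iff.2 (by
    have : 0 ≤ w * τ ^ 2 / 2 := by positivity
    linarith)
  have h2 := Real.exp_pos (-(w * τ ^ 2 / 2))
  nlinarith [Real.cos_le_one (τ * d), Real.neg_one_le_cos (τ * d)]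

@[simp] lemma gaussAbs_zero (d : ℝ) : gaussAbs d 0 = |d| := by
  simp [gaussAbs]

lemma gaussAbs_neg (d w : ℝ) : gaussAbs (-d) w = gaussAbs d w := by
  unfold gaussAbs
  rw [← gaussianReal_map_neg, integral_map (by fun_prop) (by fun_prop)]
  simp

lemma integral_cos_mul_exp_neg_sq (d : ℝ) {w : ℝ} (hw : 0 < w) :
    ∫ τ : ℝ, Real.cos (τ * d) * Real.exp (-(w * τ ^ 2 / 2))
      = 2 * Real.pi * (1 / √(2 * Real.pi * w) * Real.exp (-(1 / (2 * w)) * d ^ 2)) := by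
  have hpi := Real.pi_pos
  have hb : 0 < ((w / 2 : ℝ) : ℂ).re := by rw [Complex.ofReal_re]; positivity
  have h := integral_cexp_quadratic (b := -((w / 2 : ℝ) : ℂ)) (by rw [Complex.neg_re]; linarith)
    (Complex.I * d) 0
  have hi : Integrable fun τ : ℝ =>
      Complex.exp (-((w / 2 : ℝ) : ℂ) * τ ^ 2 + Complex.I * d * τ + 0) :=
    integrable_cexp_quadratic hb _ _
  have h1 : ∫ τ : ℝ, RCLike.re
      (Complex.exp (-((w / 2 : ℝ) : ℂ) * τ ^ 2 + Complex.I * d * τ + 0)) = RCLike.re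
      (∫ τ : ℝ, Complex.exp (-((w / 2 : ℝ) : ℂ) * τ ^ 2 + Complex.I * d * τ + 0)) := integral_re hi
  have h2 : ∀ τ : ℝ, RCLike.re
      (Complex.exp (-((w / 2 : ℝ) : ℂ) * τ ^ 2 + Complex.I * d * τ + 0))
      = Real.cos (τ * d) * Real.exp (-(w * τ ^ 2 / 2)) := by
    intro τ
    have : (-((w / 2 : ℝ) : ℂ) * τ ^ 2 + Complex.I * d * τ + 0)
        = ((-(w * τ ^ 2 / 2) : ℝ) : ℂ) + ((τ * d : ℝ) : ℂ) * Complex.I := by push_cast; ring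
    rw [this]
    change (Complex.exp _).re = _
    rw [Complex.exp_add, ← Complex.ofReal_exp, Complex.re_ofReal_mul,
      Complex.exp_ofReal_mul_I_re, mul_comm]
  simp_rw [h2] at h1
  rw [h1, h]
  have e1 : ((Real.pi : ℂ) / -(-((w / 2 : ℝ) : ℂ))) ^ (1 / 2 : ℂ)
      = ((√(2 * Real.pi / w) : ℝ) : ℂ) := by
    rw [Real.sqrt_eq_rpow, Complex.ofReal_cpow (by positivity)]
    push_cast
    congr 1
    field_simp
  have e2 : (0 : ℂ) - (Complex.I * d) ^ 2 / (4 * -((w / 2 : ℝ) : ℂ))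
      = ((-(1 / (2 * w)) * d ^ 2 : ℝ) : ℂ) := by
    have hwc : (w : ℂ) ≠ 0 := by exact_mod_cast hw.ne'
    rw [mul_pow, Complex.I_sq]
    push_cast
    field_simp
    norm_num
    ring
  rw [e1, e2, ← Complex.ofReal_exp, ← Complex.ofReal_mul]
  change (((√(2 * Real.pi / w) * Real.exp (-(1 / (2 * w)) * d ^ 2) : ℝ)) : ℂ).re = _
  rw [Complex.ofReal_re]
  have e3 : √(2 * Real.pi / w) = 2 * Real.pi * (1 / √(2 * Real.pi * w)) := by
    have h4 : 2 * Real.pi / w = (2 * Real.pi) ^ 2 / (2 * Real.pi * w) := by field_simp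
    rw [h4, Real.sqrt_div (by positivity), Real.sqrt_sq (by positivity)]
    ring
  rw [e3]; ring

lemma integral_exp_neg_mul_sq (w₁ w₂ τ : ℝ) :
    ∫ w in w₁..w₂, Real.exp (-(w * τ ^ 2 / 2)) * τ ^ 2 / 2
      = Real.exp (-(w₁ * τ ^ 2 / 2)) - Real.exp (-(w₂ * τ ^ 2 / 2)) := by
  have h : ∀ w ∈ Set.uIcc w₁ w₂, HasDerivAt (fun w => -Real.exp (-(w * τ ^ 2 / 2)))
      (Real.exp (-(w * τ ^ 2 / 2)) * τ ^ 2 / 2) w := by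
    intro w _
    have h1 : HasDerivAt (fun w : ℝ => -(w * τ ^ 2 / 2)) (-(1 * τ ^ 2 / 2)) w :=
      (((hasDerivAt_id w).mul_const _).div_const _).neg
    exact h1.exp.neg.congr_deriv (by ring)
  rw [intervalIntegral.integral_eq_sub_of_hasDerivAt h
    (Continuous.intervalIntegrable (by fun_prop) _ _)]
  ring

/-- A form of the heat equation: the derivative of `E|N(d, w)|` in `w` is the normal density at `d`.
On the Fourier side the derivative of the integrand is `cos(τd) e^{-wτ²/2}/2`, whose integral over
`τ` is `π` times that density, and Fubini exchanges the two integrations. -/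
lemma gaussAbs_sub_gaussAbs (d : ℝ) {w₁ w₂ : ℝ} (h₁ : 0 ≤ w₁) (h₁₂ : w₁ ≤ w₂) :
    gaussAbs d w₂ - gaussAbs d w₁
      = ∫ w in w₁..w₂, 1 / √(2 * Real.pi * w) * Real.exp (-(1 / (2 * w)) * d ^ 2) := by
  have hpi := Real.pi_pos
  have hexp : ∀ w : ℝ, 0 < w → ∫ τ : ℝ, Real.exp (-(w * τ ^ 2 / 2)) = √(2 * Real.pi) * w ^ (-(1 / 2) : ℝ) := by
    intro w hw
    have := integral_gaussian (w / 2)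
    have e : ∀ τ : ℝ, -(w * τ ^ 2 / 2) = -(w / 2) * τ ^ 2 := fun τ => by ring
    simp_rw [e]
    rw [this, Real.rpow_neg hw.le, ← Real.sqrt_eq_rpow, ← Real.sqrt_inv, ← Real.sqrt_mul (by positivity)]
    congr 1; field_simp
  have hint : Integrable (fun p : ℝ × ℝ => Real.cos (p.2 * d) * Real.exp (-(p.1 * p.2 ^ 2 / 2)))
      ((volume.restrict (Set.Ioc w₁ w₂)).prod volume) := by
    have h0 : Integrable (fun p : ℝ × ℝ => Real.exp (-(p.1 * p.2 ^ 2 / 2)))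
      ((volume.restrict (Set.Ioc w₁ w₂)).prod volume) := by
      rw [integrable_prod_iff (by fun_prop)]
      constructor
      · rw [ae_restrict_iff' measurableSet_Ioc]
        refine ae_of_all _ fun w hw => ?_
        have hw0 : 0 < w / 2 := by linarith [hw.1]
        convert integrable_exp_neg_mul_sq hw0 using 3
        ring
      -- The case `w₁ = 0` is allowed since the singularity `w^{-1/2}` is integrable at zero.
      · have h2 : IntegrableOn (fun w : ℝ => √(2 * Real.pi) * w ^ (-(1 / 2) : ℝ)) (Set.Ioc w₁ w₂) :=
          ((intervalIntegrable_iff_integrableOn_Ioc_of_le h₁₂).1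
            (intervalIntegral.intervalIntegrable_rpow' (by norm_num))).const_mul _
        refine h2.congr_fun (fun w hw => ?_) measurableSet_Ioc
        simp only [Real.norm_eq_abs, Real.abs_exp]
        rw [hexp w (by linarith [hw.1])]
    refine h0.mono' (by fun_prop) (ae_of_all _ fun p => ?_)
    rw [norm_mul, Real.norm_eq_abs, Real.norm_eq_abs, Real.abs_exp]
    exact mul_le_of_le_one_left (Real.exp_pos _).le (Real.abs_cos_le_one _)
  have hswap := integral_integral_swap
    (f := fun w τ : ℝ => Real.cos (τ * d) * Real.exp (-(w * τ ^ 2 / 2))) hint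
  have hR : ∀ τ : ℝ, τ ≠ 0 → ∫ w in Set.Ioc w₁ w₂, Real.cos (τ * d) * Real.exp (-(w * τ ^ 2 / 2))
      = 2 * (gaussAbsIntegrand d w₂ τ - gaussAbsIntegrand d w₁ τ) := by
    intro τ hτ
    rw [← intervalIntegral.integral_of_le h₁₂, intervalIntegral.integral_const_mul]
    have h3 := integral_exp_neg_mul_sq w₁ w₂ τ
    have h4 : ∀ w : ℝ, Real.exp (-(w * τ ^ 2 / 2)) * τ ^ 2 / 2
        = (τ ^ 2 / 2) * Real.exp (-(w * τ ^ 2 / 2)) := fun w => by ring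
    simp_rw [h4, intervalIntegral.integral_const_mul] at h3
    have h5 : ∫ w in w₁..w₂, Real.exp (-(w * τ ^ 2 / 2))
        = 2 * (τ ^ 2)⁻¹ * (Real.exp (-(w₁ * τ ^ 2 / 2)) - Real.exp (-(w₂ * τ ^ 2 / 2))) := by
      rw [← h3]
      generalize (∫ w in w₁..w₂, Real.exp (-(w * τ ^ 2 / 2))) = J
      field_simp
    rw [h5, gaussAbsIntegrand, gaussAbsIntegrand]; ring
  have hL : ∫ w in Set.Ioc w₁ w₂, ∫ τ : ℝ, Real.cos (τ * d) * Real.exp (-(w * τ ^ 2 / 2))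
      = 2 * Real.pi *
        ∫ w in w₁..w₂, 1 / √(2 * Real.pi * w) * Real.exp (-(1 / (2 * w)) * d ^ 2) := by
    rw [intervalIntegral.integral_of_le h₁₂, ← integral_const_mul]
    refine setIntegral_congr_fun measurableSet_Ioc fun w hw => ?_
    exact integral_cos_mul_exp_neg_sq d (by linarith [hw.1])
  have hR' : ∫ τ : ℝ, ∫ w in Set.Ioc w₁ w₂, Real.cos (τ * d) * Real.exp (-(w * τ ^ 2 / 2))
      = 2 * (Real.pi * gaussAbs d w₂ - Real.pi * gaussAbs d w₁) := by
    rw [← integral_gaussAbsIntegrand d h₁, ← integral_gaussAbsIntegrand d (h₁.trans h₁₂),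
      ← integral_sub (integrable_gaussAbsIntegrand d (h₁.trans h₁₂))
        (integrable_gaussAbsIntegrand d h₁), ← integral_const_mul]
    refine integral_congr_ae ?_
    have h0 : ∀ᵐ t : ℝ, t ≠ 0 := by simp [ae_iff]
    filter_upwards [h0] with τ hτ
    exact hR τ hτ
  rw [hL, hR'] at hswap
  have : 2 * Real.pi * (∫ w in w₁..w₂, 1 / √(2 * Real.pi * w) * Real.exp (-(1 / (2 * w)) * d ^ 2))
      = 2 * Real.pi * (gaussAbs d w₂ - gaussAbs d w₁) := by rw [hswap]; ring
  exact (mul_left_cancel₀ (by positivity) this).symm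

/-- This is the form in which `Γ_q` arises from counting meetings: an absolute moment at the final
time minus one at the time when the later walk starts. -/
lemma GammaQ_eq (κ : ℝ) {σa2 : ℝ} (hσ : 0 ≤ σa2) (a b : ℝ≥0 × ℝ) :
    GammaQ κ σa2 a b = κ / 2 * (gaussAbs (a.2 - b.2) (σa2 * ((b.1 : ℝ) + a.1))
      - gaussAbs (a.2 - b.2) (σa2 * |(b.1 : ℝ) - a.1|)) := by
  rw [GammaQ, gaussAbs_sub_gaussAbs _ (by positivity)]
  refine mul_le_mul_of_nonneg_left ?_ hσ
  rw [abs_le]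
  constructor <;> linarith [a.1.2, b.1.2]

/-! The kernel `Γ₀`. -/

/-- The difference of the indicators of `{x < y}` and `{x < q}`. -/
noncomputable def stepDiff (q y x : ℝ) : ℝ :=
  (Set.Iio y).indicator (fun _ => (1 : ℝ)) x - (Set.Iio q).indicator (fun _ => (1 : ℝ)) x

lemma measurable_stepDiff : Measurable fun p : ℝ × ℝ × ℝ => stepDiff p.1 p.2.1 p.2.2 := by
  unfold stepDiff
  have h1 : MeasurableSet {p : ℝ × ℝ × ℝ | p.2.2 < p.2.1} :=
    measurableSet_lt (by fun_prop) (by fun_prop)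
  have h2 : MeasurableSet {p : ℝ × ℝ × ℝ | p.2.2 < p.1} :=
    measurableSet_lt (by fun_prop) (by fun_prop)
  exact (measurable_const.indicator h1).sub (measurable_const.indicator h2)

lemma abs_stepDiff (q y x : ℝ) :
    |stepDiff q y x| = (Set.Ico (min q y) (max q y)).indicator (fun _ => (1 : ℝ)) x := by
  simp only [stepDiff, Set.indicator, Set.mem_Iio, Set.mem_Ico, min_le_iff, lt_max_iff]
  split_ifs <;> first | (norm_num; done) | (exfalso; grind)

lemma stepDiff_sq (q y x : ℝ) :
    stepDiff q y x ^ 2 = (Set.Ico (min q y) (max q y)).indicator (fun _ => (1 : ℝ)) x := by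
  rw [← sq_abs, abs_stepDiff]
  simp only [Set.indicator]; split_ifs <;> norm_num

lemma integrable_stepDiff_sq (q y : ℝ) : Integrable fun x => stepDiff q y x ^ 2 := by
  simp_rw [stepDiff_sq]
  exact (integrable_indicator_iff measurableSet_Ico).2 (by simp)

lemma integral_stepDiff_sq (q y : ℝ) : ∫ x, stepDiff q y x ^ 2 = |q - y| := by
  simp_rw [stepDiff_sq]
  rw [integral_indicator measurableSet_Ico]
  simp [max_sub_min_eq_abs, abs_sub_comm]

/-- Polarization: each factor is a difference of two indicators, and `(A - B)(C - D)` is a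
combination of the squares of the four cross differences. -/
lemma stepDiff_mul (q r y y' x : ℝ) : stepDiff q y x * stepDiff r y' x
    = (stepDiff r y x ^ 2 + stepDiff q y' x ^ 2 - stepDiff y' y x ^ 2 - stepDiff r q x ^ 2) / 2 := by
  unfold stepDiff
  simp only [Set.indicator]
  split_ifs <;> norm_num

lemma integrable_stepDiff_mul (q r y y' : ℝ) :
    Integrable fun x => stepDiff q y x * stepDiff r y' x := by
  simp_rw [stepDiff_mul]
  exact ((((integrable_stepDiff_sq _ _).add (integrable_stepDiff_sq _ _)).sub
    (integrable_stepDiff_sq _ _)).sub (integrable_stepDiff_sq _ _)).div_const 2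

lemma integral_stepDiff_mul (q r y y' : ℝ) : ∫ x, stepDiff q y x * stepDiff r y' x
    = (|y - r| + |y' - q| - |y - y'| - |q - r|) / 2 := by
  have i := integrable_stepDiff_sq
  simp_rw [stepDiff_mul]
  rw [integral_div, integral_sub (f := fun x => stepDiff r y x ^ 2 + stepDiff q y' x ^ 2
      - stepDiff y' y x ^ 2) (((i _ _).add (i _ _)).sub (i _ _)) (i _ _),
    integral_sub (f := fun x => stepDiff r y x ^ 2 + stepDiff q y' x ^ 2)
      ((i _ _).add (i _ _)) (i _ _), integral_add (i _ _) (i _ _)]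
  simp_rw [integral_stepDiff_sq]
  rw [abs_sub_comm r y, abs_sub_comm q y', abs_sub_comm y' y, abs_sub_comm r q]

/-- `P[q + σ_a B(s) > x]` for `x ≥ q` and `-P[q + σ_a B(s) ≤ x]` for `x < q`. -/
noncomputable def signedTail (σa2 : ℝ) (a : ℝ≥0 × ℝ) (x : ℝ) : ℝ :=
  if a.2 ≤ x then probGT σa2 a.1 (x - a.2) else -probLE σa2 a.1 (x - a.2)

lemma scaledBMLaw_map_add (σa2 : ℝ) (a : ℝ≥0 × ℝ) :
    (scaledBMLaw σa2 a.1).map (fun y => y + a.2) = gaussianReal a.2 (σa2.toNNReal * a.1) := by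
  rw [scaledBMLaw, gaussianReal_map_add_const, zero_add]

/-- A signed tail is thus a mean over one Gaussian variable, and a product of two of them a mean
over two independent ones. -/
lemma signedTail_eq (σa2 : ℝ) (a : ℝ≥0 × ℝ) (x : ℝ) :
    signedTail σa2 a x
      = ∫ y, stepDiff a.2 y x ∂gaussianReal a.2 (σa2.toNNReal * a.1) := by
  have : IsProbabilityMeasure (scaledBMLaw σa2 a.1) := by unfold scaledBMLaw; infer_instance
  have h1 : ∀ y : ℝ, (Set.Iio (y + a.2)).indicator (fun _ => (1 : ℝ)) x
      = (Set.Ioi (x - a.2)).indicator (fun _ => (1 : ℝ)) y := by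
    intro y
    simp only [Set.indicator, Set.mem_Iio, Set.mem_Ioi, sub_lt_iff_lt_add]
  have hm : Measurable fun y : ℝ => stepDiff a.2 y x :=
    measurable_stepDiff.comp (by fun_prop : Measurable fun y : ℝ => (a.2, y, x))
  rw [← scaledBMLaw_map_add, integral_map (by fun_prop) hm.aestronglyMeasurable]
  simp only [stepDiff, h1]
  rw [integral_sub ((integrable_const _).indicator measurableSet_Ioi) (integrable_const _),
    integral_indicator measurableSet_Ioi]
  simp only [integral_const, smul_eq_mul, mul_one, measureReal_restrict_apply MeasurableSet.univ,
    Set.univ_inter, probReal_univ, one_mul, signedTail]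
  split_ifs with h
  · rw [Set.indicator_of_notMem (by simpa using h), sub_zero, probGT]
  · rw [Set.indicator_of_mem (by simpa using h), probLE, ← Set.compl_Iic,
      probReal_compl_eq_one_sub measurableSet_Iic]
    ring

lemma integrable_abs_sub_gaussianReal (d c : ℝ) (w : ℝ≥0) :
    Integrable (fun y : ℝ => |y - c|) (gaussianReal d w) :=
  ((integrable_id_gaussianReal d w).sub (integrable_const c)).abs

lemma integral_abs_sub_gaussianReal (d c w : ℝ) :
    ∫ y, |y - c| ∂gaussianReal d w.toNNReal = gaussAbs (d - c) w := by
  rw [gaussAbs, ← gaussianReal_map_sub_const, integral_map (by fun_prop) (by fun_prop)]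

lemma integrable_stepDiff_mul_prod (q r : ℝ) (w w' : ℝ≥0) :
    Integrable (fun p : (ℝ × ℝ) × ℝ => stepDiff q p.1.1 p.2 * stepDiff r p.1.2 p.2)
      (((gaussianReal q w).prod (gaussianReal r w')).prod volume) := by
  have hm1 : Measurable fun p : (ℝ × ℝ) × ℝ => stepDiff q p.1.1 p.2 :=
    measurable_stepDiff.comp (by fun_prop : Measurable fun p : (ℝ × ℝ) × ℝ => (q, p.1.1, p.2))
  have hm2 : Measurable fun p : (ℝ × ℝ) × ℝ => stepDiff r p.1.2 p.2 :=
    measurable_stepDiff.comp (by fun_prop : Measurable fun p : (ℝ × ℝ) × ℝ => (r, p.1.2, p.2))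
  have hm : Measurable fun p : (ℝ × ℝ) × ℝ => stepDiff q p.1.1 p.2 * stepDiff r p.1.2 p.2 :=
    hm1.mul hm2
  rw [integrable_prod_iff hm.aestronglyMeasurable]
  refine ⟨ae_of_all _ fun p => integrable_stepDiff_mul q r p.1 p.2, ?_⟩
  have hb : Integrable (fun p : ℝ × ℝ => |p.1 - q|) ((gaussianReal q w).prod (gaussianReal r w')) :=
    (integrable_abs_sub_gaussianReal q q w).comp_fst _
  refine hb.mono' ?_ (ae_of_all _ fun p => ?_)
  · exact hm.norm.stronglyMeasurable.integral_prod_right.aestronglyMeasurable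
  · rw [Real.norm_of_nonneg (integral_nonneg fun _ => norm_nonneg _), ← abs_sub_comm,
      ← integral_stepDiff_sq]
    refine integral_mono (integrable_stepDiff_mul q r p.1 p.2).norm
      (integrable_stepDiff_sq _ _) fun x => ?_
    simp only [norm_mul, Real.norm_eq_abs, abs_stepDiff, stepDiff_sq, Set.indicator]
    split_ifs <;> norm_num

/-- After Fubini the `x`-integral is done first. Polarization turns it into distances between the
points `q`, `r` and two independent Gaussian variables, which are then averaged. -/
lemma integral_signedTail_mul {σa2 : ℝ} (hσ : 0 ≤ σa2) (a b : ℝ≥0 × ℝ) :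
    Integrable (fun x => signedTail σa2 a x * signedTail σa2 b x) ∧
    ∫ x, signedTail σa2 a x * signedTail σa2 b x
      = (gaussAbs (a.2 - b.2) (σa2 * a.1) + gaussAbs (b.2 - a.2) (σa2 * b.1)
        - gaussAbs (a.2 - b.2) (σa2 * (a.1 + b.1)) - |a.2 - b.2|) / 2 := by
  set w := σa2.toNNReal * a.1 with hw
  set w' := σa2.toNNReal * b.1 with hw'
  have hint := integrable_stepDiff_mul_prod a.2 b.2 w w'
  have hprod : ∀ x, ∫ p : ℝ × ℝ, stepDiff a.2 p.1 x * stepDiff b.2 p.2 x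
      ∂((gaussianReal a.2 w).prod (gaussianReal b.2 w'))
      = signedTail σa2 a x * signedTail σa2 b x := by
    intro x
    rw [integral_prod_mul (fun y => stepDiff a.2 y x) (fun y => stepDiff b.2 y x),
      signedTail_eq, signedTail_eq]
  have hs := integral_integral_swap
    (f := fun (p : ℝ × ℝ) (x : ℝ) => stepDiff a.2 p.1 x * stepDiff b.2 p.2 x) hint
  simp_rw [hprod, integral_stepDiff_mul] at hs
  refine ⟨by simpa only [hprod] using hint.integral_prod_right, hs.symm.trans ?_⟩
  have e1 : (w : ℝ≥0) = (σa2 * a.1).toNNReal := by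
    rw [hw, Real.toNNReal_mul hσ, Real.toNNReal_coe]
  have e2 : (w' : ℝ≥0) = (σa2 * b.1).toNNReal := by
    rw [hw', Real.toNNReal_mul hσ, Real.toNNReal_coe]
  have e3 : w + w' = (σa2 * (a.1 + b.1)).toNNReal := by
    rw [hw, hw', ← mul_add, ← NNReal.coe_add, Real.toNNReal_mul hσ, Real.toNNReal_coe]
  set ν := (gaussianReal a.2 w).prod (gaussianReal b.2 w')
  have i1 : Integrable (fun p : ℝ × ℝ => |p.1 - b.2|) ν :=
    (integrable_abs_sub_gaussianReal a.2 b.2 w).comp_fst _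
  have i2 : Integrable (fun p : ℝ × ℝ => |p.2 - a.2|) ν :=
    (integrable_abs_sub_gaussianReal b.2 a.2 w').comp_snd _
  have i3 : Integrable (fun p : ℝ × ℝ => |p.1 - p.2|) ν :=
    (((integrable_id_gaussianReal a.2 w).comp_fst _).sub
      ((integrable_id_gaussianReal b.2 w').comp_snd _)).abs
  rw [integral_div, integral_sub (f := fun p : ℝ × ℝ => |p.1 - b.2| + |p.2 - a.2| - |p.1 - p.2|)
      ((i1.add i2).sub i3) (integrable_const _),
    integral_sub (f := fun p : ℝ × ℝ => |p.1 - b.2| + |p.2 - a.2|) (i1.add i2) i3,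
    integral_add i1 i2]
  have j1 : ∫ p : ℝ × ℝ, |p.1 - b.2| ∂ν = gaussAbs (a.2 - b.2) (σa2 * a.1) := by
    rw [integral_fun_fst (fun y : ℝ => |y - b.2|), e1, integral_abs_sub_gaussianReal]; simp
  have j2 : ∫ p : ℝ × ℝ, |p.2 - a.2| ∂ν = gaussAbs (b.2 - a.2) (σa2 * b.1) := by
    rw [integral_fun_snd (fun y : ℝ => |y - a.2|), e2, integral_abs_sub_gaussianReal]; simp
  have j3 : ∫ p : ℝ × ℝ, |p.1 - p.2| ∂ν = gaussAbs (a.2 - b.2) (σa2 * (a.1 + b.1)) := by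
    have hc : ν.map (fun p => p.1 - p.2) = gaussianReal (a.2 - b.2) (w + w') := by
      have hmap := Measure.map_prod_map (gaussianReal a.2 w) (gaussianReal b.2 w')
        (f := id) (g := fun y : ℝ => -y) measurable_id (by fun_prop)
      rw [sub_eq_add_neg a.2, ← gaussianReal_conv_gaussianReal, Measure.conv,
        ← gaussianReal_map_neg (μ := b.2)]
      rw [Measure.map_id] at hmap
      rw [hmap, Measure.map_map (by fun_prop) (by fun_prop)]
      rfl
    rw [gaussAbs, ← e3, ← hc, integral_map (by fun_prop) (by fun_prop)]
  rw [j1, j2, j3]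
  simp

/-- All integrals in `Γ₀` are restrictions of the integral of one function, the product of two
signed tails. Between `q` and `r` the two tails have opposite signs, hence the subtracted terms. -/
lemma Gamma0_eq {σa2 : ℝ} (hσ : 0 ≤ σa2) (a b : ℝ≥0 × ℝ) :
    Gamma0 σa2 a b = (gaussAbs (a.2 - b.2) (σa2 * a.1) + gaussAbs (b.2 - a.2) (σa2 * b.1)
        - gaussAbs (a.2 - b.2) (σa2 * (a.1 + b.1)) - |a.2 - b.2|) / 2 := by
  obtain ⟨hint, heq⟩ := integral_signedTail_mul hσ a b
  rw [← heq, Gamma0]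
  set f := fun x => signedTail σa2 a x * signedTail σa2 b x with hf
  have hmm : min a.2 b.2 ≤ max a.2 b.2 := min_le_max
  have s1 : ∫ x, f x = (∫ x in Set.Iio (min a.2 b.2), f x)
      + ((∫ x in (min a.2 b.2)..(max a.2 b.2), f x) + ∫ x in Set.Ioi (max a.2 b.2), f x) := by
    rw [intervalIntegral.integral_interval_add_Ioi hint.integrableOn hint.integrableOn,
      ← integral_Iic_eq_integral_Iio, intervalIntegral.integral_Iic_add_Ioi hint.integrableOn
        hint.integrableOn]
  have h1 : ∫ x in Set.Iio (min a.2 b.2), f x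
      = ∫ x in Set.Iio (min a.2 b.2), probLE σa2 a.1 (x - a.2) * probLE σa2 b.1 (x - b.2) := by
    refine setIntegral_congr_fun measurableSet_Iio fun x hx => ?_
    rw [Set.mem_Iio, lt_min_iff] at hx
    simp only [hf, signedTail, if_neg hx.1.not_ge, if_neg hx.2.not_ge]; ring
  have h2 : ∫ x in Set.Ioi (max a.2 b.2), f x
      = ∫ x in Set.Ioi (max a.2 b.2), probGT σa2 a.1 (x - a.2) * probGT σa2 b.1 (x - b.2) := by
    refine setIntegral_congr_fun measurableSet_Ioi fun x hx => ?_
    rw [Set.mem_Ioi, max_lt_iff] at hx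
    simp only [hf, signedTail, if_pos hx.1.le, if_pos hx.2.le]
  have h3 : ∫ x in (min a.2 b.2)..(max a.2 b.2), f x
      = -((if a.2 < b.2 then
        ∫ x in a.2..b.2, probGT σa2 a.1 (x - a.2) * probLE σa2 b.1 (x - b.2) else 0)
    + (if b.2 < a.2 then
        ∫ x in b.2..a.2, probLE σa2 a.1 (x - a.2) * probGT σa2 b.1 (x - b.2) else 0)) := by
    rcases lt_trichotomy a.2 b.2 with h | h | h
    · rw [if_pos h, if_neg h.not_gt, min_eq_left h.le, max_eq_right h.le, add_zero,
        ← intervalIntegral.integral_neg]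
      refine intervalIntegral.integral_congr_ae ?_
      -- At this endpoint the signed tail already takes its other branch, so one point is discarded.
      have h0 : ∀ᵐ t : ℝ, t ≠ b.2 := by simp [ae_iff]
      filter_upwards [h0] with x hx0 hx
      rw [Set.uIoc_of_le h.le] at hx
      have : x < b.2 := lt_of_le_of_ne hx.2 hx0
      simp only [hf, signedTail, if_pos hx.1.le, if_neg this.not_ge]; ring
    · rw [if_neg h.not_lt, if_neg h.not_gt, h]; simp
    · rw [if_neg h.not_gt, if_pos h, min_eq_right h.le, max_eq_left h.le, zero_add,
        ← intervalIntegral.integral_neg]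
      refine intervalIntegral.integral_congr_ae ?_
      have h0 : ∀ᵐ t : ℝ, t ≠ a.2 := by simp [ae_iff]
      filter_upwards [h0] with x hx0 hx
      rw [Set.uIoc_of_le h.le] at hx
      have : x < a.2 := lt_of_le_of_ne hx.2 hx0
      simp only [hf, signedTail, if_pos hx.1.le, if_neg this.not_ge]; ring
  rw [s1, h1, h2, h3]
  ring

end Covariances
-- Walks in a fixed environment and the duality with heights.
section Walks

/-- The possible steps. -/
noncomputable abbrev steps (M : ℕ) : Finset ℤ := Finset.Icc (-(M : ℤ)) M

/-- The box `{-R, ..., R}`. -/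
noncomputable abbrev box (R : ℕ) : Finset ℤ := Finset.Icc (-(R : ℤ)) R

lemma mem_box {R : ℕ} {x : ℤ} : x ∈ box R ↔ |x| ≤ R := by
  rw [Finset.mem_Icc, abs_le]

/-- Probability vectors supported on the possible steps. -/
structure IsProbVec (M : ℕ) (p : ℤ → ℝ) : Prop where
  nonneg : ∀ j, 0 ≤ p j
  range : ∀ j : ℤ, (M : ℤ) < |j| → p j = 0
  sum_eq_one : ∑ j ∈ steps M, p j = 1

lemma IsProbVec.le_one {M : ℕ} {p : ℤ → ℝ} (hp : IsProbVec M p) (j : ℤ) : p j ≤ 1 := by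
  by_cases hj : j ∈ steps M
  · rw [← hp.sum_eq_one]
    exact Finset.single_le_sum (fun i _ => hp.nonneg i) hj
  · rw [mem_box, not_le] at hj
    rw [hp.range j hj]; exact zero_le_one

/-- The mass at time `m` of a walk started at time `s` in `k`, in the environment `e`. -/
noncomputable def mass (M : ℕ) (e : ℕ → ℤ → ℤ → ℝ) (s : ℕ) (k : ℤ) : ℕ → ℤ → ℝ
  | 0, y => if s = 0 ∧ y = k then 1 else 0
  | m + 1, y => ∑ j ∈ steps M, mass M e s k m (y - j) * e m (y - j) j
      + if s = m + 1 ∧ y = k then 1 else 0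

variable {M : ℕ} {e : ℕ → ℤ → ℤ → ℝ} {s : ℕ} {k : ℤ}

lemma mass_eq_zero_of_lt {m : ℕ} (h : m < s) (y : ℤ) : mass M e s k m y = 0 := by
  induction m generalizing y with
  | zero => rw [mass, if_neg]; omega
  | succ m ih =>
    rw [mass, if_neg (by omega), add_zero]
    exact Finset.sum_eq_zero fun j _ => by rw [ih (by omega), zero_mul]

lemma mass_self (y : ℤ) : mass M e s k s y = if y = k then 1 else 0 := by
  cases s with
  | zero => simp [mass]
  | succ m =>
    rw [mass, Finset.sum_eq_zero fun j _ => by rw [mass_eq_zero_of_lt (by omega), zero_mul]]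
    simp

lemma mass_eq_zero_of_abs {m : ℕ} {y : ℤ} (h : |k| + M * m < |y|) : mass M e s k m y = 0 := by
  induction m generalizing y with
  | zero =>
    rw [mass, if_neg]
    rintro ⟨-, rfl⟩; simp at h
  | succ m ih =>
    push_cast at h
    rw [mass, if_neg, add_zero]
    · refine Finset.sum_eq_zero fun j hj => ?_
      rw [ih, zero_mul]
      rw [mem_box] at hj
      have := abs_sub_abs_le_abs_sub y j
      linarith
    · rintro ⟨-, rfl⟩
      have : (0 : ℤ) ≤ M * (m + 1) := by positivity
      linarith

lemma mass_nonneg (he : ∀ m x, IsProbVec M (e m x)) (m : ℕ) (y : ℤ) : 0 ≤ mass M e s k m y := by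
  induction m generalizing y with
  | zero => rw [mass]; split_ifs <;> norm_num
  | succ m ih =>
    rw [mass]
    refine add_nonneg (Finset.sum_nonneg fun j _ => mul_nonneg (ih _) ((he _ _).nonneg _)) ?_
    split_ifs <;> norm_num

/-- Both supports lie inside the box, so the two sums are sums over all of `ℤ`, which are invariant
under shifts. -/
lemma sum_box_shift {E : Type*} [AddCommMonoid E] {R : ℕ} {j : ℤ} (hj : |j| ≤ M) (g : ℤ → E)
    (hg : ∀ x, g x ≠ 0 → |x| + M ≤ R) :
    ∑ y ∈ box R, g (y - j) = ∑ x ∈ box R, g x := by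
  have h1 : (Function.support g) ⊆ box R := by
    intro x hx
    rw [Finset.mem_coe, mem_box]
    have := hg x hx
    omega
  have h2 : (Function.support fun y => g (y - j)) ⊆ box R := by
    intro y hy
    rw [Finset.mem_coe, mem_box]
    have := hg _ hy
    have := abs_sub_abs_le_abs_sub y j
    omega
  rw [← finsum_eq_sum_of_support_subset _ h1, ← finsum_eq_sum_of_support_subset _ h2]
  exact finsum_comp_equiv (Equiv.subRight j)

/-- One step of the walk, integrated against a test function. -/
lemma sum_mass_succ {E : Type*} [AddCommGroup E] [Module ℝ E] {R m : ℕ}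
    (hR : |k| + M * (m + 1 : ℕ) ≤ R) (f : ℤ → E) :
    ∑ y ∈ box R, mass M e s k (m + 1) y • f y
      = ∑ x ∈ box R, mass M e s k m x • ∑ j ∈ steps M, e m x j • f (x + j)
        + if s = m + 1 then f k else 0 := by
  push_cast at hR
  have hk : k ∈ box R := by
    rw [mem_box]
    have : (0 : ℤ) ≤ M * (m + 1) := by positivity
    linarith
  simp only [mass, add_smul, Finset.sum_add_distrib]
  congr 1
  · simp only [Finset.sum_smul, Finset.smul_sum]
    rw [Finset.sum_comm, Finset.sum_comm (s := box R) (t := steps M)]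
    refine Finset.sum_congr rfl fun j hj => ?_
    have h := sum_box_shift (R := R) (mem_box.1 hj)
      (fun x => mass M e s k m x • e m x j • f (x + j)) (fun x hx => by
        by_contra hc
        refine hx ?_
        rw [mass_eq_zero_of_abs, zero_smul]
        linarith)
    rw [← h]
    refine Finset.sum_congr rfl fun y _ => ?_
    rw [sub_add_cancel, mul_smul]
  · by_cases hs : s = m + 1
    · simp only [hs, true_and, if_true]
      rw [Finset.sum_eq_single k]
      · simp
      · intro b _ hb; simp [hb]
      · exact fun h => absurd hk h
    · simp [hs]

lemma sum_mass_self {E : Type*} [AddCommGroup E] [Module ℝ E] {R : ℕ}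
    (hR : |k| ≤ R) (f : ℤ → E) :
    ∑ y ∈ box R, mass M e s k s y • f y = f k := by
  simp only [mass_self]
  rw [Finset.sum_eq_single k]
  · simp
  · intro b _ hb; simp [hb]
  · exact fun h => absurd (mem_box.2 hR) h

lemma sum_mass (he : ∀ m x, IsProbVec M (e m x)) {R m : ℕ} (hR : |k| + M * m ≤ R) :
    ∑ y ∈ box R, mass M e s k m y = if s ≤ m then 1 else 0 := by
  rcases lt_or_ge m s with h | h
  · rw [if_neg (by omega)]
    exact Finset.sum_eq_zero fun y _ => mass_eq_zero_of_lt h y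
  rw [if_pos h]
  induction m, h using Nat.le_induction with
  | base =>
    have := sum_mass_self (M := M) (e := e) (s := s) (k := k) (R := R) (by
      have : (0 : ℤ) ≤ M * s := by positivity
      linarith) (fun _ => (1 : ℝ))
    simpa using this
  | succ m hm ih =>
    have h := sum_mass_succ (M := M) (e := e) (s := s) (k := k) hR (fun _ => (1 : ℝ))
    simp only [smul_eq_mul, mul_one, (he _ _).sum_eq_one] at h
    rw [h, if_neg (by omega), add_zero]
    refine ih ?_
    push_cast at hR
    have : (0 : ℤ) ≤ M := by positivity
    linarith

lemma sum_mass_le_one (he : ∀ m x, IsProbVec M (e m x)) {R m : ℕ} (hR : |k| + M * m ≤ R) :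
    ∑ y ∈ box R, mass M e s k m y ≤ 1 := by
  rw [sum_mass he hR]; split_ifs <;> norm_num

lemma mass_le_one (he : ∀ m x, IsProbVec M (e m x)) (m : ℕ) (y : ℤ) : mass M e s k m y ≤ 1 := by
  have h := sum_mass_le_one (s := s) (k := k) he (R := k.natAbs + M * m + y.natAbs) (m := m)
    (by push_cast; linarith [abs_nonneg y])
  refine (Finset.single_le_sum (fun i _ => mass_nonneg he m i) ?_).trans h
  rw [mem_box]; push_cast
  have : (0 : ℤ) ≤ M * m := by positivity
  linarith [abs_nonneg k, abs_nonneg y]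

/-- The environment seen backwards from time `N`. -/
def reflectTime (N m : ℕ) : ℕ := if m < N then N - m else m + 1

/-- Times below `N` go onto `{1, ..., N}` and the others beyond `N`. Injectivity on all of `ℕ` lets
the reflected environment inherit independence. -/
lemma reflectTime_injective (N : ℕ) : Function.Injective (reflectTime N) := by
  intro a b h
  unfold reflectTime at h
  split_ifs at h <;> omega

/-- The heights of the random average process are quenched averages of the initial heights. -/
lemma height_eq_sum_mass (u : ℕ → ℤ → ℤ → ℝ) (σ : ℤ → ℝ) {N τ R : ℕ} (hτ : τ ≤ N)
    (hR : |k| + M * N ≤ R) :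
    height M u σ τ k
      = ∑ x ∈ box R, mass M (fun m => u (reflectTime N m)) (N - τ) k N x * σ x := by
  have hMN : (0 : ℤ) ≤ M * N := by positivity
  -- The quenched mean of the height at time `N - m` is constant in `m`: a step of the walk undoes
  -- one application of the averaging rule. At `m = N - τ` it is the height itself, at `m = N` a
  -- mean of initial heights.
  have key : ∀ m, N - τ ≤ m → m ≤ N → ∑ x ∈ box R,
      mass M (fun m => u (reflectTime N m)) (N - τ) k m x * height M u σ (N - m) x
      = height M u σ τ k := by
    intro m hm
    induction m, hm using Nat.le_induction with
    | base =>
      intro _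
      have := sum_mass_self (M := M) (e := fun m => u (reflectTime N m)) (s := N - τ) (k := k)
        (R := R) (by linarith) (height M u σ (N - (N - τ)))
      rw [show N - (N - τ) = τ by omega] at this ⊢
      simpa using this
    | succ m hm ih =>
      intro hmN
      rw [← ih (by omega)]
      have h := sum_mass_succ (M := M) (e := fun m => u (reflectTime N m)) (s := N - τ) (k := k)
        (R := R) (m := m) (by
          have : (M : ℤ) * (m + 1 : ℕ) ≤ M * N := by gcongr
          linarith) (height M u σ (N - (m + 1)))
      simp only [smul_eq_mul] at h
      rw [h, if_neg (by omega), add_zero]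
      refine Finset.sum_congr rfl fun x _ => ?_
      congr 1
      have h1 : N - m = (N - (m + 1)) + 1 := by omega
      rw [h1, height]
      refine Finset.sum_congr rfl fun j _ => ?_
      rw [reflectTime, if_pos (by omega), h1]
  have := key N (by omega) le_rfl
  rw [← this]
  simp [height]

end Walks

/-! ### The i.i.d. environment and the information in sets of its sites. -/

section Environment

variable {Ω : Type*}

/-- An i.i.d. environment of everywhere defined probability vectors with common law that of `w`. -/
structure IsEnv [MeasurableSpace Ω] (μ : Measure Ω) (M : ℕ) (w : Ω → ℤ → ℝ)
    (e : ℕ → ℤ → Ω → ℤ → ℝ) : Prop where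
  base_measurable : Measurable w
  base_isProbVec : ∀ ω, IsProbVec M (w ω)
  measurable : ∀ m x, Measurable (e m x)
  isProbVec : ∀ m x ω, IsProbVec M (e m x ω)
  indep : iIndepFun (fun p : ℕ × ℤ => e p.1 p.2) μ
  identDistrib : ∀ m x, IdentDistrib (e m x) w μ μ

/-- The information carried by the space-time points in `T`. -/
@[reducible] def info (e : ℕ → ℤ → Ω → ℤ → ℝ) (T : Set (ℕ × ℤ)) : MeasurableSpace Ω :=
  ⨆ p ∈ T, MeasurableSpace.comap (e p.1 p.2) MeasurableSpace.pi

/-- The space-time points before time `m`. -/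
def before (m : ℕ) : Set (ℕ × ℤ) := {p | p.1 < m}

lemma before_mono {m m' : ℕ} (h : m ≤ m') : before m ⊆ before m' := fun _ hp => lt_of_lt_of_le hp h

lemma info_mono {e : ℕ → ℤ → Ω → ℤ → ℝ} {S T : Set (ℕ × ℤ)} (h : S ⊆ T) : info e S ≤ info e T :=
  biSup_mono h

lemma measurable_info {e : ℕ → ℤ → Ω → ℤ → ℝ} {T : Set (ℕ × ℤ)} {m : ℕ} {x : ℤ}
    (h : (m, x) ∈ T) : Measurable[info e T] (e m x) := by
  have h1 : MeasurableSpace.comap (e m x) MeasurableSpace.pi ≤ info e T :=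
    le_biSup (fun p : ℕ × ℤ => MeasurableSpace.comap (e p.1 p.2) MeasurableSpace.pi) h
  exact measurable_iff_comap_le.2 h1

lemma measurable_info_apply {e : ℕ → ℤ → Ω → ℤ → ℝ} {T : Set (ℕ × ℤ)} {m : ℕ} {x : ℤ}
    (h : (m, x) ∈ T) (j : ℤ) : Measurable[info e T] fun ω => e m x ω j :=
  (measurable_pi_apply j).comp (measurable_info h)

/-- The step out of time `m` uses only the weights at time `m`. Quenched laws at time `m` are
therefore predictable, that is, independent of those weights. -/
lemma measurable_mass {e : ℕ → ℤ → Ω → ℤ → ℝ} {M s : ℕ} {k : ℤ} (m : ℕ) (y : ℤ) :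
    Measurable[info e (before m)] fun ω => mass M (fun m x => e m x ω) s k m y := by
  induction m generalizing y with
  | zero => simp only [mass]; exact measurable_const
  | succ m ih =>
    simp only [mass]
    refine Measurable.add ?_ measurable_const
    refine Finset.measurable_fun_sum _ fun j _ => Measurable.mul ?_ ?_
    · exact (ih (y - j)).mono (info_mono (before_mono m.le_succ)) le_rfl
    · exact measurable_info_apply (T := before (m + 1)) (by simp [before]) j

namespace IsEnv

variable [MeasurableSpace Ω] {μ : Measure Ω} {M : ℕ} {w : Ω → ℤ → ℝ} {e : ℕ → ℤ → Ω → ℤ → ℝ}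
  (he : IsEnv μ M w e)

include he in
lemma info_le (T : Set (ℕ × ℤ)) : info e T ≤ ‹MeasurableSpace Ω› :=
  iSup₂_le fun p _ => (he.measurable p.1 p.2).comap_le

include he in
-- This replaces conditional expectations throughout: functions of disjoint sets of sites factor
-- under the integral.
lemma integral_mul_of_disjoint {𝕜 : Type*} [RCLike 𝕜] {S T : Set (ℕ × ℤ)} (hST : Disjoint S T)
    {f g : Ω → 𝕜} (hf : Measurable[info e S] f) (hg : Measurable[info e T] g) :
    ∫ ω, f ω * g ω ∂μ = (∫ ω, f ω ∂μ) * ∫ ω, g ω ∂μ := by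
  have h0 : iIndep (fun p : ℕ × ℤ => MeasurableSpace.comap (e p.1 p.2) MeasurableSpace.pi) μ :=
    (iIndepFun_iff_iIndep _ _ _).1 he.indep
  have h1 : Indep (info e S) (info e T) μ :=
    indep_iSup_of_disjoint (m := fun p : ℕ × ℤ => MeasurableSpace.comap (e p.1 p.2)
      MeasurableSpace.pi) (fun p => (he.measurable p.1 p.2).comap_le) h0 hST
  have h2 : IndepFun f g μ :=
    indep_of_indep_of_le_right (indep_of_indep_of_le_left h1 hf.comap_le) hg.comap_le
  exact h2.integral_fun_mul_eq_mul_integral (hf.mono (he.info_le S) le_rfl).aestronglyMeasurable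
    (hg.mono (he.info_le T) le_rfl).aestronglyMeasurable

end IsEnv

end Environment
-- Characteristic function defects, the span condition and the potential kernel.
section PotentialKernel

/-- `∑_{x,y} r(x, y) (1 - cos (t (x - y)))`. -/
noncomputable def cosDefect (M : ℕ) (r : ℤ → ℤ → ℝ) (t : ℝ) : ℝ :=
  ∑ x ∈ steps M, ∑ y ∈ steps M, r x y * (1 - Real.cos (t * ((x : ℝ) - y)))

/-- The defect `1 - |φ|²` of the characteristic function `φ` of `p`. -/
noncomputable abbrev charDefect (M : ℕ) (p : ℤ → ℝ) : ℝ → ℝ :=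
  cosDefect M fun x y => p x * p y

/-- The mean of a probability vector. -/
noncomputable def vecMean (M : ℕ) (p : ℤ → ℝ) : ℝ := ∑ x ∈ steps M, (x : ℝ) * p x

/-- The variance of a probability vector. -/
noncomputable def vecVar (M : ℕ) (p : ℤ → ℝ) : ℝ :=
  ∑ x ∈ steps M, ((x : ℝ) - vecMean M p) ^ 2 * p x

variable {M : ℕ} {p : ℤ → ℝ}

lemma continuous_cosDefect (r : ℤ → ℤ → ℝ) : Continuous (cosDefect M r) := by
  unfold cosDefect; fun_prop

lemma measurable_cosDefect (r : ℤ → ℤ → ℝ) : Measurable (cosDefect M r) :=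
  (continuous_cosDefect r).measurable

lemma cosDefect_nonneg {r : ℤ → ℤ → ℝ} (hr : ∀ x y, 0 ≤ r x y) (t : ℝ) : 0 ≤ cosDefect M r t :=
  Finset.sum_nonneg fun x _ => Finset.sum_nonneg fun y _ =>
    mul_nonneg (hr x y) (one_sub_cos_nonneg _)

lemma charDefect_nonneg (hp : IsProbVec M p) (t : ℝ) : 0 ≤ charDefect M p t :=
  cosDefect_nonneg (fun x y => mul_nonneg (hp.nonneg x) (hp.nonneg y)) t

lemma sum_sum_mul_eq_one (hp : IsProbVec M p) :
    ∑ x ∈ steps M, ∑ y ∈ steps M, p x * p y = 1 := by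
  rw [← Finset.sum_mul_sum, hp.sum_eq_one, one_mul]

lemma sum_sq_diff (hp : IsProbVec M p) :
    ∑ x ∈ steps M, ∑ y ∈ steps M, p x * p y * ((x : ℝ) - y) ^ 2 = 2 * vecVar M p := by
  set V := vecMean M p with hV
  have h1 : ∀ x y : ℤ, p x * p y * ((x : ℝ) - y) ^ 2 = ((x : ℝ) - V) ^ 2 * p x * p y
      + p x * (((y : ℝ) - V) ^ 2 * p y) - 2 * ((((x : ℝ) - V) * p x) * (((y : ℝ) - V) * p y)) := by
    intro x y; ring
  have h2 : ∑ x ∈ steps M, ((x : ℝ) - V) * p x = 0 := by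
    simp only [sub_mul, Finset.sum_sub_distrib, ← Finset.mul_sum, hp.sum_eq_one]
    rw [mul_one, hV, vecMean, sub_self]
  simp_rw [h1, Finset.sum_sub_distrib, Finset.sum_add_distrib]
  rw [← Finset.sum_mul_sum, ← Finset.sum_mul_sum]
  simp_rw [← Finset.mul_sum]
  rw [← Finset.sum_mul, h2, hp.sum_eq_one, vecVar]
  ring

lemma vecVar_nonneg (hp : IsProbVec M p) : 0 ≤ vecVar M p :=
  Finset.sum_nonneg fun x _ => mul_nonneg (sq_nonneg _) (hp.nonneg x)

lemma cosDefect_le (r : ℤ → ℤ → ℝ) (hr : ∀ x y, 0 ≤ r x y) (t : ℝ) : cosDefect M r t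
    ≤ (∑ x ∈ steps M, ∑ y ∈ steps M, r x y * ((x : ℝ) - y) ^ 2) * (t ^ 2 / 2) := by
  rw [cosDefect, Finset.sum_mul]
  refine Finset.sum_le_sum fun x _ => ?_
  rw [Finset.sum_mul]
  refine Finset.sum_le_sum fun y _ => ?_
  rw [mul_assoc]
  exact mul_le_mul_of_nonneg_left ((one_sub_cos_le _).trans_eq (by ring)) (hr x y)

lemma abs_one_sub_cos_sub_le (x : ℝ) : |1 - Real.cos x - x ^ 2 / 2| ≤ x ^ 4 := by
  have h4 : |x| ^ 4 = x ^ 4 := by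
    rw [show (4 : ℕ) = 2 * 2 from rfl, pow_mul, sq_abs, ← pow_mul]
  rcases le_or_gt |x| 1 with h | h
  · have h1 := Real.cos_bound h
    rw [show 1 - Real.cos x - x ^ 2 / 2 = -(Real.cos x - (1 - x ^ 2 / 2)) by ring, abs_neg]
    refine h1.trans ?_
    rw [h4]
    have : 0 ≤ x ^ 4 := by positivity
    linarith
  · have h1 := one_sub_cos_le x
    have h2 := one_sub_cos_nonneg x
    have h3 : x ^ 2 ≤ x ^ 4 := by
      have : 1 ≤ x ^ 2 := by rw [← sq_abs]; nlinarith [abs_nonneg x]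
      nlinarith
    rw [abs_le]
    constructor <;> nlinarith [sq_nonneg x]

lemma abs_one_sub_cos_mul_sub_le (t z : ℝ) :
    |1 - Real.cos (t * z) - z ^ 2 * (1 - Real.cos t)| ≤ (z ^ 4 + z ^ 2) * t ^ 4 := by
  have h1 := abs_one_sub_cos_sub_le (t * z)
  have h2 := abs_one_sub_cos_sub_le t
  have e : 1 - Real.cos (t * z) - z ^ 2 * (1 - Real.cos t)
      = (1 - Real.cos (t * z) - (t * z) ^ 2 / 2) - z ^ 2 * (1 - Real.cos t - t ^ 2 / 2) := by ring
  rw [e]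
  refine (abs_sub _ _).trans ?_
  rw [abs_mul, abs_of_nonneg (sq_nonneg z)]
  nlinarith [mul_le_mul_of_nonneg_left h2 (sq_nonneg z)]

/-- The expansion is made against `1 - cos t` and not `t²/2`, so that the potential kernel can be
compared with the exactly computed Fejér integrals. -/
lemma abs_charDefect_sub_le (hp : IsProbVec M p) : ∃ C, 0 ≤ C ∧ ∀ t : ℝ,
    |charDefect M p t - 2 * vecVar M p * (1 - Real.cos t)| ≤ C * t ^ 4 := by
  refine ⟨∑ x ∈ steps M, ∑ y ∈ steps M,
    p x * p y * (((x : ℝ) - y) ^ 4 + ((x : ℝ) - y) ^ 2), ?_, fun t => ?_⟩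
  · exact Finset.sum_nonneg fun x _ => Finset.sum_nonneg fun y _ =>
      mul_nonneg (mul_nonneg (hp.nonneg x) (hp.nonneg y)) (by positivity)
  · rw [← sum_sq_diff hp]
    unfold charDefect cosDefect
    simp_rw [Finset.sum_mul, ← Finset.sum_sub_distrib]
    refine (Finset.abs_sum_le_sum_abs _ _).trans (Finset.sum_le_sum fun x _ => ?_)
    refine (Finset.abs_sum_le_sum_abs _ _).trans (Finset.sum_le_sum fun y _ => ?_)
    have hpp := mul_nonneg (hp.nonneg x) (hp.nonneg y)
    rw [mul_assoc (p x * p y), ← mul_sub, abs_mul, abs_of_nonneg hpp, mul_assoc (p x * p y)]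
    exact mul_le_mul_of_nonneg_left (abs_one_sub_cos_mul_sub_le _ _) hpp

/-- The probability vector `p` has span `1`. -/
def HasSpanOne (p : ℤ → ℝ) : Prop :=
  ¬ ∃ h : ℤ, 1 < h ∧ ∃ x : ℤ, ∑' k : ℤ, p (x + k * h) = 1

lemma tsum_eq_one_of_support (hp : IsProbVec M p) {h x₀ : ℤ} (hh : 0 < h)
    (hsupp : ∀ x, p x ≠ 0 → h ∣ x - x₀) : ∑' k : ℤ, p (x₀ + k * h) = 1 := by
  have hinj : Function.Injective fun k : ℤ => x₀ + k * h := by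
    intro a b hab
    simp only [add_right_inj] at hab
    exact mul_right_cancel₀ hh.ne' hab
  have h1 : ∑' k : ℤ, p (x₀ + k * h) = ∑' x : ℤ, p x := by
    refine hinj.tsum_eq (f := p) fun x hx => ?_
    obtain ⟨c, hc⟩ := hsupp x hx
    exact ⟨c, by simp only; rw [mul_comm, ← hc]; ring⟩
  rw [h1, tsum_eq_sum (s := steps M), hp.sum_eq_one]
  intro x hx
  rw [mem_box, not_le] at hx
  exact hp.range x hx

/-- If the defect vanished at `t`, every difference of two points of the support would lie in the
subgroup of integers `z` with `tz ∈ 2πℤ`. This subgroup is proper for `0 < |t| ≤ π`, which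
contradicts span one. -/
lemma charDefect_pos (hp : IsProbVec M p) (hspan : HasSpanOne p) {t : ℝ} (ht : |t| ≤ Real.pi)
    (h0 : t ≠ 0) : 0 < charDefect M p t := by
  refine lt_of_le_of_ne (charDefect_nonneg hp t) fun hz => hspan ?_
  have hpi := Real.pi_pos
  let G : AddSubgroup ℤ :=
    { carrier := {z : ℤ | ∃ n : ℤ, (n : ℝ) * (2 * Real.pi) = t * z}
      zero_mem' := ⟨0, by simp⟩
      add_mem' := by
        rintro a b ⟨n, hn⟩ ⟨m, hm⟩
        exact ⟨n + m, by push_cast; rw [add_mul, hn, hm]; ring⟩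
      neg_mem' := by
        rintro a ⟨n, hn⟩
        exact ⟨-n, by push_cast; rw [neg_mul, hn]; ring⟩ }
  have hG : ∀ x y, p x ≠ 0 → p y ≠ 0 → x - y ∈ G := by
    intro x y hx hy
    have hmem : ∀ z, p z ≠ 0 → z ∈ steps M := by
      intro z hzz
      by_contra hc
      rw [mem_box, not_le] at hc
      exact hzz (hp.range z hc)
    have hnn : ∀ x ∈ steps M, ∀ y ∈ steps M,
        0 ≤ p x * p y * (1 - Real.cos (t * ((x : ℝ) - y))) := fun x _ y _ =>
      mul_nonneg (mul_nonneg (hp.nonneg x) (hp.nonneg y)) (one_sub_cos_nonneg _)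
    have h1 := (Finset.sum_eq_zero_iff_of_nonneg fun x hx =>
      Finset.sum_nonneg (hnn x hx)).1 hz.symm x (hmem x hx)
    have h2 := (Finset.sum_eq_zero_iff_of_nonneg (hnn x (hmem x hx))).1 h1 y (hmem y hy)
    have h3 : Real.cos (t * ((x : ℝ) - y)) = 1 := by
      rcases mul_eq_zero.1 h2 with h | h
      · exact absurd h (mul_ne_zero hx hy)
      · linarith
    obtain ⟨n, hn⟩ := (Real.cos_eq_one_iff _).1 h3
    exact ⟨n, by rw [hn]; push_cast; ring⟩
  obtain ⟨x₀, hx₀⟩ : ∃ x, p x ≠ 0 := by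
    by_contra hc
    push Not at hc
    have := hp.sum_eq_one
    rw [Finset.sum_eq_zero fun x _ => hc x] at this
    exact zero_ne_one this
  obtain ⟨g, hg⟩ := Int.subgroup_cyclic G
  have hdvd : ∀ z, z ∈ G ↔ g.natAbs ∣ z.natAbs := by
    intro z
    rw [hg, ← AddSubgroup.zmultiples_eq_closure, Int.mem_zmultiples_iff, Int.natAbs_dvd_natAbs]
  -- If `1` belonged to the subgroup, `t` would be a nonzero multiple of `2π`.
  have hg1 : g.natAbs ≠ 1 := by
    intro h1
    have : (1 : ℤ) ∈ G := by rw [hdvd, h1]; simp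
    obtain ⟨n, hn⟩ := this
    rw [Int.cast_one, mul_one] at hn
    have hn0 : n ≠ 0 := by rintro rfl; simp at hn; exact h0 hn.symm
    have : (1 : ℝ) ≤ |(n : ℝ)| := by exact_mod_cast Int.one_le_abs hn0
    have h2 : |t| = |(n : ℝ)| * (2 * Real.pi) := by
      rw [← hn, abs_mul, abs_of_pos (by positivity : 0 < 2 * Real.pi)]
    nlinarith
  rcases Nat.eq_zero_or_pos g.natAbs with h | h
  -- The trivial subgroup means that `p` is a point mass, so any `h > 1` contradicts the span
  -- condition; `2` is taken.
  · refine ⟨2, by norm_num, x₀, tsum_eq_one_of_support hp (by norm_num) fun x hx => ?_⟩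
    have := (hdvd _).1 (hG x x₀ hx hx₀)
    rw [h, zero_dvd_iff, Int.natAbs_eq_zero] at this
    rw [this]; exact dvd_zero _
  · refine ⟨g.natAbs, by omega, x₀, tsum_eq_one_of_support hp (by omega) fun x hx => ?_⟩
    exact Int.natCast_dvd.2 ((hdvd _).1 (hG x x₀ hx hx₀))

lemma vecVar_pos (hp : IsProbVec M p) (hspan : HasSpanOne p) : 0 < vecVar M p := by
  have h1 := charDefect_pos hp hspan (t := 1)
    (by rw [abs_one]; linarith [Real.pi_gt_three]) one_ne_zero
  have h2 := cosDefect_le (M := M) (fun x y => p x * p y)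
    (fun x y => mul_nonneg (hp.nonneg x) (hp.nonneg y)) 1
  rw [sum_sq_diff hp] at h2
  linarith

/-- Near zero the quadratic expansion with positive variance gives the bound; away from zero it
follows from positivity and compactness. -/
lemma exists_le_charDefect (hp : IsProbVec M p) (hspan : HasSpanOne p) :
    ∃ c, 0 < c ∧ ∀ t, |t| ≤ Real.pi → c * t ^ 2 ≤ charDefect M p t := by
  have hpi := Real.pi_pos
  have hσ := vecVar_pos hp hspan
  obtain ⟨C, hC0, hC⟩ := abs_charDefect_sub_le hp
  set σ := vecVar M p
  -- For `|t| ≤ δ` the quartic error is at most `(2/π²)σt²`, half of the lower bound `2σ · (2/π²)t²`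
  -- for the main term.
  obtain ⟨δ, hδ, hδ1⟩ : ∃ δ : ℝ, 0 < δ ∧ C * δ ^ 2 ≤ 2 / Real.pi ^ 2 * σ := by
    refine ⟨√(2 / Real.pi ^ 2 * σ / (C + 1)), by positivity, ?_⟩
    rw [Real.sq_sqrt (by positivity), ← mul_div_assoc, div_le_iff₀ (by positivity)]
    have : 0 ≤ 2 / Real.pi ^ 2 * σ := by positivity
    nlinarith
  have hK : IsCompact {t : ℝ | δ ≤ |t| ∧ |t| ≤ Real.pi} := by
    refine (isCompact_Icc (a := -Real.pi) (b := Real.pi)).of_isClosed_subset ?_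
      fun t ht => abs_le.1 ht.2
    exact (isClosed_le continuous_const continuous_abs).inter
      (isClosed_le continuous_abs continuous_const)
  obtain ⟨m, hm, hmin⟩ : ∃ m, 0 < m ∧ ∀ t : ℝ, δ ≤ |t| → |t| ≤ Real.pi → m ≤ charDefect M p t := by
    rcases Set.eq_empty_or_nonempty {t : ℝ | δ ≤ |t| ∧ |t| ≤ Real.pi} with h | h
    · exact ⟨1, one_pos, fun t h1 h2 => absurd (show t ∈ {t : ℝ | δ ≤ |t| ∧ |t| ≤ Real.pi} from
        ⟨h1, h2⟩) (by rw [h]; simp)⟩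
    · obtain ⟨t₀, ht₀, hmin⟩ := hK.exists_isMinOn h
        (continuous_cosDefect (M := M) fun x y => p x * p y).continuousOn
      refine ⟨_, charDefect_pos hp hspan ht₀.2 ?_, fun t h1 h2 => hmin ⟨h1, h2⟩⟩
      rintro rfl
      have := ht₀.1
      rw [abs_zero] at this; linarith
  refine ⟨min (2 / Real.pi ^ 2 * σ) (m / Real.pi ^ 2), by positivity, fun t ht => ?_⟩
  rcases le_or_gt δ |t| with h | h
  · refine le_trans ?_ (hmin t h ht)
    have h2 : t ^ 2 ≤ Real.pi ^ 2 := by rw [← sq_abs]; gcongr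
    calc _ ≤ m / Real.pi ^ 2 * Real.pi ^ 2 := by
          gcongr; exact min_le_right _ _
      _ = m := by field_simp
  · have h1 := (abs_le.1 (hC t)).1
    have h2 := two_div_pi_sq_mul_sq_le_one_sub_cos ht
    have h3 : t ^ 2 ≤ δ ^ 2 := by rw [← sq_abs]; gcongr
    have h4 : C * t ^ 4 ≤ 2 / Real.pi ^ 2 * σ * t ^ 2 := by
      calc C * t ^ 4 = C * t ^ 2 * t ^ 2 := by ring
        _ ≤ C * δ ^ 2 * t ^ 2 := by gcongr
        _ ≤ _ := by gcongr
    have h5 : 2 * σ * (2 / Real.pi ^ 2 * t ^ 2) ≤ 2 * σ * (1 - Real.cos t) := by gcongr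
    calc _ ≤ 2 / Real.pi ^ 2 * σ * t ^ 2 := by gcongr; exact min_le_left _ _
      _ ≤ _ := by linarith

/-- The potential kernel of the symmetrized walk. -/
noncomputable def potential (M : ℕ) (p : ℤ → ℝ) (y : ℤ) : ℝ :=
  1 / (2 * Real.pi) * ∫ t in (-Real.pi)..Real.pi, (1 - Real.cos (t * y)) / charDefect M p t

@[simp] lemma potential_zero : potential M p 0 = 0 := by simp [potential]

lemma exists_abs_div_charDefect_le (hp : IsProbVec M p) (hspan : HasSpanOne p) :
    ∃ C, 0 ≤ C ∧ ∀ (g : ℝ) (B t : ℝ), 0 ≤ B → |t| ≤ Real.pi → |g| ≤ B * t ^ 2 →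
      |g / charDefect M p t| ≤ C * B := by
  obtain ⟨c, hc, h⟩ := exists_le_charDefect hp hspan
  refine ⟨c⁻¹, by positivity, fun g B t hB ht hg => ?_⟩
  rcases eq_or_ne t 0 with rfl | h0
  · have : charDefect M p 0 = 0 := by simp [cosDefect]
    rw [this, div_zero, abs_zero]; positivity
  · have h1 := h t ht
    have ht2 : 0 < t ^ 2 := by positivity
    have h2 : 0 < charDefect M p t := lt_of_lt_of_le (by positivity) h1
    rw [abs_div, abs_of_pos h2, div_le_iff₀ h2]
    calc |g| ≤ B * t ^ 2 := hg
      _ = c⁻¹ * B * (c * t ^ 2) := by field_simp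
      _ ≤ _ := by gcongr

end PotentialKernel
-- Linear growth of the potential kernel and its Poisson equation.
section PotentialAsymptotics

lemma intervalIntegrable_finsetSum {ι : Type*} (s : Finset ι) {f : ι → ℝ → ℝ} {a b : ℝ}
    (h : ∀ i, IntervalIntegrable (f i) volume a b) :
    IntervalIntegrable (fun t => ∑ i ∈ s, f i t) volume a b := by
  have := IntervalIntegrable.sum s fun i _ => h i
  rwa [show (∑ i ∈ s, f i) = fun t => ∑ i ∈ s, f i t from funext fun t => by simp] at this

variable {M : ℕ} {p : ℤ → ℝ}

lemma intervalIntegrable_div_charDefect (hp : IsProbVec M p) (hspan : HasSpanOne p) {g : ℝ → ℝ}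
    (hg : Measurable g) {B : ℝ} (hB : 0 ≤ B) (h : ∀ t, |t| ≤ Real.pi → |g t| ≤ B * t ^ 2) :
    IntervalIntegrable (fun t => g t / charDefect M p t) volume (-Real.pi) Real.pi := by
  obtain ⟨C, -, hC⟩ := exists_abs_div_charDefect_le hp hspan
  exact intervalIntegrable_of_bound (hg.div (measurable_cosDefect _)) (C * B)
    fun t ht => hC _ _ _ hB ht (h t ht)

lemma abs_one_sub_cos_mul_le (t y : ℝ) : |1 - Real.cos (t * y)| ≤ y ^ 2 / 2 * t ^ 2 := by
  rw [abs_of_nonneg (one_sub_cos_nonneg _)]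
  exact (one_sub_cos_le _).trans_eq (by ring)

lemma intervalIntegrable_potential (hp : IsProbVec M p) (hspan : HasSpanOne p) (y : ℤ) :
    IntervalIntegrable (fun t => (1 - Real.cos (t * y)) / charDefect M p t) volume
      (-Real.pi) Real.pi :=
  intervalIntegrable_div_charDefect hp hspan (by fun_prop) (B := (y : ℝ) ^ 2 / 2) (by positivity)
    fun t _ => abs_one_sub_cos_mul_le t y

lemma potential_nonneg (hp : IsProbVec M p) (y : ℤ) : 0 ≤ potential M p y := by
  have hpi := Real.pi_pos
  refine mul_nonneg (by positivity) (intervalIntegral.integral_nonneg (by linarith) fun t _ => ?_)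
  exact div_nonneg (one_sub_cos_nonneg _) (charDefect_nonneg hp t)

/-- With the denominator replaced by `2σ(1 - cos t)` the integral is exactly `|y|/(2σ)`. The
replacement costs a bounded amount uniformly in `y`, because the denominators are of order `t²` and
differ by `O(t⁴)`. -/
lemma exists_abs_potential_sub_le (hp : IsProbVec M p) (hspan : HasSpanOne p) :
    ∃ C, 0 ≤ C ∧ ∀ y : ℤ, |potential M p y - |(y : ℝ)| / (2 * vecVar M p)| ≤ C := by
  have hpi := Real.pi_pos
  have hσ := vecVar_pos hp hspan
  obtain ⟨C, hC0, hC⟩ := abs_charDefect_sub_le hp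
  obtain ⟨c, hc, hcd⟩ := exists_le_charDefect hp hspan
  set σ := vecVar M p
  -- The quotient of the error `C t⁴` by the product of the two quadratic lower bounds for the
  -- denominators. The factor `2` in the bound `2 * B` is the bound for `1 - cos`.
  set B := C / (c * (2 * σ * (2 / Real.pi ^ 2))) with hB
  have hB0 : 0 ≤ B := by positivity
  have hbr : ∀ t, |t| ≤ Real.pi → ∀ y : ℤ, |(1 - Real.cos (t * y)) / charDefect M p t
      - (1 - Real.cos (t * y)) / (1 - Real.cos t) / (2 * σ)| ≤ 2 * B := by
    intro t ht y
    rcases eq_or_ne t 0 with rfl | h0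
    · simpa using hB0
    have h1 := hcd t ht
    have h2 := two_div_pi_sq_mul_sq_le_one_sub_cos ht
    have ht2 : 0 < t ^ 2 := by positivity
    have h3 : 0 < charDefect M p t := lt_of_lt_of_le (by positivity) h1
    have h4 : 0 < 1 - Real.cos t := lt_of_lt_of_le (by positivity) h2
    have e : (1 - Real.cos (t * y)) / charDefect M p t
      - (1 - Real.cos (t * y)) / (1 - Real.cos t) / (2 * σ)
      = (1 - Real.cos (t * y)) * (-(charDefect M p t - 2 * σ * (1 - Real.cos t))
        / (charDefect M p t * (2 * σ * (1 - Real.cos t)))) := by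
      field_simp; ring
    have h5 : |1 - Real.cos (t * y)| ≤ 2 := by
      rw [abs_of_nonneg (one_sub_cos_nonneg _)]
      linarith [Real.neg_one_le_cos (t * y)]
    rw [e, abs_mul]
    refine mul_le_mul h5 ?_ (abs_nonneg _) (by norm_num)
    rw [abs_div, abs_neg, abs_of_pos (by positivity : 0 < charDefect M p t *
      (2 * σ * (1 - Real.cos t))), hB, div_le_div_iff₀ (by positivity) (by positivity)]
    calc _ ≤ C * t ^ 4 * (c * (2 * σ * (2 / Real.pi ^ 2))) := by gcongr; exact hC t
      _ = C * (c * t ^ 2 * (2 * σ * (2 / Real.pi ^ 2 * t ^ 2))) := by ring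
      _ ≤ _ := by gcongr
  refine ⟨2 * B, by positivity, fun y => ?_⟩
  have h1 := intervalIntegrable_potential hp hspan y
  have h2 := (intervalIntegrable_fejer y).div_const (2 * σ)
  have e : potential M p y - |(y : ℝ)| / (2 * σ) = 1 / (2 * Real.pi) *
      ∫ t in (-Real.pi)..Real.pi, ((1 - Real.cos (t * y)) / charDefect M p t
      - (1 - Real.cos (t * y)) / (1 - Real.cos t) / (2 * σ)) := by
    rw [intervalIntegral.integral_sub h1 h2, intervalIntegral.integral_div, integral_fejer,
      potential, mul_sub]
    congr 1
    field_simp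
  rw [e, abs_mul, abs_of_pos (by positivity)]
  have h3 := intervalIntegral.norm_integral_le_of_norm_le_const (a := -Real.pi) (b := Real.pi)
    (C := 2 * B) (f := fun t => (1 - Real.cos (t * y)) / charDefect M p t
      - (1 - Real.cos (t * y)) / (1 - Real.cos t) / (2 * σ)) (fun t ht => by
        rw [Set.uIoc_of_le (by linarith)] at ht
        exact hbr t (abs_le.2 ⟨ht.1.le, ht.2⟩) y)
  rw [Real.norm_eq_abs, show Real.pi - -Real.pi = 2 * Real.pi by ring,
    abs_of_pos (by positivity : 0 < 2 * Real.pi)] at h3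
  calc _ ≤ 1 / (2 * Real.pi) * (2 * B * (2 * Real.pi)) := by gcongr
    _ = 2 * B := by field_simp

/-- The kernel is at bounded distance from a Lipschitz function. This bounds the noise of the
potential under single steps. -/
lemma exists_abs_potential_increment_le (hp : IsProbVec M p) (hspan : HasSpanOne p) (K : ℝ) :
    ∃ L, 0 ≤ L ∧ ∀ x y : ℤ, |(x : ℝ) - y| ≤ K → |potential M p x - potential M p y| ≤ L := by
  obtain ⟨C, hC0, hC⟩ := exists_abs_potential_sub_le hp hspan
  have hσ := vecVar_pos hp hspan
  refine ⟨2 * C + |K| / (2 * vecVar M p), by positivity, fun x y h => ?_⟩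
  have h1 := abs_le.1 (hC x)
  have h2 := abs_le.1 (hC y)
  have h3 : |(|(x : ℝ)|) / (2 * vecVar M p) - |(y : ℝ)| / (2 * vecVar M p)|
      ≤ |K| / (2 * vecVar M p) := by
    rw [← sub_div, abs_div, abs_of_pos (by positivity : 0 < 2 * vecVar M p)]
    exact div_le_div_of_nonneg_right
      ((abs_abs_sub_abs_le_abs_sub _ _).trans (h.trans (le_abs_self K))) (by positivity)
  have h4 := abs_le.1 h3
  rw [abs_le]; constructor <;> linarith

/-- Applied to the joint law of two steps taken from one site in one environment, the right side is
`β`. -/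
lemma sum_mul_potential (hp : IsProbVec M p) (hspan : HasSpanOne p) (r : ℤ → ℤ → ℝ) :
    ∑ z ∈ steps M, ∑ w ∈ steps M, r z w * potential M p (z - w)
      = 1 / (2 * Real.pi) * ∫ t in (-Real.pi)..Real.pi, cosDefect M r t / charDefect M p t := by
  have hi : ∀ z w : ℤ, IntervalIntegrable (fun t => r z w *
      ((1 - Real.cos (t * ((z - w : ℤ) : ℝ))) / charDefect M p t)) volume (-Real.pi) Real.pi :=
    fun z w => (intervalIntegrable_potential hp hspan (z - w)).const_mul _
  have e : ∀ t, cosDefect M r t / charDefect M p t = ∑ z ∈ steps M, ∑ w ∈ steps M, r z w *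
      ((1 - Real.cos (t * ((z - w : ℤ) : ℝ))) / charDefect M p t) := by
    intro t
    rw [cosDefect, Finset.sum_div]
    refine Finset.sum_congr rfl fun z _ => ?_
    rw [Finset.sum_div]
    refine Finset.sum_congr rfl fun w _ => ?_
    push_cast
    rw [mul_div_assoc]
  simp_rw [e]
  rw [intervalIntegral.integral_finsetSum fun z _ =>
    
    intervalIntegrable_finsetSum (steps M) fun w => hi z w, Finset.mul_sum]
  refine Finset.sum_congr rfl fun z _ => ?_
  rw [intervalIntegral.integral_finsetSum fun w _ => hi z w, Finset.mul_sum]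
  refine Finset.sum_congr rfl fun w _ => ?_
  rw [intervalIntegral.integral_const_mul, potential]
  ring

/-- The difference of two independent steps is symmetric, so the sine part of the addition formula
cancels. -/
lemma sum_mul_cos_add (hp : IsProbVec M p) (t y : ℝ) :
    ∑ z ∈ steps M, ∑ w ∈ steps M, p z * p w * (1 - Real.cos (t * (y + z - w)))
      = (1 - Real.cos (t * y)) + Real.cos (t * y) * charDefect M p t := by
  have hs : ∑ z ∈ steps M, ∑ w ∈ steps M, p z * p w * Real.sin (t * ((z : ℝ) - w)) = 0 := by
    have h : ∑ z ∈ steps M, ∑ w ∈ steps M, p z * p w * Real.sin (t * ((z : ℝ) - w))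
        = -∑ z ∈ steps M, ∑ w ∈ steps M, p z * p w * Real.sin (t * ((z : ℝ) - w)) := by
      conv_lhs => rw [Finset.sum_comm]
      rw [← Finset.sum_neg_distrib]
      refine Finset.sum_congr rfl fun z _ => ?_
      rw [← Finset.sum_neg_distrib]
      refine Finset.sum_congr rfl fun w _ => ?_
      rw [show t * ((w : ℝ) - z) = -(t * (z - w)) by ring, Real.sin_neg]
      ring
    linarith
  have h1 := sum_sum_mul_eq_one hp
  have e : ∀ z w : ℤ, p z * p w * (1 - Real.cos (t * (y + z - w)))
      = p z * p w * (1 - Real.cos (t * y))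
        + Real.cos (t * y) * (p z * p w * (1 - Real.cos (t * ((z : ℝ) - w))))
        + Real.sin (t * y) * (p z * p w * Real.sin (t * ((z : ℝ) - w))) := by
    intro z w
    rw [show t * (y + z - w) = t * y + t * ((z : ℝ) - w) by ring, Real.cos_add]
    ring
  simp_rw [e, Finset.sum_add_distrib, ← Finset.mul_sum, ← Finset.sum_mul]
  rw [hs, h1]
  simp only [charDefect, cosDefect]
  ring

/-- One step adds `charDefect` times `cos (ty)` to the numerator. The denominator cancels, and what
is left is the mean of `cos (ty)` over a period, which is one for `y = 0` and zero otherwise. -/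
lemma sum_mul_potential_add (hp : IsProbVec M p) (hspan : HasSpanOne p) (y : ℤ) :
    ∑ z ∈ steps M, ∑ w ∈ steps M, p z * p w * potential M p (y + z - w)
      = potential M p y + if y = 0 then 1 else 0 := by
  have hpi := Real.pi_pos
  have hi : ∀ z w : ℤ, IntervalIntegrable (fun t => p z * p w *
      ((1 - Real.cos (t * ((y + z - w : ℤ) : ℝ))) / charDefect M p t)) volume
      (-Real.pi) Real.pi :=
    fun z w => (intervalIntegrable_potential hp hspan (y + z - w)).const_mul _
  have h1 : ∑ z ∈ steps M, ∑ w ∈ steps M, p z * p w * potential M p (y + z - w)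
      = 1 / (2 * Real.pi) * ∫ t in (-Real.pi)..Real.pi,
        ∑ z ∈ steps M, ∑ w ∈ steps M, p z * p w *
          ((1 - Real.cos (t * ((y + z - w : ℤ) : ℝ))) / charDefect M p t) := by
    rw [intervalIntegral.integral_finsetSum fun z _ =>
      
    intervalIntegrable_finsetSum (steps M) fun w => hi z w, Finset.mul_sum]
    refine Finset.sum_congr rfl fun z _ => ?_
    rw [intervalIntegral.integral_finsetSum fun w _ => hi z w, Finset.mul_sum]
    refine Finset.sum_congr rfl fun w _ => ?_
    rw [intervalIntegral.integral_const_mul, potential]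
    ring
  have h2 : ∫ t in (-Real.pi)..Real.pi, ∑ z ∈ steps M, ∑ w ∈ steps M, p z * p w *
          ((1 - Real.cos (t * ((y + z - w : ℤ) : ℝ))) / charDefect M p t)
      = ∫ t in (-Real.pi)..Real.pi,
        ((1 - Real.cos (t * y)) / charDefect M p t + Real.cos (t * y)) := by
    refine intervalIntegral.integral_congr_ae ?_
    have h0 : ∀ᵐ t : ℝ, t ≠ 0 := by
      rw [ae_iff]; simp
    filter_upwards [h0] with t ht0 ht
    rw [Set.uIoc_of_le (by linarith)] at ht
    have hpos := charDefect_pos hp hspan (abs_le.2 ⟨ht.1.le, ht.2⟩) ht0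
    have h3 := sum_mul_cos_add hp t y
    rw [eq_comm, div_add' _ _ _ hpos.ne', ← h3, Finset.sum_div]
    refine Finset.sum_congr rfl fun z _ => ?_
    rw [Finset.sum_div]
    refine Finset.sum_congr rfl fun w _ => ?_
    push_cast
    rw [mul_div_assoc]
  rw [h1, h2, intervalIntegral.integral_add (intervalIntegrable_potential hp hspan y)
    ((by fun_prop : Continuous fun t : ℝ => Real.cos (t * y)).intervalIntegrable _ _), mul_add,
    ← potential]
  congr 1
  split_ifs with h
  · subst h
    simp only [Int.cast_zero, mul_zero, Real.cos_zero, intervalIntegral.integral_const,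
      smul_eq_mul]
    field_simp; ring
  · rw [integral_cos_mul_int h, mul_zero]

end PotentialAsymptotics
-- Finite Fourier series.
section Characters

/-- The finite Fourier series `∑_{x ∈ s} a(x) e^{itx}`. -/
noncomputable def fourierSum (s : Finset ℤ) (a : ℤ → ℝ) (t : ℝ) : ℂ :=
  ∑ x ∈ s, (a x : ℂ) * Complex.exp (Complex.I * t * x)

lemma fourierSum_re (s : Finset ℤ) (a : ℤ → ℝ) (t : ℝ) :
    (fourierSum s a t).re = ∑ x ∈ s, a x * Real.cos (t * x) := by
  rw [fourierSum, Complex.re_sum]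
  refine Finset.sum_congr rfl fun x _ => ?_
  rw [show Complex.I * t * x = ((t * x : ℝ) : ℂ) * Complex.I by push_cast; ring,
    Complex.re_ofReal_mul, Complex.exp_ofReal_mul_I_re]

lemma fourierSum_im (s : Finset ℤ) (a : ℤ → ℝ) (t : ℝ) :
    (fourierSum s a t).im = ∑ x ∈ s, a x * Real.sin (t * x) := by
  rw [fourierSum, Complex.im_sum]
  refine Finset.sum_congr rfl fun x _ => ?_
  rw [show Complex.I * t * x = ((t * x : ℝ) : ℂ) * Complex.I by push_cast; ring,
    Complex.im_ofReal_mul, Complex.exp_ofReal_mul_I_im]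

lemma re_fourierSum_mul_conj (s : Finset ℤ) (a b : ℤ → ℝ) (t : ℝ) :
    (fourierSum s a t * (starRingEnd ℂ) (fourierSum s b t)).re
      = ∑ x ∈ s, ∑ y ∈ s, a x * b y * Real.cos (t * ((x : ℝ) - y)) := by
  rw [Complex.mul_re, Complex.conj_re, Complex.conj_im, mul_neg, sub_neg_eq_add, fourierSum_re,
    fourierSum_re, fourierSum_im, fourierSum_im, Finset.sum_mul_sum, Finset.sum_mul_sum,
    ← Finset.sum_add_distrib]
  refine Finset.sum_congr rfl fun x _ => ?_
  rw [← Finset.sum_add_distrib]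
  refine Finset.sum_congr rfl fun y _ => ?_
  rw [mul_sub, Real.cos_sub]; ring

lemma norm_fourierSum_sq (s : Finset ℤ) (a : ℤ → ℝ) (t : ℝ) :
    ‖fourierSum s a t‖ ^ 2 = ∑ x ∈ s, ∑ y ∈ s, a x * a y * Real.cos (t * ((x : ℝ) - y)) := by
  rw [← re_fourierSum_mul_conj, Complex.mul_conj, Complex.ofReal_re, Complex.normSq_eq_norm_sq]

lemma norm_fourierSum_le {s : Finset ℤ} {a : ℤ → ℝ} (ha : ∀ x, 0 ≤ a x) (t : ℝ) :
    ‖fourierSum s a t‖ ≤ ∑ x ∈ s, a x := by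
  refine (norm_sum_le _ _).trans (Finset.sum_le_sum fun x _ => ?_)
  rw [show Complex.I * t * x = ((t * x : ℝ) : ℂ) * Complex.I by push_cast; ring, norm_mul,
    Complex.norm_exp_ofReal_mul_I, mul_one, Complex.norm_real, Real.norm_of_nonneg (ha x)]

lemma one_sub_norm_fourierSum_sq {M : ℕ} {p : ℤ → ℝ} (hp : IsProbVec M p) (t : ℝ) :
    1 - ‖fourierSum (steps M) p t‖ ^ 2 = charDefect M p t := by
  rw [norm_fourierSum_sq, ← sum_sum_mul_eq_one hp]
  simp only [charDefect, cosDefect, mul_sub, mul_one, Finset.sum_sub_distrib]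

lemma charDefect_le_one {M : ℕ} {p : ℤ → ℝ} (hp : IsProbVec M p) (t : ℝ) :
    charDefect M p t ≤ 1 := by
  rw [← one_sub_norm_fourierSum_sq hp]
  linarith [sq_nonneg ‖fourierSum (steps M) p t‖]

/-- The defect is at most one, and the mean of `1 - cos (ty)` over a period is one when `y ≠ 0`. -/
lemma one_le_potential {M : ℕ} {p : ℤ → ℝ} (hp : IsProbVec M p) (hspan : HasSpanOne p) {y : ℤ}
    (hy : y ≠ 0) : 1 ≤ potential M p y := by
  have hpi := Real.pi_pos
  have h1 : ∫ t in (-Real.pi)..Real.pi, (1 - Real.cos (t * y)) = 2 * Real.pi := by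
    rw [intervalIntegral.integral_sub (by simp)
      ((by fun_prop : Continuous fun t : ℝ => Real.cos (t * y)).intervalIntegrable _ _),
      integral_cos_mul_int hy]
    simp; ring
  have h2 : ∫ t in (-Real.pi)..Real.pi, (1 - Real.cos (t * y))
      ≤ ∫ t in (-Real.pi)..Real.pi, (1 - Real.cos (t * y)) / charDefect M p t := by
    refine intervalIntegral.integral_mono_on (by linarith)
      ((by fun_prop : Continuous fun t : ℝ => 1 - Real.cos (t * y)).intervalIntegrable _ _)
      (intervalIntegrable_potential hp hspan y) fun t ht => ?_
    rcases eq_or_ne t 0 with rfl | h0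
    · simp
    have hpos := charDefect_pos hp hspan (abs_le.2 ht) h0
    rw [le_div_iff₀ hpos]
    exact mul_le_of_le_one_right (one_sub_cos_nonneg _) (charDefect_le_one hp t)
  rw [h1] at h2
  rw [potential, one_div, ← div_eq_inv_mul, le_div_iff₀ (by positivity)]
  linarith

end Characters

/-! ### The constants of the model in terms of one- and two-point functions. -/

section Constants

variable {Ω : Type*} [MeasurableSpace Ω] {μ : Measure Ω} [IsProbabilityMeasure μ] {M : ℕ}
  {w : Ω → ℤ → ℝ}

/-- The two-point function `E u_0(0, x) u_0(0, y)`. -/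
noncomputable def pairProb (μ : Measure Ω) (w : Ω → ℤ → ℝ) (x y : ℤ) : ℝ :=
  ∫ ω, w ω x * w ω y ∂μ

lemma integrable_of_bound {E : Type*} [NormedAddCommGroup E] {f : Ω → E}
    (hf : AEStronglyMeasurable f μ) (C : ℝ) (h : ∀ ω, ‖f ω‖ ≤ C) : Integrable f μ :=
  Integrable.of_bound hf C (Eventually.of_forall h)

lemma integrable_apply (hw : Measurable w) (hP : ∀ ω, IsProbVec M (w ω)) (x : ℤ) :
    Integrable (fun ω => w ω x) μ := by
  refine integrable_of_bound ((measurable_pi_apply x).comp hw).aestronglyMeasurable 1 fun ω => ?_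
  rw [Real.norm_of_nonneg ((hP ω).nonneg x)]
  exact (hP ω).le_one x

lemma integrable_apply_mul_apply (hw : Measurable w) (hP : ∀ ω, IsProbVec M (w ω)) (x y : ℤ) :
    Integrable (fun ω => w ω x * w ω y) μ := by
  refine integrable_of_bound (((measurable_pi_apply x).comp hw).mul
    ((measurable_pi_apply y).comp hw)).aestronglyMeasurable 1 fun ω => ?_
  rw [Real.norm_of_nonneg (mul_nonneg ((hP ω).nonneg x) ((hP ω).nonneg y))]
  exact mul_le_one₀ ((hP ω).le_one x) ((hP ω).nonneg y) ((hP ω).le_one y)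

lemma isProbVec_avgProb (hw : Measurable w) (hP : ∀ ω, IsProbVec M (w ω)) :
    IsProbVec M (avgProb μ w) where
  nonneg j := integral_nonneg fun ω => (hP ω).nonneg j
  range j hj := by
    rw [avgProb]; simp [(hP _).range j hj]
  sum_eq_one := by
    simp only [avgProb]
    rw [← integral_finsetSum _ fun j _ => integrable_apply hw hP j]
    simp [(hP _).sum_eq_one]

omit [IsProbabilityMeasure μ] in
lemma pairProb_nonneg (hP : ∀ ω, IsProbVec M (w ω)) (x y : ℤ) : 0 ≤ pairProb μ w x y :=
  integral_nonneg fun ω => mul_nonneg ((hP ω).nonneg x) ((hP ω).nonneg y)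

lemma meanDrift_eq (hw : Measurable w) (hP : ∀ ω, IsProbVec M (w ω)) :
    meanDrift μ M w = vecMean M (avgProb μ w) := by
  simp only [meanDrift, drift, vecMean, avgProb]
  rw [integral_finsetSum _ fun j _ => (integrable_apply hw hP j).const_mul _]
  simp only [integral_const_mul]

lemma avgVar_eq (hw : Measurable w) (hP : ∀ ω, IsProbVec M (w ω)) :
    avgVar μ M w = vecVar M (avgProb μ w) := by
  rw [avgVar, vecVar, meanDrift_eq hw hP]

lemma one_sub_lam (hw : Measurable w) (hP : ∀ ω, IsProbVec M (w ω)) (t : ℝ) :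
    1 - lam μ M w t = cosDefect M (pairProb μ w) t := by
  have h1 : ∀ ω, 1 - ‖randChar M w ω t‖ ^ 2
      = ∑ x ∈ steps M, ∑ y ∈ steps M, w ω x * w ω y * (1 - Real.cos (t * ((x : ℝ) - y))) := by
    intro ω
    exact one_sub_norm_fourierSum_sq (hP ω) t
  have hi := integrable_apply_mul_apply (μ := μ) hw hP
  have h2 : Integrable (fun ω => 1 - ‖randChar M w ω t‖ ^ 2) μ := by
    simp only [h1]
    exact integrable_finsetSum _ fun x _ => integrable_finsetSum _ fun y _ => (hi x y).mul_const _
  have h3 : Integrable (fun ω => ‖randChar M w ω t‖ ^ 2) μ := by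
    have := (integrable_const (1 : ℝ)).sub h2
    refine this.congr (Eventually.of_forall fun ω => ?_)
    simp
  rw [lam, show (1 : ℝ) = ∫ _, (1 : ℝ) ∂μ by simp, ← integral_sub (integrable_const _) h3]
  simp only [h1]
  rw [integral_finsetSum _ fun x _ => integrable_finsetSum _ fun y _ => (hi x y).mul_const _,
    cosDefect]
  refine Finset.sum_congr rfl fun x _ => ?_
  rw [integral_finsetSum _ fun y _ => (hi x y).mul_const _]
  refine Finset.sum_congr rfl fun y _ => ?_
  rw [integral_mul_const, pairProb]

/-- This identifies `β` as the mean potential after two walks leave a common site in a common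
environment, that is, the gain per meeting. -/
lemma beta_eq (hw : Measurable w) (hP : ∀ ω, IsProbVec M (w ω))
    (hspan : HasSpanOne (avgProb μ w)) :
    beta μ M w = ∑ z ∈ steps M, ∑ v ∈ steps M,
      pairProb μ w z v * potential M (avgProb μ w) (z - v) := by
  have hp := isProbVec_avgProb (μ := μ) hw hP
  rw [sum_mul_potential hp hspan, beta]
  congr 2
  funext t
  rw [one_sub_lam hw hP, ← one_sub_norm_fourierSum_sq hp]
  rfl

/-- If no two distinct steps had positive joint weight, the weights would almost surely be a point
mass, against ellipticity. A pair with positive joint weight contributes a potential of at least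
one. -/
lemma beta_pos (hw : Measurable w) (hP : ∀ ω, IsProbVec M (w ω))
    (hspan : HasSpanOne (avgProb μ w)) (hell : Elliptic μ M w) : 0 < beta μ M w := by
  have hp := isProbVec_avgProb (μ := μ) hw hP
  obtain ⟨x, hx, y, hy, hxy, hr⟩ : ∃ x ∈ steps M, ∃ y ∈ steps M, x ≠ y ∧ 0 < pairProb μ w x y := by
    by_contra hc
    push Not at hc
    have h0 : ∀ x ∈ steps M, ∀ y ∈ steps M, x ≠ y → ∀ᵐ ω ∂μ, w ω x * w ω y = 0 := by
      intro x hx y hy hxy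
      exact (integral_eq_zero_iff_of_nonneg (fun ω => mul_nonneg ((hP ω).nonneg x)
        ((hP ω).nonneg y)) (integrable_apply_mul_apply hw hP x y)).1
        (le_antisymm (hc x hx y hy hxy) (pairProb_nonneg hP x y))
    have h1 : ∀ᵐ ω ∂μ, ∀ x ∈ steps M, ∀ y ∈ steps M, x ≠ y → w ω x * w ω y = 0 := by
      simp only [ae_all_iff]
      exact h0
    refine hell.ne' (measure_mono_null ?_ (ae_iff.1 h1))
    intro ω hω hcon
    have hs := (hP ω).sum_eq_one
    obtain ⟨x, hx, hx0⟩ : ∃ x ∈ steps M, w ω x ≠ 0 := by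
      by_contra hz
      push Not at hz
      rw [Finset.sum_eq_zero hz] at hs
      exact zero_ne_one hs
    rw [Finset.sum_eq_single_of_mem x hx fun y hy hyx =>
      (mul_eq_zero.1 (hcon x hx y hy hyx.symm)).resolve_left hx0] at hs
    exact absurd hs (hω x hx).ne
  rw [beta_eq hw hP hspan]
  have hnn : ∀ z v : ℤ, 0 ≤ pairProb μ w z v * potential M (avgProb μ w) (z - v) := fun z v =>
    mul_nonneg (pairProb_nonneg hP z v) (potential_nonneg hp _)
  refine lt_of_lt_of_le (mul_pos hr (lt_of_lt_of_le one_pos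
    (one_le_potential hp hspan (sub_ne_zero.2 hxy)))) ?_
  refine le_trans ?_ (Finset.single_le_sum (f := fun z => ∑ v ∈ steps M,
    pairProb μ w z v * potential M (avgProb μ w) (z - v))
    (fun z _ => Finset.sum_nonneg fun v _ => hnn z v) hx)
  exact Finset.single_le_sum (f := fun v =>
    pairProb μ w x v * potential M (avgProb μ w) (x - v)) (fun v _ => hnn x v) hy

end Constants
-- Quenched laws in the random environment and orthogonality of noises.
section QuenchedWalk

variable {Ω : Type*} [MeasurableSpace Ω] {μ : Measure Ω} [IsProbabilityMeasure μ] {M : ℕ}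
  {w : Ω → ℤ → ℝ} {e : ℕ → ℤ → Ω → ℤ → ℝ}

/-- The quenched distribution at time `m` of the walk started at time `s` in `k`. -/
noncomputable abbrev qmass (M : ℕ) (e : ℕ → ℤ → Ω → ℤ → ℝ) (s : ℕ) (k : ℤ) (m : ℕ) (ω : Ω) :
    ℤ → ℝ :=
  mass M (fun m x => e m x ω) s k m

lemma disjoint_before {m : ℕ} {T : Set (ℕ × ℤ)} (hT : ∀ p ∈ T, p.1 = m) :
    Disjoint (before m) T :=
  Set.disjoint_left.2 fun p hp hpT => by
    have h1 : p.1 < m := hp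
    have := hT p hpT
    omega

namespace IsEnv

lemma isProbVec_avg (he : IsEnv μ M w e) : IsProbVec M (avgProb μ w) :=
  isProbVec_avgProb he.base_measurable he.base_isProbVec

lemma measurable_of_info (he : IsEnv μ M w e) {β : Type*} [MeasurableSpace β]
    {T : Set (ℕ × ℤ)} {f : Ω → β} (hf : Measurable[info e T] f) : Measurable f :=
  hf.mono (he.info_le T) le_rfl

lemma integral_comp (he : IsEnv μ M w e) {E : Type*} [NormedAddCommGroup E] [NormedSpace ℝ E]
    [MeasurableSpace E] [BorelSpace E] {g : (ℤ → ℝ) → E} (hg : Measurable g) (m : ℕ) (x : ℤ) :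
    ∫ ω, g (e m x ω) ∂μ = ∫ ω, g (w ω) ∂μ :=
  ((he.identDistrib m x).comp hg).integral_eq

lemma integral_apply (he : IsEnv μ M w e) (m : ℕ) (x j : ℤ) :
    ∫ ω, e m x ω j ∂μ = avgProb μ w j :=
  he.integral_comp (measurable_pi_apply j) m x

lemma integral_apply_mul_apply (he : IsEnv μ M w e) (m : ℕ) (x i j : ℤ) :
    ∫ ω, e m x ω i * e m x ω j ∂μ = pairProb μ w i j :=
  he.integral_comp ((measurable_pi_apply i).mul (measurable_pi_apply j)) m x

lemma integral_apply_mul_apply_of_ne (he : IsEnv μ M w e) (m : ℕ) {x y : ℤ} (hxy : x ≠ y)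
    (i j : ℤ) : ∫ ω, e m x ω i * e m y ω j ∂μ = avgProb μ w i * avgProb μ w j := by
  rw [he.integral_mul_of_disjoint (S := {(m, x)}) (T := {(m, y)}) (by simp [hxy])
    (measurable_info_apply (Set.mem_singleton _) i)
    (measurable_info_apply (Set.mem_singleton _) j), he.integral_apply, he.integral_apply]

lemma measurable_apply (he : IsEnv μ M w e) (m : ℕ) (x j : ℤ) :
    Measurable fun ω => e m x ω j :=
  (measurable_pi_apply j).comp (he.measurable m x)

lemma measurable_qmass (he : IsEnv μ M w e) (s : ℕ) (k : ℤ) (m : ℕ) (y : ℤ) :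
    Measurable fun ω => qmass M e s k m ω y :=
  he.measurable_of_info (measurable_mass m y)

lemma qmass_nonneg (he : IsEnv μ M w e) (s : ℕ) (k : ℤ) (m : ℕ) (ω : Ω) (y : ℤ) :
    0 ≤ qmass M e s k m ω y := mass_nonneg (fun m x => he.isProbVec m x ω) m y

lemma qmass_le_one (he : IsEnv μ M w e) (s : ℕ) (k : ℤ) (m : ℕ) (ω : Ω) (y : ℤ) :
    qmass M e s k m ω y ≤ 1 := mass_le_one (fun m x => he.isProbVec m x ω) m y

lemma sum_qmass_le_one (he : IsEnv μ M w e) {s : ℕ} {k : ℤ} {m R : ℕ} (hR : |k| + M * m ≤ R)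
    (ω : Ω) : ∑ y ∈ box R, qmass M e s k m ω y ≤ 1 :=
  sum_mass_le_one (fun m x => he.isProbVec m x ω) hR

lemma sum_qmass (he : IsEnv μ M w e) {s : ℕ} {k : ℤ} {m R : ℕ} (hs : s ≤ m)
    (hR : |k| + M * m ≤ R) (ω : Ω) : ∑ y ∈ box R, qmass M e s k m ω y = 1 := by
  rw [sum_mass (fun m x => he.isProbVec m x ω) hR, if_pos hs]

lemma integrable_qmass (he : IsEnv μ M w e) (s : ℕ) (k : ℤ) (m : ℕ) (y : ℤ) :
    Integrable (fun ω => qmass M e s k m ω y) μ :=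
  integrable_of_bound (he.measurable_qmass s k m y).aestronglyMeasurable 1 fun ω => by
    rw [Real.norm_of_nonneg (he.qmass_nonneg ..)]
    exact he.qmass_le_one ..

/-- The annealed walk is the homogeneous walk with steps distributed according to `avgProb`. -/
lemma integral_qmass (he : IsEnv μ M w e) (s : ℕ) (k : ℤ) (m : ℕ) (y : ℤ) :
    ∫ ω, qmass M e s k m ω y ∂μ = mass M (fun _ _ => avgProb μ w) s k m y := by
  induction m generalizing y with
  | zero => simp [mass]
  | succ m ih =>
    have hi : ∀ j, Integrable (fun ω => qmass M e s k m ω (y - j) * e m (y - j) ω j) μ := by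
      intro j
      refine integrable_of_bound ((he.measurable_qmass s k m _).mul
        (he.measurable_apply m _ j)).aestronglyMeasurable 1 fun ω => ?_
      rw [Real.norm_of_nonneg (mul_nonneg (he.qmass_nonneg ..) ((he.isProbVec ..).nonneg j))]
      exact mul_le_one₀ (he.qmass_le_one ..) ((he.isProbVec ..).nonneg j)
        ((he.isProbVec ..).le_one j)
    simp only [mass]
    rw [integral_add (integrable_finsetSum _ fun j _ => hi j) (integrable_const _),
      integral_finsetSum _ fun j _ => hi j]
    congr 1
    · refine Finset.sum_congr rfl fun j _ => ?_
      rw [he.integral_mul_of_disjoint (S := before m) (T := {(m, y - j)})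
        (disjoint_before (by simp)) (measurable_mass m (y - j))
        (measurable_info_apply (Set.mem_singleton _) j), he.integral_apply]
      exact congrArg (· * _) (ih (y - j))
    · simp

/-- Orthogonality of the increments of a martingale of the environment. -/
lemma integral_add_sum_sq_le (he : IsEnv μ M w e) {ι : Type*} (I : Finset ι) {m : ℕ}
    {A : Ω → ℝ} (hA : Measurable[info e (before m)] A) {B : ℝ} (hAB : ∀ ω, |A ω| ≤ B)
    {f : ι → Ω → ℝ} (hf : ∀ i, Measurable[info e (before m)] (f i)) (hf0 : ∀ i ω, 0 ≤ f i ω)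
    (hf1 : ∀ i ω, f i ω ≤ 1) {T : ι → Set (ℕ × ℤ)} (hT : ∀ i, ∀ p ∈ T i, p.1 = m)
    {g : ι → Ω → ℝ} (hg : ∀ i, Measurable[info e (T i)] (g i)) {c : ℝ}
    (hgc : ∀ i ω, |g i ω| ≤ c) (hg0 : ∀ i, ∫ ω, g i ω ∂μ = 0) (o : ι → ι → ℝ)
    (ho : ∀ i j, 0 ≤ o i j) (ho1 : ∀ i j, ¬ Disjoint (T i) (T j) → 1 ≤ o i j) :
    ∫ ω, (A ω + ∑ i ∈ I, f i ω * g i ω) ^ 2 ∂μ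
      ≤ ∫ ω, A ω ^ 2 ∂μ + c ^ 2 * ∫ ω, ∑ i ∈ I, ∑ j ∈ I, o i j * (f i ω * f j ω) ∂μ := by
  have hA' := he.measurable_of_info hA
  have hf' := fun i => he.measurable_of_info (hf i)
  have hg' := fun i => he.measurable_of_info (hg i)
  have hfa : ∀ i ω, |f i ω| ≤ 1 := fun i ω => by rw [abs_of_nonneg (hf0 i ω)]; exact hf1 i ω
  have hB : 0 ≤ B := by
    obtain ⟨ω⟩ := nonempty_of_isProbabilityMeasure μ
    exact (abs_nonneg _).trans (hAB ω)
  have e1 : ∀ ω, (A ω + ∑ i ∈ I, f i ω * g i ω) ^ 2 = A ω ^ 2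
      + ∑ i ∈ I, 2 * (A ω * f i ω * g i ω)
      + ∑ i ∈ I, ∑ j ∈ I, f i ω * f j ω * (g i ω * g j ω) := by
    intro ω
    rw [add_sq, sq (∑ i ∈ I, f i ω * g i ω), Finset.sum_mul_sum, Finset.mul_sum]
    congr 1
    · congr 1
      exact Finset.sum_congr rfl fun i _ => by ring
    · exact Finset.sum_congr rfl fun i _ => Finset.sum_congr rfl fun j _ => by ring
  have iA : Integrable (fun ω => A ω ^ 2) μ :=
    integrable_of_bound (hA'.pow_const 2).aestronglyMeasurable (B ^ 2) fun ω => by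
      rw [Real.norm_eq_abs, abs_pow]; gcongr; exact hAB ω
  have iB : ∀ i, Integrable (fun ω => 2 * (A ω * f i ω * g i ω)) μ := fun i =>
    (integrable_of_bound ((hA'.mul (hf' i)).mul (hg' i)).aestronglyMeasurable (B * 1 * c)
      fun ω => by
        simp only [Real.norm_eq_abs, Pi.mul_apply, abs_mul]
        gcongr
        exacts [hAB ω, hfa i ω, hgc i ω]).const_mul 2
  have iC : ∀ i j, Integrable (fun ω => f i ω * f j ω * (g i ω * g j ω)) μ := fun i j =>
    integrable_of_bound (((hf' i).mul (hf' j)).mul ((hg' i).mul (hg' j))).aestronglyMeasurable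
      (1 * 1 * (c * c)) fun ω => by
        have hc : 0 ≤ c := (abs_nonneg _).trans (hgc i ω)
        simp only [Real.norm_eq_abs, abs_mul]
        gcongr
        exacts [hfa i ω, hfa j ω, hgc i ω, hgc j ω]
  have iD : ∀ i j, Integrable (fun ω => o i j * (f i ω * f j ω)) μ := fun i j =>
    (integrable_of_bound ((hf' i).mul (hf' j)).aestronglyMeasurable
      (1 * 1) fun ω => by
        simp only [Real.norm_eq_abs, Pi.mul_apply, abs_mul]
        gcongr
        exacts [hfa i ω, hfa j ω]).const_mul _
  have iAB : Integrable (fun ω => A ω ^ 2 + ∑ i ∈ I, 2 * (A ω * f i ω * g i ω)) μ :=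
    iA.add (integrable_finsetSum _ fun i _ => iB i)
  simp_rw [e1]
  rw [integral_add iAB
    (integrable_finsetSum _ fun i _ => integrable_finsetSum _ fun j _ => iC i j),
    integral_add iA (integrable_finsetSum _ fun i _ => iB i),
    integral_finsetSum _ fun i _ => iB i]
  -- The noise at time `m` is centered and independent of everything known before `m`.
  have z1 : ∑ i ∈ I, ∫ ω, 2 * (A ω * f i ω * g i ω) ∂μ = 0 := by
    refine Finset.sum_eq_zero fun i _ => ?_
    rw [integral_const_mul, he.integral_mul_of_disjoint (f := fun ω => A ω * f i ω)
      (disjoint_before (hT i))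
      (hA.mul (hf i)) (hg i), hg0, mul_zero, mul_zero]
  rw [z1, add_zero, integral_finsetSum _ fun i _ => integrable_finsetSum _ fun j _ => iC i j,
    integral_finsetSum _ fun i _ => integrable_finsetSum _ fun j _ => iD i j, Finset.mul_sum]
  refine add_le_add le_rfl (Finset.sum_le_sum fun i _ => ?_)
  rw [integral_finsetSum _ fun j _ => iC i j, integral_finsetSum _ fun j _ => iD i j,
    Finset.mul_sum]
  refine Finset.sum_le_sum fun j _ => ?_
  have hff : ∀ ω, 0 ≤ f i ω * f j ω := fun ω => mul_nonneg (hf0 i ω) (hf0 j ω)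
  -- Noises on disjoint sets of sites are orthogonal. For the others `|gᵢ gⱼ| ≤ c²`, and the pair is
  -- counted by `o i j ≥ 1`.
  by_cases hd : Disjoint (T i) (T j)
  · rw [he.integral_mul_of_disjoint (f := fun ω => f i ω * f j ω)
      (g := fun ω => g i ω * g j ω) (S := before m) (T := T i ∪ T j)
      (Set.disjoint_union_right.2 ⟨disjoint_before (hT i), disjoint_before (hT j)⟩)
      ((hf i).mul (hf j)) (((hg i).mono (info_mono Set.subset_union_left) le_rfl).mul
        ((hg j).mono (info_mono Set.subset_union_right) le_rfl)),
      he.integral_mul_of_disjoint hd (hg i) (hg j), hg0, zero_mul, mul_zero]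
    exact mul_nonneg (sq_nonneg _) (integral_nonneg fun ω => mul_nonneg (ho i j) (hff ω))
  · rw [← integral_const_mul]
    refine integral_mono (iC i j) ((iD i j).const_mul _) fun ω => ?_
    have hc : 0 ≤ c := (abs_nonneg _).trans (hgc i ω)
    have h1 : g i ω * g j ω ≤ c ^ 2 := by
      rw [sq]
      refine (le_abs_self _).trans ?_
      rw [abs_mul]
      exact mul_le_mul (hgc i ω) (hgc j ω) (abs_nonneg _) hc
    calc f i ω * f j ω * (g i ω * g j ω) ≤ f i ω * f j ω * c ^ 2 :=
          mul_le_mul_of_nonneg_left h1 (hff ω)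
      _ = c ^ 2 * (1 * (f i ω * f j ω)) := by ring
      _ ≤ _ := by
        refine mul_le_mul_of_nonneg_left ?_ (sq_nonneg _)
        exact mul_le_mul_of_nonneg_right (ho1 i j hd) (hff ω)

end IsEnv

end QuenchedWalk
-- A calculus of bounded measurable functions.
section BoundedMeasurable

variable {Ω : Type*}

/-- Bounded functions that are measurable with respect to `𝓕`. -/
structure BddMeas (𝓕 : MeasurableSpace Ω) (f : Ω → ℝ) : Prop where
  meas : Measurable[𝓕] f
  bdd : ∃ B, ∀ ω, |f ω| ≤ B

namespace BddMeas

variable {𝓕 𝓖 : MeasurableSpace Ω} {f g : Ω → ℝ}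

lemma const (c : ℝ) : BddMeas 𝓕 fun _ => c := ⟨measurable_const, |c|, fun _ => le_rfl⟩

lemma add (hf : BddMeas 𝓕 f) (hg : BddMeas 𝓕 g) : BddMeas 𝓕 fun ω => f ω + g ω := by
  obtain ⟨A, hA⟩ := hf.bdd
  obtain ⟨B, hB⟩ := hg.bdd
  exact ⟨hf.meas.add hg.meas, A + B, fun ω => (abs_add_le _ _).trans (add_le_add (hA ω) (hB ω))⟩

lemma mul (hf : BddMeas 𝓕 f) (hg : BddMeas 𝓕 g) : BddMeas 𝓕 fun ω => f ω * g ω := by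
  obtain ⟨A, hA⟩ := hf.bdd
  obtain ⟨B, hB⟩ := hg.bdd
  refine ⟨hf.meas.mul hg.meas, A * B, fun ω => ?_⟩
  rw [abs_mul]
  exact mul_le_mul (hA ω) (hB ω) (abs_nonneg _) ((abs_nonneg _).trans (hA ω))

lemma const_mul (c : ℝ) (hf : BddMeas 𝓕 f) : BddMeas 𝓕 fun ω => c * f ω := (const c).mul hf

lemma mul_const (c : ℝ) (hf : BddMeas 𝓕 f) : BddMeas 𝓕 fun ω => f ω * c := hf.mul (const c)

lemma sub (hf : BddMeas 𝓕 f) (hg : BddMeas 𝓕 g) : BddMeas 𝓕 fun ω => f ω - g ω := by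
  simpa [sub_eq_add_neg] using hf.add (hg.const_mul (-1))

lemma sum {ι : Type*} (s : Finset ι) {f : ι → Ω → ℝ} (hf : ∀ i, BddMeas 𝓕 (f i)) :
    BddMeas 𝓕 fun ω => ∑ i ∈ s, f i ω := by
  choose B hB using fun i => (hf i).bdd
  exact ⟨Finset.measurable_fun_sum _ fun i _ => (hf i).meas, ∑ i ∈ s, B i, fun ω =>
    (Finset.abs_sum_le_sum_abs _ _).trans (Finset.sum_le_sum fun i _ => hB i ω)⟩

lemma pow (hf : BddMeas 𝓕 f) (n : ℕ) : BddMeas 𝓕 fun ω => f ω ^ n := by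
  obtain ⟨A, hA⟩ := hf.bdd
  refine ⟨hf.meas.pow_const n, A ^ n, fun ω => ?_⟩
  rw [abs_pow]
  exact pow_le_pow_left₀ (abs_nonneg _) (hA ω) n

lemma mono (hf : BddMeas 𝓕 f) (h : 𝓕 ≤ 𝓖) : BddMeas 𝓖 f := ⟨hf.meas.mono h le_rfl, hf.bdd⟩

lemma integrable [m : MeasurableSpace Ω] {μ : Measure Ω} [IsFiniteMeasure μ]
    (hf : BddMeas m f) : Integrable f μ := by
  obtain ⟨A, hA⟩ := hf.bdd
  exact Integrable.of_bound hf.meas.aestronglyMeasurable A (Eventually.of_forall hA)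

end BddMeas

end BoundedMeasurable

/-! ### Concentration of quenched characteristic functions. -/

section QuenchedCharacter

variable {Ω : Type*} [MeasurableSpace Ω] {μ : Measure Ω} [IsProbabilityMeasure μ] {M : ℕ}
  {w : Ω → ℤ → ℝ} {e : ℕ → ℤ → Ω → ℤ → ℝ}

/-- The effect of the fluctuations of the environment on a test function, in one step. -/
noncomputable def noise (M : ℕ) (p : ℤ → ℝ) (e : ℕ → ℤ → Ω → ℤ → ℝ) (m : ℕ) (F : ℤ → ℝ) (x : ℤ)
    (ω : Ω) : ℝ :=
  ∑ j ∈ steps M, (e m x ω j - p j) * F (x + j)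

/-- The expected number of self-intersections `∑_l E ∑_x q_l(x)²`. -/
noncomputable def selfOverlap (μ : Measure Ω) (M : ℕ) (e : ℕ → ℤ → Ω → ℤ → ℝ) (s : ℕ) (k : ℤ)
    (R m : ℕ) : ℝ :=
  ∫ ω, ∑ x ∈ box R, qmass M e s k m ω x ^ 2 ∂μ

/-- The annealed characteristic function after `m` steps from `k`. -/
noncomputable def meanChar (M : ℕ) (p : ℤ → ℝ) (k : ℤ) (m : ℕ) (t : ℝ) : ℂ :=
  fourierSum (steps M) p t ^ m * Complex.exp (Complex.I * t * k)

/-- Both weights have total mass one, so subtracting the constant `F₀` changes nothing and only the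
oscillation of `F` matters. -/
lemma abs_sum_sub_mul_le {ι : Type*} {s : Finset ι} {a b F : ι → ℝ} (ha : ∀ i, 0 ≤ a i)
    (hb : ∀ i, 0 ≤ b i) (ha1 : ∑ i ∈ s, a i = 1) (hb1 : ∑ i ∈ s, b i = 1) {F₀ L : ℝ}
    (hF : ∀ i ∈ s, |F i - F₀| ≤ L) : |∑ i ∈ s, (a i - b i) * F i| ≤ 2 * L := by
  have h1 : ∑ i ∈ s, (a i - b i) * F i = ∑ i ∈ s, (a i - b i) * (F i - F₀) := by
    simp_rw [mul_sub, Finset.sum_sub_distrib, ← Finset.sum_mul, Finset.sum_sub_distrib, ha1, hb1]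
    ring
  rw [h1]
  calc _ ≤ ∑ i ∈ s, (a i + b i) * L := by
        refine (Finset.abs_sum_le_sum_abs _ _).trans (Finset.sum_le_sum fun i hi => ?_)
        rw [abs_mul]
        refine mul_le_mul ?_ (hF i hi) (abs_nonneg _) (add_nonneg (ha i) (hb i))
        rw [abs_le]; constructor <;> linarith [ha i, hb i]
    _ = 2 * L := by rw [← Finset.sum_mul, Finset.sum_add_distrib, ha1, hb1]; norm_num

namespace IsEnv

lemma bddMeas_qmass (he : IsEnv μ M w e) (s : ℕ) (k : ℤ) (m : ℕ) (y : ℤ) :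
    BddMeas (info e (before m)) fun ω => qmass M e s k m ω y :=
  ⟨measurable_mass m y, 1, fun ω => by
    rw [abs_of_nonneg (he.qmass_nonneg ..)]; exact he.qmass_le_one ..⟩

lemma bddMeas_apply (he : IsEnv μ M w e) {T : Set (ℕ × ℤ)} {m : ℕ} {x : ℤ} (h : (m, x) ∈ T)
    (j : ℤ) : BddMeas (info e T) fun ω => e m x ω j :=
  ⟨measurable_info_apply h j, 1, fun ω => by
    rw [abs_of_nonneg ((he.isProbVec ..).nonneg j)]; exact (he.isProbVec ..).le_one j⟩

lemma bddMeas_noise (he : IsEnv μ M w e) (p : ℤ → ℝ) (m : ℕ) (F : ℤ → ℝ) (x : ℤ) :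
    BddMeas (info e {(m, x)}) (noise M p e m F x) :=
  BddMeas.sum _ fun j => ((he.bddMeas_apply (Set.mem_singleton _) j).sub (BddMeas.const _)).mul_const _

lemma integral_noise (he : IsEnv μ M w e) (m : ℕ) (F : ℤ → ℝ) (x : ℤ) :
    ∫ ω, noise M (avgProb μ w) e m F x ω ∂μ = 0 := by
  have hi : ∀ j, Integrable (fun ω => e m x ω j) μ := fun j =>
    ((he.bddMeas_apply (T := Set.univ) trivial j).mono (he.info_le _)).integrable
  simp only [noise]
  have hi' : ∀ j, Integrable (fun ω => (e m x ω j - avgProb μ w j) * F (x + j)) μ := fun j =>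
    ((hi j).sub (integrable_const _)).mul_const _
  rw [integral_finsetSum _ fun j _ => hi' j]
  refine Finset.sum_eq_zero fun j _ => ?_
  rw [integral_mul_const, integral_sub (hi j) (integrable_const _), he.integral_apply]
  simp

lemma abs_noise_le (he : IsEnv μ M w e) (m : ℕ) {F : ℤ → ℝ} {x : ℤ} {F₀ L : ℝ}
    (hF : ∀ j ∈ steps M, |F (x + j) - F₀| ≤ L) (ω : Ω) :
    |noise M (avgProb μ w) e m F x ω| ≤ 2 * L :=
  abs_sum_sub_mul_le (he.isProbVec m x ω).nonneg he.isProbVec_avg.nonneg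
    (he.isProbVec m x ω).sum_eq_one he.isProbVec_avg.sum_eq_one hF

/-- The step is split into a homogeneous averaged part and, when `p` is the averaged law, a part
that is centered given the past. -/
lemma sum_qmass_succ (p : ℤ → ℝ) {s : ℕ} {k : ℤ} {m R : ℕ} (hs : s ≤ m)
    (hR : |k| + M * (m + 1 : ℕ) ≤ R) (F : ℤ → ℝ) (ω : Ω) :
    ∑ y ∈ box R, qmass M e s k (m + 1) ω y * F y
      = ∑ x ∈ box R, qmass M e s k m ω x * ∑ j ∈ steps M, p j * F (x + j)
        + ∑ x ∈ box R, qmass M e s k m ω x * noise M (p) e m F x ω := by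
  have h := sum_mass_succ (M := M) (e := fun m x => e m x ω) (s := s) (k := k) hR F
  simp only [smul_eq_mul] at h
  rw [h, if_neg (by omega), add_zero, ← Finset.sum_add_distrib]
  refine Finset.sum_congr rfl fun x _ => ?_
  rw [← mul_add, noise, ← Finset.sum_add_distrib]
  congr 1
  exact Finset.sum_congr rfl fun j _ => by ring

/-- Noises at distinct sites are orthogonal, so only the diagonal survives: the squared masses,
whose sum is the probability that two walks in one environment meet. -/
lemma integral_add_sum_noise_sq_le (he : IsEnv μ M w e) {s : ℕ} {k : ℤ} {m R : ℕ}
    {A : Ω → ℝ} (hA : BddMeas (info e (before m)) A) {F : ℤ → ℝ} {L : ℝ}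
    (hF : ∀ x, ∀ j ∈ steps M, |F (x + j) - F x| ≤ L) :
    ∫ ω, (A ω + ∑ x ∈ box R, qmass M e s k m ω x * noise M (avgProb μ w) e m F x ω) ^ 2 ∂μ
      ≤ ∫ ω, A ω ^ 2 ∂μ + (2 * L) ^ 2 * selfOverlap μ M e s k R m := by
  obtain ⟨B, hB⟩ := hA.bdd
  refine (he.integral_add_sum_sq_le (box R) hA.meas hB (f := fun x ω => qmass M e s k m ω x)
    (fun x => measurable_mass m x) (fun x ω => he.qmass_nonneg ..) (fun x ω => he.qmass_le_one ..)
    (T := fun x => {(m, x)}) (by simp) (fun x => (he.bddMeas_noise _ m F x).meas)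
    (fun x ω => he.abs_noise_le m (hF x) ω) (fun x => he.integral_noise m F x)
    (fun x y => if x = y then 1 else 0) (fun x y => by split_ifs <;> norm_num)
    (fun x y h => by
      by_cases hxy : x = y
      · simp [hxy]
      · exact absurd (by simpa using hxy) h)).trans_eq ?_
  congr 2
  refine integral_congr_ae (Eventually.of_forall fun ω => Finset.sum_congr rfl fun x hx => ?_)
  simp only [ite_mul, one_mul, zero_mul]
  rw [Finset.sum_ite_eq, if_pos hx, sq]

lemma bddMeas_fourierSum_re (he : IsEnv μ M w e) (s : ℕ) (k : ℤ) (m R : ℕ) (t : ℝ) :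
    BddMeas (info e (before m)) fun ω => (fourierSum (box R) (qmass M e s k m ω) t).re := by
  simp only [fourierSum_re]
  exact BddMeas.sum _ fun x => (he.bddMeas_qmass s k m x).mul_const _

lemma bddMeas_fourierSum_im (he : IsEnv μ M w e) (s : ℕ) (k : ℤ) (m R : ℕ) (t : ℝ) :
    BddMeas (info e (before m)) fun ω => (fourierSum (box R) (qmass M e s k m ω) t).im := by
  simp only [fourierSum_im]
  exact BddMeas.sum _ fun x => (he.bddMeas_qmass s k m x).mul_const _

/-- Concentration of the quenched characteristic function. -/
lemma integral_norm_fourierSum_sub_sq_le (he : IsEnv μ M w e) {s : ℕ} {k : ℤ} {N R : ℕ}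
    (hR : |k| + M * N ≤ R) (hs : s ≤ N) (t : ℝ) :
    ∫ ω, ‖fourierSum (box R) (qmass M e s k N ω) t - meanChar M (avgProb μ w) k (N - s) t‖ ^ 2 ∂μ
      ≤ 8 * (M * t) ^ 2 * ∑ m ∈ Finset.Ico s N, selfOverlap μ M e s k R m := by
  induction N, hs using Nat.le_induction with
  | base =>
    have h1 : ∀ ω, fourierSum (box R) (qmass M e s k s ω) t
        = Complex.exp (Complex.I * t * k) := by
      intro ω
      have := sum_mass_self (M := M) (e := fun m x => e m x ω) (s := s) (k := k) (R := R) (by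
        have : (0 : ℤ) ≤ M * s := by positivity
        linarith) (fun x => Complex.exp (Complex.I * t * x))
      simpa [fourierSum] using this
    simp [h1, meanChar]
  | succ m hm ih =>
    have hRm : |k| + M * (m : ℤ) ≤ R := by
      push_cast at hR
      have : (0 : ℤ) ≤ M := by positivity
      linarith
    specialize ih hRm
    set p := avgProb μ w
    set φ := fourierSum (steps M) p t
    -- The error evolves by multiplication with the annealed factor `φ`, of modulus at most one,
    -- plus a fresh noise orthogonal to the past.
    set X := fun ω => fourierSum (box R) (qmass M e s k m ω) t - meanChar M p k (m - s) t with hX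
    have hXre : BddMeas (info e (before m)) fun ω => (X ω).re := by
      simp only [hX, Complex.sub_re]
      exact (he.bddMeas_fourierSum_re ..).sub (BddMeas.const _)
    have hXim : BddMeas (info e (before m)) fun ω => (X ω).im := by
      simp only [hX, Complex.sub_im]
      exact (he.bddMeas_fourierSum_im ..).sub (BddMeas.const _)
    have hAre : BddMeas (info e (before m)) fun ω => (φ * X ω).re := by
      simp only [Complex.mul_re]
      exact (hXre.const_mul _).sub (hXim.const_mul _)
    have hAim : BddMeas (info e (before m)) fun ω => (φ * X ω).im := by
      simp only [Complex.mul_im]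
      exact (hXim.const_mul _).add (hXre.const_mul _)
    set Nre := fun ω => ∑ x ∈ box R, qmass M e s k m ω x
      * noise M p e m (fun x => Real.cos (t * x)) x ω
    set Nim := fun ω => ∑ x ∈ box R, qmass M e s k m ω x
      * noise M p e m (fun x => Real.sin (t * x)) x ω
    set Y := fun ω => fourierSum (box R) (qmass M e s k (m + 1) ω) t
      - meanChar M p k (m + 1 - s) t with hY
    have hmean : meanChar M p k (m + 1 - s) t = φ * meanChar M p k (m - s) t := by
      rw [meanChar, meanChar, show m + 1 - s = (m - s) + 1 by omega, pow_succ]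
      ring
    have hYre : ∀ ω, (Y ω).re = (φ * X ω).re + Nre ω := by
      intro ω
      have h := sum_qmass_succ (e := e) p hm hR (fun x => Real.cos (t * x)) ω
      have h2 : ∑ x ∈ box R, qmass M e s k m ω x * ∑ j ∈ steps M, p j * Real.cos (t * ((x + j : ℤ) : ℝ))
          = (φ * fourierSum (box R) (qmass M e s k m ω) t).re := by
        rw [Complex.mul_re, fourierSum_re, fourierSum_re, fourierSum_im, fourierSum_im,
          Finset.sum_mul_sum, Finset.sum_mul_sum, Finset.sum_comm, Finset.sum_comm (s := steps M),
          ← Finset.sum_sub_distrib]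
        refine Finset.sum_congr rfl fun x _ => ?_
        rw [← Finset.sum_sub_distrib, Finset.mul_sum]
        refine Finset.sum_congr rfl fun j _ => ?_
        push_cast
        rw [mul_add, Real.cos_add]; ring
      rw [h2] at h
      simp only [hY, hX, hmean, Complex.sub_re, mul_sub, fourierSum_re (box R) (qmass M e s k (m + 1) ω)]
      rw [h]; ring
    have hYim : ∀ ω, (Y ω).im = (φ * X ω).im + Nim ω := by
      intro ω
      have h := sum_qmass_succ (e := e) p hm hR (fun x => Real.sin (t * x)) ω
      have h2 : ∑ x ∈ box R, qmass M e s k m ω x * ∑ j ∈ steps M, p j * Real.sin (t * ((x + j : ℤ) : ℝ))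
          = (φ * fourierSum (box R) (qmass M e s k m ω) t).im := by
        rw [Complex.mul_im, fourierSum_re, fourierSum_re, fourierSum_im, fourierSum_im,
          Finset.sum_mul_sum, Finset.sum_mul_sum, Finset.sum_comm, Finset.sum_comm (s := steps M),
          ← Finset.sum_add_distrib]
        refine Finset.sum_congr rfl fun x _ => ?_
        rw [← Finset.sum_add_distrib, Finset.mul_sum]
        refine Finset.sum_congr rfl fun j _ => ?_
        push_cast
        rw [mul_add, Real.sin_add]; ring
      rw [h2] at h
      simp only [hY, hX, hmean, Complex.sub_im, mul_sub, fourierSum_im (box R) (qmass M e s k (m + 1) ω)]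
      rw [h]; ring
    have hlip : ∀ j ∈ steps M, |t * (j : ℝ)| ≤ M * |t| := by
      intro j hj
      rw [abs_mul, mul_comm]
      gcongr
      exact_mod_cast mem_box.1 hj
    have hre := he.integral_add_sum_noise_sq_le (s := s) (k := k) (R := R) hAre
      (F := fun x => Real.cos (t * x)) (L := M * |t|) (fun x j hj => by
        refine (Real.abs_cos_sub_cos_le _ _).trans ?_
        refine le_of_eq_of_le ?_ (hlip j hj)
        congr 1
        push_cast
        ring)
    have him := he.integral_add_sum_noise_sq_le (s := s) (k := k) (R := R) hAim
      (F := fun x => Real.sin (t * x)) (L := M * |t|) (fun x j hj => by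
        refine (Real.abs_sin_sub_sin_le _ _).trans ?_
        refine le_of_eq_of_le ?_ (hlip j hj)
        congr 1
        push_cast
        ring)
    have hle := he.info_le (before m)
    have hNre : BddMeas ‹MeasurableSpace Ω› Nre := BddMeas.sum _ fun x =>
      ((he.bddMeas_qmass s k m x).mono hle).mul ((he.bddMeas_noise p m _ x).mono (he.info_le _))
    have hNim : BddMeas ‹MeasurableSpace Ω› Nim := BddMeas.sum _ fun x =>
      ((he.bddMeas_qmass s k m x).mono hle).mul ((he.bddMeas_noise p m _ x).mono (he.info_le _))
    have hnsq : ∀ z : ℂ, ‖z‖ ^ 2 = z.re ^ 2 + z.im ^ 2 := fun z => by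
      rw [← Complex.normSq_eq_norm_sq, Complex.normSq_apply]; ring
    have hY2 : ∫ ω, ‖Y ω‖ ^ 2 ∂μ = ∫ ω, ((φ * X ω).re + Nre ω) ^ 2 ∂μ
        + ∫ ω, ((φ * X ω).im + Nim ω) ^ 2 ∂μ := by
      rw [← integral_add (((hAre.mono hle).add hNre).pow 2).integrable
        (((hAim.mono hle).add hNim).pow 2).integrable]
      simp only [hnsq, hYre, hYim]
    have hX2 : ∫ ω, (φ * X ω).re ^ 2 ∂μ + ∫ ω, (φ * X ω).im ^ 2 ∂μ ≤ ∫ ω, ‖X ω‖ ^ 2 ∂μ := by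
      rw [← integral_add ((hAre.mono hle).pow 2).integrable ((hAim.mono hle).pow 2).integrable]
      refine integral_mono ((((hAre.mono hle).pow 2).add ((hAim.mono hle).pow 2)).integrable)
        ?_ fun ω => ?_
      · simp only [hnsq]
        exact (((hXre.mono hle).pow 2).add ((hXim.mono hle).pow 2)).integrable
      · change (φ * X ω).re ^ 2 + (φ * X ω).im ^ 2 ≤ ‖X ω‖ ^ 2
        rw [← hnsq, norm_mul]
        have h1 : ‖φ‖ ≤ 1 := by
          have := norm_fourierSum_le (s := steps M) he.isProbVec_avg.nonneg t
          rwa [he.isProbVec_avg.sum_eq_one] at this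
        gcongr
        exact mul_le_of_le_one_left (norm_nonneg _) h1
    -- The real and the imaginary part each contribute `(2M|t|)²` times the self-overlap, hence the
    -- factor `8`.
    rw [hY2, Finset.sum_Ico_succ_top hm, mul_add]
    have hsq : (2 * (M * |t|)) ^ 2 = 4 * (M * t) ^ 2 := by
      rw [mul_pow, mul_pow, sq_abs]; ring
    rw [hsq] at hre him
    linarith

end IsEnv

end QuenchedCharacter
-- Two walks in a common environment.
section PairSums

/-- `∑_{x, y} a(x) b(y) F(x - y)`. -/
noncomputable def pairSum (R : ℕ) (a b : ℤ → ℝ) (F : ℤ → ℝ) : ℝ :=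
  ∑ x ∈ box R, ∑ y ∈ box R, a x * b y * F (x - y)

/-- `∑_x a(x) b(x)`. -/
noncomputable def overlap (R : ℕ) (a b : ℤ → ℝ) : ℝ := ∑ x ∈ box R, a x * b x

/-- The number of coincidences between the points of two pairs. -/
noncomputable def meets (i j : ℤ × ℤ) : ℝ :=
  (if i.1 = j.1 then 1 else 0) + (if i.1 = j.2 then 1 else 0)
    + (if i.2 = j.1 then 1 else 0) + (if i.2 = j.2 then 1 else 0)

lemma meets_nonneg (i j : ℤ × ℤ) : 0 ≤ meets i j := by
  unfold meets; positivity

lemma one_le_meets {m : ℕ} {i j : ℤ × ℤ}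
    (h : ¬ Disjoint ({(m, i.1), (m, i.2)} : Set (ℕ × ℤ)) {(m, j.1), (m, j.2)}) :
    1 ≤ meets i j := by
  by_contra hc
  refine h (Set.disjoint_left.2 fun p hp hp' => hc ?_)
  have hnn : ∀ P : Prop, ∀ [Decidable P], (0 : ℝ) ≤ if P then 1 else 0 := fun P _ => by
    split_ifs <;> norm_num
  have h11 := hnn (i.1 = j.1)
  have h12 := hnn (i.1 = j.2)
  have h21 := hnn (i.2 = j.1)
  have h22 := hnn (i.2 = j.2)
  unfold meets
  rcases hp with rfl | rfl <;> rcases hp' with hp' | hp' <;>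
    simp only [Prod.mk.injEq, true_and, Set.mem_singleton_iff] at hp' <;>
    simp only [hp', if_true] at h11 h12 h21 h22 ⊢ <;> linarith

/-- Summing out the second pair leaves `a` or `b` at the coinciding site. The result is at most `∑
a² + 2 ∑ ab + ∑ b²`, and `2ab ≤ a² + b²`. -/
lemma sum_overlapping_le {s : Finset ℤ} {a b : ℤ → ℝ} (ha : ∀ x, 0 ≤ a x) (hb : ∀ x, 0 ≤ b x)
    (ha1 : ∑ x ∈ s, a x ≤ 1) (hb1 : ∑ x ∈ s, b x ≤ 1) :
    ∑ i ∈ s ×ˢ s, ∑ j ∈ s ×ˢ s,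
      (meets i j * ((a i.1 * b i.2) * (a j.1 * b j.2)))
      ≤ 2 * (∑ x ∈ s, a x ^ 2 + ∑ x ∈ s, b x ^ 2) := by
  have h1 : ∀ x ∈ s, ∀ y ∈ s, ∑ j ∈ s ×ˢ s,
      (((if x = j.1 then 1 else 0) + (if x = j.2 then 1 else 0)
        + (if y = j.1 then 1 else 0) + (if y = j.2 then 1 else 0) : ℝ)
        * ((a x * b y) * (a j.1 * b j.2)))
      ≤ a x * b y * (a x + b x + a y + b y) := by
    intro x hx y hy
    have hl : ∀ z ∈ s, ∑ j ∈ s ×ˢ s, (if z = j.1 then 1 else 0 : ℝ) * (a j.1 * b j.2) ≤ a z := by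
      intro z hz
      rw [Finset.sum_product]
      simp only [ite_mul, one_mul, zero_mul]
      rw [Finset.sum_comm]
      simp only [Finset.sum_ite_eq, hz, if_true]
      rw [← Finset.mul_sum]
      exact mul_le_of_le_one_right (ha z) hb1
    have hr : ∀ z ∈ s, ∑ j ∈ s ×ˢ s, (if z = j.2 then 1 else 0 : ℝ) * (a j.1 * b j.2) ≤ b z := by
      intro z hz
      rw [Finset.sum_product]
      simp only [ite_mul, one_mul, zero_mul]
      simp only [Finset.sum_ite_eq, hz, if_true]
      rw [← Finset.sum_mul]
      exact mul_le_of_le_one_left (hb z) ha1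
    have e : ∀ j : ℤ × ℤ, (((if x = j.1 then 1 else 0) + (if x = j.2 then 1 else 0)
        + (if y = j.1 then 1 else 0) + (if y = j.2 then 1 else 0) : ℝ)
        * ((a x * b y) * (a j.1 * b j.2)))
        = (a x * b y) * (((if x = j.1 then 1 else 0 : ℝ) * (a j.1 * b j.2)
          + (if x = j.2 then 1 else 0 : ℝ) * (a j.1 * b j.2))
          + (if y = j.1 then 1 else 0 : ℝ) * (a j.1 * b j.2)
          + (if y = j.2 then 1 else 0 : ℝ) * (a j.1 * b j.2)) := by
      intro j; ring
    rw [Finset.sum_congr rfl fun j _ => e j, ← Finset.mul_sum, Finset.sum_add_distrib,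
      Finset.sum_add_distrib, Finset.sum_add_distrib]
    refine mul_le_mul_of_nonneg_left ?_ (mul_nonneg (ha x) (hb y))
    linarith [hl x hx, hr x hx, hl y hy, hr y hy]
  rw [Finset.sum_product]
  refine (Finset.sum_le_sum fun x hx => Finset.sum_le_sum fun y hy => h1 x hx y hy).trans ?_
  have e : ∀ x y, a x * b y * (a x + b x + a y + b y)
      = (a x ^ 2 + a x * b x) * b y + a x * (a y * b y + b y ^ 2) := by
    intro x y; ring
  simp_rw [e, Finset.sum_add_distrib]
  rw [← Finset.sum_mul_sum, ← Finset.sum_mul_sum]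
  have hab : ∑ x ∈ s, a x * b x ≤ (∑ x ∈ s, a x ^ 2 + ∑ x ∈ s, b x ^ 2) / 2 := by
    rw [← Finset.sum_add_distrib, Finset.sum_div]
    exact Finset.sum_le_sum fun x _ => by nlinarith [sq_nonneg (a x - b x)]
  have h2 : (∑ x ∈ s, (a x ^ 2 + a x * b x)) * ∑ y ∈ s, b y ≤ ∑ x ∈ s, (a x ^ 2 + a x * b x) :=
    mul_le_of_le_one_right (Finset.sum_nonneg fun x _ =>
      add_nonneg (sq_nonneg _) (mul_nonneg (ha x) (hb x))) hb1
  have h3 : (∑ x ∈ s, a x) * ∑ y ∈ s, (a y * b y + b y ^ 2) ≤ ∑ y ∈ s, (a y * b y + b y ^ 2) :=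
    mul_le_of_le_one_left (Finset.sum_nonneg fun x _ =>
      add_nonneg (mul_nonneg (ha x) (hb x)) (sq_nonneg _)) ha1
  rw [Finset.sum_add_distrib] at h2 h3
  simp_rw [Finset.sum_add_distrib] at *
  linarith

variable {Ω : Type*} [MeasurableSpace Ω] {μ : Measure Ω} [IsProbabilityMeasure μ] {M : ℕ}
  {w : Ω → ℤ → ℝ} {e : ℕ → ℤ → Ω → ℤ → ℝ}

/-- The joint law of one step of two walks in `x` and `y`, in a common environment. -/
noncomputable def jointStep (μ : Measure Ω) (w : Ω → ℤ → ℝ) (x y : ℤ) (z v : ℤ) : ℝ :=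
  if x = y then pairProb μ w z v else avgProb μ w z * avgProb μ w v

/-- The fluctuation of the environment seen by two walks in `i.1` and `i.2`. -/
noncomputable def pairNoise (μ : Measure Ω) (w : Ω → ℤ → ℝ) (M : ℕ) (e : ℕ → ℤ → Ω → ℤ → ℝ)
    (m : ℕ) (F : ℤ → ℝ) (i : ℤ × ℤ) (ω : Ω) : ℝ :=
  ∑ z ∈ steps M, ∑ v ∈ steps M,
    (e m i.1 ω z * e m i.2 ω v - jointStep μ w i.1 i.2 z v) * F (i.1 + z - (i.2 + v))

lemma pairSum_eq_mul_sum (R : ℕ) (a b F : ℤ → ℝ) :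
    pairSum R a b F = ∑ x ∈ box R, a x * ∑ y ∈ box R, b y * F (x - y) := by
  simp only [pairSum, Finset.mul_sum, mul_assoc]

namespace IsEnv

lemma sum_pairProb (he : IsEnv μ M w e) :
    ∑ z ∈ steps M, ∑ v ∈ steps M, pairProb μ w z v = 1 := by
  have hi := integrable_apply_mul_apply (μ := μ) he.base_measurable he.base_isProbVec
  simp only [pairProb]
  simp_rw [← integral_finsetSum (steps M) fun v _ => hi _ v]
  rw [← integral_finsetSum _ fun z _ => integrable_finsetSum _ fun v _ => hi z v]
  simp [sum_sum_mul_eq_one (he.base_isProbVec _)]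

lemma sum_jointStep (he : IsEnv μ M w e) (x y : ℤ) :
    ∑ z ∈ steps M, ∑ v ∈ steps M, jointStep μ w x y z v = 1 := by
  unfold jointStep
  split_ifs
  · exact he.sum_pairProb
  · exact sum_sum_mul_eq_one he.isProbVec_avg

lemma jointStep_nonneg (he : IsEnv μ M w e) (x y z v : ℤ) : 0 ≤ jointStep μ w x y z v := by
  unfold jointStep
  split_ifs
  · exact pairProb_nonneg he.base_isProbVec _ _
  · exact mul_nonneg (he.isProbVec_avg.nonneg _) (he.isProbVec_avg.nonneg _)

lemma integral_step_mul_step (he : IsEnv μ M w e) (m : ℕ) (x y z v : ℤ) :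
    ∫ ω, e m x ω z * e m y ω v ∂μ = jointStep μ w x y z v := by
  unfold jointStep
  split_ifs with h
  · subst h; exact he.integral_apply_mul_apply m x z v
  · exact he.integral_apply_mul_apply_of_ne m h z v

lemma bddMeas_pairNoise (he : IsEnv μ M w e) (m : ℕ) (F : ℤ → ℝ) (i : ℤ × ℤ) :
    BddMeas (info e {(m, i.1), (m, i.2)}) (pairNoise μ w M e m F i) :=
  BddMeas.sum _ fun z => BddMeas.sum _ fun v => (((he.bddMeas_apply (by simp) z).mul
    (he.bddMeas_apply (by simp) v)).sub (BddMeas.const _)).mul_const _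

lemma integral_pairNoise (he : IsEnv μ M w e) (m : ℕ) (F : ℤ → ℝ) (i : ℤ × ℤ) :
    ∫ ω, pairNoise μ w M e m F i ω ∂μ = 0 := by
  have hi : ∀ z v, Integrable (fun ω => e m i.1 ω z * e m i.2 ω v) μ := fun z v =>
    (((he.bddMeas_apply (T := Set.univ) trivial z).mul
      (he.bddMeas_apply (T := Set.univ) trivial v)).mono (he.info_le _)).integrable
  have hi' : ∀ z v, Integrable (fun ω => (e m i.1 ω z * e m i.2 ω v
      - jointStep μ w i.1 i.2 z v) * F (i.1 + z - (i.2 + v))) μ := fun z v =>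
    ((hi z v).sub (integrable_const _)).mul_const _
  simp only [pairNoise]
  rw [integral_finsetSum _ fun z _ => integrable_finsetSum _ fun v _ => hi' z v]
  refine Finset.sum_eq_zero fun z _ => ?_
  rw [integral_finsetSum _ fun v _ => hi' z v]
  refine Finset.sum_eq_zero fun v _ => ?_
  rw [integral_mul_const, integral_sub (hi z v) (integrable_const _), he.integral_step_mul_step]
  simp

lemma abs_pairNoise_le (he : IsEnv μ M w e) (m : ℕ) {F : ℤ → ℝ} {L : ℝ}
    (hF : ∀ y z : ℤ, |(y : ℝ) - z| ≤ 2 * M → |F y - F z| ≤ L) (i : ℤ × ℤ) (ω : Ω) :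
    |pairNoise μ w M e m F i ω| ≤ 2 * L := by
  have h := abs_sum_sub_mul_le (s := steps M ×ˢ steps M)
    (a := fun j => e m i.1 ω j.1 * e m i.2 ω j.2)
    (b := fun j => jointStep μ w i.1 i.2 j.1 j.2)
    (F := fun j => F (i.1 + j.1 - (i.2 + j.2))) (F₀ := F (i.1 - i.2)) (L := L)
    (fun j => mul_nonneg ((he.isProbVec ..).nonneg _) ((he.isProbVec ..).nonneg _))
    (fun j => he.jointStep_nonneg ..)
    (by rw [Finset.sum_product, ← Finset.sum_mul_sum, (he.isProbVec ..).sum_eq_one,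
          (he.isProbVec ..).sum_eq_one, one_mul])
    (by rw [Finset.sum_product, he.sum_jointStep])
    (fun j hj => by
      rw [Finset.mem_product, mem_box, mem_box] at hj
      refine hF _ _ ?_
      have h1 : |(j.1 : ℝ)| ≤ M := by exact_mod_cast hj.1
      have h2 : |(j.2 : ℝ)| ≤ M := by exact_mod_cast hj.2
      rw [abs_le] at *
      push_cast
      constructor <;> linarith)
  rwa [Finset.sum_product] at h

/-- A Doob decomposition in one step: `jointStep` carries the mean of the product of two weights,
which differs from the product of means exactly when the walks share a site. -/
lemma pairSum_succ {s s' : ℕ} {k k' : ℤ} {m R : ℕ} (hs : s ≤ m)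
    (hs' : s' ≤ m) (hR : |k| + M * (m + 1 : ℕ) ≤ R) (hR' : |k'| + M * (m + 1 : ℕ) ≤ R)
    (F : ℤ → ℝ) (ω : Ω) :
    pairSum R (qmass M e s k (m + 1) ω) (qmass M e s' k' (m + 1) ω) F
      = ∑ x ∈ box R, ∑ y ∈ box R, qmass M e s k m ω x * qmass M e s' k' m ω y *
          (∑ z ∈ steps M, ∑ v ∈ steps M, jointStep μ w x y z v * F (x + z - (y + v)))
        + ∑ i ∈ box R ×ˢ box R, (qmass M e s k m ω i.1 * qmass M e s' k' m ω i.2)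
          * pairNoise μ w M e m F i ω := by
  rw [pairSum_eq_mul_sum]
  have h := sum_mass_succ (M := M) (e := fun m x => e m x ω) (s := s) (k := k) hR
    (fun x => ∑ y ∈ box R, qmass M e s' k' (m + 1) ω y * F (x - y))
  simp only [smul_eq_mul] at h
  rw [h, if_neg (by omega), add_zero, Finset.sum_product, ← Finset.sum_add_distrib]
  refine Finset.sum_congr rfl fun x _ => ?_
  have h2 : ∀ z, ∑ y ∈ box R, qmass M e s' k' (m + 1) ω y * F (x + z - y)
      = ∑ y ∈ box R, qmass M e s' k' m ω y * ∑ v ∈ steps M, e m y ω v * F (x + z - (y + v)) := by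
    intro z
    have h := sum_mass_succ (M := M) (e := fun m x => e m x ω) (s := s') (k := k') hR'
      (fun y => F (x + z - y))
    simp only [smul_eq_mul] at h
    rw [h, if_neg (by omega), add_zero]
  simp only [h2]
  rw [← Finset.sum_add_distrib, Finset.mul_sum]
  simp_rw [Finset.mul_sum]
  rw [Finset.sum_comm]
  refine Finset.sum_congr rfl fun y _ => ?_
  rw [pairNoise, Finset.mul_sum, ← Finset.sum_add_distrib]
  refine Finset.sum_congr rfl fun z _ => ?_
  rw [Finset.mul_sum, ← Finset.sum_add_distrib]
  refine Finset.sum_congr rfl fun v _ => ?_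
  ring

lemma bddMeas_pairSum (he : IsEnv μ M w e) (s s' : ℕ) (k k' : ℤ) (m R : ℕ) (F : ℤ → ℝ) :
    BddMeas (info e (before m))
      fun ω => pairSum R (qmass M e s k m ω) (qmass M e s' k' m ω) F :=
  BddMeas.sum _ fun x => BddMeas.sum _ fun y =>
    ((he.bddMeas_qmass s k m x).mul (he.bddMeas_qmass s' k' m y)).mul_const _

lemma bddMeas_overlap (he : IsEnv μ M w e) (s s' : ℕ) (k k' : ℤ) (m R : ℕ) :
    BddMeas (info e (before m))
      fun ω => overlap R (qmass M e s k m ω) (qmass M e s' k' m ω) :=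
  BddMeas.sum _ fun x => (he.bddMeas_qmass s k m x).mul (he.bddMeas_qmass s' k' m x)

lemma integral_add_sum_pairNoise (he : IsEnv μ M w e) {s s' : ℕ} {k k' : ℤ} {m R : ℕ} (F : ℤ → ℝ) :
    ∫ ω, ∑ i ∈ box R ×ˢ box R, (qmass M e s k m ω i.1 * qmass M e s' k' m ω i.2)
          * pairNoise μ w M e m F i ω ∂μ = 0 := by
  have hf : ∀ i : ℤ × ℤ, BddMeas (info e (before m))
      fun ω => qmass M e s k m ω i.1 * qmass M e s' k' m ω i.2 := fun i =>
    (he.bddMeas_qmass s k m i.1).mul (he.bddMeas_qmass s' k' m i.2)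
  rw [integral_finsetSum _ fun i _ => (((hf i).mono (he.info_le _)).mul
    ((he.bddMeas_pairNoise m F i).mono (he.info_le _))).integrable]
  refine Finset.sum_eq_zero fun i _ => ?_
  rw [he.integral_mul_of_disjoint (f := fun ω => qmass M e s k m ω i.1 * qmass M e s' k' m ω i.2)
    (disjoint_before (m := m) (T := {(m, i.1), (m, i.2)}) (by simp)) (hf i).meas
    (he.bddMeas_pairNoise m F i).meas, he.integral_pairNoise, mul_zero]

/-- Only pairs of positions that share a site are correlated. The noise bound gives `(2L)²` and
`sum_overlapping_le` a further factor `2`. -/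
lemma integral_add_sum_pairNoise_sq_le (he : IsEnv μ M w e) {s s' : ℕ} {k k' : ℤ} {m R : ℕ}
    (hR : |k| + M * m ≤ R) (hR' : |k'| + M * m ≤ R)
    {A : Ω → ℝ} (hA : BddMeas (info e (before m)) A) {F : ℤ → ℝ} {L : ℝ}
    (hF : ∀ y z : ℤ, |(y : ℝ) - z| ≤ 2 * M → |F y - F z| ≤ L) :
    ∫ ω, (A ω + ∑ i ∈ box R ×ˢ box R, (qmass M e s k m ω i.1 * qmass M e s' k' m ω i.2)
          * pairNoise μ w M e m F i ω) ^ 2 ∂μ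
      ≤ ∫ ω, A ω ^ 2 ∂μ
        + 8 * L ^ 2 * (selfOverlap μ M e s k R m + selfOverlap μ M e s' k' R m) := by
  obtain ⟨B, hB⟩ := hA.bdd
  have hq : ∀ s k x, BddMeas ‹MeasurableSpace Ω› fun ω => qmass M e s k m ω x := fun s k x =>
    (he.bddMeas_qmass s k m x).mono (he.info_le _)
  have h := he.integral_add_sum_sq_le (box R ×ˢ box R) hA.meas hB
    (f := fun i ω => qmass M e s k m ω i.1 * qmass M e s' k' m ω i.2)
    (fun i => (measurable_mass m i.1).mul (measurable_mass m i.2))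
    (fun i ω => mul_nonneg (he.qmass_nonneg ..) (he.qmass_nonneg ..))
    (fun i ω => mul_le_one₀ (he.qmass_le_one ..) (he.qmass_nonneg ..) (he.qmass_le_one ..))
    (T := fun i => {(m, i.1), (m, i.2)}) (by simp) (fun i => (he.bddMeas_pairNoise m F i).meas)
    (fun i ω => he.abs_pairNoise_le m hF i ω) (fun i => he.integral_pairNoise m F i)
    meets meets_nonneg (fun i j h => one_le_meets h)
  refine h.trans (add_le_add le_rfl ?_)
  have h2 : ∫ ω, ∑ i ∈ box R ×ˢ box R, ∑ j ∈ box R ×ˢ box R,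
      (meets i j * ((qmass M e s k m ω i.1 * qmass M e s' k' m ω i.2)
          * (qmass M e s k m ω j.1 * qmass M e s' k' m ω j.2))) ∂μ
      ≤ 2 * (selfOverlap μ M e s k R m + selfOverlap μ M e s' k' R m) := by
    have hs : ∀ s k, BddMeas ‹MeasurableSpace Ω› fun ω => ∑ x ∈ box R, qmass M e s k m ω x ^ 2 :=
      fun s k => BddMeas.sum _ fun x => (hq s k x).pow 2
    rw [selfOverlap, selfOverlap, ← integral_add (hs s k).integrable (hs s' k').integrable,
      ← integral_const_mul]
    refine integral_mono (BddMeas.integrable (BddMeas.sum _ fun i => BddMeas.sum _ fun j =>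
      (((hq s k i.1).mul (hq s' k' i.2)).mul ((hq s k j.1).mul (hq s' k' j.2))).const_mul _))
      (((hs s k).add (hs s' k')).const_mul 2).integrable fun ω => ?_
    exact sum_overlapping_le (he.qmass_nonneg s k m ω) (he.qmass_nonneg s' k' m ω)
      (he.sum_qmass_le_one hR ω) (he.sum_qmass_le_one hR' ω)
  calc _ ≤ (2 * L) ^ 2 * (2 * (selfOverlap μ M e s k R m + selfOverlap μ M e s' k' R m)) := by
        gcongr
    _ = _ := by ring

end IsEnv

end PairSums
-- Counting meetings with the potential kernel.
section Collisions

variable {Ω : Type*} [MeasurableSpace Ω] {μ : Measure Ω} [IsProbabilityMeasure μ] {M : ℕ}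
  {w : Ω → ℤ → ℝ} {e : ℕ → ℤ → Ω → ℤ → ℝ}

/-- The expected position at time `m` of the annealed walk started at time `s` in `k`. -/
noncomputable def center (V : ℝ) (s : ℕ) (k : ℤ) (m : ℕ) : ℝ := k + ((m : ℝ) - s) * V

lemma sum_step_sq {p : ℤ → ℝ} (hp : IsProbVec M p) (a : ℝ) :
    ∑ j ∈ steps M, p j * (a + j - vecMean M p) ^ 2 = a ^ 2 + vecVar M p := by
  have h0 : ∑ j ∈ steps M, p j * (j - vecMean M p) = 0 := by
    simp_rw [mul_sub, Finset.sum_sub_distrib, ← Finset.sum_mul, hp.sum_eq_one, vecMean]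
    rw [one_mul, sub_eq_zero]
    exact Finset.sum_congr rfl fun j _ => mul_comm _ _
  have e : ∀ j : ℤ, p j * (a + j - vecMean M p) ^ 2 = a ^ 2 * p j
      + 2 * a * (p j * (j - vecMean M p)) + ((j : ℝ) - vecMean M p) ^ 2 * p j := by
    intro j; ring
  simp_rw [e, Finset.sum_add_distrib, ← Finset.mul_sum]
  rw [h0, hp.sum_eq_one, vecVar]; ring

lemma sum_mass_mul_sq {p : ℤ → ℝ} (hp : IsProbVec M p) {s m R : ℕ} {k : ℤ} (hs : s ≤ m)
    (hR : |k| + M * m ≤ R) :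
    ∑ x ∈ box R, mass M (fun _ _ => p) s k m x * ((x : ℝ) - center (vecMean M p) s k m) ^ 2
      = ((m : ℝ) - s) * vecVar M p := by
  induction m, hs using Nat.le_induction with
  | base =>
    have := sum_mass_self (M := M) (e := fun _ _ => p) (s := s) (k := k) (R := R) (by
        have : (0 : ℤ) ≤ M * s := by positivity
        linarith) (fun x => ((x : ℝ) - center (vecMean M p) s k s) ^ 2)
    simp only [smul_eq_mul] at this
    rw [this, center]; simp
  | succ m hm ih =>
    have hRm : |k| + M * (m : ℤ) ≤ R := by
      push_cast at hR
      have : (0 : ℤ) ≤ M := by positivity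
      linarith
    have h := sum_mass_succ (M := M) (e := fun _ _ => p) (s := s) (k := k) hR
      (fun x => ((x : ℝ) - center (vecMean M p) s k (m + 1)) ^ 2)
    simp only [smul_eq_mul] at h
    rw [h, if_neg (by omega), add_zero]
    have e : ∀ x : ℤ, ∑ j ∈ steps M, p j
        * (((x + j : ℤ) : ℝ) - center (vecMean M p) s k (m + 1)) ^ 2
        = ((x : ℝ) - center (vecMean M p) s k m) ^ 2 + vecVar M p := by
      intro x
      rw [← sum_step_sq hp]
      refine Finset.sum_congr rfl fun j _ => ?_
      simp only [center]
      push_cast; ring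
    have h1 := sum_mass (M := M) (e := fun _ _ => p) (s := s) (k := k) (fun _ _ => hp) hRm
    rw [if_pos hm] at h1
    simp_rw [e, mul_add, Finset.sum_add_distrib, ← Finset.sum_mul]
    rw [ih hRm, h1]
    push_cast; ring

lemma pairSum_mono {R : ℕ} {a b : ℤ → ℝ} (ha : ∀ x, 0 ≤ a x) (hb : ∀ x, 0 ≤ b x) {F G : ℤ → ℝ}
    (h : ∀ z, F z ≤ G z) : pairSum R a b F ≤ pairSum R a b G :=
  Finset.sum_le_sum fun x _ => Finset.sum_le_sum fun y _ =>
    mul_le_mul_of_nonneg_left (h _) (mul_nonneg (ha x) (hb y))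

lemma pairSum_nonneg {R : ℕ} {a b : ℤ → ℝ} (ha : ∀ x, 0 ≤ a x) (hb : ∀ x, 0 ≤ b x) {F : ℤ → ℝ}
    (h : ∀ z, 0 ≤ F z) : 0 ≤ pairSum R a b F :=
  Finset.sum_nonneg fun x _ => Finset.sum_nonneg fun y _ =>
    mul_nonneg (mul_nonneg (ha x) (hb y)) (h _)

lemma pairSum_add (R : ℕ) (a b F G : ℤ → ℝ) :
    pairSum R a b (fun z => F z + G z) = pairSum R a b F + pairSum R a b G := by
  simp only [pairSum, mul_add, Finset.sum_add_distrib]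

lemma pairSum_const_mul (R : ℕ) (a b F : ℤ → ℝ) (c : ℝ) :
    pairSum R a b (fun z => c * F z) = c * pairSum R a b F := by
  simp only [pairSum, Finset.mul_sum]
  exact Finset.sum_congr rfl fun x _ => Finset.sum_congr rfl fun y _ => by ring

lemma pairSum_const (R : ℕ) (a b : ℤ → ℝ) (c : ℝ) :
    pairSum R a b (fun _ => c) = (∑ x ∈ box R, a x) * (∑ y ∈ box R, b y) * c := by
  rw [Finset.sum_mul_sum]
  simp only [pairSum, Finset.sum_mul]

namespace IsEnv

lemma integral_sum_qmass_mul_sq (he : IsEnv μ M w e) {s m R : ℕ} {k : ℤ} (hs : s ≤ m)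
    (hR : |k| + M * m ≤ R) :
    ∫ ω, ∑ x ∈ box R, qmass M e s k m ω x * ((x : ℝ) - center (meanDrift μ M w) s k m) ^ 2 ∂μ
      = ((m : ℝ) - s) * avgVar μ M w := by
  rw [integral_finsetSum _ fun x _ => (he.integrable_qmass s k m x).mul_const _,
    meanDrift_eq he.base_measurable he.base_isProbVec,
    avgVar_eq he.base_measurable he.base_isProbVec, ← sum_mass_mul_sq he.isProbVec_avg hs hR]
  refine Finset.sum_congr rfl fun x _ => ?_
  rw [integral_mul_const, he.integral_qmass]

lemma integral_pairSum_sq_le (he : IsEnv μ M w e) {s s' m R : ℕ} {k k' : ℤ} (hs : s ≤ m)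
    (hs' : s' ≤ m) (hR : |k| + M * m ≤ R) (hR' : |k'| + M * m ≤ R) :
    ∫ ω, pairSum R (qmass M e s k m ω) (qmass M e s' k' m ω) (fun z => (z : ℝ) ^ 2) ∂μ
      ≤ 3 * (((m : ℝ) - s) * avgVar μ M w + ((m : ℝ) - s') * avgVar μ M w
        + (center (meanDrift μ M w) s k m - center (meanDrift μ M w) s' k' m) ^ 2) := by
  set c := center (meanDrift μ M w) s k m
  set c' := center (meanDrift μ M w) s' k' m
  have hle := he.info_le (before m)
  have hS : ∀ s k c, BddMeas ‹MeasurableSpace Ω›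
      fun ω => ∑ x ∈ box R, qmass M e s k m ω x * ((x : ℝ) - c) ^ 2 := fun s k c =>
    (BddMeas.sum _ fun x => (he.bddMeas_qmass s k m x).mul_const _).mono hle
  rw [← he.integral_sum_qmass_mul_sq hs hR, ← he.integral_sum_qmass_mul_sq hs' hR',
    ← integral_add (hS s k c).integrable (hS s' k' c').integrable,
    show (c - c') ^ 2 = ∫ _, (c - c') ^ 2 ∂μ by simp,
    ← integral_add ((hS s k c).add (hS s' k' c')).integrable (integrable_const _),
    ← integral_const_mul]
  refine integral_mono ((he.bddMeas_pairSum s s' k k' m R _).mono hle).integrable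
    ((((hS s k c).add (hS s' k' c')).add (BddMeas.const _)).const_mul 3).integrable fun ω => ?_
  have h1 := he.sum_qmass hs hR ω
  have h1' := he.sum_qmass hs' hR' ω
  have e1 : ∑ x ∈ box R, ∑ y ∈ box R, qmass M e s k m ω x * qmass M e s' k' m ω y
      * (3 * (((x : ℝ) - c) ^ 2 + ((y : ℝ) - c') ^ 2 + (c - c') ^ 2))
      = 3 * (∑ x ∈ box R, qmass M e s k m ω x * ((x : ℝ) - c) ^ 2
        + ∑ x ∈ box R, qmass M e s' k' m ω x * ((x : ℝ) - c') ^ 2 + (c - c') ^ 2) := by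
    have e2 : ∀ x y : ℤ, qmass M e s k m ω x * qmass M e s' k' m ω y
        * (3 * (((x : ℝ) - c) ^ 2 + ((y : ℝ) - c') ^ 2 + (c - c') ^ 2))
        = 3 * ((qmass M e s k m ω x * ((x : ℝ) - c) ^ 2) * qmass M e s' k' m ω y)
        + 3 * (qmass M e s k m ω x * (qmass M e s' k' m ω y * ((y : ℝ) - c') ^ 2))
        + 3 * (c - c') ^ 2 * (qmass M e s k m ω x * qmass M e s' k' m ω y) := by
      intro x y; ring
    simp_rw [e2, Finset.sum_add_distrib, ← Finset.mul_sum, ← Finset.sum_mul]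
    rw [h1, h1']; ring
  change _ ≤ 3 * (∑ x ∈ box R, qmass M e s k m ω x * ((x : ℝ) - c) ^ 2
        + ∑ x ∈ box R, qmass M e s' k' m ω x * ((x : ℝ) - c') ^ 2 + (c - c') ^ 2)
  rw [← e1]
  refine Finset.sum_le_sum fun x _ => Finset.sum_le_sum fun y _ =>
    mul_le_mul_of_nonneg_left ?_ (mul_nonneg (he.qmass_nonneg ..) (he.qmass_nonneg ..))
  push_cast
  nlinarith [sq_nonneg ((x - c) + (y - c')), sq_nonneg ((x - c) - (c - c')),
    sq_nonneg ((y - c') + (c - c'))]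

/-- At distinct positions the steps are independent and the Poisson equation leaves the potential
unchanged; at a common position it gains the mean potential `β` after one joint step. -/
lemma sum_jointStep_mul_potential (he : IsEnv μ M w e) (hspan : HasSpanOne (avgProb μ w))
    (x y : ℤ) :
    ∑ z ∈ steps M, ∑ v ∈ steps M,
      jointStep μ w x y z v * potential M (avgProb μ w) (x + z - (y + v))
      = potential M (avgProb μ w) (x - y) + if x = y then beta μ M w else 0 := by
  unfold jointStep
  split_ifs with h
  · subst h
    rw [sub_self, potential_zero, zero_add, beta_eq he.base_measurable he.base_isProbVec hspan]
    simp only [add_sub_add_left_eq_sub]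
  · have h2 := sum_mul_potential_add he.isProbVec_avg hspan (x - y)
    rw [if_neg (sub_ne_zero.2 h)] at h2
    rw [← h2]
    refine Finset.sum_congr rfl fun z _ => Finset.sum_congr rfl fun v _ => ?_
    congr 2; ring

/-- The compensated potential of the difference of two walks. -/
noncomputable def pairMart (μ : Measure Ω) (w : Ω → ℤ → ℝ) (M : ℕ) (e : ℕ → ℤ → Ω → ℤ → ℝ)
    (s s' : ℕ) (k k' : ℤ) (R m₀ m : ℕ) (ω : Ω) : ℝ :=
  pairSum R (qmass M e s k m ω) (qmass M e s' k' m ω) (potential M (avgProb μ w))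
    - pairSum R (qmass M e s k m₀ ω) (qmass M e s' k' m₀ ω) (potential M (avgProb μ w))
    - beta μ M w * ∑ l ∈ Finset.Ico m₀ m, overlap R (qmass M e s k l ω) (qmass M e s' k' l ω)

lemma bddMeas_pairMart (he : IsEnv μ M w e) (s s' : ℕ) (k k' : ℤ) (R : ℕ) {m₀ m : ℕ} (h : m₀ ≤ m) :
    BddMeas (info e (before m)) (pairMart μ w M e s s' k k' R m₀ m) := by
  have h1 := he.bddMeas_pairSum s s' k k' m R (potential M (avgProb μ w))
  have h2 := (he.bddMeas_pairSum s s' k k' m₀ R (potential M (avgProb μ w))).mono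
    (info_mono (before_mono h))
  have h3 : BddMeas (info e (before m)) fun ω => ∑ l ∈ Finset.Ico m₀ m,
      overlap R (qmass M e s k l ω) (qmass M e s' k' l ω) := by
    -- The rule for sums asks measurability of all terms, including those outside the range of
    -- summation; truncating the index at `m` provides it.
    have e1 : ∀ ω, ∑ l ∈ Finset.Ico m₀ m, overlap R (qmass M e s k l ω) (qmass M e s' k' l ω)
        = ∑ l ∈ Finset.Ico m₀ m,
          overlap R (qmass M e s k (min l m) ω) (qmass M e s' k' (min l m) ω) := fun ω =>
      Finset.sum_congr rfl fun l hl => by rw [min_eq_left (Finset.mem_Ico.1 hl).2.le]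
    simp only [e1]
    exact BddMeas.sum _ fun l => (he.bddMeas_overlap s s' k k' (min l m) R).mono
      (info_mono (before_mono (min_le_right l m)))
  exact (h1.sub h2).sub (h3.const_mul _)

lemma pairMart_succ (he : IsEnv μ M w e) (hspan : HasSpanOne (avgProb μ w)) {s s' : ℕ} {k k' : ℤ}
    {m₀ m R : ℕ} (hs : s ≤ m₀) (hs' : s' ≤ m₀) (h : m₀ ≤ m) (hR : |k| + M * (m + 1 : ℕ) ≤ R)
    (hR' : |k'| + M * (m + 1 : ℕ) ≤ R) (ω : Ω) :
    pairMart μ w M e s s' k k' R m₀ (m + 1) ω = pairMart μ w M e s s' k k' R m₀ m ω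
      + ∑ i ∈ box R ×ˢ box R, (qmass M e s k m ω i.1 * qmass M e s' k' m ω i.2)
          * pairNoise μ w M e m (potential M (avgProb μ w)) i ω := by
  have h1 : ∑ x ∈ box R, ∑ y ∈ box R, qmass M e s k m ω x * qmass M e s' k' m ω y *
      (potential M (avgProb μ w) (x - y) + if x = y then beta μ M w else 0)
      = pairSum R (qmass M e s k m ω) (qmass M e s' k' m ω) (potential M (avgProb μ w))
        + beta μ M w * overlap R (qmass M e s k m ω) (qmass M e s' k' m ω) := by
    simp_rw [mul_add, Finset.sum_add_distrib]
    rw [pairSum, overlap, Finset.mul_sum]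
    congr 1
    refine Finset.sum_congr rfl fun x hx => ?_
    simp only [mul_ite, mul_zero]
    rw [Finset.sum_ite_eq, if_pos hx, mul_comm]
  have h2 := pairSum_succ (μ := μ) (w := w) (e := e) (hs.trans h) (hs'.trans h) hR hR'
    (potential M (avgProb μ w)) ω
  simp_rw [he.sum_jointStep_mul_potential hspan] at h2
  rw [h1] at h2
  rw [pairMart, pairMart, h2, Finset.sum_Ico_succ_top h, mul_add]
  ring

lemma integral_pairMart (he : IsEnv μ M w e) (hspan : HasSpanOne (avgProb μ w)) {s s' : ℕ}
    {k k' : ℤ} {m₀ N R : ℕ} (hs : s ≤ m₀) (hs' : s' ≤ m₀) (h : m₀ ≤ N)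
    (hR : |k| + M * N ≤ R) (hR' : |k'| + M * N ≤ R) :
    ∫ ω, pairMart μ w M e s s' k k' R m₀ N ω ∂μ = 0 := by
  induction N, h using Nat.le_induction with
  | base => simp [pairMart]
  | succ m hm ih =>
    have hM : (0 : ℤ) ≤ M := by positivity
    have hRm : |k| + M * (m : ℤ) ≤ R := by push_cast at hR; linarith
    have hRm' : |k'| + M * (m : ℤ) ≤ R := by push_cast at hR'; linarith
    simp_rw [he.pairMart_succ hspan hs hs' hm hR hR']
    rw [integral_add ((he.bddMeas_pairMart s s' k k' R hm).mono (he.info_le _)).integrable,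
      ih hRm hRm', he.integral_add_sum_pairNoise, add_zero]
    exact BddMeas.integrable (BddMeas.sum _ fun i =>
      (((he.bddMeas_qmass s k m i.1).mul (he.bddMeas_qmass s' k' m i.2)).mono
        (he.info_le _)).mul ((he.bddMeas_pairNoise m _ i).mono (he.info_le _)))

lemma integral_pairMart_sq_le (he : IsEnv μ M w e) (hspan : HasSpanOne (avgProb μ w)) {L : ℝ}
    (hL : ∀ y z : ℤ, |(y : ℝ) - z| ≤ 2 * M →
      |potential M (avgProb μ w) y - potential M (avgProb μ w) z| ≤ L) {s s' : ℕ}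
    {k k' : ℤ} {m₀ N R : ℕ} (hs : s ≤ m₀) (hs' : s' ≤ m₀) (h : m₀ ≤ N)
    (hR : |k| + M * N ≤ R) (hR' : |k'| + M * N ≤ R) :
    ∫ ω, pairMart μ w M e s s' k k' R m₀ N ω ^ 2 ∂μ
      ≤ 8 * L ^ 2 * ∑ m ∈ Finset.Ico m₀ N,
        (selfOverlap μ M e s k R m + selfOverlap μ M e s' k' R m) := by
  induction N, h using Nat.le_induction with
  | base => simp [pairMart]
  | succ m hm ih =>
    have hM : (0 : ℤ) ≤ M := by positivity
    have hRm : |k| + M * (m : ℤ) ≤ R := by push_cast at hR; linarith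
    have hRm' : |k'| + M * (m : ℤ) ≤ R := by push_cast at hR'; linarith
    simp_rw [he.pairMart_succ hspan hs hs' hm hR hR']
    have h1 := he.integral_add_sum_pairNoise_sq_le (s := s) (s' := s') hRm hRm'
      (he.bddMeas_pairMart s s' k k' R hm) hL
    have h2 := ih hRm hRm'
    rw [Finset.sum_Ico_succ_top hm, mul_add]
    linarith

/-- Mean collision times are of the order of the square root of the time. -/
lemma exists_sum_selfOverlap_le (μ : Measure Ω) [IsProbabilityMeasure μ] (M : ℕ) (w : Ω → ℤ → ℝ)
    (hspan : HasSpanOne (avgProb μ w)) (hell : Elliptic μ M w) :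
    ∃ C, 0 ≤ C ∧ ∀ e, IsEnv μ M w e → ∀ (s N R : ℕ) (k : ℤ), s ≤ N → |k| + M * N ≤ R →
      ∑ m ∈ Finset.Ico s N, selfOverlap μ M e s k R m ≤ C * √N := by
  -- The constant may depend on the law of the weights but not on the environment `e`. If no
  -- environment exists there is nothing to prove.
  by_cases hex : ∃ e, IsEnv μ M w e
  swap
  · exact ⟨0, le_rfl, fun e he => absurd ⟨e, he⟩ hex⟩
  obtain ⟨e₀, he₀⟩ := hex
  have hp := he₀.isProbVec_avg
  have hβ := beta_pos he₀.base_measurable he₀.base_isProbVec hspan hell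
  have hσ : 0 < avgVar μ M w := by
    rw [avgVar_eq he₀.base_measurable he₀.base_isProbVec]
    exact vecVar_pos hp hspan
  obtain ⟨C, hC0, hC⟩ := exists_abs_potential_sub_le hp hspan
  rw [← avgVar_eq he₀.base_measurable he₀.base_isProbVec] at hC
  set σ := avgVar μ M w
  refine ⟨((3 * σ + 1 / 2) / (2 * σ) + C) / beta μ M w, by positivity,
    fun e he s N R k hs hR => ?_⟩
  rcases Nat.eq_zero_or_pos N with rfl | hN
  · simp
  have hN1 : (1 : ℝ) ≤ √N := by
    rw [Real.one_le_sqrt]; exact_mod_cast hN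
  have hNp : 0 < √(N : ℝ) := by linarith
  have hle := he.info_le (before N)
  have h0 := he.integral_pairMart hspan (s := s) (s' := s) (k := k) (k' := k) le_rfl le_rfl hs hR hR
  set W := fun m ω => pairSum R (qmass M e s k m ω) (qmass M e s k m ω) (potential M (avgProb μ w))
    with hW
  have hWi : ∀ m, Integrable (W m) μ := fun m =>
    ((he.bddMeas_pairSum s s k k m R _).mono (he.info_le _)).integrable
  have hOi : ∀ m, Integrable (fun ω => overlap R (qmass M e s k m ω) (qmass M e s k m ω)) μ :=
    fun m => ((he.bddMeas_overlap s s k k m R).mono (he.info_le _)).integrable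
  have hself : ∀ m, ∫ ω, overlap R (qmass M e s k m ω) (qmass M e s k m ω) ∂μ
      = selfOverlap μ M e s k R m := by
    intro m
    simp only [overlap, selfOverlap, sq]
  -- The compensated potential has mean zero, so `β` times the expected number of meetings is the
  -- gain of the mean potential.
  have h1 : beta μ M w * ∑ m ∈ Finset.Ico s N, selfOverlap μ M e s k R m
      = ∫ ω, W N ω ∂μ - ∫ ω, W s ω ∂μ := by
    have e1 : ∀ ω, pairMart μ w M e s s k k R s N ω = W N ω - W s ω - beta μ M w *
        ∑ l ∈ Finset.Ico s N, overlap R (qmass M e s k l ω) (qmass M e s k l ω) := fun ω => rfl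
    have hd : Integrable (fun ω => W N ω - W s ω) μ := (hWi N).sub (hWi s)
    simp_rw [e1] at h0
    rw [integral_sub hd ((integrable_finsetSum _ fun m _ => hOi m).const_mul _),
      integral_sub (hWi N) (hWi s), integral_const_mul,
      integral_finsetSum _ fun m _ => hOi m] at h0
    simp_rw [hself] at h0
    linarith
  have h2 : 0 ≤ ∫ ω, W s ω ∂μ := integral_nonneg fun ω =>
    pairSum_nonneg (he.qmass_nonneg s k s ω) (he.qmass_nonneg s k s ω) (potential_nonneg hp)
  have h3 : ∫ ω, W N ω ∂μ ≤ ((3 * σ + 1 / 2) / (2 * σ) + C) * √N := by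
    -- Linear growth and `2|z| ≤ z²/√N + √N` reduce the mean potential to a second moment, which is
    -- of order `N`.
    have hpt : ∀ z : ℤ, potential M (avgProb μ w) z
        ≤ 1 / (4 * σ * √N) * (z : ℝ) ^ 2 + (√N / (4 * σ) + C) := by
      intro z
      have h4 := (abs_le.1 (hC z)).2
      have h5 : |(z : ℝ)| / (2 * σ) ≤ 1 / (4 * σ * √N) * (z : ℝ) ^ 2 + √N / (4 * σ) := by
        have e1 : 1 / (4 * σ * √N) * (z : ℝ) ^ 2 + √N / (4 * σ) - |(z : ℝ)| / (2 * σ)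
            = (|(z : ℝ)| - √N) ^ 2 / (4 * σ * √N) := by
          rw [← sq_abs (z : ℝ)]
          field_simp
          ring
        have : 0 ≤ (|(z : ℝ)| - √N) ^ 2 / (4 * σ * √N) := by positivity
        linarith
      linarith
    have hsq := he.integral_pairSum_sq_le hs hs hR hR
    have hSi : Integrable (fun ω => pairSum R (qmass M e s k N ω) (qmass M e s k N ω)
        fun z => (z : ℝ) ^ 2) μ := ((he.bddMeas_pairSum s s k k N R _).mono hle).integrable
    have hmono : ∫ ω, W N ω ∂μ ≤ ∫ ω, (1 / (4 * σ * √N) * pairSum R (qmass M e s k N ω)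
        (qmass M e s k N ω) (fun z => (z : ℝ) ^ 2) + (√N / (4 * σ) + C)) ∂μ := by
      refine integral_mono (hWi N) ((hSi.const_mul _).add (integrable_const _)) fun ω => ?_
      have h6 := pairSum_mono (R := R) (he.qmass_nonneg s k N ω) (he.qmass_nonneg s k N ω) hpt
      rw [pairSum_add, pairSum_const_mul, pairSum_const, he.sum_qmass hs hR, one_mul, one_mul] at h6
      exact h6
    rw [integral_add (hSi.const_mul _) (integrable_const _), integral_const_mul] at hmono
    simp only [integral_const, probReal_univ, one_smul] at hmono
    rw [sub_self] at hsq
    have h7 : ∫ ω, pairSum R (qmass M e s k N ω) (qmass M e s k N ω) (fun z => (z : ℝ) ^ 2) ∂μ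
        ≤ 6 * σ * (√N * √N) := by
      rw [Real.mul_self_sqrt (Nat.cast_nonneg N)]
      have : (0 : ℝ) ≤ s := Nat.cast_nonneg s
      nlinarith
    calc _ ≤ _ := hmono
      _ ≤ 1 / (4 * σ * √N) * (6 * σ * (√N * √N)) + (√N / (4 * σ) + C * √N) := by
        gcongr
        exact le_mul_of_one_le_right hC0 hN1
      _ = _ := by field_simp; ring
  rw [div_mul_eq_mul_div, le_div_iff₀ hβ, mul_comm]
  linarith

end IsEnv

end Collisions
-- Expansions of exponentials and comparison of products.
section Taylor

/-- For `|x| ≤ 1` the cubic remainder is smaller than the claimed power since `α ≤ 1`; for `|x| > 1`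
the polynomial itself is bounded by that power. -/
lemma norm_cexp_sub_taylor_le {α : ℝ} (h0 : 0 ≤ α) (h1 : α ≤ 1) (x : ℝ) :
    ‖Complex.exp (x * Complex.I) - (1 + x * Complex.I - (x : ℂ) ^ 2 / 2)‖
      ≤ 4 * |x| ^ (2 + α) := by
  have hn : ‖(x : ℂ) * Complex.I‖ = |x| := by simp
  rcases le_or_gt |x| 1 with h | h
  · have h2 := Complex.exp_bound (x := x * Complex.I) (by rw [hn]; exact h) (n := 3) (by norm_num)
    have e : ∑ m ∈ Finset.range 3, ((x : ℂ) * Complex.I) ^ m / (m.factorial : ℂ)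
        = 1 + x * Complex.I - (x : ℂ) ^ 2 / 2 := by
      simp [Finset.sum_range_succ, Nat.factorial, mul_pow]
      ring
    rw [e, hn] at h2
    refine h2.trans ?_
    have h3 : |x| ^ 3 ≤ |x| ^ (2 + α) := by
      rcases eq_or_lt_of_le (abs_nonneg x) with h4 | h4
      · rw [← h4, Real.zero_rpow (by linarith)]; norm_num
      · rw [← Real.rpow_natCast]
        exact Real.rpow_le_rpow_of_exponent_ge h4 h (by push_cast; linarith)
    have h5 : 0 ≤ |x| ^ 3 := by positivity
    norm_num [Nat.factorial]
    linarith
  · have h3 : |x| ^ 2 ≤ |x| ^ (2 + α) := by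
      rw [← Real.rpow_natCast]
      exact Real.rpow_le_rpow_of_exponent_le h.le (by push_cast; linarith)
    have h4 : ‖Complex.exp (x * Complex.I) - (1 + x * Complex.I - (x : ℂ) ^ 2 / 2)‖
        ≤ 1 + (1 + |x| + |x| ^ 2 / 2) := by
      refine (norm_sub_le _ _).trans (add_le_add (Complex.norm_exp_ofReal_mul_I x).le ?_)
      refine (norm_sub_le _ _).trans (add_le_add ((norm_add_le _ _).trans ?_) ?_)
      · rw [hn, norm_one]
      · simp
    nlinarith

lemma norm_cexp_sub_taylor_le_cube (x : ℝ) :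
    ‖Complex.exp (x * Complex.I) - (1 + x * Complex.I - (x : ℂ) ^ 2 / 2)‖ ≤ 4 * |x| ^ 3 := by
  have h := norm_cexp_sub_taylor_le zero_le_one le_rfl x
  rwa [show (2 + 1 : ℝ) = (3 : ℕ) by norm_num, Real.rpow_natCast] at h

lemma abs_exp_neg_sub_le {v : ℝ} (hv : 0 ≤ v) : |Real.exp (-v) - (1 - v)| ≤ v ^ 2 := by
  rcases le_or_gt v 1 with h | h
  · have := Real.abs_exp_sub_one_sub_id_le (x := -v) (by rwa [abs_neg, abs_of_nonneg hv])
    rw [neg_sq] at this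
    refine le_of_eq_of_le ?_ this
    congr 1; ring
  · have h1 := Real.exp_pos (-v)
    have h2 : Real.exp (-v) ≤ 1 := Real.exp_le_one_iff.2 (by linarith)
    rw [abs_le]; constructor <;> nlinarith

lemma norm_prod_sub_prod_le {ι : Type*} (s : Finset ι) {f g : ι → ℂ} (hf : ∀ i ∈ s, ‖f i‖ ≤ 1)
    (hg : ∀ i ∈ s, ‖g i‖ ≤ 1) : ‖∏ i ∈ s, f i - ∏ i ∈ s, g i‖ ≤ ∑ i ∈ s, ‖f i - g i‖ := by
  classical
  induction s using Finset.induction_on with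
  | empty => simp
  | insert a s ha ih =>
    rw [Finset.prod_insert ha, Finset.prod_insert ha, Finset.sum_insert ha]
    have h1 : ‖∏ i ∈ s, f i‖ ≤ 1 := by
      rw [norm_prod]
      exact Finset.prod_le_one (fun i _ => norm_nonneg _)
        fun i hi => hf i (Finset.mem_insert_of_mem hi)
    have e : f a * ∏ i ∈ s, f i - g a * ∏ i ∈ s, g i
        = (f a - g a) * ∏ i ∈ s, f i + g a * (∏ i ∈ s, f i - ∏ i ∈ s, g i) := by ring
    rw [e]
    refine (norm_add_le _ _).trans (add_le_add ?_ ?_)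
    · rw [norm_mul]; exact mul_le_of_le_one_right (norm_nonneg _) h1
    · rw [norm_mul]
      refine (mul_le_of_le_one_left (norm_nonneg _) (hg a (Finset.mem_insert_self _ _))).trans ?_
      exact ih (fun i hi => hf i (Finset.mem_insert_of_mem hi))
        fun i hi => hg i (Finset.mem_insert_of_mem hi)

lemma norm_pow_sub_pow_le {z w : ℂ} (hz : ‖z‖ ≤ 1) (hw : ‖w‖ ≤ 1) (n : ℕ) :
    ‖z ^ n - w ^ n‖ ≤ n * ‖z - w‖ := by
  have := norm_prod_sub_prod_le (Finset.range n) (f := fun _ => z) (g := fun _ => w)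
    (fun _ _ => hz) (fun _ _ => hw)
  simpa using this

end Taylor

/-! ### The central limit theorem for the annealed walk. -/

section AnnealedLimit

variable {M : ℕ} {p : ℤ → ℝ}

/-- The characteristic function of the centered annealed step. -/
noncomputable def centeredChar (M : ℕ) (p : ℤ → ℝ) (t : ℝ) : ℂ :=
  ∑ j ∈ steps M, (p j : ℂ) * Complex.exp ((t * (j - vecMean M p) : ℝ) * Complex.I)

lemma fourierSum_eq_centeredChar (t : ℝ) : fourierSum (steps M) p t
    = Complex.exp ((t * vecMean M p : ℝ) * Complex.I) * centeredChar M p t := by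
  rw [fourierSum, centeredChar, Finset.mul_sum]
  refine Finset.sum_congr rfl fun j _ => ?_
  rw [mul_left_comm, ← Complex.exp_add]
  congr 2
  push_cast; ring

lemma norm_centeredChar_le (hp : IsProbVec M p) (t : ℝ) : ‖centeredChar M p t‖ ≤ 1 := by
  rw [← hp.sum_eq_one]
  refine (norm_sum_le _ _).trans (Finset.sum_le_sum fun j _ => ?_)
  rw [norm_mul, Complex.norm_exp_ofReal_mul_I, mul_one, Complex.norm_real,
    Real.norm_of_nonneg (hp.nonneg j)]

lemma sum_mul_sub_vecMean (hp : IsProbVec M p) :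
    ∑ j ∈ steps M, p j * ((j : ℝ) - vecMean M p) = 0 := by
  simp_rw [mul_sub, Finset.sum_sub_distrib, ← Finset.sum_mul, hp.sum_eq_one]
  rw [one_mul, vecMean, sub_eq_zero]
  exact Finset.sum_congr rfl fun j _ => mul_comm _ _

lemma exists_norm_centeredChar_sub_le (hp : IsProbVec M p) : ∃ C, 0 ≤ C ∧ ∀ t : ℝ,
    ‖centeredChar M p t - Real.exp (-(vecVar M p * t ^ 2 / 2))‖ ≤ C * (|t| ^ 3 + t ^ 4) := by
  set V := vecMean M p
  set σ := vecVar M p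
  have hσ : 0 ≤ σ := vecVar_nonneg hp
  refine ⟨max (4 * ∑ j ∈ steps M, p j * |(j : ℝ) - V| ^ 3) (σ ^ 2 / 4),
    le_max_of_le_right (by positivity), fun t => ?_⟩
  have h1 : centeredChar M p t - ((1 - σ * t ^ 2 / 2 : ℝ) : ℂ)
      = ∑ j ∈ steps M, (p j : ℂ) * (Complex.exp ((t * (j - V) : ℝ) * Complex.I)
        - (1 + (t * (j - V) : ℝ) * Complex.I - ((t * (j - V) : ℝ) : ℂ) ^ 2 / 2)) := by
    have e1 : ∑ j ∈ steps M, (p j : ℂ) = 1 := by exact_mod_cast hp.sum_eq_one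
    have e2 : ∑ j ∈ steps M, (p j : ℂ) * ((j : ℂ) - V) = 0 := by
      exact_mod_cast sum_mul_sub_vecMean hp
    have e3 : ∑ j ∈ steps M, ((j : ℂ) - V) ^ 2 * (p j : ℂ) = σ := by
      have : ∑ j ∈ steps M, ((j : ℝ) - V) ^ 2 * p j = σ := rfl
      exact_mod_cast this
    have e4 : ∀ j : ℤ, (p j : ℂ) * (Complex.exp ((t * (j - V) : ℝ) * Complex.I)
        - (1 + (t * (j - V) : ℝ) * Complex.I - ((t * (j - V) : ℝ) : ℂ) ^ 2 / 2))
        = (p j : ℂ) * Complex.exp ((t * (j - V) : ℝ) * Complex.I) - p j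
          - (t : ℂ) * Complex.I * ((p j : ℂ) * ((j : ℂ) - V))
          + (t : ℂ) ^ 2 / 2 * (((j : ℂ) - V) ^ 2 * (p j : ℂ)) := by
      intro j
      push_cast; ring
    simp_rw [e4, Finset.sum_add_distrib, Finset.sum_sub_distrib, ← Finset.mul_sum]
    rw [e1, e2, e3, ← centeredChar]
    push_cast; ring
  have h2 : ‖centeredChar M p t - ((1 - σ * t ^ 2 / 2 : ℝ) : ℂ)‖
      ≤ (4 * ∑ j ∈ steps M, p j * |(j : ℝ) - V| ^ 3) * |t| ^ 3 := by
    rw [h1, Finset.mul_sum, Finset.sum_mul]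
    refine (norm_sum_le _ _).trans (Finset.sum_le_sum fun j _ => ?_)
    rw [norm_mul, Complex.norm_real, Real.norm_of_nonneg (hp.nonneg j)]
    refine (mul_le_mul_of_nonneg_left (norm_cexp_sub_taylor_le_cube _) (hp.nonneg j)).trans_eq ?_
    rw [abs_mul, mul_pow]; ring
  have h3 : ‖((1 - σ * t ^ 2 / 2 : ℝ) : ℂ) - Real.exp (-(σ * t ^ 2 / 2))‖ ≤ σ ^ 2 / 4 * t ^ 4 := by
    rw [← Complex.ofReal_sub, Complex.norm_real, Real.norm_eq_abs, abs_sub_comm]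
    exact (abs_exp_neg_sub_le (by positivity)).trans_eq (by ring)
  calc _ ≤ ‖centeredChar M p t - ((1 - σ * t ^ 2 / 2 : ℝ) : ℂ)‖
        + ‖((1 - σ * t ^ 2 / 2 : ℝ) : ℂ) - Real.exp (-(σ * t ^ 2 / 2))‖ :=
        norm_sub_le_norm_sub_add_norm_sub _ _ _
    _ ≤ _ := add_le_add h2 h3
    _ ≤ max (4 * ∑ j ∈ steps M, p j * |(j : ℝ) - V| ^ 3) (σ ^ 2 / 4) * |t| ^ 3
        + max (4 * ∑ j ∈ steps M, p j * |(j : ℝ) - V| ^ 3) (σ ^ 2 / 4) * t ^ 4 := by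
        gcongr
        exacts [le_max_left _ _, le_max_right _ _]
    _ = _ := by ring

lemma tendsto_pnat_cast : Tendsto (fun n : ℕ+ => (n : ℝ)) atTop atTop :=
  tendsto_natCast_atTop_atTop.comp tendsto_PNat_val_atTop_atTop

lemma tendsto_sqrt_pnat : Tendsto (fun n : ℕ+ => √(n : ℝ)) atTop atTop :=
  Real.tendsto_sqrt_atTop.comp tendsto_pnat_cast

lemma sqrt_pnat_pos (n : ℕ+) : 0 < √(n : ℝ) := Real.sqrt_pos.2 (by exact_mod_cast n.pos)

/-- Each factor differs from its Gaussian counterpart by `O(n^{-3/2})`, and for numbers in the unit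
disc the difference of `m`-th powers is at most `m` times the difference, with `m` of order `n`. -/
lemma tendsto_centeredChar_pow (hp : IsProbVec M p) {m : ℕ+ → ℕ} {t : ℝ}
    (hm : Tendsto (fun n : ℕ+ => (m n : ℝ) / n) atTop (𝓝 t)) (τ : ℝ) :
    Tendsto (fun n : ℕ+ => centeredChar M p (τ / √n) ^ m n) atTop
      (𝓝 (Real.exp (-(vecVar M p * t * τ ^ 2 / 2)) : ℂ)) := by
  obtain ⟨C, hC0, hC⟩ := exists_norm_centeredChar_sub_le hp
  set σ := vecVar M p
  have hσ : 0 ≤ σ := vecVar_nonneg hp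
  have hlim : Tendsto (fun n : ℕ+ => (Real.exp (-(σ * (τ / √n) ^ 2 / 2)) : ℂ) ^ m n) atTop
      (𝓝 (Real.exp (-(σ * t * τ ^ 2 / 2)) : ℂ)) := by
    have e : ∀ n : ℕ+, (Real.exp (-(σ * (τ / √n) ^ 2 / 2)) : ℂ) ^ m n
        = (Real.exp (-(σ * ((m n : ℝ) / n) * τ ^ 2 / 2)) : ℂ) := by
      intro n
      rw [← Complex.ofReal_pow, ← Real.exp_nat_mul, div_pow, Real.sq_sqrt (Nat.cast_nonneg _)]
      congr 2; ring
    simp_rw [e]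
    refine (Complex.continuous_ofReal.tendsto _).comp ((Real.continuous_exp.tendsto _).comp ?_)
    exact ((((hm.const_mul σ).mul_const (τ ^ 2)).div_const 2).neg)
  have hdiff : Tendsto (fun n : ℕ+ => centeredChar M p (τ / √n) ^ m n
      - (Real.exp (-(σ * (τ / √n) ^ 2 / 2)) : ℂ) ^ m n) atTop (𝓝 0) := by
    refine squeeze_zero_norm (a := fun n : ℕ+ => (m n : ℝ) / n * (C * (|τ| ^ 3 / √n
      + τ ^ 4 * ((1 / √n) * (1 / √n))))) (fun n => ?_) ?_
    · have hn := sqrt_pnat_pos n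
      have h1 := norm_pow_sub_pow_le (norm_centeredChar_le hp (τ / √n))
        (w := (Real.exp (-(σ * (τ / √n) ^ 2 / 2)) : ℂ)) (by
          rw [Complex.norm_real, Real.norm_of_nonneg (Real.exp_pos _).le, Real.exp_le_one_iff]
          have : 0 ≤ σ * (τ / √n) ^ 2 / 2 := by positivity
          linarith) (m n)
      refine h1.trans ((mul_le_mul_of_nonneg_left (hC _) (Nat.cast_nonneg _)).trans_eq ?_)
      have hs : √(n : ℝ) ^ 2 = n := Real.sq_sqrt (Nat.cast_nonneg _)
      rw [abs_div, abs_of_pos hn, ← hs]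
      generalize √(n : ℝ) = r at hn
      rw [Real.sqrt_sq hn.le]
      field_simp
    · have h0 : Tendsto (fun n : ℕ+ => 1 / √(n : ℝ)) atTop (𝓝 0) :=
        tendsto_const_nhds.div_atTop tendsto_sqrt_pnat
      have h3 : Tendsto (fun n : ℕ+ => |τ| ^ 3 / √(n : ℝ)) atTop (𝓝 0) :=
        tendsto_const_nhds.div_atTop tendsto_sqrt_pnat
      have := hm.mul (((h3.add ((h0.mul h0).const_mul (τ ^ 4))).const_mul C))
      simpa using this
  simpa using hdiff.add hlim

lemma meanChar_eq (k : ℤ) (m : ℕ) (t : ℝ) : meanChar M p k m t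
    = centeredChar M p t ^ m * Complex.exp ((t * (k + m * vecMean M p) : ℝ) * Complex.I) := by
  rw [meanChar, fourierSum_eq_centeredChar, mul_pow, ← Complex.exp_nat_mul, mul_assoc,
    mul_left_comm, ← Complex.exp_add]
  congr 2
  push_cast; ring

lemma norm_meanChar_le (hp : IsProbVec M p) (k : ℤ) (m : ℕ) (t : ℝ) : ‖meanChar M p k m t‖ ≤ 1 := by
  rw [meanChar_eq, norm_mul, Complex.norm_exp_ofReal_mul_I, mul_one, norm_pow]
  exact pow_le_one₀ (norm_nonneg _) (norm_centeredChar_le hp t)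

/-- The product is the characteristic function of the difference of two independent annealed walks:
the variances add and the drifts combine into one phase. -/
lemma tendsto_re_meanChar_mul_conj (hp : IsProbVec M p) {m m' : ℕ+ → ℕ} {k k' : ℕ+ → ℤ}
    {t t' d : ℝ} (hm : Tendsto (fun n : ℕ+ => (m n : ℝ) / n) atTop (𝓝 t))
    (hm' : Tendsto (fun n : ℕ+ => (m' n : ℝ) / n) atTop (𝓝 t'))
    (hd : Tendsto (fun n : ℕ+ => ((k n + m n * vecMean M p) - (k' n + m' n * vecMean M p)) / √n)
      atTop (𝓝 d)) (τ : ℝ) :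
    Tendsto (fun n : ℕ+ => (meanChar M p (k n) (m n) (τ / √n)
      * (starRingEnd ℂ) (meanChar M p (k' n) (m' n) (τ / √n))).re) atTop
      (𝓝 (Real.cos (τ * d) * Real.exp (-(vecVar M p * (t + t') * τ ^ 2 / 2)))) := by
  have h1 := tendsto_centeredChar_pow hp hm τ
  have h2 := (Complex.continuous_conj.tendsto _).comp (tendsto_centeredChar_pow hp hm' τ)
  have h3 : Tendsto (fun n : ℕ+ => Complex.exp ((τ * (((k n + m n * vecMean M p)
      - (k' n + m' n * vecMean M p)) / √n) : ℝ) * Complex.I)) atTop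
      (𝓝 (Complex.exp ((τ * d : ℝ) * Complex.I))) := by
    have hc : Continuous fun x : ℝ => Complex.exp ((τ * x : ℝ) * Complex.I) := by fun_prop
    exact (hc.tendsto d).comp hd
  have h4 := (Complex.continuous_re.tendsto _).comp ((h1.mul h2).mul h3)
  rw [Complex.conj_ofReal, ← Complex.ofReal_mul, ← Real.exp_add, Complex.re_ofReal_mul,
    Complex.exp_ofReal_mul_I_re] at h4
  have e : Real.cos (τ * d) * Real.exp (-(vecVar M p * (t + t') * τ ^ 2 / 2))
      = Real.exp (-(vecVar M p * t * τ ^ 2 / 2) + -(vecVar M p * t' * τ ^ 2 / 2))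
        * Real.cos (τ * d) := by
    rw [mul_comm]; congr 2; ring
  rw [e]
  refine h4.congr fun n => ?_
  simp only [Function.comp_apply]
  congr 1
  rw [meanChar_eq, meanChar_eq, map_mul, map_pow, ← Complex.exp_conj, map_mul, Complex.conj_ofReal,
    Complex.conj_I]
  have e2 : Complex.exp ((τ * (((k n + m n * vecMean M p)
      - (k' n + m' n * vecMean M p)) / √n) : ℝ) * Complex.I)
      = Complex.exp ((τ / √n * (k n + m n * vecMean M p) : ℝ) * Complex.I)
        * Complex.exp ((τ / √n * (k' n + m' n * vecMean M p) : ℝ) * -Complex.I) := by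
    rw [← Complex.exp_add]
    congr 1
    push_cast; ring
  rw [e2]; ring

end AnnealedLimit
-- From characteristic functions to mean absolute differences, in `L¹`.
section MeanAbsolute

variable {Ω : Type*} [MeasurableSpace Ω] {μ : Measure Ω} [IsProbabilityMeasure μ]

/-- The expected error is taken for each `τ` first, and dominated convergence is applied in `τ`. The
domination needs the quadratic bound near zero only in mean, uniformly in `n`; the pathwise bound
serves integrability alone and may depend on `n`. -/
lemma tendsto_integral_abs_fejer_sub {H : ℕ+ → ℝ → Ω → ℝ}
    (hH : ∀ n, Measurable (Function.uncurry (H n))) (hH0 : ∀ n τ ω, 0 ≤ H n τ ω)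
    (hH2 : ∀ n τ ω, H n τ ω ≤ 2) (hHb : ∀ n, ∃ b, ∀ τ ω, H n τ ω ≤ b * τ ^ 2) {B : ℝ}
    (hB : ∀ᶠ n in atTop, ∀ τ, ∫ ω, H n τ ω ∂μ ≤ B * τ ^ 2) {d v : ℝ} (hv : 0 ≤ v)
    (hlim : ∀ τ, Tendsto (fun n => ∫ ω, |H n τ ω
      - (1 - Real.cos (τ * d) * Real.exp (-(v * τ ^ 2 / 2)))| ∂μ) atTop (𝓝 0)) :
    Tendsto (fun n : ℕ+ => ∫ ω, |1 / (2 * Real.pi) * (∫ τ, H n τ ω * fejerKernel √n τ)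
      - gaussAbs d v| ∂μ) atTop (𝓝 0) := by
  have hpi := Real.pi_pos
  set g : ℝ → ℝ := fun τ => 1 - Real.cos (τ * d) * Real.exp (-(v * τ ^ 2 / 2)) with hg
  have hg2 : ∀ τ, |g τ| ≤ 2 := by
    intro τ
    have h1 : |Real.cos (τ * d) * Real.exp (-(v * τ ^ 2 / 2))| ≤ 1 := by
      rw [abs_mul, abs_of_pos (Real.exp_pos _)]
      refine mul_le_one₀ (Real.abs_cos_le_one _) (Real.exp_pos _).le (Real.exp_le_one_iff.2 ?_)
      have : 0 ≤ v * τ ^ 2 / 2 := by positivity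
      linarith
    have h2 := abs_le.1 h1
    rw [abs_le]; constructor <;> simp only [hg] <;> linarith
  have hgm : Measurable g := by fun_prop
  have hGi : Integrable fun τ => gaussAbsIntegrand d v τ := integrable_gaussAbsIntegrand d hv
  have hG : ∀ τ, gaussAbsIntegrand d v τ = g τ * (τ ^ 2)⁻¹ := fun τ => rfl
  have hHω : ∀ n ω, Measurable fun τ => H n τ ω := fun n ω =>
    (hH n).comp (measurable_id.prodMk measurable_const)
  have hHτ : ∀ n τ, Measurable (H n τ) := fun n τ =>
    (hH n).comp (measurable_const.prodMk measurable_id)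
  have hbound : ∀ {c b τ r : ℝ}, 0 ≤ c → 0 < r → c ≤ 2 → c ≤ b * τ ^ 2 →
      c * fejerKernel r τ ≤ Real.pi ^ 2 / 2 * (max 2 b * min 1 (τ ^ 2)⁻¹) := by
    intro c b τ r hc hr h2 hb
    calc c * fejerKernel r τ ≤ c * (Real.pi ^ 2 / 2 * (τ ^ 2)⁻¹) :=
          mul_le_mul_of_nonneg_left (fejerKernel_le hr τ) hc
      _ = Real.pi ^ 2 / 2 * (c * (τ ^ 2)⁻¹) := by ring
      _ ≤ _ := mul_le_mul_of_nonneg_left (min_mul_le_min (by norm_num) h2 hb) (by positivity)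
  have hFi : ∀ n ω, Integrable fun τ => H n τ ω * fejerKernel √n τ := by
    intro n ω
    obtain ⟨b, hb⟩ := hHb n
    refine ((integrable_min_one_inv_sq.const_mul (max 2 b)).const_mul (Real.pi ^ 2 / 2)).mono'
      ((hHω n ω).mul (measurable_fejerKernel _)).aestronglyMeasurable
      (Eventually.of_forall fun τ => ?_)
    rw [Real.norm_of_nonneg (mul_nonneg (hH0 n τ ω) (fejerKernel_nonneg _ _))]
    exact hbound (hH0 n τ ω) (sqrt_pnat_pos n) (hH2 n τ ω) (hb τ ω)
  set D : ℕ+ → ℝ → Ω → ℝ := fun n τ ω =>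
    H n τ ω * fejerKernel √n τ - 2 * gaussAbsIntegrand d v τ with hD
  have hgam : Measurable (gaussAbsIntegrand d v) := by
    unfold gaussAbsIntegrand; fun_prop
  have hDm : ∀ n, Measurable (Function.uncurry (D n)) := fun n =>
    ((hH n).mul ((measurable_fejerKernel _).comp measurable_fst)).sub
      ((hgam.comp measurable_fst).const_mul 2)
  have hDm' : ∀ n, Measurable (Function.uncurry fun τ ω => ENNReal.ofReal |D n τ ω|) := fun n =>
    ENNReal.measurable_ofReal.comp (continuous_abs.measurable.comp (hDm n))
  have hDω : ∀ n τ, BddMeas ‹MeasurableSpace Ω› (D n τ) := fun n τ =>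
    (BddMeas.mul_const _ ⟨hHτ n τ, 2, fun ω => by
      rw [abs_of_nonneg (hH0 n τ ω)]; exact hH2 n τ ω⟩).sub (BddMeas.const _)
  have hDabs : ∀ n τ, Integrable (fun ω => |D n τ ω|) μ := fun n τ => (hDω n τ).integrable.abs
  have hpt : ∀ n ω, ENNReal.ofReal |1 / (2 * Real.pi) * (∫ τ, H n τ ω * fejerKernel √n τ)
      - gaussAbs d v| ≤ ∫⁻ τ, ENNReal.ofReal |D n τ ω| := by
    intro n ω
    have hDi : Integrable fun τ => D n τ ω := (hFi n ω).sub (hGi.const_mul 2)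
    rw [← ofReal_integral_eq_lintegral_ofReal hDi.abs (Eventually.of_forall fun τ => abs_nonneg _)]
    refine ENNReal.ofReal_le_ofReal ?_
    have e : 1 / (2 * Real.pi) * (∫ τ, H n τ ω * fejerKernel √n τ) - gaussAbs d v
        = 1 / (2 * Real.pi) * ∫ τ, D n τ ω := by
      simp only [hD]
      rw [integral_sub (hFi n ω) (hGi.const_mul 2), integral_const_mul,
        integral_gaussAbsIntegrand d hv]
      field_simp
    rw [e, abs_mul, abs_of_pos (by positivity)]
    refine (mul_le_of_le_one_left (abs_nonneg _) ?_).trans abs_integral_le_integral_abs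
    rw [div_le_one (by positivity)]
    linarith [Real.pi_gt_three]
  have hmain : Tendsto (fun n => ∫⁻ τ, ∫⁻ ω, ENNReal.ofReal |D n τ ω| ∂μ) atTop (𝓝 0) := by
    have h0 : (0 : ℝ≥0∞) = ∫⁻ _ : ℝ, 0 := by simp
    rw [h0]
    refine tendsto_lintegral_filter_of_dominated_convergence
      (fun τ => ENNReal.ofReal (Real.pi ^ 2 / 2 * (max 2 B * min 1 (τ ^ 2)⁻¹)
        + 2 * gaussAbsIntegrand d v τ))
      (Eventually.of_forall fun n => (hDm' n).lintegral_prod_right') ?_ ?_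
      (Eventually.of_forall fun τ => ?_)
    · filter_upwards [hB] with n hBn
      refine Eventually.of_forall fun τ => ?_
      rw [← ofReal_integral_eq_lintegral_ofReal (hDabs n τ)
        (Eventually.of_forall fun τ => abs_nonneg _)]
      refine ENNReal.ofReal_le_ofReal ?_
      have hHi : Integrable (H n τ) μ := BddMeas.integrable ⟨hHτ n τ, 2, fun ω => by
        rw [abs_of_nonneg (hH0 n τ ω)]; exact hH2 n τ ω⟩
      have h1 : ∫ ω, |D n τ ω| ∂μ ≤ ∫ ω, (H n τ ω * fejerKernel √n τ
          + 2 * gaussAbsIntegrand d v τ) ∂μ := by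
        refine integral_mono (hDabs n τ) ((hHi.mul_const _).add (integrable_const _)) fun ω => ?_
        refine (abs_sub _ _).trans_eq ?_
        rw [abs_of_nonneg (mul_nonneg (hH0 n τ ω) (fejerKernel_nonneg _ _)),
          abs_of_nonneg (mul_nonneg zero_le_two (gaussAbsIntegrand_nonneg d hv τ))]
      refine h1.trans ?_
      rw [integral_add (hHi.mul_const _) (integrable_const _), integral_mul_const]
      simp only [integral_const, probReal_univ, one_smul]
      refine add_le_add (hbound (integral_nonneg (hH0 n τ)) (sqrt_pnat_pos n) ?_ (hBn τ)) le_rfl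
      calc ∫ ω, H n τ ω ∂μ ≤ ∫ _, (2 : ℝ) ∂μ :=
            integral_mono hHi (integrable_const _) (hH2 n τ)
        _ = 2 := by simp
    · refine ne_of_lt (Integrable.lintegral_lt_top ?_)
      exact ((integrable_min_one_inv_sq.const_mul _).const_mul _).add (hGi.const_mul 2)
    · have h1 : ∀ n, ∫⁻ ω, ENNReal.ofReal |D n τ ω| ∂μ = ENNReal.ofReal (∫ ω, |D n τ ω| ∂μ) :=
        fun n => (ofReal_integral_eq_lintegral_ofReal (hDabs n τ)
          (Eventually.of_forall fun τ => abs_nonneg _)).symm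
      simp_rw [h1]
      rw [← ENNReal.ofReal_zero]
      refine (ENNReal.continuous_ofReal.tendsto _).comp ?_
      have hK := tendsto_fejerKernel tendsto_sqrt_pnat τ
      refine squeeze_zero (g := fun n : ℕ+ => fejerKernel √n τ * ∫ ω, |H n τ ω - g τ| ∂μ
        + |fejerKernel √n τ - 2 * (τ ^ 2)⁻¹| * 2) (fun n => integral_nonneg fun ω => abs_nonneg _)
        (fun n => ?_) ?_
      · have hHi : BddMeas ‹MeasurableSpace Ω› (fun ω => H n τ ω - g τ) :=
          BddMeas.sub ⟨hHτ n τ, 2, fun ω => by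
            rw [abs_of_nonneg (hH0 n τ ω)]; exact hH2 n τ ω⟩ (BddMeas.const _)
        have h2 : ∫ ω, |D n τ ω| ∂μ ≤ ∫ ω, (fejerKernel √n τ * |H n τ ω - g τ|
            + |fejerKernel √n τ - 2 * (τ ^ 2)⁻¹| * 2) ∂μ := by
          refine integral_mono (hDabs n τ) ((hHi.integrable.abs.const_mul _).add
            (integrable_const _)) fun ω => ?_
          have e : D n τ ω = fejerKernel √n τ * (H n τ ω - g τ)
              + (fejerKernel √n τ - 2 * (τ ^ 2)⁻¹) * g τ := by
            simp only [hD, hG]; ring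
          simp only [e]
          refine (abs_add_le _ _).trans ?_
          rw [abs_mul, abs_mul, abs_of_nonneg (fejerKernel_nonneg _ _)]
          exact add_le_add le_rfl (mul_le_mul_of_nonneg_left (hg2 τ) (abs_nonneg _))
        refine h2.trans_eq ?_
        rw [integral_add (hHi.integrable.abs.const_mul _) (integrable_const _), integral_const_mul]
        simp
      · have h3 : Tendsto (fun n : ℕ+ => |fejerKernel √n τ - 2 * (τ ^ 2)⁻¹| * 2) atTop (𝓝 0) := by
          have := ((hK.sub_const (2 * (τ ^ 2)⁻¹)).abs).mul_const 2
          simpa using this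
        simpa using (hK.mul (hlim τ)).add h3
  -- If the error is not integrable, its Bochner integral is zero and the bound is trivial;
  -- integrability in `ω` thus needs no separate proof.
  have hZ : ∀ n, ∫ ω, |1 / (2 * Real.pi) * (∫ τ, H n τ ω * fejerKernel √n τ) - gaussAbs d v| ∂μ
      ≤ (∫⁻ τ, ∫⁻ ω, ENNReal.ofReal |D n τ ω| ∂μ).toReal ∨
      (∫⁻ τ, ∫⁻ ω, ENNReal.ofReal |D n τ ω| ∂μ) = ∞ := by
    intro n
    by_cases htop : (∫⁻ τ, ∫⁻ ω, ENNReal.ofReal |D n τ ω| ∂μ) = ∞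
    · exact Or.inr htop
    refine Or.inl ?_
    set Z := fun ω => |1 / (2 * Real.pi) * (∫ τ, H n τ ω * fejerKernel √n τ) - gaussAbs d v|
    by_cases hZi : Integrable Z μ
    · rw [← ENNReal.ofReal_le_iff_le_toReal htop,
        ofReal_integral_eq_lintegral_ofReal hZi (Eventually.of_forall fun ω => abs_nonneg _),
        lintegral_lintegral_swap (hDm' n).aemeasurable]
      exact lintegral_mono (hpt n)
    · rw [integral_undef hZi]; exact ENNReal.toReal_nonneg
  have hreal := (ENNReal.tendsto_toReal ENNReal.zero_ne_top).comp hmain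
  rw [ENNReal.toReal_zero] at hreal
  refine squeeze_zero' (Eventually.of_forall fun n => integral_nonneg fun ω => abs_nonneg _) ?_ hreal
  filter_upwards [hmain.eventually (gt_mem_nhds ENNReal.zero_lt_top)] with n hn
  exact (hZ n).resolve_right hn.ne

lemma integral_le_sqrt {f : Ω → ℝ} (hf : BddMeas ‹MeasurableSpace Ω› f) :
    ∫ ω, f ω ∂μ ≤ √(∫ ω, f ω ^ 2 ∂μ) := by
  refine Real.le_sqrt_of_sq_le ?_
  set c := ∫ ω, f ω ∂μ with hc
  have h : 0 ≤ ∫ ω, (f ω - c) ^ 2 ∂μ := integral_nonneg fun ω => sq_nonneg _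
  have e : ∀ ω, (f ω - c) ^ 2 = f ω ^ 2 - 2 * c * f ω + c ^ 2 := fun ω => by ring
  simp_rw [e] at h
  rw [integral_add (((hf.pow 2).sub (hf.const_mul (2 * c))).integrable) (integrable_const _),
    integral_sub (hf.pow 2).integrable (hf.const_mul (2 * c)).integrable, integral_const_mul,
    ← hc] at h
  simp only [integral_const, probReal_univ, one_smul] at h
  nlinarith

/-- Each `|x - y|` is a Fejér integral, and summing `1 - cos (t(x - y))` against the two laws gives
one minus the real part of a product of their characteristic functions. -/
lemma pairSum_abs_eq_integral {R : ℕ} {a b : ℤ → ℝ} (ha : ∑ x ∈ box R, a x = 1)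
    (hb : ∑ x ∈ box R, b x = 1) {r : ℝ} (hr : 0 < r) :
    r⁻¹ * pairSum R a b (fun z => |(z : ℝ)|) = 1 / (2 * Real.pi) * ∫ τ,
      (1 - (fourierSum (box R) a (τ / r)
        * (starRingEnd ℂ) (fourierSum (box R) b (τ / r))).re) * fejerKernel r τ := by
  have hpi := Real.pi_pos
  have h1 : ∀ t, 1 - (fourierSum (box R) a t * (starRingEnd ℂ) (fourierSum (box R) b t)).re
      = ∑ x ∈ box R, ∑ y ∈ box R, a x * b y * (1 - Real.cos (t * ((x - y : ℤ) : ℝ))) := by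
    intro t
    have hab : ∑ x ∈ box R, ∑ y ∈ box R, a x * b y = 1 := by
      rw [← Finset.sum_mul_sum, ha, hb, one_mul]
    rw [re_fourierSum_mul_conj]
    push_cast
    simp only [mul_one_sub, Finset.sum_sub_distrib, hab]
  have h2 := integral_div_one_sub_cos (fun t =>
    1 - (fourierSum (box R) a t * (starRingEnd ℂ) (fourierSum (box R) b t)).re) hr
  have h3 : ∫ t in (-Real.pi)..Real.pi, (1 - (fourierSum (box R) a t
      * (starRingEnd ℂ) (fourierSum (box R) b t)).re) / (1 - Real.cos t)
      = 2 * Real.pi * pairSum R a b (fun z => |(z : ℝ)|) := by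
    have e : ∀ t, (1 - (fourierSum (box R) a t
      * (starRingEnd ℂ) (fourierSum (box R) b t)).re) / (1 - Real.cos t)
      = ∑ x ∈ box R, ∑ y ∈ box R, a x * b y *
        ((1 - Real.cos (t * ((x - y : ℤ) : ℝ))) / (1 - Real.cos t)) := by
      intro t
      rw [h1, Finset.sum_div]
      refine Finset.sum_congr rfl fun x _ => ?_
      rw [Finset.sum_div]
      exact Finset.sum_congr rfl fun y _ => mul_div_assoc _ _ _
    simp_rw [e]
    have hi : ∀ x y : ℤ, IntervalIntegrable (fun t : ℝ => a x * b y *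
        ((1 - Real.cos (t * ((x - y : ℤ) : ℝ))) / (1 - Real.cos t))) volume (-Real.pi) Real.pi :=
      fun x y => (intervalIntegrable_fejer _).const_mul _
    rw [intervalIntegral.integral_finsetSum fun x _ =>
      intervalIntegrable_finsetSum _ fun y => hi x y, pairSum, Finset.mul_sum]
    refine Finset.sum_congr rfl fun x _ => ?_
    rw [intervalIntegral.integral_finsetSum fun y _ => hi x y, Finset.mul_sum]
    refine Finset.sum_congr rfl fun y _ => ?_
    rw [intervalIntegral.integral_const_mul, integral_fejer]
    ring
  rw [h3] at h2
  field_simp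
  linarith

end MeanAbsolute

/-! ### Law of large numbers for the mean absolute difference of two quenched walks. -/

section MeanAbsoluteWalk

variable {Ω : Type*} [MeasurableSpace Ω] {μ : Measure Ω} [IsProbabilityMeasure μ] {M : ℕ}
  {w : Ω → ℤ → ℝ}

lemma one_sub_re_nonneg {z z' : ℂ} (hz : ‖z‖ ≤ 1) (hz' : ‖z'‖ ≤ 1) :
    0 ≤ 1 - (z * (starRingEnd ℂ) z').re ∧ 1 - (z * (starRingEnd ℂ) z').re ≤ 2 := by
  have h := Complex.abs_re_le_norm (z * (starRingEnd ℂ) z')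
  rw [norm_mul, Complex.norm_conj] at h
  have h2 : ‖z‖ * ‖z'‖ ≤ 1 := mul_le_one₀ hz (norm_nonneg _) hz'
  have h3 := abs_le.1 (h.trans h2)
  constructor <;> linarith [h3.1, h3.2]

/-- The mean absolute difference of two quenched walks is asymptotically deterministic. -/
theorem tendsto_integral_abs_pairSum_sub (hspan : HasSpanOne (avgProb μ w))
    (hell : Elliptic μ M w) {e : ℕ+ → ℕ → ℤ → Ω → ℤ → ℝ} (he : ∀ n, IsEnv μ M w (e n))
    {s s' m R : ℕ+ → ℕ} {k k' : ℕ+ → ℤ} (hs : ∀ n, s n ≤ m n) (hs' : ∀ n, s' n ≤ m n)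
    (hR : ∀ n, |k n| + M * m n ≤ R n) (hR' : ∀ n, |k' n| + M * m n ≤ R n) {T t t' d : ℝ}
    (hT : ∀ n, (m n : ℝ) ≤ T * n)
    (ht : Tendsto (fun n : ℕ+ => ((m n - s n : ℕ) : ℝ) / n) atTop (𝓝 t))
    (ht' : Tendsto (fun n : ℕ+ => ((m n - s' n : ℕ) : ℝ) / n) atTop (𝓝 t'))
    (hd : Tendsto (fun n : ℕ+ => (center (meanDrift μ M w) (s n) (k n) (m n)
      - center (meanDrift μ M w) (s' n) (k' n) (m n)) / √n) atTop (𝓝 d)) :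
    Tendsto (fun n : ℕ+ => ∫ ω, |(√n)⁻¹ * pairSum (R n) (qmass M (e n) (s n) (k n) (m n) ω)
      (qmass M (e n) (s' n) (k' n) (m n) ω) (fun z => |(z : ℝ)|)
      - gaussAbs d (avgVar μ M w * (t + t'))| ∂μ) atTop (𝓝 0) := by
  have hp := (he 1).isProbVec_avg
  have hV := meanDrift_eq (μ := μ) (he 1).base_measurable (he 1).base_isProbVec
  have hσ := avgVar_eq (μ := μ) (he 1).base_measurable (he 1).base_isProbVec
  have hσ0 : 0 ≤ avgVar μ M w := by rw [hσ]; exact vecVar_nonneg hp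
  have ht0 : 0 ≤ t := ge_of_tendsto' ht fun n => by positivity
  have ht0' : 0 ≤ t' := ge_of_tendsto' ht' fun n => by positivity
  set X : ℕ+ → ℝ → Ω → ℂ := fun n τ ω =>
    fourierSum (box (R n)) (qmass M (e n) (s n) (k n) (m n) ω) (τ / √n) with hX
  set X' : ℕ+ → ℝ → Ω → ℂ := fun n τ ω =>
    fourierSum (box (R n)) (qmass M (e n) (s' n) (k' n) (m n) ω) (τ / √n) with hX'
  have hX1 : ∀ n τ ω, ‖X n τ ω‖ ≤ 1 := fun n τ ω =>
    (norm_fourierSum_le ((he n).qmass_nonneg _ _ _ ω) _).trans ((he n).sum_qmass_le_one (hR n) ω)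
  have hX1' : ∀ n τ ω, ‖X' n τ ω‖ ≤ 1 := fun n τ ω =>
    (norm_fourierSum_le ((he n).qmass_nonneg _ _ _ ω) _).trans ((he n).sum_qmass_le_one (hR' n) ω)
  set H : ℕ+ → ℝ → Ω → ℝ := fun n τ ω => 1 - (X n τ ω * (starRingEnd ℂ) (X' n τ ω)).re with hH
  have hHsum : ∀ n τ ω, H n τ ω = pairSum (R n) (qmass M (e n) (s n) (k n) (m n) ω)
      (qmass M (e n) (s' n) (k' n) (m n) ω) (fun z => 1 - Real.cos (τ / √n * z)) := by
    intro n τ ω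
    have hab := pairSum_const (R n) (qmass M (e n) (s n) (k n) (m n) ω)
      (qmass M (e n) (s' n) (k' n) (m n) ω) 1
    rw [(he n).sum_qmass (hs n) (hR n), (he n).sum_qmass (hs' n) (hR' n)] at hab
    simp only [hH, hX, hX', re_fourierSum_mul_conj]
    simp only [pairSum, mul_one_sub, Finset.sum_sub_distrib, mul_one] at hab ⊢
    rw [hab]
    push_cast
    simp
  -- The quadratic bound near `τ = 0`: the second moment of the difference of the walks is of order
  -- `n`, which the factor `1/(2n)` compensates.
  have hHsq : ∀ n τ ω, H n τ ω ≤ τ ^ 2 / (2 * n) * pairSum (R n)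
      (qmass M (e n) (s n) (k n) (m n) ω) (qmass M (e n) (s' n) (k' n) (m n) ω)
      (fun z => (z : ℝ) ^ 2) := by
    intro n τ ω
    rw [hHsum, ← pairSum_const_mul]
    refine pairSum_mono ((he n).qmass_nonneg _ _ _ ω) ((he n).qmass_nonneg _ _ _ ω) fun z => ?_
    refine (one_sub_cos_le _).trans_eq ?_
    have : √(n : ℝ) ^ 2 = n := Real.sq_sqrt (Nat.cast_nonneg _)
    rw [mul_pow, div_pow, this]; ring
  have hSb : ∀ n, BddMeas ‹MeasurableSpace Ω› fun ω => pairSum (R n)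
      (qmass M (e n) (s n) (k n) (m n) ω) (qmass M (e n) (s' n) (k' n) (m n) ω)
      (fun z => (z : ℝ) ^ 2) := fun n =>
    ((he n).bddMeas_pairSum _ _ _ _ _ _ _).mono ((he n).info_le _)
  have hHb : ∀ n τ, BddMeas ‹MeasurableSpace Ω› (H n τ) := by
    intro n τ
    have : H n τ = fun ω => pairSum (R n) (qmass M (e n) (s n) (k n) (m n) ω)
      (qmass M (e n) (s' n) (k' n) (m n) ω) (fun z => 1 - Real.cos (τ / √n * z)) :=
      funext (hHsum n τ)
    rw [this]
    exact ((he n).bddMeas_pairSum _ _ _ _ _ _ _).mono ((he n).info_le _)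
  have hmain := tendsto_integral_abs_fejer_sub (μ := μ) (H := H)
    (B := 3 / 2 * (2 * (T * avgVar μ M w) + (|d| + 1) ^ 2)) (d := d)
    (v := avgVar μ M w * (t + t')) (fun n => ?_)
    (fun n τ ω => (one_sub_re_nonneg (hX1 n τ ω) (hX1' n τ ω)).1)
    (fun n τ ω => (one_sub_re_nonneg (hX1 n τ ω) (hX1' n τ ω)).2) (fun n => ?_) ?_
    (by positivity) (fun τ => ?_)
  · refine hmain.congr fun n => integral_congr_ae (Eventually.of_forall fun ω => ?_)
    simp only
    rw [pairSum_abs_eq_integral ((he n).sum_qmass (hs n) (hR n) ω)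
      ((he n).sum_qmass (hs' n) (hR' n) ω) (sqrt_pnat_pos n)]
  · have : Function.uncurry (H n) = fun p : ℝ × Ω => pairSum (R n)
      (qmass M (e n) (s n) (k n) (m n) p.2)
      (qmass M (e n) (s' n) (k' n) (m n) p.2) (fun z => 1 - Real.cos (p.1 / √n * z)) :=
      funext fun p => hHsum n p.1 p.2
    rw [this]
    refine Finset.measurable_fun_sum _ fun x _ => Finset.measurable_fun_sum _ fun y _ => ?_
    refine ((((he n).measurable_qmass _ _ _ x).comp measurable_snd).mul
      (((he n).measurable_qmass _ _ _ y).comp measurable_snd)).mul ?_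
    fun_prop
  · obtain ⟨b, hb⟩ := (hSb n).bdd
    refine ⟨1 / (2 * n) * b, fun τ ω => (hHsq n τ ω).trans ?_⟩
    have h1 := (le_abs_self _).trans (hb ω)
    have h2 : (0 : ℝ) ≤ τ ^ 2 / (2 * n) := by positivity
    exact (mul_le_mul_of_nonneg_left h1 h2).trans_eq (by ring)
  · filter_upwards [hd.abs.eventually (gt_mem_nhds (lt_add_one |d|))] with n hn τ
    have h1 := (he n).integral_pairSum_sq_le (hs n) (hs' n) (hR n) (hR' n)
    have hn0 : (0 : ℝ) < n := by exact_mod_cast n.pos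
    have hsq : √(n : ℝ) ^ 2 = n := Real.sq_sqrt (Nat.cast_nonneg _)
    set Δ := center (meanDrift μ M w) (s n) (k n) (m n)
      - center (meanDrift μ M w) (s' n) (k' n) (m n)
    have h2 : Δ ^ 2 ≤ (|d| + 1) ^ 2 * n := by
      rw [abs_div, abs_of_pos (sqrt_pnat_pos n), div_lt_iff₀ (sqrt_pnat_pos n)] at hn
      rw [← sq_abs Δ, ← hsq, ← mul_pow]
      exact pow_le_pow_left₀ (abs_nonneg _) hn.le 2
    have h3 : ((m n : ℝ) - s n) * avgVar μ M w ≤ T * n * avgVar μ M w :=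
      mul_le_mul_of_nonneg_right (by linarith [hT n, Nat.cast_nonneg (α := ℝ) (s n)]) hσ0
    have h4 : ((m n : ℝ) - s' n) * avgVar μ M w ≤ T * n * avgVar μ M w :=
      mul_le_mul_of_nonneg_right (by linarith [hT n, Nat.cast_nonneg (α := ℝ) (s' n)]) hσ0
    calc ∫ ω, H n τ ω ∂μ ≤ τ ^ 2 / (2 * n) * ∫ ω, pairSum (R n)
          (qmass M (e n) (s n) (k n) (m n) ω) (qmass M (e n) (s' n) (k' n) (m n) ω)
          (fun z => (z : ℝ) ^ 2) ∂μ := by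
          rw [← integral_const_mul]
          exact integral_mono (hHb n τ).integrable ((hSb n).integrable.const_mul _) (hHsq n τ)
      _ ≤ τ ^ 2 / (2 * n) * (3 * (T * n * avgVar μ M w + T * n * avgVar μ M w
          + (|d| + 1) ^ 2 * n)) := by
          gcongr
          linarith
      _ = _ := by field_simp; ring
  · obtain ⟨C, hC0, hC⟩ := IsEnv.exists_sum_selfOverlap_le μ M w hspan hell
    set mc : ℕ+ → ℂ := fun n => meanChar M (avgProb μ w) (k n) (m n - s n) (τ / √n)
    set mc' : ℕ+ → ℂ := fun n => meanChar M (avgProb μ w) (k' n) (m n - s' n) (τ / √n)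
    have hre := tendsto_re_meanChar_mul_conj hp (k := k) (k' := k') (d := d) ht ht' (by
      refine hd.congr fun n => ?_
      simp only [center, hV]
      rw [Nat.cast_sub (hs n), Nat.cast_sub (hs' n)]) τ
    rw [← hσ] at hre
    have hT0 : 0 ≤ T := by
      have := hT 1
      simp only [PNat.one_coe, Nat.cast_one, mul_one] at this
      exact (Nat.cast_nonneg _).trans this
    -- At frequency `τ/√n` the squared error is of order `τ²/n` times `O(√n)` expected meetings.
    have hconc : ∀ (n : ℕ+) (s : ℕ) (k : ℤ), s ≤ m n → |k| + M * m n ≤ R n →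
        ∫ ω, ‖fourierSum (box (R n)) (qmass M (e n) s k (m n) ω) (τ / √n)
          - meanChar M (avgProb μ w) k (m n - s) (τ / √n)‖ ∂μ
          ≤ √(8 * (M * τ) ^ 2 * (C * √T) * (√n)⁻¹) := by
      intro n s k hs hR
      have hn0 := sqrt_pnat_pos n
      have hbdd : BddMeas ‹MeasurableSpace Ω› fun ω =>
          ‖fourierSum (box (R n)) (qmass M (e n) s k (m n) ω) (τ / √n)
          - meanChar M (avgProb μ w) k (m n - s) (τ / √n)‖ := by
        refine ⟨?_, 1 + 1, fun ω => ?_⟩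
        · refine Measurable.norm (Measurable.sub ?_ measurable_const)
          exact Finset.measurable_fun_sum _ fun x _ =>
            (Complex.measurable_ofReal.comp ((he n).measurable_qmass _ _ _ x)).mul_const _
        · rw [abs_norm]
          exact (norm_sub_le _ _).trans (add_le_add ((norm_fourierSum_le
            ((he n).qmass_nonneg _ _ _ ω) _).trans ((he n).sum_qmass_le_one hR ω))
            (norm_meanChar_le hp _ _ _))
      refine (integral_le_sqrt hbdd).trans (Real.sqrt_le_sqrt ?_)
      refine ((he n).integral_norm_fourierSum_sub_sq_le hR hs _).trans ?_
      have h1 : √(m n : ℝ) ≤ √T * √n := by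
        rw [← Real.sqrt_mul hT0]; exact Real.sqrt_le_sqrt (hT n)
      calc 8 * (M * (τ / √n)) ^ 2 * ∑ l ∈ Finset.Ico s (m n), selfOverlap μ M (e n) s k (R n) l
          ≤ 8 * (M * (τ / √n)) ^ 2 * (C * (√T * √n)) := by
            refine mul_le_mul_of_nonneg_left ((hC _ (he n) _ _ _ _ hs hR).trans ?_) (by positivity)
            exact mul_le_mul_of_nonneg_left h1 hC0
        _ = _ := by field_simp
    have hsqrt : Tendsto (fun n : ℕ+ => √(8 * (M * τ) ^ 2 * (C * √T) * (√n)⁻¹)) atTop (𝓝 0) := by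
      have h := (tendsto_inv_atTop_zero.comp tendsto_sqrt_pnat).const_mul
        (8 * (M * τ) ^ 2 * (C * √T))
      rw [mul_zero] at h
      have := (Real.continuous_sqrt.tendsto _).comp h
      rwa [Real.sqrt_zero] at this
    refine squeeze_zero (g := fun n : ℕ+ => √(8 * (M * τ) ^ 2 * (C * √T) * (√n)⁻¹)
      + √(8 * (M * τ) ^ 2 * (C * √T) * (√n)⁻¹)
      + |(mc n * (starRingEnd ℂ) (mc' n)).re
        - Real.cos (τ * d) * Real.exp (-(avgVar μ M w * (t + t') * τ ^ 2 / 2))|)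
      (fun n => integral_nonneg fun ω => abs_nonneg _) (fun n => ?_) ?_
    · have hbX : ∀ (s : ℕ) (k : ℤ) (c : ℂ), Integrable (fun ω =>
          ‖fourierSum (box (R n)) (qmass M (e n) s k (m n) ω) (τ / √n) - c‖) μ := by
        intro s k c
        refine (Integrable.sub ?_ (integrable_const c)).norm
        exact integrable_finsetSum _ fun x _ =>
          ((he n).integrable_qmass _ _ _ x).ofReal.mul_const _
      refine le_trans (integral_mono (((hHb n τ).sub (BddMeas.const _)).integrable.abs)
        (((hbX (s n) (k n) (mc n)).add (hbX (s' n) (k' n) (mc' n))).add (integrable_const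
          |(mc n * (starRingEnd ℂ) (mc' n)).re
        - Real.cos (τ * d) * Real.exp (-(avgVar μ M w * (t + t') * τ ^ 2 / 2))|))
        fun ω => ?_) ?_
      · simp only [hH, Pi.add_apply]
        -- The quenched factors are replaced by annealed ones one at a time; the remaining
        -- deterministic term is handled by the annealed limit.
        have e1 : 1 - (X n τ ω * (starRingEnd ℂ) (X' n τ ω)).re
            - (1 - Real.cos (τ * d) * Real.exp (-(avgVar μ M w * (t + t') * τ ^ 2 / 2)))
            = -((X n τ ω - mc n) * (starRingEnd ℂ) (X' n τ ω)
              + mc n * (starRingEnd ℂ) (X' n τ ω - mc' n)).re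
              - ((mc n * (starRingEnd ℂ) (mc' n)).re
              - Real.cos (τ * d) * Real.exp (-(avgVar μ M w * (t + t') * τ ^ 2 / 2))) := by
          rw [show (X n τ ω - mc n) * (starRingEnd ℂ) (X' n τ ω)
              + mc n * (starRingEnd ℂ) (X' n τ ω - mc' n)
              = X n τ ω * (starRingEnd ℂ) (X' n τ ω) - mc n * (starRingEnd ℂ) (mc' n) by
            rw [map_sub]; ring, Complex.sub_re]
          ring
        rw [e1]
        refine (abs_sub _ _).trans (add_le_add ?_ le_rfl)
        rw [abs_neg]
        refine (Complex.abs_re_le_norm _).trans ((norm_add_le _ _).trans (add_le_add ?_ ?_))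
        · rw [norm_mul, Complex.norm_conj]
          exact mul_le_of_le_one_right (norm_nonneg _) (hX1' n τ ω)
        · rw [norm_mul, Complex.norm_conj]
          exact mul_le_of_le_one_left (norm_nonneg _) (norm_meanChar_le hp _ _ _)
      · rw [integral_add' ((hbX _ _ _).add (hbX _ _ _)) (integrable_const _),
          integral_add' (hbX _ _ _) (hbX _ _ _)]
        simp only [integral_const, probReal_univ, one_smul]
        exact add_le_add (add_le_add (hconc n _ _ (hs n) (hR n)) (hconc n _ _ (hs' n) (hR' n)))
          le_rfl
    · have h5 := (hre.sub_const (Real.cos (τ * d)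
        * Real.exp (-(avgVar μ M w * (t + t') * τ ^ 2 / 2)))).abs
      rw [sub_self, abs_zero] at h5
      simpa using (hsqrt.add hsqrt).add h5

end MeanAbsoluteWalk
-- The number of meetings of two walks.
section QuadraticVariation

variable {Ω : Type*} [MeasurableSpace Ω] {μ : Measure Ω} [IsProbabilityMeasure μ] {M : ℕ}
  {w : Ω → ℤ → ℝ}

lemma abs_pairSum_le {R : ℕ} {a b : ℤ → ℝ} (ha : ∀ x, 0 ≤ a x) (hb : ∀ x, 0 ≤ b x)
    (ha1 : ∑ x ∈ box R, a x = 1) (hb1 : ∑ x ∈ box R, b x = 1) {F : ℤ → ℝ} {C : ℝ}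
    (hF : ∀ z, |F z| ≤ C) : |pairSum R a b F| ≤ C := by
  have h1 := pairSum_mono (R := R) ha hb (F := F) (G := fun _ => C) fun z => (abs_le.1 (hF z)).2
  have h2 := pairSum_mono (R := R) ha hb (F := fun _ => -C) (G := F) fun z => (abs_le.1 (hF z)).1
  rw [pairSum_const, ha1, hb1, one_mul, one_mul] at h1 h2
  exact abs_le.2 ⟨h2, h1⟩

lemma tendsto_inv_sqrt_pnat : Tendsto (fun n : ℕ+ => (√(n : ℝ))⁻¹) atTop (𝓝 0) :=
  tendsto_inv_atTop_zero.comp tendsto_sqrt_pnat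

/-- By the compensated potential, `β` times the number of meetings is the gain of the quenched mean
potential from the later start to time `N`, up to a martingale of `L²` size `n^{1/4}`. The potential
is `|z|/(2σ_a²)` up to a bounded error, and both mean absolute differences obey the law of large
numbers. -/
theorem tendsto_integral_abs_overlap_sub (hspan : HasSpanOne (avgProb μ w))
    (hell : Elliptic μ M w) {e : ℕ+ → ℕ → ℤ → Ω → ℤ → ℝ} (he : ∀ n, IsEnv μ M w (e n))
    {s s' N R : ℕ+ → ℕ} {k k' : ℕ+ → ℤ} (hs : ∀ n, s n ≤ N n) (hs' : ∀ n, s' n ≤ N n)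
    (hR : ∀ n, |k n| + M * N n ≤ R n) (hR' : ∀ n, |k' n| + M * N n ≤ R n) {T : ℝ}
    (hT : ∀ n, (N n : ℝ) ≤ T * n) (a b : ℝ≥0 × ℝ)
    (ha : Tendsto (fun n : ℕ+ => ((N n - s n : ℕ) : ℝ) / n) atTop (𝓝 a.1))
    (hb : Tendsto (fun n : ℕ+ => ((N n - s' n : ℕ) : ℝ) / n) atTop (𝓝 b.1))
    (hd : Tendsto (fun n : ℕ+ => (center (meanDrift μ M w) (s n) (k n) (N n)
      - center (meanDrift μ M w) (s' n) (k' n) (N n)) / √n) atTop (𝓝 (a.2 - b.2))) :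
    Tendsto (fun n : ℕ+ => ∫ ω, |driftVar μ M w * ((√n)⁻¹ * ∑ l ∈ Finset.Ico (max (s n) (s' n)) (N n),
      overlap (R n) (qmass M (e n) (s n) (k n) l ω) (qmass M (e n) (s' n) (k' n) l ω))
      - GammaQ (kappa μ M w) (avgVar μ M w) a b| ∂μ) atTop (𝓝 0) := by
  have hp := (he 1).isProbVec_avg
  have hβ := beta_pos (he 1).base_measurable (he 1).base_isProbVec hspan hell
  have hσ : 0 < avgVar μ M w := by
    rw [avgVar_eq (he 1).base_measurable (he 1).base_isProbVec]
    exact vecVar_pos hp hspan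
  have hD : 0 ≤ driftVar μ M w := integral_nonneg fun ω => sq_nonneg _
  obtain ⟨C, hC0, hC⟩ := IsEnv.exists_sum_selfOverlap_le μ M w hspan hell
  obtain ⟨C₁, hC₁0, hC₁⟩ := exists_abs_potential_sub_le hp hspan
  rw [← avgVar_eq (he 1).base_measurable (he 1).base_isProbVec] at hC₁
  obtain ⟨L, hL0, hL⟩ := exists_abs_potential_increment_le hp hspan (2 * M)
  set σ := avgVar μ M w
  set m₀ : ℕ+ → ℕ := fun n => max (s n) (s' n) with hm₀
  have hm₀N : ∀ n, m₀ n ≤ N n := fun n => max_le (hs n) (hs' n)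
  have hT0 : 0 ≤ T := by
    have := hT 1
    simp only [PNat.one_coe, Nat.cast_one, mul_one] at this
    exact (Nat.cast_nonneg _).trans this
  have hcast : ∀ {x y : ℕ}, x ≤ y → ((y - x : ℕ) : ℝ) = y - x := fun h => Nat.cast_sub h
  have hm1 : Tendsto (fun n : ℕ+ => ((m₀ n - s n : ℕ) : ℝ) / n) atTop
      (𝓝 (a.1 - min (a.1 : ℝ) b.1)) := by
    refine (ha.sub (ha.min hb)).congr fun n => ?_
    rw [min_div_div_right (Nat.cast_nonneg _), ← sub_div, hcast (hs n), hcast (hs' n),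
      hcast (le_max_left _ _), Nat.cast_max, min_sub_sub_left]
    congr 1; ring
  have hm2 : Tendsto (fun n : ℕ+ => ((m₀ n - s' n : ℕ) : ℝ) / n) atTop
      (𝓝 (b.1 - min (a.1 : ℝ) b.1)) := by
    refine (hb.sub (ha.min hb)).congr fun n => ?_
    rw [min_div_div_right (Nat.cast_nonneg _), ← sub_div, hcast (hs n), hcast (hs' n),
      hcast (le_max_right _ _), Nat.cast_max, min_sub_sub_left]
    congr 1; ring
  have hMN : ∀ n, (M : ℤ) * m₀ n ≤ M * N n := fun n => by gcongr; exact hm₀N n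
  have hRm : ∀ n, |k n| + M * m₀ n ≤ R n := fun n => (add_le_add le_rfl (hMN n)).trans (hR n)
  have hRm' : ∀ n, |k' n| + M * m₀ n ≤ R n := fun n => (add_le_add le_rfl (hMN n)).trans (hR' n)
  have hend := tendsto_integral_abs_pairSum_sub hspan hell he hs hs' hR hR' hT ha hb hd
  have hstart := tendsto_integral_abs_pairSum_sub hspan hell he (s := s) (s' := s') (m := m₀)
    (k := k) (k' := k') (R := R) (fun n => le_max_left _ _)
    (fun n => le_max_right _ _) hRm hRm' (T := T) (fun n => le_trans (by
      exact_mod_cast hm₀N n) (hT n)) hm1 hm2 (d := a.2 - b.2) (by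
        refine hd.congr fun n => ?_
        simp only [center]
        congr 1; ring)
  -- At the later of the two starting times only the earlier walk has moved, for a rescaled duration
  -- `|t - s|`. This gives the lower limit of integration in `Γ_q`.
  have habs : (a.1 : ℝ) - min (a.1 : ℝ) b.1 + (b.1 - min (a.1 : ℝ) b.1) = |(b.1 : ℝ) - a.1| := by
    rcases le_total (a.1 : ℝ) b.1 with h | h
    · rw [min_eq_left h, abs_of_nonneg (sub_nonneg.2 h)]; ring
    · rw [min_eq_right h, abs_of_nonpos (sub_nonpos.2 h)]; ring
  rw [habs] at hstart
  rw [add_comm] at hend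
  have hG := GammaQ_eq (kappa μ M w) hσ.le a b
  set g₁ := gaussAbs (a.2 - b.2) (σ * ((b.1 : ℝ) + a.1))
  set g₀ := gaussAbs (a.2 - b.2) (σ * |(b.1 : ℝ) - a.1|)
  set P : ℕ+ → ℕ → Ω → ℝ := fun n m ω => pairSum (R n) (qmass M (e n) (s n) (k n) m ω)
    (qmass M (e n) (s' n) (k' n) m ω) (fun z => |(z : ℝ)|)
  set Y : ℕ+ → Ω → ℝ := fun n =>
    IsEnv.pairMart μ w M (e n) (s n) (s' n) (k n) (k' n) (R n) (m₀ n) (N n)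
  have hPb : ∀ n m, BddMeas ‹MeasurableSpace Ω› (P n m) := fun n m =>
    ((he n).bddMeas_pairSum _ _ _ _ _ _ _).mono ((he n).info_le _)
  have hYb : ∀ n, BddMeas ‹MeasurableSpace Ω› (Y n) := fun n =>
    ((he n).bddMeas_pairMart _ _ _ _ _ (hm₀N n)).mono ((he n).info_le _)
  have hW : ∀ n m ω, s n ≤ m → s' n ≤ m → m ≤ N n →
      |pairSum (R n) (qmass M (e n) (s n) (k n) m ω) (qmass M (e n) (s' n) (k' n) m ω)
        (potential M (avgProb μ w)) - 1 / (2 * σ) * P n m ω| ≤ C₁ := by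
    intro n m ω h1 h2 h3
    have hM : (M : ℤ) * m ≤ M * N n := by gcongr
    have h4 := abs_pairSum_le (R := R n) ((he n).qmass_nonneg (s n) (k n) m ω)
      ((he n).qmass_nonneg (s' n) (k' n) m ω)
      ((he n).sum_qmass h1 ((add_le_add le_rfl hM).trans (hR n)) ω)
      ((he n).sum_qmass h2 ((add_le_add le_rfl hM).trans (hR' n)) ω) hC₁
    have e1 : ∀ z : ℤ, potential M (avgProb μ w) z - |(z : ℝ)| / (2 * σ)
        = potential M (avgProb μ w) z + (-(1 / (2 * σ))) * |(z : ℝ)| := fun z => by ring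
    simp_rw [e1] at h4
    rw [pairSum_add, pairSum_const_mul] at h4
    refine le_of_eq_of_le ?_ h4
    congr 1; ring
  -- Cauchy–Schwarz and the `O(√n)` bound on self-overlaps: the mean absolute value is of order
  -- `n^{1/4}`.
  have hYlim : ∀ n, ∫ ω, |Y n ω| ∂μ ≤ √(8 * L ^ 2 * (2 * (C * √T)) * √n) := by
    intro n
    have hYa : BddMeas ‹MeasurableSpace Ω› fun ω => |Y n ω| := by
      obtain ⟨B, hB⟩ := (hYb n).bdd
      exact ⟨continuous_abs.measurable.comp (hYb n).meas, B, fun ω => by rw [abs_abs]; exact hB ω⟩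
    refine (integral_le_sqrt hYa).trans (Real.sqrt_le_sqrt ?_)
    simp only [sq_abs]
    refine ((he n).integral_pairMart_sq_le hspan hL (le_max_left _ _) (le_max_right _ _) (hm₀N n)
      (hR n) (hR' n)).trans ?_
    have h1 : √(N n : ℝ) ≤ √T * √n := by
      rw [← Real.sqrt_mul hT0]; exact Real.sqrt_le_sqrt (hT n)
    have h2 : ∀ (s : ℕ) (k : ℤ), s ≤ m₀ n → |k| + M * N n ≤ R n →
        ∑ m ∈ Finset.Ico (m₀ n) (N n), selfOverlap μ M (e n) s k (R n) m ≤ C * (√T * √n) := by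
      intro s k hs hR
      refine le_trans ?_ ((hC _ (he n) s _ _ _ (hs.trans (hm₀N n)) hR).trans
        (mul_le_mul_of_nonneg_left h1 hC0))
      refine Finset.sum_le_sum_of_subset_of_nonneg (Finset.Ico_subset_Ico hs le_rfl) fun i _ _ =>
        integral_nonneg fun ω => Finset.sum_nonneg fun x _ => sq_nonneg _
    rw [Finset.sum_add_distrib]
    have h3 := h2 (s n) (k n) (le_max_left _ _) (hR n)
    have h4 := h2 (s' n) (k' n) (le_max_right _ _) (hR' n)
    calc _ ≤ 8 * L ^ 2 * (C * (√T * √n) + C * (√T * √n)) := by gcongr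
      _ = _ := by ring
  -- `σ_D²` comes from the drift noise, `1/β` from the gain per meeting and `1/(2σ_a²)` from the
  -- slope of the potential.
  have hκ : kappa μ M w / 2 = driftVar μ M w / beta μ M w * (1 / (2 * σ)) := by
    change driftVar μ M w / (beta μ M w * σ) / 2 = _
    field_simp
  have hkey : ∀ (n : ℕ+) ω, |driftVar μ M w * ((√n)⁻¹ * ∑ l ∈ Finset.Ico (m₀ n) (N n),
      overlap (R n) (qmass M (e n) (s n) (k n) l ω) (qmass M (e n) (s' n) (k' n) l ω))
      - GammaQ (kappa μ M w) σ a b| ≤ driftVar μ M w / beta μ M w *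
        ((√n)⁻¹ * |Y n ω| + 1 / (2 * σ) * |(√n)⁻¹ * P n (N n) ω - g₁|
          + 1 / (2 * σ) * |(√n)⁻¹ * P n (m₀ n) ω - g₀| + (√n)⁻¹ * (2 * C₁)) := by
    intro n ω
    have hn := sqrt_pnat_pos n
    set O := ∑ l ∈ Finset.Ico (m₀ n) (N n),
      overlap (R n) (qmass M (e n) (s n) (k n) l ω) (qmass M (e n) (s' n) (k' n) l ω) with hO
    set W₁ := pairSum (R n) (qmass M (e n) (s n) (k n) (N n) ω)
      (qmass M (e n) (s' n) (k' n) (N n) ω) (potential M (avgProb μ w))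
    set W₀ := pairSum (R n) (qmass M (e n) (s n) (k n) (m₀ n) ω)
      (qmass M (e n) (s' n) (k' n) (m₀ n) ω) (potential M (avgProb μ w))
    have hY : Y n ω = W₁ - W₀ - beta μ M w * O := rfl
    have e1 : driftVar μ M w * ((√n)⁻¹ * O) - GammaQ (kappa μ M w) σ a b
        = driftVar μ M w / beta μ M w * (-((√n)⁻¹ * Y n ω)
          + 1 / (2 * σ) * ((√n)⁻¹ * P n (N n) ω - g₁)
          - 1 / (2 * σ) * ((√n)⁻¹ * P n (m₀ n) ω - g₀)
          + (√n)⁻¹ * ((W₁ - 1 / (2 * σ) * P n (N n) ω)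
            - (W₀ - 1 / (2 * σ) * P n (m₀ n) ω))) := by
      rw [hG, hκ, hY]
      field_simp
      ring
    have h1 := hW n (N n) ω (hs n) (hs' n) le_rfl
    have h2 := hW n (m₀ n) ω (le_max_left _ _) (le_max_right _ _) (hm₀N n)
    rw [e1, abs_mul, abs_of_nonneg (div_nonneg hD hβ.le)]
    refine mul_le_mul_of_nonneg_left ?_ (div_nonneg hD hβ.le)
    refine (abs_add_le _ _).trans (add_le_add ((abs_sub _ _).trans
      (add_le_add ((abs_add_le _ _).trans (add_le_add ?_ ?_)) ?_)) ?_)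
    · rw [abs_neg, abs_mul, abs_of_pos (inv_pos.2 hn)]
    · rw [abs_mul, abs_of_pos (by positivity)]
    · rw [abs_mul, abs_of_pos (by positivity)]
    · rw [abs_mul, abs_of_pos (inv_pos.2 hn)]
      refine mul_le_mul_of_nonneg_left ((abs_sub _ _).trans ?_) (inv_pos.2 hn).le
      linarith
  have hOb : ∀ n : ℕ+, BddMeas ‹MeasurableSpace Ω› fun ω => driftVar μ M w * ((√n)⁻¹ *
      ∑ l ∈ Finset.Ico (m₀ n) (N n), overlap (R n) (qmass M (e n) (s n) (k n) l ω)
        (qmass M (e n) (s' n) (k' n) l ω)) - GammaQ (kappa μ M w) σ a b := fun n =>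
    (((BddMeas.sum _ fun l => ((he n).bddMeas_overlap _ _ _ _ l _).mono
      ((he n).info_le _)).const_mul _).const_mul _).sub (BddMeas.const _)
  have hP1 : ∀ (n : ℕ+) m (g : ℝ), Integrable (fun ω => |(√n)⁻¹ * P n m ω - g|) μ := fun n m g =>
    (((hPb n m).const_mul _).sub (BddMeas.const g)).integrable.abs
  refine squeeze_zero (g := fun n : ℕ+ => driftVar μ M w / beta μ M w *
    ((√n)⁻¹ * √(8 * L ^ 2 * (2 * (C * √T)) * √n)
      + 1 / (2 * σ) * ∫ ω, |(√n)⁻¹ * P n (N n) ω - g₁| ∂μ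
      + 1 / (2 * σ) * ∫ ω, |(√n)⁻¹ * P n (m₀ n) ω - g₀| ∂μ + (√n)⁻¹ * (2 * C₁)))
    (fun n => integral_nonneg fun ω => abs_nonneg _) (fun n => ?_) ?_
  · have i1 : Integrable (fun ω => (√n)⁻¹ * |Y n ω|) μ := ((hYb n).integrable.abs).const_mul _
    have i2 : Integrable (fun ω => (√n)⁻¹ * |Y n ω|
        + 1 / (2 * σ) * |(√n)⁻¹ * P n (N n) ω - g₁|) μ := i1.add ((hP1 n _ _).const_mul _)
    have i3 : Integrable (fun ω => (√n)⁻¹ * |Y n ω|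
        + 1 / (2 * σ) * |(√n)⁻¹ * P n (N n) ω - g₁|
        + 1 / (2 * σ) * |(√n)⁻¹ * P n (m₀ n) ω - g₀|) μ := i2.add ((hP1 n _ _).const_mul _)
    refine (integral_mono (hOb n).integrable.abs
      ((i3.add (integrable_const ((√n)⁻¹ * (2 * C₁)))).const_mul _) (hkey n)).trans ?_
    rw [integral_const_mul, integral_add' i3 (integrable_const _), integral_add i2
      ((hP1 n _ _).const_mul _), integral_add i1 ((hP1 n _ _).const_mul _), integral_const_mul,
      integral_const_mul, integral_const_mul]
    simp only [integral_const, probReal_univ, one_smul]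
    refine mul_le_mul_of_nonneg_left ?_ (div_nonneg hD hβ.le)
    have := mul_le_mul_of_nonneg_left (hYlim n) (inv_pos.2 (sqrt_pnat_pos n)).le
    linarith
  · have h1 : Tendsto (fun n : ℕ+ => (√n)⁻¹ * √(8 * L ^ 2 * (2 * (C * √T)) * √n)) atTop (𝓝 0) := by
      have e1 : ∀ n : ℕ+, (√(n : ℝ))⁻¹ * √(8 * L ^ 2 * (2 * (C * √T)) * √n)
          = √(8 * L ^ 2 * (2 * (C * √T)) * (√n)⁻¹) := by
        intro n
        have hn := sqrt_pnat_pos n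
        have hK : 0 ≤ 8 * L ^ 2 * (2 * (C * √T)) := by positivity
        rw [Real.sqrt_mul hK, Real.sqrt_mul hK, Real.sqrt_inv]
        have h4 : √√(n : ℝ) * √√(n : ℝ) = √n := Real.mul_self_sqrt hn.le
        have h5 : 0 < √√(n : ℝ) := Real.sqrt_pos.2 hn
        generalize √√(n : ℝ) = y at h4 h5 ⊢
        rw [← h4]
        field_simp
      simp_rw [e1]
      have h := tendsto_inv_sqrt_pnat.const_mul (8 * L ^ 2 * (2 * (C * √T)))
      rw [mul_zero] at h
      have := (Real.continuous_sqrt.tendsto _).comp h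
      rwa [Real.sqrt_zero] at this
    have h2 := (((h1.add (hend.const_mul (1 / (2 * σ)))).add (hstart.const_mul (1 / (2 * σ)))).add
      (tendsto_inv_sqrt_pnat.mul_const (2 * C₁))).const_mul (driftVar μ M w / beta μ M w)
    simpa using h2

end QuadraticVariation
-- A martingale central limit theorem with explicit error.
section MartingaleCLT

variable {Ω : Type*} [MeasurableSpace Ω] {μ : Measure Ω} [IsProbabilityMeasure μ] {M : ℕ}
  {w : Ω → ℤ → ℝ} {e : ℕ → ℤ → Ω → ℤ → ℝ}

/-- The Gaussian damping factor `e^{-b⁺/2}`. -/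
noncomputable def damp (b : ℝ) : ℝ := Real.exp (-(max b 0 / 2))

lemma damp_nonneg (b : ℝ) : 0 ≤ damp b := (Real.exp_pos _).le

lemma damp_le_one (b : ℝ) : damp b ≤ 1 := by
  rw [damp, Real.exp_le_one_iff]
  have := le_max_right b 0
  linarith

lemma abs_damp_le_one (b : ℝ) : |damp b| ≤ 1 := by
  rw [abs_of_nonneg (damp_nonneg b)]; exact damp_le_one b

lemma continuous_damp : Continuous damp := by
  unfold damp; fun_prop

lemma one_sub_damp_le (b : ℝ) : 1 - damp b ≤ max b 0 / 2 := by
  have := Real.add_one_le_exp (-(max b 0 / 2))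
  unfold damp
  linarith

/-- Here `b` is the variance still to be spent. While `v ≤ b`, the expansion of the exponential
costs `O(v²)`. When `v` exceeds `b` the damping saturates at one, and the loss is charged to the
increase of the overshoot, which telescopes. -/
lemma abs_mul_damp_sub_damp_le {v : ℝ} (hv : 0 ≤ v) (b : ℝ) :
    |(1 - v / 2) * damp (b - v) - damp b| ≤ v ^ 2 + (max (v - b) 0 - max (-b) 0) / 2 := by
  unfold damp
  rcases le_total v b with h | h
  · have h1 := abs_exp_neg_sub_le (v := v / 2) (by linarith)
    rw [max_eq_left (by linarith : (0:ℝ) ≤ b - v), max_eq_left (by linarith : 0 ≤ b),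
      max_eq_right (by linarith : v - b ≤ 0), max_eq_right (by linarith : -b ≤ 0)]
    have e1 : Real.exp (-(b / 2)) = Real.exp (-((b - v) / 2)) * Real.exp (-(v / 2)) := by
      rw [← Real.exp_add]; congr 1; ring
    have e2 : (1 - v / 2) * Real.exp (-((b - v) / 2)) - Real.exp (-(b / 2))
        = -(Real.exp (-((b - v) / 2)) * (Real.exp (-(v / 2)) - (1 - v / 2))) := by
      rw [e1]; ring
    rw [e2, abs_neg, abs_mul, abs_of_pos (Real.exp_pos _)]
    have h2 : Real.exp (-((b - v) / 2)) ≤ 1 := Real.exp_le_one_iff.2 (by linarith)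
    calc _ ≤ 1 * (v / 2) ^ 2 := by gcongr
      _ ≤ _ := by nlinarith [sq_nonneg v]
  · rw [max_eq_right (by linarith : b - v ≤ 0), max_eq_left (by linarith : 0 ≤ v - b)]
    simp only [zero_div, neg_zero, Real.exp_zero, mul_one]
    rcases le_total 0 b with hb | hb
    · have h1 := abs_exp_neg_sub_le (v := b / 2) (by linarith)
      rw [max_eq_left hb, max_eq_right (by linarith : -b ≤ 0)]
      rw [abs_le] at h1 ⊢
      constructor <;> nlinarith
    · rw [max_eq_right hb, max_eq_left (by linarith : 0 ≤ -b)]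
      simp only [zero_div, neg_zero, Real.exp_zero]
      rw [abs_le]
      constructor <;> nlinarith [sq_nonneg v]

/-- Splitting into real and imaginary parts lets the orthogonality statements, made for real test
functions, be applied. -/
lemma integral_cexp_mul_ofReal {S X : Ω → ℝ} (hS : Measurable S) (hX : Integrable X μ) :
    ∫ ω, Complex.exp (S ω * Complex.I) * (X ω : ℂ) ∂μ
      = ((∫ ω, Real.cos (S ω) * X ω ∂μ : ℝ) : ℂ)
        + ((∫ ω, Real.sin (S ω) * X ω ∂μ : ℝ) : ℂ) * Complex.I := by
  have h1 : Integrable (fun ω => Real.cos (S ω) * X ω) μ :=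
    hX.bdd_mul (Real.measurable_cos.comp hS).aestronglyMeasurable
      (Eventually.of_forall fun ω => Real.abs_cos_le_one _)
  have h2 : Integrable (fun ω => Real.sin (S ω) * X ω) μ :=
    hX.bdd_mul (Real.measurable_sin.comp hS).aestronglyMeasurable
      (Eventually.of_forall fun ω => Real.abs_sin_le_one _)
  rw [← integral_complex_ofReal, ← integral_complex_ofReal, ← integral_mul_const, ← integral_add h1.ofReal
    (h2.ofReal.mul_const _)]
  refine integral_congr_ae (Eventually.of_forall fun ω => ?_)
  simp only [Complex.exp_mul_I]
  push_cast
  ring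

namespace IsEnv

/-- The fluctuation of the drift at a site. -/
noncomputable abbrev driftNoise (μ : Measure Ω) (M : ℕ) (w : Ω → ℤ → ℝ) (e : ℕ → ℤ → Ω → ℤ → ℝ)
    (m : ℕ) (x : ℤ) (ω : Ω) : ℝ :=
  noise M (avgProb μ w) e m (fun z => (z : ℝ)) x ω

lemma driftNoise_eq (he : IsEnv μ M w e) (m : ℕ) (x : ℤ) (ω : Ω) :
    driftNoise μ M w e m x ω
      = ∑ j ∈ steps M, (j : ℝ) * e m x ω j - meanDrift μ M w := by
  rw [meanDrift_eq he.base_measurable he.base_isProbVec, vecMean, driftNoise, noise]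
  have h1 := (he.isProbVec m x ω).sum_eq_one
  have h2 := he.isProbVec_avg.sum_eq_one
  have e1 : ∀ j : ℤ, (e m x ω j - avgProb μ w j) * ((x + j : ℤ) : ℝ)
      = (j * e m x ω j - j * avgProb μ w j) + (x * e m x ω j - x * avgProb μ w j) := by
    intro j; push_cast; ring
  simp_rw [e1, Finset.sum_add_distrib, Finset.sum_sub_distrib, ← Finset.mul_sum, h1, h2]
  ring

lemma abs_driftNoise_le (he : IsEnv μ M w e) (m : ℕ) (x : ℤ) (ω : Ω) :
    |driftNoise μ M w e m x ω| ≤ 2 * M :=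
  he.abs_noise_le m (F₀ := x) (L := M) (fun j hj => by
    push_cast
    rw [add_sub_cancel_left, ← Int.cast_abs]
    exact_mod_cast mem_box.1 hj) ω

lemma integral_driftNoise_mul (he : IsEnv μ M w e) (m : ℕ) (x y : ℤ) :
    ∫ ω, driftNoise μ M w e m x ω * driftNoise μ M w e m y ω ∂μ
      = if x = y then driftVar μ M w else 0 := by
  split_ifs with h
  · subst h
    simp_rw [he.driftNoise_eq, ← sq]
    exact he.integral_comp (g := fun q : ℤ → ℝ =>
      (∑ j ∈ steps M, (j : ℝ) * q j - meanDrift μ M w) ^ 2)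
      (((Finset.measurable_fun_sum _ fun j _ =>
        (measurable_pi_apply j).const_mul _).sub_const _).pow_const 2) m x
  · rw [he.integral_mul_of_disjoint (S := {(m, x)}) (T := {(m, y)}) (by simpa using h)
      (he.bddMeas_noise _ m _ x).meas (he.bddMeas_noise _ m _ y).meas, he.integral_noise, zero_mul]

/-- The increment of the martingale with predictable weights `f`. -/
noncomputable def incr (μ : Measure Ω) (M : ℕ) (w : Ω → ℤ → ℝ) (e : ℕ → ℤ → Ω → ℤ → ℝ)
    (R : ℕ) (f : ℕ → ℤ → Ω → ℝ) (m : ℕ) (ω : Ω) : ℝ :=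
  ∑ x ∈ box R, f m x ω * driftNoise μ M w e m x ω

/-- The conditional variance of the increment. -/
noncomputable def condVar (μ : Measure Ω) (M : ℕ) (w : Ω → ℤ → ℝ)
    (R : ℕ) (f : ℕ → ℤ → Ω → ℝ) (m : ℕ) (ω : Ω) : ℝ :=
  driftVar μ M w * ∑ x ∈ box R, f m x ω ^ 2

variable {f : ℕ → ℤ → Ω → ℝ} {R : ℕ}

lemma info_singleton_le {m n : ℕ} (h : m < n) (x : ℤ) :
    info e {(m, x)} ≤ info e (before n) :=
  info_mono (Set.singleton_subset_iff.2 h)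

lemma bddMeas_incr (he : IsEnv μ M w e) (hf : ∀ m x, BddMeas (info e (before m)) (f m x))
    {m n : ℕ} (h : m < n) : BddMeas (info e (before n)) (incr μ M w e R f m) :=
  BddMeas.sum _ fun x => ((hf m x).mono (info_mono (before_mono h.le))).mul
    ((he.bddMeas_noise _ m _ x).mono (info_singleton_le h x))

lemma bddMeas_condVar (hf : ∀ m x, BddMeas (info e (before m)) (f m x)) {m n : ℕ} (h : m ≤ n) :
    BddMeas (info e (before n)) (condVar μ M w R f m) :=
  (BddMeas.sum _ fun x => ((hf m x).mono (info_mono (before_mono h))).pow 2).const_mul _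

lemma integral_mul_incr (he : IsEnv μ M w e) (hf : ∀ m x, BddMeas (info e (before m)) (f m x))
    {m : ℕ} {A : Ω → ℝ} (hA : BddMeas (info e (before m)) A) :
    ∫ ω, A ω * incr μ M w e R f m ω ∂μ = 0 := by
  simp only [incr, Finset.mul_sum, ← mul_assoc]
  have hg := fun x => he.bddMeas_noise (avgProb μ w) m (fun z => (z : ℝ)) x
  rw [integral_finsetSum _ fun x _ => (((hA.mul (hf m x)).mono (he.info_le _)).mul
    ((hg x).mono (he.info_le _))).integrable]
  refine Finset.sum_eq_zero fun x _ => ?_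
  rw [he.integral_mul_of_disjoint (f := fun ω => A ω * f m x ω)
    (disjoint_before (by simp)) (hA.mul (hf m x)).meas (hg x).meas, he.integral_noise, mul_zero]

lemma integral_mul_incr_sq (he : IsEnv μ M w e)
    (hf : ∀ m x, BddMeas (info e (before m)) (f m x))
    {m : ℕ} {A : Ω → ℝ} (hA : BddMeas (info e (before m)) A) :
    ∫ ω, A ω * incr μ M w e R f m ω ^ 2 ∂μ = ∫ ω, A ω * condVar μ M w R f m ω ∂μ := by
  have hg := fun x => he.bddMeas_noise (avgProb μ w) m (fun z => (z : ℝ)) x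
  have e1 : ∀ ω, A ω * incr μ M w e R f m ω ^ 2 = ∑ x ∈ box R, ∑ y ∈ box R,
      (A ω * (f m x ω * f m y ω)) *
        (driftNoise μ M w e m x ω * driftNoise μ M w e m y ω) := by
    intro ω
    rw [incr, sq, Finset.sum_mul_sum, Finset.mul_sum]
    refine Finset.sum_congr rfl fun x _ => ?_
    rw [Finset.mul_sum]
    exact Finset.sum_congr rfl fun y _ => by ring
  have e2 : ∀ ω, A ω * condVar μ M w R f m ω
      = ∑ x ∈ box R, (A ω * (f m x ω * f m x ω)) * driftVar μ M w := by
    intro ω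
    rw [condVar, Finset.mul_sum, Finset.mul_sum]
    exact Finset.sum_congr rfl fun x _ => by ring
  have hAf := fun x y => hA.mul ((hf m x).mul (hf m y))
  have hi : ∀ x y, Integrable (fun ω => (A ω * (f m x ω * f m y ω)) *
        (driftNoise μ M w e m x ω * driftNoise μ M w e m y ω)) μ := fun x y =>
    (((hAf x y).mono (he.info_le _)).mul
      (((hg x).mono (he.info_le _)).mul ((hg y).mono (he.info_le _)))).integrable
  simp_rw [e1, e2]
  rw [integral_finsetSum _ fun x _ => integrable_finsetSum _ fun y _ => hi x y,
    integral_finsetSum _ fun x _ => (((hAf x x).mono (he.info_le _)).mul_const _).integrable]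
  refine Finset.sum_congr rfl fun x hx => ?_
  rw [integral_finsetSum _ fun y _ => hi x y, integral_mul_const]
  have e3 : ∀ y, ∫ ω, (A ω * (f m x ω * f m y ω)) *
        (driftNoise μ M w e m x ω * driftNoise μ M w e m y ω) ∂μ
      = if x = y then (∫ ω, A ω * (f m x ω * f m y ω) ∂μ) * driftVar μ M w else 0 := by
    intro y
    rw [he.integral_mul_of_disjoint (f := fun ω => A ω * (f m x ω * f m y ω))
      (g := fun ω => driftNoise μ M w e m x ω * driftNoise μ M w e m y ω)
      (S := before m) (T := {(m, x), (m, y)}) (disjoint_before (by simp)) (hAf x y).meas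
      (((hg x).mono (info_mono (by simp))).mul ((hg y).mono (info_mono (by simp)))).meas,
      he.integral_driftNoise_mul]
    split_ifs <;> simp
  simp_rw [e3]
  rw [Finset.sum_ite_eq, if_pos hx]

lemma abs_incr_le (he : IsEnv μ M w e) {δ : ℝ} (hδ : ∀ m ω, ∑ x ∈ box R, |f m x ω| ≤ δ) (m : ℕ)
    (ω : Ω) : |incr μ M w e R f m ω| ≤ δ * (2 * M) := by
  refine (Finset.abs_sum_le_sum_abs _ _).trans ?_
  refine le_trans (Finset.sum_le_sum fun x _ => ?_)
    ((Finset.sum_mul _ _ _).symm.le.trans (mul_le_mul_of_nonneg_right (hδ m ω) (by positivity)))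
  rw [abs_mul]
  exact mul_le_mul_of_nonneg_left (he.abs_driftNoise_le m x ω) (abs_nonneg _)

lemma driftVar_nonneg : 0 ≤ driftVar μ M w := integral_nonneg fun _ => sq_nonneg _

lemma driftVar_le (he : IsEnv μ M w e) : driftVar μ M w ≤ (2 * M) ^ 2 := by
  have h := he.integral_driftNoise_mul 0 0 0
  rw [if_pos rfl] at h
  have hb := ((he.bddMeas_noise (avgProb μ w) 0 (fun z => (z : ℝ)) 0).mono (he.info_le _))
  rw [← h]
  refine (integral_mono (hb.mul hb).integrable (integrable_const ((2 * (M : ℝ)) ^ 2))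
    fun ω => ?_).trans_eq (by simp)
  have := he.abs_driftNoise_le 0 0 ω
  rw [← sq, ← sq_abs]
  exact pow_le_pow_left₀ (abs_nonneg _) this 2

lemma condVar_nonneg (m : ℕ) (ω : Ω) : 0 ≤ condVar μ M w R f m ω :=
  mul_nonneg driftVar_nonneg (Finset.sum_nonneg fun _ _ => sq_nonneg _)

lemma condVar_le (he : IsEnv μ M w e) {δ : ℝ} (hδ : ∀ m ω, ∑ x ∈ box R, |f m x ω| ≤ δ) (m : ℕ)
    (ω : Ω) : condVar μ M w R f m ω ≤ (δ * (2 * M)) ^ 2 := by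
  rw [mul_pow, mul_comm]
  have h1 : ∑ x ∈ box R, f m x ω ^ 2 ≤ δ ^ 2 := by
    calc ∑ x ∈ box R, f m x ω ^ 2 = ∑ x ∈ box R, |f m x ω| ^ 2 := by simp_rw [sq_abs]
      _ ≤ (∑ x ∈ box R, |f m x ω|) ^ 2 := Finset.sum_sq_le_sq_sum_of_nonneg fun _ _ => abs_nonneg _
      _ ≤ δ ^ 2 := pow_le_pow_left₀ (Finset.sum_nonneg fun _ _ => abs_nonneg _) (hδ m ω) 2
  rw [mul_comm, mul_comm (δ ^ 2)]
  exact mul_le_mul he.driftVar_le h1 (Finset.sum_nonneg fun _ _ => sq_nonneg _) (sq_nonneg _)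

/-- The martingale with predictable weights `f`. -/
noncomputable def mart (μ : Measure Ω) (M : ℕ) (w : Ω → ℤ → ℝ) (e : ℕ → ℤ → Ω → ℤ → ℝ)
    (R : ℕ) (f : ℕ → ℤ → Ω → ℝ) (m : ℕ) (ω : Ω) : ℝ :=
  ∑ l ∈ Finset.range m, incr μ M w e R f l ω

/-- The predictable quadratic variation. -/
noncomputable def quadVar (μ : Measure Ω) (M : ℕ) (w : Ω → ℤ → ℝ)
    (R : ℕ) (f : ℕ → ℤ → Ω → ℝ) (m : ℕ) (ω : Ω) : ℝ :=
  ∑ l ∈ Finset.range m, condVar μ M w R f l ω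

lemma bddMeas_mart (he : IsEnv μ M w e) (hf : ∀ m x, BddMeas (info e (before m)) (f m x))
    (m : ℕ) : BddMeas (info e (before m)) (mart μ M w e R f m) := by
  induction m with
  | zero => simpa [mart] using! BddMeas.const 0
  | succ m ih =>
    unfold mart at ih ⊢
    simp only [Finset.sum_range_succ _ m]
    exact (ih.mono (info_mono (before_mono m.le_succ))).add (he.bddMeas_incr hf m.lt_succ_self)

/-- The shift by one is predictability: the variance of the increment at time `m` is known before
its noise is revealed, so it may enter the damping factor. -/
lemma bddMeas_quadVar (hf : ∀ m x, BddMeas (info e (before m)) (f m x))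
    (m : ℕ) : BddMeas (info e (before m)) (quadVar μ M w R f (m + 1)) := by
  induction m with
  | zero =>
    have h : quadVar μ M w R f (0 + 1) = condVar μ M w R f 0 := funext fun ω => by simp [quadVar]
    rw [h]
    exact bddMeas_condVar (μ := μ) hf le_rfl
  | succ m ih =>
    unfold quadVar at ih ⊢
    simp only [Finset.sum_range_succ _ (m + 1)]
    exact (ih.mono (info_mono (before_mono m.le_succ))).add (bddMeas_condVar (μ := μ) hf le_rfl)

lemma bddMeas_quadVar' (he : IsEnv μ M w e) (hf : ∀ m x, BddMeas (info e (before m)) (f m x))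
    (m : ℕ) : BddMeas ‹MeasurableSpace Ω› (quadVar μ M w R f m) := by
  cases m with
  | zero => simpa [quadVar] using! BddMeas.const 0
  | succ m => exact (bddMeas_quadVar hf m).mono (he.info_le _)

lemma bddMeas_comp {𝓕 : MeasurableSpace Ω} {g : ℝ → ℝ} (hg : Continuous g) {C : ℝ}
    (hgC : ∀ x, |g x| ≤ C) {A : Ω → ℝ} (hA : BddMeas 𝓕 A) : BddMeas 𝓕 fun ω => g (A ω) :=
  ⟨hg.measurable.comp hA.meas, C, fun _ => hgC _⟩

/-- The conditional second order expansion of the characteristic function of an increment. -/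
lemma norm_integral_increment_le (he : IsEnv μ M w e)
    (hf : ∀ m x, BddMeas (info e (before m)) (f m x)) {δ : ℝ}
    (hδ : ∀ m ω, ∑ x ∈ box R, |f m x ω| ≤ δ) {m : ℕ} {S A : Ω → ℝ}
    (hS : BddMeas (info e (before m)) S) (hA : BddMeas (info e (before m)) A)
    (hA1 : ∀ ω, |A ω| ≤ 1) :
    ‖∫ ω, Complex.exp ((S ω + incr μ M w e R f m ω : ℝ) * Complex.I) * (A ω : ℂ) ∂μ
      - ∫ ω, Complex.exp (S ω * Complex.I) * ((A ω * (1 - condVar μ M w R f m ω / 2) : ℝ) : ℂ) ∂μ‖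
      ≤ 4 * (δ * (2 * M)) * ∫ ω, condVar μ M w R f m ω ∂μ := by
  set ξ := incr μ M w e R f m with hξ
  set v := condVar μ M w R f m with hv
  have hSm := he.measurable_of_info hS.meas
  have hA' := hA.mono (he.info_le _)
  have hξ' : BddMeas _ ξ := (he.bddMeas_incr hf (Nat.lt_succ_self m)).mono (he.info_le _)
  have hv' : BddMeas _ v := (bddMeas_condVar (μ := μ) (M := M) (w := w) (R := R) hf
    (le_refl m)).mono (he.info_le _)
  have hcos : BddMeas (info e (before m)) fun ω => Real.cos (S ω) :=
    bddMeas_comp Real.continuous_cos Real.abs_cos_le_one hS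
  have hsin : BddMeas (info e (before m)) fun ω => Real.sin (S ω) :=
    bddMeas_comp Real.continuous_sin Real.abs_sin_le_one hS
  have hmeas : Measurable fun ω => Complex.exp (S ω * Complex.I) := by fun_prop
  have hexp1 : ∀ᵐ ω ∂μ, ‖Complex.exp (S ω * Complex.I)‖ ≤ 1 :=
    Eventually.of_forall fun ω => (Complex.norm_exp_ofReal_mul_I _).le
  have hic : ∀ {X : Ω → ℝ}, Integrable X μ →
      Integrable (fun ω => Complex.exp (S ω * Complex.I) * (X ω : ℂ)) μ := fun hX =>
    hX.ofReal.bdd_mul hmeas.aestronglyMeasurable hexp1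
  -- Given the past, the first-order term vanishes and the squared increment may be replaced by its
  -- conditional variance; the cubic remainder is left.
  have z1 : ∫ ω, Complex.exp (S ω * Complex.I) * ((A ω * ξ ω : ℝ) : ℂ) ∂μ = 0 := by
    rw [integral_cexp_mul_ofReal hSm (hA'.mul hξ').integrable]
    simp_rw [← mul_assoc]
    rw [he.integral_mul_incr hf (hcos.mul hA), he.integral_mul_incr hf (hsin.mul hA)]
    simp
  have z2 : ∫ ω, Complex.exp (S ω * Complex.I) * ((A ω * ξ ω ^ 2 : ℝ) : ℂ) ∂μ
      = ∫ ω, Complex.exp (S ω * Complex.I) * ((A ω * v ω : ℝ) : ℂ) ∂μ := by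
    rw [integral_cexp_mul_ofReal hSm (hA'.mul (hξ'.pow 2)).integrable,
      integral_cexp_mul_ofReal hSm (hA'.mul hv').integrable]
    simp_rw [← mul_assoc]
    rw [he.integral_mul_incr_sq hf (hcos.mul hA), he.integral_mul_incr_sq hf (hsin.mul hA)]
  have iA := hic hA'.integrable
  have iAξ := hic (hA'.mul hξ').integrable
  have iAξ2 := hic (hA'.mul (hξ'.pow 2)).integrable
  have iAv := hic (hA'.mul hv').integrable
  have e1 : ∫ ω, Complex.exp (S ω * Complex.I) * ((A ω * (1 - v ω / 2) : ℝ) : ℂ) ∂μ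
      = ∫ ω, Complex.exp (S ω * Complex.I) * ((A ω : ℂ) * (1 + ξ ω * Complex.I
        - (ξ ω : ℂ) ^ 2 / 2)) ∂μ := by
    have a1 : ∀ ω, Complex.exp (S ω * Complex.I) * ((A ω * (1 - v ω / 2) : ℝ) : ℂ)
        = Complex.exp (S ω * Complex.I) * (A ω : ℂ)
          - Complex.exp (S ω * Complex.I) * ((A ω * v ω : ℝ) : ℂ) * (1 / 2) := by
      intro ω; push_cast; ring
    have a2 : ∀ ω, Complex.exp (S ω * Complex.I) * ((A ω : ℂ) * (1 + ξ ω * Complex.I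
        - (ξ ω : ℂ) ^ 2 / 2)) = Complex.exp (S ω * Complex.I) * (A ω : ℂ)
          + Complex.exp (S ω * Complex.I) * ((A ω * ξ ω : ℝ) : ℂ) * Complex.I
          - Complex.exp (S ω * Complex.I) * ((A ω * ξ ω ^ 2 : ℝ) : ℂ) * (1 / 2) := by
      intro ω; push_cast; ring
    simp_rw [a1, a2]
    have i1 : Integrable (fun ω => Complex.exp (S ω * Complex.I) * (A ω : ℂ)
          + Complex.exp (S ω * Complex.I) * ((A ω * ξ ω : ℝ) : ℂ) * Complex.I) μ :=
      iA.add (iAξ.mul_const _)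
    rw [integral_sub iA (iAv.mul_const _), integral_sub i1
      (iAξ2.mul_const _), integral_add iA (iAξ.mul_const _), integral_mul_const,
      integral_mul_const, integral_mul_const, z1, z2]
    ring
  have iE : Integrable (fun ω => Complex.exp ((S ω + ξ ω : ℝ) * Complex.I) * (A ω : ℂ)) μ := by
    refine hA'.integrable.ofReal.bdd_mul (c := 1) ?_ (Eventually.of_forall fun ω =>
      (Complex.norm_exp_ofReal_mul_I _).le)
    have := hξ'.meas
    exact (by fun_prop : Measurable fun ω =>
      Complex.exp ((S ω + ξ ω : ℝ) * Complex.I)).aestronglyMeasurable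
  have iT : Integrable (fun ω => Complex.exp (S ω * Complex.I) * ((A ω : ℂ) * (1 + ξ ω * Complex.I
        - (ξ ω : ℂ) ^ 2 / 2))) μ := by
    refine ((iA.add (iAξ.mul_const Complex.I)).sub (iAξ2.mul_const (1 / 2))).congr
      (Eventually.of_forall fun ω => ?_)
    simp only [Pi.add_apply, Pi.sub_apply]
    push_cast; ring
  have hc : 0 ≤ δ * (2 * M) := by
    obtain ⟨ω⟩ := nonempty_of_isProbabilityMeasure μ
    exact (abs_nonneg _).trans (he.abs_incr_le hδ m ω)
  have hvi : ∫ ω, ξ ω ^ 2 ∂μ = ∫ ω, v ω ∂μ := by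
    simpa using he.integral_mul_incr_sq (R := R) (m := m) hf (BddMeas.const 1)
  rw [e1, ← integral_sub iE iT]
  refine (norm_integral_le_integral_norm _).trans ?_
  rw [← hvi, ← integral_const_mul]
  refine integral_mono (iE.sub iT).norm ((hξ'.pow 2).integrable.const_mul _) fun ω => ?_
  have e2 : Complex.exp ((S ω + ξ ω : ℝ) * Complex.I) * (A ω : ℂ)
      - Complex.exp (S ω * Complex.I) * ((A ω : ℂ) * (1 + ξ ω * Complex.I - (ξ ω : ℂ) ^ 2 / 2))
      = Complex.exp (S ω * Complex.I) * ((A ω : ℂ) *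
        (Complex.exp (ξ ω * Complex.I) - (1 + ξ ω * Complex.I - (ξ ω : ℂ) ^ 2 / 2))) := by
    push_cast
    rw [add_mul, Complex.exp_add]; ring
  change ‖_ - _‖ ≤ 4 * (δ * (2 * M)) * ξ ω ^ 2
  rw [e2, norm_mul, norm_mul, Complex.norm_exp_ofReal_mul_I, one_mul, Complex.norm_real,
    Real.norm_eq_abs]
  have h3 := norm_cexp_sub_taylor_le_cube (ξ ω)
  have h4 := he.abs_incr_le hδ m ω
  calc _ ≤ 1 * (4 * |ξ ω| ^ 3) := mul_le_mul (hA1 ω) h3 (norm_nonneg _) zero_le_one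
    _ = 4 * |ξ ω| * ξ ω ^ 2 := by rw [← sq_abs (ξ ω)]; ring
    _ ≤ 4 * (δ * (2 * M)) * ξ ω ^ 2 := by gcongr

/-- A quantitative martingale central limit theorem: the characteristic function of the
martingale is Gaussian up to the fluctuations of its quadratic variation. -/
theorem norm_integral_cexp_mart_sub_le (he : IsEnv μ M w e)
    (hf : ∀ m x, BddMeas (info e (before m)) (f m x)) {δ : ℝ}
    (hδ : ∀ m ω, ∑ x ∈ box R, |f m x ω| ≤ δ) {Q : ℝ} (hQ : 0 ≤ Q) (N : ℕ) :
    ‖∫ ω, Complex.exp (mart μ M w e R f N ω * Complex.I) ∂μ - Real.exp (-(Q / 2))‖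
      ≤ (4 * (δ * (2 * M)) + (δ * (2 * M)) ^ 2) * ∫ ω, quadVar μ M w R f N ω ∂μ
        + ∫ ω, |quadVar μ M w R f N ω - Q| ∂μ := by
  set S := mart μ M w e R f
  set V := quadVar μ M w R f
  set v := condVar μ M w R f
  set c := δ * (2 * M) with hc_def
  have hV0 : ∀ ω, V 0 ω = 0 := fun ω => by simp [V, quadVar]
  have hS0 : ∀ ω, S 0 ω = 0 := fun ω => by simp [S, mart]
  have hVs : ∀ m ω, V (m + 1) ω = V m ω + v m ω := fun m ω => Finset.sum_range_succ _ _
  have hSs : ∀ m ω, S (m + 1) ω = S m ω + incr μ M w e R f m ω :=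
    fun m ω => Finset.sum_range_succ _ _
  have hSb : ∀ m, BddMeas (info e (before m)) (S m) := fun m => he.bddMeas_mart hf m
  have hVb : ∀ m, BddMeas (info e (before m)) (V (m + 1)) := fun m => bddMeas_quadVar hf m
  have hVb' : ∀ m, BddMeas ‹MeasurableSpace Ω› (V m) := fun m => he.bddMeas_quadVar' hf m
  have hvb : ∀ m, BddMeas ‹MeasurableSpace Ω› (v m) := fun m =>
    (bddMeas_condVar (μ := μ) (M := M) (w := w) (R := R) hf (le_refl m)).mono (he.info_le _)
  have hDb : ∀ m, BddMeas (info e (before m)) fun ω => damp (Q - V (m + 1) ω) := fun m =>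
    bddMeas_comp continuous_damp abs_damp_le_one ((BddMeas.const Q).sub (hVb m))
  have hDb' : ∀ m, BddMeas ‹MeasurableSpace Ω› fun ω => damp (Q - V m ω) := fun m =>
    bddMeas_comp continuous_damp abs_damp_le_one ((BddMeas.const Q).sub (hVb' m))
  have hmax : ∀ m, Integrable (fun ω => max (V m ω - Q) 0) μ := fun m =>
    ((hVb' m).sub (BddMeas.const Q)).integrable.pos_part
  have hSm : ∀ m, Measurable (S m) := fun m => he.measurable_of_info (hSb m).meas
  have hexpm : ∀ m, AEStronglyMeasurable (fun ω => Complex.exp (S m ω * Complex.I)) μ := fun m =>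
    (by have := hSm m; fun_prop : Measurable fun ω =>
      Complex.exp (S m ω * Complex.I)).aestronglyMeasurable
  have hexp1 : ∀ m, ∀ᵐ ω ∂μ, ‖Complex.exp (S m ω * Complex.I)‖ ≤ 1 := fun m =>
    Eventually.of_forall fun ω => (Complex.norm_exp_ofReal_mul_I _).le
  have hic : ∀ m {X : Ω → ℝ}, Integrable X μ →
      Integrable (fun ω => Complex.exp (S m ω * Complex.I) * (X ω : ℂ)) μ := fun m _ hX =>
    hX.ofReal.bdd_mul (hexpm m) (hexp1 m)
  -- The damped characteristic function starts at `e^{-Q/2}` and would be conserved by exactly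
  -- Gaussian steps. The errors are the cubic remainder, the squared variances and the growth of the
  -- overshoot `(V - Q)⁺`.
  have hmain : ∀ m, ‖∫ ω, Complex.exp (S m ω * Complex.I) * (damp (Q - V m ω) : ℂ) ∂μ
      - Real.exp (-(Q / 2))‖ ≤ (4 * c + c ^ 2) * ∫ ω, V m ω ∂μ
        + (∫ ω, max (V m ω - Q) 0 ∂μ) / 2 := by
    intro m
    induction m with
    | zero =>
      simp only [hS0, hV0, Complex.ofReal_zero, zero_mul, Complex.exp_zero, one_mul, sub_zero,
        zero_sub, integral_const, probReal_univ, one_smul, damp, max_eq_left hQ, sub_self,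
        norm_zero, mul_zero, zero_add, max_eq_right (neg_nonpos.2 hQ), zero_div, le_refl]
    | succ m ih =>
      have h1 := he.norm_integral_increment_le hf hδ (hSb m) (hDb m) fun ω => abs_damp_le_one _
      have h2 : ‖∫ ω, Complex.exp (S m ω * Complex.I)
            * ((damp (Q - V (m + 1) ω) * (1 - v m ω / 2) : ℝ) : ℂ) ∂μ
          - ∫ ω, Complex.exp (S m ω * Complex.I) * (damp (Q - V m ω) : ℂ) ∂μ‖
          ≤ c ^ 2 * ∫ ω, v m ω ∂μ
            + ((∫ ω, max (V (m + 1) ω - Q) 0 ∂μ) - ∫ ω, max (V m ω - Q) 0 ∂μ) / 2 := by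
        have hX : BddMeas ‹MeasurableSpace Ω› fun ω =>
            damp (Q - V (m + 1) ω) * (1 - v m ω / 2) := by
          refine (hDb' (m + 1)).mul ((BddMeas.const 1).sub ?_)
          simpa [div_eq_mul_inv] using (hvb m).mul_const (1 / 2)
        have i1 := hic m hX.integrable
        have i2 := hic m (hDb' m).integrable
        rw [← integral_sub i1 i2]
        refine (norm_integral_le_integral_norm _).trans ?_
        have i3 : Integrable (fun ω => (max (V (m + 1) ω - Q) 0 - max (V m ω - Q) 0) / 2) μ :=
          ((hmax _).sub (hmax _)).div_const _
        rw [← integral_const_mul, ← integral_sub (hmax _) (hmax _), ← integral_div,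
          ← integral_add ((hvb m).integrable.const_mul _) i3]
        refine integral_mono (i1.sub i2).norm (((hvb m).integrable.const_mul _).add i3) fun ω => ?_
        have h3 := abs_mul_damp_sub_damp_le (condVar_nonneg (μ := μ) (M := M) (w := w) (R := R)
          (f := f) m ω) (Q - V m ω)
        have h4 := he.condVar_le hδ m ω
        have h5 := condVar_nonneg (μ := μ) (M := M) (w := w) (R := R) (f := f) m ω
        change ‖_ - _‖ ≤ c ^ 2 * v m ω + (max (V (m + 1) ω - Q) 0 - max (V m ω - Q) 0) / 2
        rw [← mul_sub, norm_mul, Complex.norm_exp_ofReal_mul_I, one_mul, ← Complex.ofReal_sub,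
          Complex.norm_real, Real.norm_eq_abs, hVs]
        rw [show V m ω + v m ω - Q = v m ω - (Q - V m ω) by ring,
          show Q - (V m ω + v m ω) = Q - V m ω - v m ω by ring,
          show V m ω - Q = -(Q - V m ω) by ring, mul_comm (damp _)]
        refine h3.trans (add_le_add ?_ le_rfl)
        rw [sq]
        exact mul_le_mul_of_nonneg_right h4 h5
      have h6 : ∫ ω, V (m + 1) ω ∂μ = ∫ ω, V m ω ∂μ + ∫ ω, v m ω ∂μ := by
        simp_rw [hVs]
        exact integral_add (hVb' m).integrable (hvb m).integrable
      simp_rw [← hSs] at h1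
      rw [h6]
      have h7 := norm_add₃_le.trans (add_le_add (add_le_add h1 h2) ih)
      rw [sub_add_sub_cancel, sub_add_sub_cancel] at h7
      linarith
  -- Removing the damping at the end costs at most half of the mean unspent variance `(Q - V)⁺`.
  have hlast : ‖∫ ω, Complex.exp (S N ω * Complex.I) ∂μ
      - ∫ ω, Complex.exp (S N ω * Complex.I) * (damp (Q - V N ω) : ℂ) ∂μ‖
      ≤ (∫ ω, max (Q - V N ω) 0 ∂μ) / 2 := by
    have i1 : Integrable (fun ω => Complex.exp (S N ω * Complex.I)) μ :=
      integrable_of_bound (hexpm N) 1 fun ω => (Complex.norm_exp_ofReal_mul_I _).le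
    have i2 := hic N (hDb' N).integrable
    rw [← integral_sub i1 i2, ← integral_div]
    refine (norm_integral_le_integral_norm _).trans ?_
    refine integral_mono (i1.sub i2).norm
      (((BddMeas.const Q).sub (hVb' N)).integrable.pos_part.div_const _) fun ω => ?_
    have e1 : Complex.exp (S N ω * Complex.I)
        - Complex.exp (S N ω * Complex.I) * (damp (Q - V N ω) : ℂ)
        = Complex.exp (S N ω * Complex.I) * ((1 - damp (Q - V N ω) : ℝ) : ℂ) := by
      push_cast; ring
    change ‖_ - _‖ ≤ _
    rw [e1, norm_mul, Complex.norm_exp_ofReal_mul_I, one_mul, Complex.norm_real,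
      Real.norm_of_nonneg (sub_nonneg.2 (damp_le_one _))]
    exact one_sub_damp_le _
  have hpos : (∫ ω, max (Q - V N ω) 0 ∂μ) + ∫ ω, max (V N ω - Q) 0 ∂μ
      = ∫ ω, |V N ω - Q| ∂μ := by
    rw [← integral_add ((BddMeas.const Q).sub (hVb' N)).integrable.pos_part (hmax N)]
    refine integral_congr_ae (Eventually.of_forall fun ω => ?_)
    change max (Q - V N ω) 0 + max (V N ω - Q) 0 = |V N ω - Q|
    rcases le_total (V N ω) Q with h | h
    · rw [max_eq_left (by linarith), max_eq_right (by linarith), abs_of_nonpos (by linarith)]; ring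
    · rw [max_eq_right (by linarith), max_eq_left (by linarith), abs_of_nonneg (by linarith)]; ring
  have habs : 0 ≤ ∫ ω, |V N ω - Q| ∂μ := integral_nonneg fun _ => abs_nonneg _
  have h8 := (norm_add_le _ _).trans (add_le_add hlast (hmain N))
  rw [sub_add_sub_cancel] at h8
  linarith

end IsEnv
end MartingaleCLT
-- Gaussian limit of the quenched mean displacements.
section QuenchedMean

variable {Ω : Type*} [MeasurableSpace Ω] {μ : Measure Ω} [IsProbabilityMeasure μ] {M : ℕ}
  {w : Ω → ℤ → ℝ}

/-- The mean displacement of the quenched walk is a martingale of the environment. -/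
lemma IsEnv.sum_qmass_mul_id_sub_center {e : ℕ → ℤ → Ω → ℤ → ℝ} (he : IsEnv μ M w e) {s N R : ℕ}
    {k : ℤ} (hs : s ≤ N) (hR : |k| + M * N ≤ R) (ω : Ω) :
    ∑ x ∈ box R, qmass M e s k N ω x * x - center (meanDrift μ M w) s k N
      = ∑ m ∈ Finset.range N, ∑ x ∈ box R, qmass M e s k m ω x * driftNoise μ M w e m x ω := by
  have h0 : ∑ m ∈ Finset.range s, ∑ x ∈ box R,
      qmass M e s k m ω x * driftNoise μ M w e m x ω = 0 :=
    Finset.sum_eq_zero fun m hm => Finset.sum_eq_zero fun x _ => by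
      rw [qmass, mass_eq_zero_of_lt (Finset.mem_range.1 hm), zero_mul]
  induction N, hs using Nat.le_induction with
  | base =>
    have h := sum_mass_self (M := M) (e := fun m x => e m x ω) (s := s) (k := k) (R := R) (by
      have : (0 : ℤ) ≤ M * s := by positivity
      linarith) (fun x : ℤ => (x : ℝ))
    simp only [smul_eq_mul] at h
    rw [h0, h, center]
    ring
  | succ m hm ih =>
    have hRm : |k| + M * (m : ℤ) ≤ R := by
      push_cast at hR
      have : (0 : ℤ) ≤ M := by positivity
      linarith
    rw [Finset.sum_range_succ, ← ih hRm, IsEnv.sum_qmass_succ (avgProb μ w) hm hR]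
    have h1 : ∀ x : ℤ, ∑ j ∈ steps M, avgProb μ w j * ((x + j : ℤ) : ℝ)
        = x + meanDrift μ M w := by
      intro x
      rw [meanDrift_eq he.base_measurable he.base_isProbVec, vecMean]
      have e1 : ∀ j : ℤ, avgProb μ w j * ((x + j : ℤ) : ℝ)
          = avgProb μ w j * x + j * avgProb μ w j := by intro j; push_cast; ring
      simp_rw [e1, Finset.sum_add_distrib, ← Finset.sum_mul, he.isProbVec_avg.sum_eq_one, one_mul]
    simp_rw [h1, mul_add, Finset.sum_add_distrib, ← Finset.sum_mul, he.sum_qmass hm hRm]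
    simp only [center]
    push_cast
    ring

/-- No relation between `R` and `m` is assumed, since the martingale theorem asks for a bound on the
weights at all times. -/
lemma IsEnv.sum_box_qmass_le_one {e : ℕ → ℤ → Ω → ℤ → ℝ} (he : IsEnv μ M w e) (s : ℕ) (k : ℤ)
    (m R : ℕ) (ω : Ω) : ∑ x ∈ box R, qmass M e s k m ω x ≤ 1 := by
  refine le_trans ?_ (he.sum_qmass_le_one (s := s) (k := k) (m := m)
    (R := max R (k.natAbs + M * m)) ?_ ω)
  · refine Finset.sum_le_sum_of_subset_of_nonneg (fun x hx => ?_) fun x _ _ => he.qmass_nonneg ..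
    rw [mem_box] at hx ⊢
    exact hx.trans (by exact_mod_cast le_max_left _ _)
  · rw [Int.abs_eq_natAbs]
    exact_mod_cast le_max_right _ _

lemma rpow_neg_quarter_sq (n : ℕ+) : ((n : ℝ) ^ (-(1 / 4) : ℝ)) ^ 2 = (√(n : ℝ))⁻¹ := by
  rw [Real.sqrt_eq_rpow, ← Real.rpow_natCast, ← Real.rpow_mul (Nat.cast_nonneg _),
    ← Real.rpow_neg (Nat.cast_nonneg _)]
  norm_num

lemma rpow_neg_quarter_nonneg (n : ℕ+) : 0 ≤ (n : ℝ) ^ (-(1 / 4) : ℝ) :=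
  Real.rpow_nonneg (Nat.cast_nonneg _) _

lemma tendsto_rpow_neg_quarter :
    Tendsto (fun n : ℕ+ => (n : ℝ) ^ (-(1 / 4) : ℝ)) atTop (𝓝 0) :=
  (tendsto_rpow_neg_atTop (by norm_num)).comp tendsto_pnat_cast

variable {e : ℕ+ → ℕ → ℤ → Ω → ℤ → ℝ} {J : Type*} [Fintype J]

/-- The central limit theorem for the quenched means of finitely many walks. -/
theorem tendsto_integral_cexp_quenchedMean (hspan : HasSpanOne (avgProb μ w))
    (hell : Elliptic μ M w) (he : ∀ n, IsEnv μ M w (e n))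
    {s : J → ℕ+ → ℕ} {N R : ℕ+ → ℕ} {k : J → ℕ+ → ℤ} (hs : ∀ j n, s j n ≤ N n)
    (hR : ∀ j n, |k j n| + M * N n ≤ R n) {T : ℝ} (hT : ∀ n, (N n : ℝ) ≤ T * n)
    (a : J → ℝ≥0 × ℝ)
    (ha : ∀ j, Tendsto (fun n : ℕ+ => ((N n - s j n : ℕ) : ℝ) / n) atTop (𝓝 (a j).1))
    (hd : ∀ i j, Tendsto (fun n : ℕ+ => (center (meanDrift μ M w) (s i n) (k i n) (N n)
      - center (meanDrift μ M w) (s j n) (k j n) (N n)) / √n) atTop (𝓝 ((a i).2 - (a j).2)))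
    (θ : J → ℝ) :
    Tendsto (fun n : ℕ+ => ∫ ω, Complex.exp (((n : ℝ) ^ (-(1 / 4) : ℝ) * ∑ j, θ j *
      (∑ x ∈ box (R n), qmass M (e n) (s j n) (k j n) (N n) ω x * x
        - center (meanDrift μ M w) (s j n) (k j n) (N n)) : ℝ) * Complex.I) ∂μ) atTop
      (𝓝 (Real.exp (-((∑ i, ∑ j, θ i * θ j
        * GammaQ (kappa μ M w) (avgVar μ M w) (a i) (a j)) / 2)) : ℝ)) := by
  set Q := ∑ i, ∑ j, θ i * θ j * GammaQ (kappa μ M w) (avgVar μ M w) (a i) (a j)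
  set q : ℕ+ → J → ℕ → Ω → ℤ → ℝ := fun n j l ω => qmass M (e n) (s j n) (k j n) l ω
  -- The predictable weights at each time have total size `O(n^{-1/4})`, so no single increment
  -- matters in the limit.
  set f : ℕ+ → ℕ → ℤ → Ω → ℝ := fun n l x ω => (n : ℝ) ^ (-(1 / 4) : ℝ) * ∑ j, θ j * q n j l ω x
  have hf : ∀ n l x, BddMeas (info (e n) (before l)) (f n l x) := fun n l x =>
    (BddMeas.sum _ fun j => ((he n).bddMeas_qmass _ _ _ _).const_mul _).const_mul _
  set V : ℕ+ → Ω → ℝ := fun n => IsEnv.quadVar μ M w (R n) (f n) (N n)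
  have hV : ∀ n, BddMeas ‹MeasurableSpace Ω› (V n) := fun n => (he n).bddMeas_quadVar' (hf n) _
  set O : ℕ+ → J → J → Ω → ℝ := fun n i j ω => driftVar μ M w * ((√n)⁻¹ *
    ∑ l ∈ Finset.Ico (max (s i n) (s j n)) (N n), overlap (R n) (q n i l ω) (q n j l ω))
  -- A walk has no mass before its start, so the meetings may be summed from time zero for all pairs
  -- at once.
  have hO : ∀ n i j ω, O n i j ω = driftVar μ M w * ((√n)⁻¹ *
      ∑ l ∈ Finset.range (N n), overlap (R n) (q n i l ω) (q n j l ω)) := by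
    intro n i j ω
    simp only [O]
    congr 2
    refine Finset.sum_subset (fun l hl => Finset.mem_range.2 (Finset.mem_Ico.1 hl).2)
      fun l hl hl' => Finset.sum_eq_zero fun x _ => ?_
    rw [Finset.mem_range] at hl
    rw [Finset.mem_Ico, not_and', not_le] at hl'
    rcases lt_max_iff.1 (hl' hl) with h | h
    · simp only [q, qmass]; rw [mass_eq_zero_of_lt h, zero_mul]
    · simp only [q, qmass]; rw [mass_eq_zero_of_lt h, mul_zero]
  have hVO : ∀ n ω, V n ω = ∑ i, ∑ j, θ i * θ j * O n i j ω := by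
    intro n ω
    have e1 : ∀ l, IsEnv.condVar μ M w (R n) (f n) l ω = ∑ i, ∑ j, θ i * θ j *
        (driftVar μ M w * ((√n)⁻¹ * overlap (R n) (q n i l ω) (q n j l ω))) := by
      intro l
      have e2 : ∀ x, f n l x ω ^ 2 = ∑ i, ∑ j, θ i * θ j * ((√n)⁻¹ * (q n i l ω x * q n j l ω x)) := by
        intro x
        simp only [f]
        rw [mul_pow, rpow_neg_quarter_sq, sq, Finset.sum_mul_sum, Finset.mul_sum]
        refine Finset.sum_congr rfl fun i _ => ?_
        rw [Finset.mul_sum]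
        exact Finset.sum_congr rfl fun j _ => by ring
      simp only [IsEnv.condVar, e2]
      rw [Finset.sum_comm, Finset.mul_sum]
      refine Finset.sum_congr rfl fun i _ => ?_
      rw [Finset.sum_comm, Finset.mul_sum]
      refine Finset.sum_congr rfl fun j _ => ?_
      simp only [overlap]
      rw [← Finset.mul_sum, ← Finset.mul_sum]
      ring
    simp only [V, IsEnv.quadVar, e1]
    rw [Finset.sum_comm]
    refine Finset.sum_congr rfl fun i _ => ?_
    rw [Finset.sum_comm]
    refine Finset.sum_congr rfl fun j _ => ?_
    rw [hO, ← Finset.mul_sum, ← Finset.mul_sum, ← Finset.mul_sum]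
  have hOlim : ∀ i j, Tendsto (fun n => ∫ ω, |O n i j ω
      - GammaQ (kappa μ M w) (avgVar μ M w) (a i) (a j)| ∂μ) atTop (𝓝 0) := fun i j =>
    tendsto_integral_abs_overlap_sub hspan hell he (hs i) (hs j) (hR i) (hR j) hT (a i) (a j)
      (ha i) (ha j) (hd i j)
  have hOb : ∀ n i j, BddMeas ‹MeasurableSpace Ω› (O n i j) := fun n i j =>
    ((BddMeas.sum _ fun l => (BddMeas.sum _ fun x => ((((he n).bddMeas_qmass _ _ l _).mul
      ((he n).bddMeas_qmass _ _ l _)).mono ((he n).info_le _)))).const_mul _).const_mul _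
  have hVlim : Tendsto (fun n => ∫ ω, |V n ω - Q| ∂μ) atTop (𝓝 0) := by
    refine squeeze_zero (fun n => integral_nonneg fun _ => abs_nonneg _) (fun n => ?_)
      (g := fun n => ∑ i, ∑ j, |θ i * θ j| * ∫ ω, |O n i j ω
      - GammaQ (kappa μ M w) (avgVar μ M w) (a i) (a j)| ∂μ) ?_
    · have hi : ∀ i j, Integrable (fun ω => |θ i * θ j| * |O n i j ω
          - GammaQ (kappa μ M w) (avgVar μ M w) (a i) (a j)|) μ := fun i j =>
        ((hOb n i j).sub (BddMeas.const _)).integrable.abs.const_mul _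
      simp_rw [← integral_const_mul]
      simp_rw [← integral_finsetSum _ fun j _ => hi _ j]
      rw [← integral_finsetSum _ fun i _ => integrable_finsetSum _ fun j _ => hi i j]
      refine integral_mono ((hV n).sub (BddMeas.const _)).integrable.abs
        (integrable_finsetSum _ fun i _ => integrable_finsetSum _ fun j _ => hi i j) fun ω => ?_
      change |V n ω - Q| ≤ _
      rw [hVO, ← Finset.sum_sub_distrib]
      refine (Finset.abs_sum_le_sum_abs _ _).trans (Finset.sum_le_sum fun i _ => ?_)
      rw [← Finset.sum_sub_distrib]
      refine (Finset.abs_sum_le_sum_abs _ _).trans (Finset.sum_le_sum fun j _ => ?_)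
      rw [← mul_sub, abs_mul]
    · have := tendsto_finsetSum (s := Finset.univ) fun i _ =>
        tendsto_finsetSum (s := Finset.univ) fun j _ => (hOlim i j).const_mul |θ i * θ j|
      simpa using this
  have hVint : Tendsto (fun n => ∫ ω, V n ω ∂μ) atTop (𝓝 Q) := by
    rw [tendsto_iff_norm_sub_tendsto_zero]
    refine squeeze_zero (fun n => norm_nonneg _) (fun n => ?_) hVlim
    have : ∫ ω, V n ω ∂μ - Q = ∫ ω, (V n ω - Q) ∂μ := by
      rw [integral_sub (hV n).integrable (integrable_const _)]; simp
    rw [this]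
    exact norm_integral_le_integral_norm _
  -- The limit of mean quadratic variations is nonnegative; positivity of `Γ_q` is not checked
  -- directly.
  have hQ : 0 ≤ Q := ge_of_tendsto hVint (Eventually.of_forall fun n =>
    integral_nonneg fun ω => Finset.sum_nonneg fun l _ => IsEnv.condVar_nonneg l ω)
  have hbound : ∀ n : ℕ+, ∀ l ω, ∑ x ∈ box (R n), |f n l x ω|
      ≤ (n : ℝ) ^ (-(1 / 4) : ℝ) * ∑ j, |θ j| := by
    intro n l ω
    have h1 : ∀ x, |f n l x ω| ≤ (n : ℝ) ^ (-(1 / 4) : ℝ) * ∑ j, |θ j| * q n j l ω x := by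
      intro x
      rw [abs_mul, abs_of_nonneg (rpow_neg_quarter_nonneg n)]
      refine mul_le_mul_of_nonneg_left ((Finset.abs_sum_le_sum_abs _ _).trans
        (Finset.sum_le_sum fun j _ => ?_)) (rpow_neg_quarter_nonneg n)
      rw [abs_mul, abs_of_nonneg ((he n).qmass_nonneg ..)]
    refine (Finset.sum_le_sum fun x _ => h1 x).trans ?_
    rw [← Finset.mul_sum, Finset.sum_comm]
    refine mul_le_mul_of_nonneg_left (Finset.sum_le_sum fun j _ => ?_) (rpow_neg_quarter_nonneg n)
    rw [← Finset.mul_sum]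
    exact mul_le_of_le_one_right (abs_nonneg _) ((he n).sum_box_qmass_le_one ..)
  have hmart : ∀ (n : ℕ+) ω, (n : ℝ) ^ (-(1 / 4) : ℝ) * ∑ j, θ j *
      (∑ x ∈ box (R n), qmass M (e n) (s j n) (k j n) (N n) ω x * x
        - center (meanDrift μ M w) (s j n) (k j n) (N n))
      = IsEnv.mart μ M w (e n) (R n) (f n) (N n) ω := by
    intro n ω
    simp_rw [(he n).sum_qmass_mul_id_sub_center (hs _ n) (hR _ n)]
    simp only [IsEnv.mart, IsEnv.incr, f]
    simp_rw [mul_assoc, Finset.sum_mul, Finset.mul_sum]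
    rw [Finset.sum_comm]
    refine Finset.sum_congr rfl fun l _ => ?_
    rw [Finset.sum_comm]
    exact Finset.sum_congr rfl fun x _ => Finset.sum_congr rfl fun j _ => by ring
  simp_rw [hmart]
  rw [tendsto_iff_norm_sub_tendsto_zero]
  refine squeeze_zero (fun n => norm_nonneg _)
    (fun n => (he n).norm_integral_cexp_mart_sub_le (hf n) (hbound n) hQ (N n)) ?_
  have h1 := ((tendsto_rpow_neg_quarter.mul_const (∑ j, |θ j|)).mul_const (2 * (M : ℝ)))
  have h2 := (((h1.const_mul 4).add (h1.pow 2)).mul hVint).add hVlim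
  simpa using h2

end QuenchedMean
-- Summation by parts and tail sums of signed measures.
section SummationByParts

variable {R : ℕ} {ν : ℤ → ℝ}

/-- The tail sums `∑_{x ≥ i} ν(x)`. -/
noncomputable def tail (R : ℕ) (ν : ℤ → ℝ) (i : ℤ) : ℝ := ∑ x ∈ box R, if i ≤ x then ν x else 0

/-- The indices of the increments between the points of `box R`. -/
noncomputable abbrev gaps (R : ℕ) : Finset ℤ := Finset.Ioc (-(R : ℤ)) R

lemma sum_Ioc_sub (σ : ℤ → ℝ) (a : ℤ) (n : ℕ) :
    ∑ i ∈ Finset.Ioc a (a + n), (σ i - σ (i - 1)) = σ (a + n) - σ a := by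
  induction n with
  | zero => simp
  | succ n ih =>
    have h : Finset.Ioc a (a + (n + 1 : ℕ)) = insert (a + (n + 1 : ℕ)) (Finset.Ioc a (a + n)) := by
      ext i; simp only [Finset.mem_Ioc, Finset.mem_insert]; omega
    rw [h, Finset.sum_insert (by simp), ih]
    push_cast
    rw [show a + (n + 1 : ℤ) - 1 = a + n by ring]
    ring

lemma sum_gaps_ite (σ : ℤ → ℝ) {x : ℤ} (hx : x ∈ box R) :
    ∑ i ∈ gaps R, (if i ≤ x then σ i - σ (i - 1) else 0) = σ x - σ (-(R : ℤ)) := by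
  rw [← Finset.sum_filter]
  rw [Finset.mem_Icc] at hx
  obtain ⟨n, hn⟩ := Int.le.dest hx.1
  rw [← hn, ← sum_Ioc_sub]
  congr 1
  ext i
  simp only [Finset.mem_filter, Finset.mem_Ioc]
  omega

/-- Summation by parts. -/
lemma sum_mul_eq_sum_tail (hν : ∑ x ∈ box R, ν x = 0) (σ : ℤ → ℝ) :
    ∑ x ∈ box R, ν x * σ x = ∑ i ∈ gaps R, tail R ν i * (σ i - σ (i - 1)) := by
  have h1 : ∑ x ∈ box R, ν x * σ x = ∑ x ∈ box R, ν x * (σ x - σ (-(R : ℤ))) := by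
    simp_rw [mul_sub, Finset.sum_sub_distrib, ← Finset.sum_mul, hν, zero_mul, sub_zero]
  rw [h1]
  simp only [tail, Finset.sum_mul]
  rw [Finset.sum_comm]
  refine Finset.sum_congr rfl fun x hx => ?_
  rw [← sum_gaps_ite σ hx, Finset.mul_sum]
  refine Finset.sum_congr rfl fun i _ => ?_
  split_ifs <;> simp

lemma sum_tail (hν : ∑ x ∈ box R, ν x = 0) :
    ∑ i ∈ gaps R, tail R ν i = ∑ x ∈ box R, ν x * x := by
  rw [sum_mul_eq_sum_tail hν]
  refine Finset.sum_congr rfl fun i _ => ?_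
  push_cast; ring

/-- Summation by parts is applied to the function `x ↦ ∑ ν(y) min(x, y)`, whose increments are the
tails of `ν`. In `min(x, y) = (x + y - |x - y|)/2` the linear parts drop out because `ν` has mass
zero. -/
lemma sum_tail_sq (hν : ∑ x ∈ box R, ν x = 0) :
    ∑ i ∈ gaps R, tail R ν i ^ 2 = -(pairSum R ν ν (fun z => |(z : ℝ)|) / 2) := by
  have h1 := sum_mul_eq_sum_tail hν fun x => ∑ y ∈ box R, ν y * (min x y : ℤ)
  have h2 : ∀ i : ℤ, (∑ y ∈ box R, ν y * (min i y : ℤ)) - ∑ y ∈ box R, ν y * (min (i - 1) y : ℤ)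
      = tail R ν i := by
    intro i
    rw [← Finset.sum_sub_distrib, tail]
    refine Finset.sum_congr rfl fun y _ => ?_
    split_ifs with h
    · rw [min_eq_left h, min_eq_left (by omega)]; push_cast; ring
    · rw [min_eq_right (by omega), min_eq_right (by omega)]; ring
  simp_rw [h2, ← sq] at h1
  rw [← h1]
  have h3 : ∀ x y : ℤ, ((min x y : ℤ) : ℝ) = (x + y - |((x - y : ℤ) : ℝ)|) / 2 := by
    intro x y
    push_cast
    rcases le_total (x : ℝ) y with h | h
    · rw [min_eq_left h, abs_of_nonpos (by linarith)]; ring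
    · rw [min_eq_right h, abs_of_nonneg (by linarith)]; ring
  have h4 : ∀ x, ∑ y ∈ box R, ν y * (min x y : ℤ) = (∑ y ∈ box R, ν y * y) / 2
      - (∑ y ∈ box R, ν y * |((x - y : ℤ) : ℝ)|) / 2 := by
    intro x
    have e1 : ∀ y, ν y * (min x y : ℤ) = ν y * (x / 2) + ν y * y / 2
        - ν y * |((x - y : ℤ) : ℝ)| / 2 := by
      intro y; rw [h3]; ring
    simp_rw [e1, Finset.sum_sub_distrib, Finset.sum_add_distrib, ← Finset.sum_mul, hν, zero_mul,
      zero_add, Finset.sum_div]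
  simp_rw [h4, mul_sub, Finset.sum_sub_distrib, ← Finset.sum_mul, hν, zero_mul, zero_sub]
  rw [pairSum_eq_mul_sum, Finset.sum_div]
  congr 1
  exact Finset.sum_congr rfl fun x _ => by ring

lemma tail_sum {J : Type*} (s : Finset J) (θ : J → ℝ) (ν : J → ℤ → ℝ) (i : ℤ) :
    tail R (fun x => ∑ j ∈ s, θ j * ν j x) i = ∑ j ∈ s, θ j * tail R (ν j) i := by
  simp only [tail, Finset.mul_sum]
  rw [Finset.sum_comm]
  refine Finset.sum_congr rfl fun x _ => ?_
  split_ifs <;> simp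

/-- The point mass. -/
def dirac (m x : ℤ) : ℝ := if x = m then 1 else 0

lemma sum_dirac_mul {m : ℤ} (hm : m ∈ box R) (F : ℤ → ℝ) :
    ∑ x ∈ box R, dirac m x * F x = F m := by
  simp only [dirac, ite_mul, one_mul, zero_mul]
  rw [Finset.sum_ite_eq' , if_pos hm]

lemma sum_dirac {m : ℤ} (hm : m ∈ box R) : ∑ x ∈ box R, dirac m x = 1 := by
  simpa using sum_dirac_mul hm fun _ => 1

variable {q : ℤ → ℝ} {m : ℤ}

lemma tail_sub_dirac (hq : ∑ x ∈ box R, q x = 1) (hm : m ∈ box R) (i : ℤ) :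
    tail R (fun x => q x - dirac m x) i
      = ∑ x ∈ box R, q x * ((if i ≤ x then 1 else 0) - (if i ≤ m then 1 else 0)) := by
  simp_rw [mul_sub, Finset.sum_sub_distrib, ← Finset.sum_mul, hq, one_mul]
  have h := sum_dirac_mul hm fun x => if i ≤ x then (1 : ℝ) else 0
  rw [← h, ← Finset.sum_sub_distrib, tail]
  refine Finset.sum_congr rfl fun x _ => ?_
  split_ifs <;> simp

lemma abs_tail_sub_dirac_le_one (hq0 : ∀ x, 0 ≤ q x) (hq : ∑ x ∈ box R, q x = 1)
    (hm : m ∈ box R) (i : ℤ) : |tail R (fun x => q x - dirac m x) i| ≤ 1 := by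
  rw [tail_sub_dirac hq hm]
  refine le_of_le_of_eq ((Finset.abs_sum_le_sum_abs _ _).trans
    (Finset.sum_le_sum fun x _ => ?_)) hq
  rw [abs_mul, abs_of_nonneg (hq0 x)]
  refine mul_le_of_le_one_right (hq0 x) ?_
  split_ifs <;> norm_num

/-- A point `x` contributes only to the gaps between `x` and `m`: there are at most `|x - m|` of
them, and each lies within `|x - m| + |m - c|` of `c`. -/
lemma sum_abs_tail_sub_dirac_mul_le (hq0 : ∀ x, 0 ≤ q x) (hq : ∑ x ∈ box R, q x = 1)
    (hm : m ∈ box R) {D : ℝ} (hD : 0 < D) (c : ℝ) :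
    ∑ i ∈ gaps R, |tail R (fun x => q x - dirac m x) i| * (1 + |i - c| / D)
      ≤ ∑ x ∈ box R, q x * (|(x : ℝ) - m| * (1 + (|(x : ℝ) - m| + |m - c|) / D)) := by
  have h1 : ∀ i : ℤ, |tail R (fun x => q x - dirac m x) i| * (1 + |i - c| / D)
      ≤ ∑ x ∈ box R, q x * (|(if i ≤ x then 1 else 0) - (if i ≤ m then 1 else 0)|
        * (1 + |i - c| / D)) := by
    intro i
    rw [tail_sub_dirac hq hm]
    simp_rw [← mul_assoc, ← Finset.sum_mul]
    refine mul_le_mul_of_nonneg_right ((Finset.abs_sum_le_sum_abs _ _).trans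
      (Finset.sum_le_sum fun x _ => ?_)) (by positivity)
    rw [abs_mul, abs_of_nonneg (hq0 x)]
  refine (Finset.sum_le_sum fun i _ => h1 i).trans ?_
  rw [Finset.sum_comm]
  refine Finset.sum_le_sum fun x _ => ?_
  rw [← Finset.mul_sum]
  refine mul_le_mul_of_nonneg_left ?_ (hq0 x)
  have h2 : ∀ i ∈ gaps R, |(if i ≤ x then (1 : ℝ) else 0) - (if i ≤ m then 1 else 0)|
      * (1 + |i - c| / D) ≤ if i ∈ Finset.Ioc (min x m) (max x m) then
        1 + (|(x : ℝ) - m| + |m - c|) / D else 0 := by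
    intro i _
    by_cases hi : i ∈ Finset.Ioc (min x m) (max x m)
    · rw [if_pos hi]
      have h3 : |(if i ≤ x then (1 : ℝ) else 0) - (if i ≤ m then 1 else 0)| ≤ 1 := by
        split_ifs <;> norm_num
      have h4 : |(i : ℝ) - m| ≤ |(x : ℝ) - m| := by
        have : |i - m| ≤ |x - m| := by
          rw [Finset.mem_Ioc] at hi
          rcases le_total x m with h | h
          · rw [min_eq_left h, max_eq_right h] at hi
            rw [abs_of_nonpos (by omega), abs_of_nonpos (by omega)]; omega
          · rw [min_eq_right h, max_eq_left h] at hi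
            rw [abs_of_nonneg (by omega), abs_of_nonneg (by omega)]; omega
        exact_mod_cast this
      have h5 : |(i : ℝ) - c| ≤ |(x : ℝ) - m| + |m - c| :=
        (abs_sub_le _ (m : ℝ) _).trans (add_le_add h4 le_rfl)
      calc _ ≤ 1 * (1 + |i - c| / D) := mul_le_mul_of_nonneg_right h3 (by positivity)
        _ ≤ _ := by rw [one_mul]; gcongr
    · rw [if_neg hi]
      rw [Finset.mem_Ioc, min_lt_iff, le_max_iff] at hi
      have h3 : (i ≤ x ↔ i ≤ m) := by omega
      simp [h3]
  refine (Finset.sum_le_sum h2).trans ?_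
  rw [← Finset.sum_filter, Finset.sum_const, nsmul_eq_mul]
  refine mul_le_mul_of_nonneg_right ?_ (by positivity)
  have h3 : ((gaps R).filter (· ∈ Finset.Ioc (min x m) (max x m))).card ≤ (max x m - min x m).toNat := by
    rw [← Int.card_Ioc]
    exact Finset.card_le_card fun i hi => (Finset.mem_filter.1 hi).2
  have h4 : (((max x m - min x m).toNat : ℕ) : ℝ) = |(x : ℝ) - m| := by
    have : (((max x m - min x m).toNat : ℕ) : ℤ) = |x - m| := by
      rw [Int.toNat_of_nonneg (by simp), max_sub_min_eq_abs']
    exact_mod_cast this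
  rw [← h4]
  exact_mod_cast h3

end SummationByParts
-- Characteristic functions of weighted sums of independent variables.
section ProductCharacteristicFunction

variable {Ω : Type*} [MeasurableSpace Ω] {μ : Measure Ω} [IsProbabilityMeasure μ]

lemma sq_le_one_add_rpow {α x : ℝ} (hα : 0 ≤ α) : x ^ 2 ≤ 1 + |x| ^ (2 + α) := by
  rcases le_total |x| 1 with h | h
  · have h1 : x ^ 2 ≤ 1 := by rw [← sq_abs]; exact pow_le_one₀ (abs_nonneg _) h
    have h2 : 0 ≤ |x| ^ (2 + α) := Real.rpow_nonneg (abs_nonneg _) _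
    linarith
  · have h1 : |x| ^ (2 : ℝ) ≤ |x| ^ (2 + α) := Real.rpow_le_rpow_of_exponent_le h (by linarith)
    rw [Real.rpow_two, sq_abs] at h1
    linarith

lemma abs_exp_neg_sub_exp_neg_le {a b : ℝ} (ha : 0 ≤ a) (hb : 0 ≤ b) :
    |Real.exp (-a) - Real.exp (-b)| ≤ |a - b| := by
  wlog h : a ≤ b generalizing a b
  · rw [abs_sub_comm, abs_sub_comm a]; exact this hb ha (le_of_not_ge h)
  have h1 : Real.exp (-b) = Real.exp (-a) * Real.exp (-(b - a)) := by
    rw [← Real.exp_add]; congr 1; ring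
  have h2 := Real.add_one_le_exp (-(b - a))
  have h3 : Real.exp (-a) ≤ 1 := Real.exp_le_one_iff.2 (by linarith)
  have h4 : Real.exp (-(b - a)) ≤ 1 := Real.exp_le_one_iff.2 (by linarith)
  rw [h1, abs_of_nonneg (by nlinarith [Real.exp_pos (-a)]), abs_of_nonpos (by linarith)]
  nlinarith [Real.exp_pos (-a)]

lemma norm_cexp_mul_exp_sub_le {a a' b b' : ℝ} (hb : 0 ≤ b) (hb' : 0 ≤ b') :
    ‖Complex.exp (a * Complex.I) * (Real.exp (-b) : ℂ)
      - Complex.exp (a' * Complex.I) * (Real.exp (-b') : ℂ)‖ ≤ |a - a'| + |b - b'| := by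
  have e1 : Complex.exp (a * Complex.I) * (Real.exp (-b) : ℂ)
      - Complex.exp (a' * Complex.I) * (Real.exp (-b') : ℂ)
      = (Complex.exp (a * Complex.I) - Complex.exp (a' * Complex.I)) * (Real.exp (-b) : ℂ)
        + Complex.exp (a' * Complex.I) * ((Real.exp (-b) - Real.exp (-b') : ℝ) : ℂ) := by
    push_cast; ring
  rw [e1]
  refine (norm_add_le _ _).trans (add_le_add ?_ ?_)
  · rw [norm_mul, Complex.norm_real, Real.norm_of_nonneg (Real.exp_pos _).le]
    have h1 := norm_exp_I_mul_sub_exp_I_mul_le a a'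
    have h2 : Real.exp (-b) ≤ 1 := Real.exp_le_one_iff.2 (by linarith)
    exact (mul_le_of_le_one_right (norm_nonneg _) h2).trans h1
  · rw [norm_mul, Complex.norm_exp_ofReal_mul_I, one_mul, Complex.norm_real, Real.norm_eq_abs]
    exact abs_exp_neg_sub_exp_neg_le hb hb'

/-- The second order expansion of a characteristic function, with moments of order `2 + α`. -/
lemma norm_charFun_sub_le {Y : Ω → ℝ} (hY : Measurable Y) {ρ v α C : ℝ} (hα : 0 ≤ α) (hα1 : α ≤ 1)
    (hint : Integrable (fun ω => |Y ω - ρ| ^ (2 + α)) μ)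
    (hC : ∫ ω, |Y ω - ρ| ^ (2 + α) ∂μ ≤ C) (hmean : ∫ ω, Y ω ∂μ = ρ)
    (hvar : variance Y μ = v) (t : ℝ) :
    ‖∫ ω, Complex.exp ((t * Y ω : ℝ) * Complex.I) ∂μ
      - Complex.exp ((t * ρ : ℝ) * Complex.I) * (Real.exp (-(t ^ 2 * v / 2)) : ℂ)‖
      ≤ 4 * |t| ^ (2 + α) * C + (t ^ 2 * v / 2) ^ 2 := by
  have hv : 0 ≤ v := hvar ▸ variance_nonneg Y μ
  set W : Ω → ℝ := fun ω => Y ω - ρ with hW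
  have hWm : Measurable W := hY.sub_const ρ
  have hW2 : Integrable (fun ω => W ω ^ 2) μ :=
    Integrable.mono' ((integrable_const 1).add hint) (hWm.pow_const 2).aestronglyMeasurable
      (Eventually.of_forall fun ω => by
        rw [Real.norm_of_nonneg (sq_nonneg _)]; exact sq_le_one_add_rpow hα)
  have hW1 : Integrable W μ :=
    Integrable.mono' ((integrable_const 1).add hW2) hWm.aestronglyMeasurable
      (Eventually.of_forall fun ω => by
        rw [Real.norm_eq_abs]
        simp only [Pi.add_apply]
        rw [← sq_abs]
        nlinarith [sq_nonneg (|W ω| - 1), abs_nonneg (W ω)])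
  have hY1 : Integrable Y μ :=
    (hW1.add (integrable_const ρ)).congr (Eventually.of_forall fun ω => by simp [hW])
  have hEW : ∫ ω, W ω ∂μ = 0 := by
    simp only [hW]
    rw [integral_sub hY1 (integrable_const _), hmean]; simp
  have hEW2 : ∫ ω, W ω ^ 2 ∂μ = v := by
    rw [← hvar, variance_eq_integral hY.aemeasurable, hmean]
  have iE : Integrable (fun ω => Complex.exp ((t * W ω : ℝ) * Complex.I)) μ :=
    integrable_of_bound (by fun_prop : Measurable fun ω =>
      Complex.exp ((t * W ω : ℝ) * Complex.I)).aestronglyMeasurable 1 fun ω =>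
        (Complex.norm_exp_ofReal_mul_I _).le
  have hfac : ∫ ω, Complex.exp ((t * Y ω : ℝ) * Complex.I) ∂μ
      = Complex.exp ((t * ρ : ℝ) * Complex.I)
        * ∫ ω, Complex.exp ((t * W ω : ℝ) * Complex.I) ∂μ := by
    rw [← integral_const_mul]
    refine integral_congr_ae (Eventually.of_forall fun ω => ?_)
    simp only [hW]
    rw [← Complex.exp_add]
    congr 1; push_cast; ring
  rw [hfac, ← mul_sub, norm_mul, Complex.norm_exp_ofReal_mul_I, one_mul]
  have iT : Integrable (fun ω => (1 : ℂ) + (t * W ω : ℝ) * Complex.I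
      - ((t * W ω : ℝ) : ℂ) ^ 2 / 2) μ := by
    have h1 := ((integrable_const (μ := μ) (1 : ℂ)).add
      ((hW1.const_mul t).ofReal.mul_const Complex.I)).sub ((hW2.const_mul (t ^ 2 / 2)).ofReal (𝕜 := ℂ))
    refine h1.congr (Eventually.of_forall fun ω => ?_)
    simp only [Pi.add_apply, Pi.sub_apply, RCLike.ofReal_mul, Complex.coe_algebraMap]
    push_cast
    simp
    ring
  have hT : ∫ ω, ((1 : ℂ) + (t * W ω : ℝ) * Complex.I - ((t * W ω : ℝ) : ℂ) ^ 2 / 2) ∂μ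
      = ((1 - t ^ 2 * v / 2 : ℝ) : ℂ) := by
    have a1 : ∀ ω, (1 : ℂ) + (t * W ω : ℝ) * Complex.I - ((t * W ω : ℝ) : ℂ) ^ 2 / 2
        = ((1 - t ^ 2 / 2 * W ω ^ 2 : ℝ) : ℂ) + ((t * W ω : ℝ) : ℂ) * Complex.I := by
      intro ω; push_cast; ring
    have i1 : Integrable (fun ω => 1 - t ^ 2 / 2 * W ω ^ 2) μ :=
      (integrable_const _).sub (hW2.const_mul _)
    simp_rw [a1]
    rw [integral_add i1.ofReal ((hW1.const_mul t).ofReal.mul_const _), integral_mul_const,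
      integral_complex_ofReal, integral_complex_ofReal, integral_const_mul, hEW,
      integral_sub (integrable_const _) (hW2.const_mul _), integral_const_mul, hEW2]
    simp
    ring
  have h1 : ‖∫ ω, Complex.exp ((t * W ω : ℝ) * Complex.I) ∂μ - ((1 - t ^ 2 * v / 2 : ℝ) : ℂ)‖
      ≤ 4 * |t| ^ (2 + α) * C := by
    rw [← hT, ← integral_sub iE iT]
    refine (norm_integral_le_integral_norm _).trans ?_
    refine le_trans ?_ (mul_le_mul_of_nonneg_left hC (by positivity))
    rw [← integral_const_mul]
    refine integral_mono (iE.sub iT).norm (hint.const_mul _) fun ω => ?_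
    refine (norm_cexp_sub_taylor_le hα hα1 (t * W ω)).trans_eq ?_
    rw [abs_mul, Real.mul_rpow (abs_nonneg _) (abs_nonneg _), mul_assoc]
  have h2 : ‖((1 - t ^ 2 * v / 2 : ℝ) : ℂ) - (Real.exp (-(t ^ 2 * v / 2)) : ℂ)‖
      ≤ (t ^ 2 * v / 2) ^ 2 := by
    rw [← Complex.ofReal_sub, Complex.norm_real, Real.norm_eq_abs, abs_sub_comm]
    exact abs_exp_neg_sub_le (by positivity)
  have h3 := (norm_add_le _ _).trans (add_le_add h1 h2)
  rwa [sub_add_sub_cancel] at h3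

/-- The characteristic function of a weighted sum of independent variables, compared to that of
a Gaussian law with a common mean and variance of the summands. -/
lemma norm_prod_charFun_sub_le {Y : ℤ → Ω → ℝ} (hY : ∀ i, Measurable (Y i)) {ρ v : ℤ → ℝ}
    {α C : ℝ} (hα : 0 ≤ α) (hα1 : α ≤ 1)
    (hint : ∀ i, Integrable (fun ω => |Y i ω - ρ i| ^ (2 + α)) μ)
    (hC : ∀ i, ∫ ω, |Y i ω - ρ i| ^ (2 + α) ∂μ ≤ C) (hmean : ∀ i, ∫ ω, Y i ω ∂μ = ρ i)
    (hvar : ∀ i, variance (Y i) μ = v i) {B : ℝ} (hB : ∀ i, |v i| ≤ B)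
    {ρ₀ v₀ κ : ℝ} (hv₀ : 0 ≤ v₀) (hκ : 0 ≤ κ) {g : ℤ → ℝ} (hg : ∀ i, 1 ≤ g i)
    (hρ : ∀ i, |ρ i - ρ₀| ≤ κ * g i) (hv : ∀ i, |v i - v₀| ≤ κ * g i)
    {G : ℤ → ℝ} {K : ℝ} (hG : ∀ i, |G i| ≤ K) {ε : ℝ} (hε : 0 ≤ ε) (I : Finset ℤ) :
    ‖∏ i ∈ I, ∫ ω, Complex.exp ((ε * G i * Y i ω : ℝ) * Complex.I) ∂μ
      - Complex.exp ((ρ₀ * (ε * ∑ i ∈ I, G i) : ℝ) * Complex.I)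
        * (Real.exp (-(v₀ * (ε ^ 2 * ∑ i ∈ I, G i ^ 2) / 2)) : ℂ)‖
      ≤ (4 * C * (ε ^ (2 + α) * K ^ (1 + α)) + ε ^ 4 * K ^ 3 * B ^ 2 + ε * κ + ε ^ 2 * K * κ)
        * ∑ i ∈ I, |G i| * g i := by
  have hv0 : ∀ i, 0 ≤ v i := fun i => hvar i ▸ variance_nonneg (Y i) μ
  have hK : 0 ≤ K := (abs_nonneg _).trans (hG 0)
  have hC0 : 0 ≤ C := le_trans (integral_nonneg fun ω => by positivity) (hC 0)
  have h1 : ‖∏ i ∈ I, ∫ ω, Complex.exp ((ε * G i * Y i ω : ℝ) * Complex.I) ∂μ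
      - ∏ i ∈ I, Complex.exp ((ε * G i * ρ i : ℝ) * Complex.I)
        * (Real.exp (-((ε * G i) ^ 2 * v i / 2)) : ℂ)‖
      ≤ ∑ i ∈ I, (4 * C * (ε ^ (2 + α) * K ^ (1 + α)) + ε ^ 4 * K ^ 3 * B ^ 2) * (|G i| * g i) := by
    refine (norm_prod_sub_prod_le I (fun i _ => ?_) (fun i _ => ?_)).trans
      (Finset.sum_le_sum fun i _ => ?_)
    · refine (norm_integral_le_integral_norm _).trans ?_
      simp_rw [Complex.norm_exp_ofReal_mul_I]
      simp
    · rw [norm_mul, Complex.norm_exp_ofReal_mul_I, one_mul, Complex.norm_real,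
        Real.norm_of_nonneg (Real.exp_pos _).le, Real.exp_le_one_iff]
      have := mul_nonneg (sq_nonneg (ε * G i)) (hv0 i)
      linarith
    · refine (norm_charFun_sub_le (hY i) hα hα1 (hint i) (hC i) (hmean i) (hvar i) _).trans ?_
      have hGi := abs_nonneg (G i)
      -- One factor `|G i|` is kept and the others are bounded by `K`, so that every error is linear
      -- in `∑ |G i|`, the quantity with a controlled mean.
      have b1 : |ε * G i| ^ (2 + α) ≤ ε ^ (2 + α) * K ^ (1 + α) * |G i| := by
        rw [abs_mul, abs_of_nonneg hε, Real.mul_rpow hε hGi, mul_assoc]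
        refine mul_le_mul_of_nonneg_left ?_ (by positivity)
        rw [show 2 + α = (1 + α) + 1 by ring, Real.rpow_add_one' hGi (by linarith)]
        exact mul_le_mul_of_nonneg_right (Real.rpow_le_rpow hGi (hG i) (by linarith)) hGi
      have b2 : ((ε * G i) ^ 2 * v i / 2) ^ 2 ≤ ε ^ 4 * K ^ 3 * B ^ 2 * |G i| := by
        have c1 : v i ^ 2 ≤ B ^ 2 := by
          rw [← sq_abs]; exact pow_le_pow_left₀ (abs_nonneg _) (hB i) 2
        have c2 : G i ^ 4 ≤ K ^ 3 * |G i| := by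
          have : G i ^ 4 = |G i| ^ 3 * |G i| := by
            rw [← pow_succ, Even.pow_abs (by decide)]
          rw [this]
          exact mul_le_mul_of_nonneg_right (pow_le_pow_left₀ hGi (hG i) 3) hGi
        calc ((ε * G i) ^ 2 * v i / 2) ^ 2 = ε ^ 4 * (G i ^ 4 * v i ^ 2) / 4 := by ring
          _ ≤ ε ^ 4 * (K ^ 3 * |G i| * B ^ 2) / 4 := by gcongr
          _ ≤ ε ^ 4 * (K ^ 3 * |G i| * B ^ 2) := by
            have : 0 ≤ ε ^ 4 * (K ^ 3 * |G i| * B ^ 2) := by positivity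
            linarith
          _ = _ := by ring
      calc _ ≤ 4 * (ε ^ (2 + α) * K ^ (1 + α) * |G i|) * C + ε ^ 4 * K ^ 3 * B ^ 2 * |G i| := by
            gcongr
        _ = (4 * C * (ε ^ (2 + α) * K ^ (1 + α)) + ε ^ 4 * K ^ 3 * B ^ 2) * (|G i| * 1) := by ring
        _ ≤ _ := by
          refine mul_le_mul_of_nonneg_left (mul_le_mul_of_nonneg_left (hg i) hGi) ?_
          positivity
  have e1 : ∏ i ∈ I, Complex.exp ((ε * G i * ρ i : ℝ) * Complex.I)
        * (Real.exp (-((ε * G i) ^ 2 * v i / 2)) : ℂ)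
      = Complex.exp ((∑ i ∈ I, ε * G i * ρ i : ℝ) * Complex.I)
        * (Real.exp (-(∑ i ∈ I, (ε * G i) ^ 2 * v i / 2)) : ℂ) := by
    rw [Finset.prod_mul_distrib, ← Complex.exp_sum, ← Complex.ofReal_prod, ← Real.exp_sum,
      ← Finset.sum_mul, Complex.ofReal_sum, Finset.sum_neg_distrib]
  have h2 := norm_cexp_mul_exp_sub_le (a := ∑ i ∈ I, ε * G i * ρ i)
    (a' := ρ₀ * (ε * ∑ i ∈ I, G i)) (b := ∑ i ∈ I, (ε * G i) ^ 2 * v i / 2)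
    (b' := v₀ * (ε ^ 2 * ∑ i ∈ I, G i ^ 2) / 2)
    (Finset.sum_nonneg fun i _ => div_nonneg (mul_nonneg (sq_nonneg _) (hv0 i)) zero_le_two)
    (by have : 0 ≤ ∑ i ∈ I, G i ^ 2 := Finset.sum_nonneg fun i _ => sq_nonneg _
        positivity)
  rw [← e1] at h2
  have h3 : |∑ i ∈ I, ε * G i * ρ i - ρ₀ * (ε * ∑ i ∈ I, G i)|
      ≤ ∑ i ∈ I, ε * κ * (|G i| * g i) := by
    have : ∑ i ∈ I, ε * G i * ρ i - ρ₀ * (ε * ∑ i ∈ I, G i)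
        = ∑ i ∈ I, ε * (G i * (ρ i - ρ₀)) := by
      rw [Finset.mul_sum, Finset.mul_sum, ← Finset.sum_sub_distrib]
      exact Finset.sum_congr rfl fun i _ => by ring
    rw [this]
    refine (Finset.abs_sum_le_sum_abs _ _).trans (Finset.sum_le_sum fun i _ => ?_)
    rw [abs_mul, abs_mul, abs_of_nonneg hε]
    calc ε * (|G i| * |ρ i - ρ₀|) ≤ ε * (|G i| * (κ * g i)) := by gcongr; exact hρ i
      _ = _ := by ring
  have h4 : |∑ i ∈ I, (ε * G i) ^ 2 * v i / 2 - v₀ * (ε ^ 2 * ∑ i ∈ I, G i ^ 2) / 2|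
      ≤ ∑ i ∈ I, ε ^ 2 * K * κ * (|G i| * g i) := by
    have : ∑ i ∈ I, (ε * G i) ^ 2 * v i / 2 - v₀ * (ε ^ 2 * ∑ i ∈ I, G i ^ 2) / 2
        = ∑ i ∈ I, ε ^ 2 * (G i ^ 2 * (v i - v₀)) / 2 := by
      rw [Finset.mul_sum, Finset.mul_sum, Finset.sum_div, ← Finset.sum_sub_distrib]
      exact Finset.sum_congr rfl fun i _ => by ring
    rw [this]
    refine (Finset.abs_sum_le_sum_abs _ _).trans (Finset.sum_le_sum fun i _ => ?_)
    have hGi := abs_nonneg (G i)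
    have hgi := zero_le_one.trans (hg i)
    rw [abs_div, abs_mul, abs_mul, abs_of_nonneg (sq_nonneg ε), abs_of_nonneg (sq_nonneg (G i)),
      abs_two, ← sq_abs (G i), sq |G i|]
    calc ε ^ 2 * (|G i| * |G i| * |v i - v₀|) / 2 ≤ ε ^ 2 * (K * |G i| * (κ * g i)) / 2 := by
          gcongr
          exacts [hG i, hv i]
      _ ≤ ε ^ 2 * (K * |G i| * (κ * g i)) := by
        have : 0 ≤ ε ^ 2 * (K * |G i| * (κ * g i)) := by positivity
        linarith
      _ = _ := by ring
  have h5 := (norm_add_le _ _).trans (add_le_add h1 (h2.trans (add_le_add h3 h4)))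
  rw [sub_add_sub_cancel] at h5
  refine h5.trans_eq ?_
  rw [← Finset.mul_sum, ← Finset.mul_sum, ← Finset.mul_sum]
  ring

end ProductCharacteristicFunction
-- Conditioning on the weights; sums of squared tails.
section InitialHeights

variable {Ω : Type*} [MeasurableSpace Ω] {μ : Measure Ω} [IsProbabilityMeasure μ] {M : ℕ}
  {w : Ω → ℤ → ℝ}

/-- Conditioning on the weights of a sum of independent variables. -/
lemma integral_cexp_sum_mul_of_indep (I : Finset ℤ) {G Y : ℤ → Ω → ℝ}
    (hG : ∀ i, Measurable (G i)) (hY : ∀ i, Measurable (Y i))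
    (hGY : IndepFun (fun ω (i : I) => G i ω) (fun ω (i : I) => Y i ω) μ) (hind : iIndepFun Y μ)
    (t : ℝ) :
    ∫ ω, Complex.exp ((∑ i ∈ I, t * G i ω * Y i ω : ℝ) * Complex.I) ∂μ
      = ∫ ω, ∏ i ∈ I, ∫ ω', Complex.exp ((t * G i ω * Y i ω' : ℝ) * Complex.I) ∂μ ∂μ := by
  have hX : Measurable fun ω (i : I) => G i ω := measurable_pi_lambda _ fun i => hG i
  have hZ : Measurable fun ω (i : I) => Y i ω := measurable_pi_lambda _ fun i => hY i
  set F : (I → ℝ) × (I → ℝ) → ℂ := fun p => Complex.exp ((∑ i, t * p.1 i * p.2 i : ℝ) * Complex.I)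
  have hF : Continuous F := by fun_prop
  have hFb : ∀ p, ‖F p‖ ≤ 1 := fun p => (Complex.norm_exp_ofReal_mul_I _).le
  have hmap := (indepFun_iff_map_prod_eq_prod_map_map hX.aemeasurable hZ.aemeasurable).1 hGY
  have := Measure.isProbabilityMeasure_map (μ := μ) hX.aemeasurable
  have := Measure.isProbabilityMeasure_map (μ := μ) hZ.aemeasurable
  have h1 : ∫ ω, F (fun i => G i ω, fun i => Y i ω) ∂μ
      = ∫ ω, ∫ ω', F (fun i => G i ω, fun i => Y i ω') ∂μ ∂μ := by
    have hFi : Integrable F ((μ.map fun ω (i : I) => G i ω).prod (μ.map fun ω (i : I) => Y i ω)) :=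
      Integrable.of_bound hF.aestronglyMeasurable 1 (Eventually.of_forall hFb)
    have h2 : ∫ ω, F (fun i => G i ω, fun i => Y i ω) ∂μ
        = ∫ p, F p ∂(μ.map fun ω => ((fun i : I => G i ω), fun i : I => Y i ω)) :=
      (integral_map (hX.prodMk hZ).aemeasurable hF.aestronglyMeasurable).symm
    have h3 : ∀ x, ∫ z, F (x, z) ∂(μ.map fun ω (i : I) => Y i ω)
        = ∫ ω', F (x, fun i => Y i ω') ∂μ := fun x =>
      integral_map hZ.aemeasurable (hF.comp (by fun_prop)).aestronglyMeasurable
    rw [h2, hmap, integral_prod _ hFi, integral_map hX.aemeasurable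
      hFi.integral_prod_left.aestronglyMeasurable]
    simp_rw [h3]
  have h4 : ∀ ω, F (fun i => G i ω, fun i => Y i ω)
      = Complex.exp ((∑ i ∈ I, t * G i ω * Y i ω : ℝ) * Complex.I) := by
    intro ω
    simp only [F]
    rw [Finset.sum_coe_sort I (fun i => t * G i ω * Y i ω)]
  simp_rw [← h4, h1]
  refine integral_congr_ae (Eventually.of_forall fun ω => ?_)
  change ∫ ω', F (fun i => G i ω, fun i => Y i ω') ∂μ = _
  have h5 : ∀ ω', F (fun i => G i ω, fun i => Y i ω')
      = ∏ i : I, Complex.exp ((t * G i ω * Y i ω' : ℝ) * Complex.I) := by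
    intro ω'
    simp only [F]
    rw [← Complex.exp_sum, ← Finset.sum_mul, Complex.ofReal_sum]
  simp_rw [h5]
  have hI : iIndepFun (fun i : I => Y i) μ := hind.precomp Subtype.val_injective
  have h6 := hI.integral_fun_prod_comp
    (f := fun (i : I) (y : ℝ) => Complex.exp ((t * G i ω * y : ℝ) * Complex.I))
    (fun i => (hY i).aemeasurable) (fun i => (by fun_prop : Measurable fun y : ℝ =>
      Complex.exp ((t * G i ω * y : ℝ) * Complex.I)).aestronglyMeasurable)
  rw [h6, Finset.prod_coe_sort I fun i => ∫ ω', Complex.exp ((t * G i ω * Y i ω' : ℝ) * Complex.I) ∂μ]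

lemma pairSum_sum {L : Type*} (s : Finset L) (R : ℕ) (θ : L → ℝ) (q : L → ℤ → ℝ) (F : ℤ → ℝ) :
    pairSum R (fun x => ∑ l ∈ s, θ l * q l x) (fun x => ∑ l ∈ s, θ l * q l x) F
      = ∑ l ∈ s, ∑ l' ∈ s, θ l * θ l' * pairSum R (q l) (q l') F := by
  have e : ∀ x y : ℤ, (∑ l ∈ s, θ l * q l x) * (∑ l ∈ s, θ l * q l y) * F (x - y)
      = ∑ l ∈ s, ∑ l' ∈ s, θ l * θ l' * (q l x * q l' y * F (x - y)) := by
    intro x y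
    rw [Finset.sum_mul_sum, Finset.sum_mul]
    refine Finset.sum_congr rfl fun l _ => ?_
    rw [Finset.sum_mul]
    exact Finset.sum_congr rfl fun l' _ => by ring
  simp only [pairSum, e]
  simp only [Finset.mul_sum]
  trans ∑ x ∈ box R, ∑ l ∈ s, ∑ y ∈ box R, ∑ l' ∈ s,
    θ l * θ l' * (q l x * q l' y * F (x - y))
  · exact Finset.sum_congr rfl fun x _ => Finset.sum_comm
  rw [Finset.sum_comm]
  refine Finset.sum_congr rfl fun l _ => ?_
  trans ∑ x ∈ box R, ∑ l' ∈ s, ∑ y ∈ box R, θ l * θ l' * (q l x * q l' y * F (x - y))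
  · exact Finset.sum_congr rfl fun x _ => Finset.sum_comm
  exact Finset.sum_comm

/-- The limit of the squared tail sums of a signed combination of quenched walks. -/
lemma tendsto_integral_abs_sum_tail_sq_sub (hspan : HasSpanOne (avgProb μ w))
    (hell : Elliptic μ M w) {e : ℕ+ → ℕ → ℤ → Ω → ℤ → ℝ} (he : ∀ n, IsEnv μ M w (e n))
    {L : Type*} [Fintype L] {s : L → ℕ+ → ℕ} {N R : ℕ+ → ℕ} {k : L → ℕ+ → ℤ}
    (hs : ∀ j n, s j n ≤ N n) (hR : ∀ j n, |k j n| + M * N n ≤ R n) {T : ℝ}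
    (hT : ∀ n, (N n : ℝ) ≤ T * n) (t r : L → ℝ)
    (ht : ∀ j, Tendsto (fun n : ℕ+ => ((N n - s j n : ℕ) : ℝ) / n) atTop (𝓝 (t j)))
    (hd : ∀ i j, Tendsto (fun n : ℕ+ => (center (meanDrift μ M w) (s i n) (k i n) (N n)
      - center (meanDrift μ M w) (s j n) (k j n) (N n)) / √n) atTop (𝓝 (r i - r j)))
    (θ : L → ℝ) (hθ : ∑ j, θ j = 0) :
    Tendsto (fun n : ℕ+ => ∫ ω, |(√n)⁻¹ * ∑ i ∈ gaps (R n), tail (R n) (fun x => ∑ j, θ j *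
        qmass M (e n) (s j n) (k j n) (N n) ω x) i ^ 2
      - -((∑ i, ∑ j, θ i * θ j * gaussAbs (r i - r j) (avgVar μ M w * (t i + t j))) / 2)| ∂μ)
      atTop (𝓝 0) := by
  set q : ℕ+ → L → Ω → ℤ → ℝ := fun n j ω => qmass M (e n) (s j n) (k j n) (N n) ω
  set P : ℕ+ → L → L → Ω → ℝ := fun n i j ω =>
    (√n)⁻¹ * pairSum (R n) (q n i ω) (q n j ω) fun z => |(z : ℝ)|
  set g : L → L → ℝ := fun i j => gaussAbs (r i - r j) (avgVar μ M w * (t i + t j))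
  have hP : ∀ n i j, BddMeas ‹MeasurableSpace Ω› (P n i j) := fun n i j =>
    (((he n).bddMeas_pairSum _ _ _ _ _ _ _).mono ((he n).info_le _)).const_mul _
  have hlim : ∀ i j, Tendsto (fun n => ∫ ω, |P n i j ω - g i j| ∂μ) atTop (𝓝 0) := fun i j =>
    tendsto_integral_abs_pairSum_sub hspan hell he (hs i) (hs j) (hR i) (hR j) hT
      (ht i) (ht j) (hd i j)
  have hsum : ∀ (n : ℕ+) ω, ∑ x ∈ box (R n), ∑ j, θ j * q n j ω x = 0 := by
    intro n ω
    rw [Finset.sum_comm]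
    simp_rw [← Finset.mul_sum]
    rw [← hθ]
    exact Finset.sum_congr rfl fun j _ => by
      rw [(he n).sum_qmass (hs j n) (hR j n), mul_one]
  have hkey : ∀ (n : ℕ+) ω, |(√(n : ℝ))⁻¹ * ∑ i ∈ gaps (R n), tail (R n) (fun x => ∑ j, θ j *
        q n j ω x) i ^ 2 - -((∑ i, ∑ j, θ i * θ j * g i j) / 2)|
      ≤ ∑ i, ∑ j, |θ i * θ j| * |P n i j ω - g i j| := by
    intro n ω
    rw [sum_tail_sq (hsum n ω), pairSum_sum]
    have e1 : (√(n : ℝ))⁻¹ * -((∑ i, ∑ j, θ i * θ j * pairSum (R n) (q n i ω) (q n j ω)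
        fun z => |(z : ℝ)|) / 2) - -((∑ i, ∑ j, θ i * θ j * g i j) / 2)
        = -((∑ i, ∑ j, θ i * θ j * (P n i j ω - g i j)) / 2) := by
      simp_rw [mul_sub, Finset.sum_sub_distrib]
      have : ∑ i, ∑ j, θ i * θ j * P n i j ω = (√(n : ℝ))⁻¹ * ∑ i, ∑ j, θ i * θ j *
          pairSum (R n) (q n i ω) (q n j ω) fun z => |(z : ℝ)| := by
        rw [Finset.mul_sum]
        refine Finset.sum_congr rfl fun i _ => ?_
        rw [Finset.mul_sum]
        exact Finset.sum_congr rfl fun j _ => by simp only [P]; ring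
      rw [this]; ring
    rw [e1, abs_neg, abs_div, abs_two]
    refine (half_le_self (abs_nonneg _)).trans ?_
    refine (Finset.abs_sum_le_sum_abs _ _).trans (Finset.sum_le_sum fun i _ => ?_)
    refine (Finset.abs_sum_le_sum_abs _ _).trans (Finset.sum_le_sum fun j _ => ?_)
    rw [abs_mul]
  have hi : ∀ n i j, Integrable (fun ω => |θ i * θ j| * |P n i j ω - g i j|) μ := fun n i j =>
    ((hP n i j).sub (BddMeas.const _)).integrable.abs.const_mul _
  refine squeeze_zero (fun n => integral_nonneg fun _ => abs_nonneg _) (fun n => ?_)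
    (g := fun n => ∑ i, ∑ j, |θ i * θ j| * ∫ ω, |P n i j ω - g i j| ∂μ) ?_
  · simp_rw [← integral_const_mul]
    simp_rw [← integral_finsetSum _ fun j _ => hi n _ j]
    rw [← integral_finsetSum _ fun i _ => integrable_finsetSum _ fun j _ => hi n i j]
    exact integral_mono_of_nonneg (Eventually.of_forall fun ω => abs_nonneg _)
      (integrable_finsetSum _ fun i _ => integrable_finsetSum _ fun j _ => hi n i j)
      (Eventually.of_forall fun ω => hkey n ω)
  · have := tendsto_finsetSum (s := Finset.univ) fun i _ =>
      tendsto_finsetSum (s := Finset.univ) fun j _ => (hlim i j).const_mul |θ i * θ j|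
    simpa using this

end InitialHeights
-- First moments of tail sums.
section QuenchedHeights

variable {Ω : Type*} [MeasurableSpace Ω] {μ : Measure Ω} [IsProbabilityMeasure μ] {M : ℕ}
  {w : Ω → ℤ → ℝ}

lemma mul_one_add_div_le {u D A B : ℝ} (hD : 0 < D) (hu : 0 ≤ u) (hA : 0 ≤ A)
    (hB : B ≤ A * D) : u * (1 + (u + B) / D) ≤ (2 + A) * (u ^ 2 / D) + (1 + A) * D := by
  have h1 : u ≤ u ^ 2 / D + D := by
    rw [← sub_nonneg]
    have : u ^ 2 / D + D - u = ((u - D / 2) ^ 2 + 3 / 4 * D ^ 2) / D := by field_simp; ring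
    rw [this]; positivity
  have h2 : B / D ≤ A := by rwa [div_le_iff₀ hD]
  have h3 : u * (1 + (u + B) / D) ≤ u ^ 2 / D + (1 + A) * u := by
    have : u * (1 + (u + B) / D) = u ^ 2 / D + u + u * (B / D) := by field_simp; ring
    rw [this]
    nlinarith
  have h4 : (1 + A) * u ≤ (1 + A) * (u ^ 2 / D + D) :=
    mul_le_mul_of_nonneg_left h1 (by linarith)
  linarith

/-- The first moment bound of the tail sums of a quenched walk around a nearby point. -/
lemma IsEnv.integral_sum_abs_tail_le {e : ℕ → ℤ → Ω → ℤ → ℝ} (he : IsEnv μ M w e) {s N R : ℕ}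
    {k m : ℤ} (hs : s ≤ N) (hR : |k| + M * N ≤ R) (hm : m ∈ box R) {B : ℝ}
    (hB : |center (meanDrift μ M w) s k N - m| ≤ B) {D A c : ℝ} (hD : 0 < D) (hA : 0 ≤ A)
    (hc : |m - c| ≤ A * D) :
    ∫ ω, ∑ i ∈ gaps R, |tail R (fun x => qmass M e s k N ω x - dirac m x) i| * (1 + |i - c| / D) ∂μ
      ≤ (2 + A) * ((2 * (((N : ℝ) - s) * avgVar μ M w) + 2 * B ^ 2) / D) + (1 + A) * D := by
  set V := meanDrift μ M w
  set q := qmass M e s k N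
  have hq : ∀ x, BddMeas ‹MeasurableSpace Ω› fun ω => q ω x := fun x =>
    (he.bddMeas_qmass s k N x).mono (he.info_le _)
  have hsq : Integrable (fun ω => ∑ x ∈ box R, q ω x * ((x : ℝ) - center V s k N) ^ 2) μ :=
    (BddMeas.sum _ fun x => (hq x).mul_const _).integrable
  have hpt : ∀ ω, ∑ i ∈ gaps R, |tail R (fun x => q ω x - dirac m x) i| * (1 + |i - c| / D)
      ≤ (2 + A) * ((2 * (∑ x ∈ box R, q ω x * ((x : ℝ) - center V s k N) ^ 2) + 2 * B ^ 2) / D)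
        + (1 + A) * D := by
    intro ω
    have hq0 := he.qmass_nonneg s k N ω
    have hq1 := he.sum_qmass hs hR ω
    refine (sum_abs_tail_sub_dirac_mul_le hq0 hq1 hm hD c).trans ?_
    have h1 : ∀ x ∈ box R, q ω x * (|(x : ℝ) - m| * (1 + (|(x : ℝ) - m| + |m - c|) / D))
        ≤ (2 + A) / D * (2 * (q ω x * ((x : ℝ) - center V s k N) ^ 2) + 2 * B ^ 2 * q ω x)
          + (1 + A) * D * q ω x := by
      intro x _
      have h := mul_one_add_div_le hD (abs_nonneg ((x : ℝ) - m)) hA hc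
      have h2 : |(x : ℝ) - m| ^ 2 ≤ 2 * ((x : ℝ) - center V s k N) ^ 2 + 2 * B ^ 2 := by
        have h3 : (center V s k N - m) ^ 2 ≤ B ^ 2 := by
          rw [← sq_abs]; exact pow_le_pow_left₀ (abs_nonneg _) hB 2
        rw [sq_abs]
        nlinarith [sq_nonneg (((x : ℝ) - center V s k N) - (center V s k N - m))]
      calc _ ≤ q ω x * ((2 + A) * ((2 * ((x : ℝ) - center V s k N) ^ 2 + 2 * B ^ 2) / D)
            + (1 + A) * D) := by
            refine mul_le_mul_of_nonneg_left (h.trans ?_) (hq0 x)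
            gcongr
        _ = _ := by ring
    refine (Finset.sum_le_sum h1).trans_eq ?_
    rw [Finset.sum_add_distrib, ← Finset.mul_sum, ← Finset.mul_sum, Finset.sum_add_distrib,
      ← Finset.mul_sum, ← Finset.mul_sum, hq1]
    ring
  rw [← he.integral_sum_qmass_mul_sq hs hR]
  have i1 : Integrable (fun ω => 2 * ∑ x ∈ box R, q ω x * ((x : ℝ) - center V s k N) ^ 2
      + 2 * B ^ 2) μ := (hsq.const_mul 2).add (integrable_const _)
  have i2 : Integrable (fun ω => (2 + A) * ((2 * ∑ x ∈ box R, q ω x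
      * ((x : ℝ) - center V s k N) ^ 2 + 2 * B ^ 2) / D)) μ := (i1.div_const D).const_mul (2 + A)
  refine (integral_mono_of_nonneg (Eventually.of_forall fun ω => Finset.sum_nonneg fun i _ => by
    positivity) (i2.add (integrable_const _)) (Eventually.of_forall hpt)).trans_eq ?_
  rw [integral_add' i2 (integrable_const _), integral_const_mul, integral_div,
    integral_add (hsq.const_mul 2) (integrable_const _), integral_const_mul]
  simp [q, V]

end QuenchedHeights
-- The central limit theorem for the heights.
section HeightsCLT

variable {Ω : Type*} [MeasurableSpace Ω] {μ : Measure Ω} [IsProbabilityMeasure μ] {M : ℕ}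
  {w : Ω → ℤ → ℝ}

lemma dirac_eq_qmass (M : ℕ) (e : ℕ → ℤ → Ω → ℤ → ℝ) (N : ℕ) (m : ℤ) (ω : Ω) :
    qmass M e N m N ω = dirac m := by
  funext x; rw [qmass, mass_self, dirac]

lemma exists_bound_of_tendsto {J : Type*} [Fintype J] {f : J → ℕ+ → ℝ} {r : J → ℝ}
    (h : ∀ j, Tendsto (f j) atTop (𝓝 (r j))) : ∃ A, 0 ≤ A ∧ ∀ᶠ n in atTop, ∀ j, |f j n| ≤ A := by
  refine ⟨∑ j, (|r j| + 1), by positivity, eventually_all.2 fun j => ?_⟩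
  filter_upwards [(h j).abs.eventually (eventually_le_nhds (lt_add_one |r j|))] with n hn
  exact hn.trans (Finset.single_le_sum (f := fun j => |r j| + 1) (fun i _ => by positivity)
    (Finset.mem_univ j))

/-- The left copy of `J` carries the walks with coefficients `θ`, the right copy the point masses,
treated as walks of duration zero with coefficients `-θ`. The four blocks combine into `Γ₀`. -/
lemma sum_sum_gaussAbs {J : Type*} [Fintype J] (θ : J → ℝ) (a : J → ℝ≥0 × ℝ) {σ : ℝ}
    (hσ : 0 ≤ σ) :
    -((∑ i : J ⊕ J, ∑ j : J ⊕ J, (Sum.elim θ (-θ) i) * (Sum.elim θ (-θ) j)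
      * gaussAbs (Sum.elim (fun j => (a j).2) (fun j => (a j).2) i
          - Sum.elim (fun j => (a j).2) (fun j => (a j).2) j)
        (σ * (Sum.elim (fun j => ((a j).1 : ℝ)) (fun _ => 0) i
          + Sum.elim (fun j => ((a j).1 : ℝ)) (fun _ => 0) j))) / 2)
      = ∑ i, ∑ j, θ i * θ j * Gamma0 σ (a i) (a j) := by
  simp only [Fintype.sum_sum_type, Sum.elim_inl, Sum.elim_inr, Pi.neg_apply, add_zero, zero_add,
    mul_zero, gaussAbs_zero, ← Finset.sum_add_distrib]
  rw [Finset.sum_div, ← Finset.sum_neg_distrib]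
  refine Finset.sum_congr rfl fun i _ => ?_
  rw [Finset.sum_div, ← Finset.sum_neg_distrib]
  refine Finset.sum_congr rfl fun j _ => ?_
  rw [Gamma0_eq hσ, ← neg_sub (a i).2 (a j).2, gaussAbs_neg]
  ring

variable {e : ℕ+ → ℕ → ℤ → Ω → ℤ → ℝ} {J : Type*} [Fintype J]

/-- The central limit theorem for the heights, in terms of the increments of the initial
heights and the tail sums of the quenched walks. -/
theorem tendsto_integral_cexp_heights (hspan : HasSpanOne (avgProb μ w))
    (hell : Elliptic μ M w) (he : ∀ n, IsEnv μ M w (e n))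
    {s : J → ℕ+ → ℕ} {N R : ℕ+ → ℕ} {k pt : J → ℕ+ → ℤ} (hs : ∀ j n, s j n ≤ N n)
    (hR : ∀ j n, |k j n| + M * N n ≤ R n) (hR' : ∀ j n, |pt j n| + M * N n ≤ R n) {T : ℝ}
    (hT : ∀ n, (N n : ℝ) ≤ T * n) (a : J → ℝ≥0 × ℝ)
    (ha : ∀ j, Tendsto (fun n : ℕ+ => ((N n - s j n : ℕ) : ℝ) / n) atTop (𝓝 (a j).1))
    {c : ℕ+ → ℝ} (hpt : ∀ j, Tendsto (fun n : ℕ+ => ((pt j n : ℝ) - c n) / √n) atTop (𝓝 (a j).2))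
    {B : ℝ} (hcen : ∀ j n, |center (meanDrift μ M w) (s j n) (k j n) (N n) - pt j n| ≤ B)
    {Y : ℕ+ → ℤ → Ω → ℝ} (hY : ∀ n i, Measurable (Y n i)) {ρ v : ℕ+ → ℤ → ℝ} {α C : ℝ}
    (hα : 0 < α) (hα1 : α ≤ 1) (hint : ∀ n i, Integrable (fun ω => |Y n i ω - ρ n i| ^ (2 + α)) μ)
    (hC : ∀ n i, ∫ ω, |Y n i ω - ρ n i| ^ (2 + α) ∂μ ≤ C) (hmean : ∀ n i, ∫ ω, Y n i ω ∂μ = ρ n i)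
    (hvar : ∀ n i, variance (Y n i) μ = v n i) {b : ℝ} (hb : ∀ n i, |v n i| ≤ b)
    {ρ₀ v₀ : ℝ} {κ : ℕ+ → ℝ} (hv₀ : 0 ≤ v₀) (hκ : ∀ n, 0 ≤ κ n)
    (hκlim : Tendsto (fun n : ℕ+ => (n : ℝ) ^ (1 / 4 : ℝ) * κ n) atTop (𝓝 0))
    (hρ : ∀ n i, |ρ n i - ρ₀| ≤ κ n * (1 + |i - c n| / √n))
    (hv : ∀ n i, |v n i - v₀| ≤ κ n * (1 + |i - c n| / √n))
    (hind : ∀ n, iIndepFun (Y n) μ)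
    (hindep : ∀ n, Indep (info (e n) Set.univ)
      (MeasurableSpace.comap (fun ω i => Y n i ω) MeasurableSpace.pi) μ) (θ : J → ℝ) :
    Tendsto (fun n : ℕ+ => ∫ ω, Complex.exp (((n : ℝ) ^ (-(1 / 4) : ℝ) * ∑ j, θ j *
      ∑ i ∈ gaps (R n), tail (R n) (fun x => qmass M (e n) (s j n) (k j n) (N n) ω x
        - dirac (pt j n) x) i * Y n i ω : ℝ) * Complex.I) ∂μ) atTop
      (𝓝 (Real.exp (-((∑ i, ∑ j, θ i * θ j
        * (ρ₀ ^ 2 * GammaQ (kappa μ M w) (avgVar μ M w) (a i) (a j)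
          + v₀ * Gamma0 (avgVar μ M w) (a i) (a j))) / 2)) : ℝ)) := by
  set V := meanDrift μ M w
  set q : ℕ+ → J → Ω → ℤ → ℝ := fun n j ω => qmass M (e n) (s j n) (k j n) (N n) ω
  set ε : ℕ+ → ℝ := fun n => (n : ℝ) ^ (-(1 / 4) : ℝ)
  set K := ∑ j, |θ j|
  set G : ℕ+ → ℤ → Ω → ℝ := fun n i ω => tail (R n) (fun x => ∑ j, θ j * (q n j ω x
    - dirac (pt j n) x)) i
  set Q₀ := ∑ i, ∑ j, θ i * θ j * Gamma0 (avgVar μ M w) (a i) (a j)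
  set Qq := ∑ i, ∑ j, θ i * θ j * GammaQ (kappa μ M w) (avgVar μ M w) (a i) (a j)
  set S : ℕ+ → Ω → ℝ := fun n ω => ε n ^ 2 * ∑ i ∈ gaps (R n), G n i ω ^ 2
  set L : ℕ+ → Ω → ℝ := fun n ω => ε n * ∑ i ∈ gaps (R n), G n i ω
  set g : ℕ+ → ℤ → ℝ := fun n i => 1 + |i - c n| / √n
  have hε0 : ∀ n, 0 ≤ ε n := rpow_neg_quarter_nonneg
  have hεlim : Tendsto ε atTop (𝓝 0) := tendsto_rpow_neg_quarter
  have hε2 : ∀ n : ℕ+, ε n ^ 2 = (√(n : ℝ))⁻¹ := rpow_neg_quarter_sq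
  have hσ : 0 ≤ avgVar μ M w := by
    rw [avgVar_eq (he 1).base_measurable (he 1).base_isProbVec]
    exact vecVar_nonneg (he 1).isProbVec_avg
  have hm : ∀ j n, pt j n ∈ box (R n) := fun j n => mem_box.2 (le_trans (by
    have : (0 : ℤ) ≤ M * N n := by positivity
    linarith) (hR' j n))
  have hq1 : ∀ n j ω, ∑ x ∈ box (R n), q n j ω x = 1 := fun n j ω =>
    (he n).sum_qmass (hs j n) (hR j n) ω
  have hq0 : ∀ n j ω x, 0 ≤ q n j ω x := fun n j ω x => (he n).qmass_nonneg ..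
  have hGsum : ∀ n i ω, G n i ω = ∑ j, θ j * tail (R n) (fun x => q n j ω x - dirac (pt j n) x) i :=
    fun n i ω => tail_sum _ _ _ _
  have hGi : ∀ n i, BddMeas (info (e n) Set.univ) (G n i) := fun n i => by
    refine BddMeas.sum _ fun x => ?_
    split_ifs
    · exact BddMeas.sum _ fun j => ((((he n).bddMeas_qmass _ _ _ x).mono
        (info_mono (Set.subset_univ _))).sub (BddMeas.const _)).const_mul _
    · exact BddMeas.const _
  have hGb : ∀ n i, BddMeas ‹MeasurableSpace Ω› (G n i) := fun n i =>
    (hGi n i).mono ((he n).info_le _)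
  have hGK : ∀ n i ω, |G n i ω| ≤ K := by
    intro n i ω
    rw [hGsum]
    refine (Finset.abs_sum_le_sum_abs _ _).trans (Finset.sum_le_sum fun j _ => ?_)
    rw [abs_mul]
    exact mul_le_of_le_one_right (abs_nonneg _)
      (abs_tail_sub_dirac_le_one (hq0 n j ω) (hq1 n j ω) (hm j n) i)
  have hν : ∀ n ω, ∑ x ∈ box (R n), ∑ j, θ j * (q n j ω x - dirac (pt j n) x) = 0 := by
    intro n ω
    rw [Finset.sum_comm]
    refine Finset.sum_eq_zero fun j _ => ?_
    rw [← Finset.mul_sum, Finset.sum_sub_distrib, hq1, sum_dirac (hm j n), sub_self, mul_zero]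
  have hδ : ∀ j, Tendsto (fun n : ℕ+ => (center V (s j n) (k j n) (N n) - pt j n) / √n) atTop
      (𝓝 0) := by
    intro j
    refine squeeze_zero_norm (a := fun n : ℕ+ => B * (√n)⁻¹) (fun n => ?_) (by
      simpa using tendsto_inv_sqrt_pnat.const_mul B)
    rw [Real.norm_eq_abs, abs_div, abs_of_pos (sqrt_pnat_pos n), div_eq_mul_inv]
    exact mul_le_mul_of_nonneg_right (hcen j n) (inv_pos.2 (sqrt_pnat_pos n)).le
  have hck : ∀ j, Tendsto (fun n : ℕ+ => (center V (s j n) (k j n) (N n) - c n) / √n) atTop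
      (𝓝 (a j).2) := by
    intro j
    have h := (hδ j).add (hpt j)
    rw [zero_add] at h
    refine h.congr fun n => ?_
    rw [← add_div]; congr 1; ring
  have hdiff : ∀ {x y : ℕ+ → ℝ} {r r' : ℝ}, Tendsto (fun n : ℕ+ => (x n - c n) / √n) atTop (𝓝 r) →
      Tendsto (fun n : ℕ+ => (y n - c n) / √n) atTop (𝓝 r') →
      Tendsto (fun n : ℕ+ => (x n - y n) / √n) atTop (𝓝 (r - r')) := by
    intro x y r r' hx hy
    refine (hx.sub hy).congr fun n => ?_
    rw [← sub_div]; congr 1; ring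
  have hS : Tendsto (fun n => ∫ ω, |S n ω - Q₀| ∂μ) atTop (𝓝 0) := by
    -- A point mass is the law of a walk started at the final time `N`, so one convergence statement
    -- covers all pairs.
    have hcpt : ∀ (W : ℝ) (n : ℕ+) (m : ℤ), center W (N n) m (N n) = m := fun W n m => by
      simp [center]
    have h := tendsto_integral_abs_sum_tail_sq_sub hspan hell he (L := J ⊕ J)
      (s := Sum.elim s fun _ => N) (k := Sum.elim k pt) (N := N) (R := R)
      (by rintro (j | j) n <;> simp [hs]) (by rintro (j | j) n <;> simp [hR, hR']) hT
      (Sum.elim (fun j => ((a j).1 : ℝ)) fun _ => 0)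
      (Sum.elim (fun j => (a j).2) fun j => (a j).2)
      (by rintro (j | j)
          · simpa using ha j
          · simp)
      (by rintro (i | i) (j | j) <;> simp only [Sum.elim_inl, Sum.elim_inr, hcpt]
          · exact hdiff (hck i) (hck j)
          · exact hdiff (hck i) (hpt j)
          · exact hdiff (hpt i) (hck j)
          · exact hdiff (hpt i) (hpt j))
      (Sum.elim θ (-θ)) (by simp)
    rw [sum_sum_gaussAbs θ a hσ] at h
    refine h.congr fun n => integral_congr_ae (Eventually.of_forall fun ω => ?_)
    simp only [S, hε2, G, Fintype.sum_sum_type, Sum.elim_inl, Sum.elim_inr, dirac_eq_qmass,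
      Pi.neg_apply, neg_mul, mul_sub, Finset.sum_neg_distrib, Finset.sum_sub_distrib, q, Q₀,
      ← sub_eq_add_neg]
  have hSb : ∀ n, BddMeas ‹MeasurableSpace Ω› (S n) := fun n =>
    (BddMeas.sum _ fun i => (hGb n i).pow 2).const_mul _
  have hLb : ∀ n, BddMeas ‹MeasurableSpace Ω› (L n) := fun n =>
    (BddMeas.sum _ fun i => hGb n i).const_mul _
  have hS0 : ∀ n ω, 0 ≤ S n ω := fun n ω =>
    mul_nonneg (sq_nonneg _) (Finset.sum_nonneg fun i _ => sq_nonneg _)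
  have hQ₀ : 0 ≤ Q₀ := by
    have h : Tendsto (fun n => ∫ ω, S n ω ∂μ) atTop (𝓝 Q₀) := by
      rw [tendsto_iff_norm_sub_tendsto_zero]
      refine squeeze_zero (fun n => norm_nonneg _) (fun n => ?_) hS
      have : ∫ ω, S n ω ∂μ - Q₀ = ∫ ω, (S n ω - Q₀) ∂μ := by
        rw [integral_sub (hSb n).integrable (integrable_const _)]; simp
      rw [this]
      exact norm_integral_le_integral_norm _
    exact ge_of_tendsto h (Eventually.of_forall fun n => integral_nonneg (hS0 n))
  -- Quenched walks spread over distance `√n`, so the weighted sum of tails has mean `O(√n)`,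
  -- including the factor that measures the distance to `c n`.
  have hH : ∃ CH : ℝ, ∀ᶠ n : ℕ+ in atTop,
      ∫ ω, ∑ i ∈ gaps (R n), |G n i ω| * g n i ∂μ ≤ CH * √n := by
    obtain ⟨A, hA0, hA⟩ := exists_bound_of_tendsto hpt
    refine ⟨∑ j, |θ j| * ((2 + A) * (2 * (T * avgVar μ M w) + 2 * B ^ 2) + (1 + A)), ?_⟩
    filter_upwards [hA] with n hn
    have hD := sqrt_pnat_pos n
    have h1n : (1 : ℝ) ≤ n := by exact_mod_cast n.pos
    have hsq : √(n : ℝ) * √n = n := Real.mul_self_sqrt (Nat.cast_nonneg _)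
    set X : J → Ω → ℝ := fun j ω => ∑ i ∈ gaps (R n),
      |tail (R n) (fun x => q n j ω x - dirac (pt j n) x) i| * g n i
    have hX : ∀ j, Integrable (X j) μ := by
      intro j
      refine integrable_finsetSum _ fun i _ => Integrable.mul_const ?_ _
      refine (BddMeas.integrable ?_).abs
      refine BddMeas.sum _ fun x => ?_
      split_ifs
      · exact ((((he n).bddMeas_qmass _ _ _ x).mono ((he n).info_le _)).sub (BddMeas.const _))
      · exact BddMeas.const _
    have h1 : ∀ ω, ∑ i ∈ gaps (R n), |G n i ω| * g n i ≤ ∑ j, |θ j| * X j ω := by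
      intro ω
      simp only [X, Finset.mul_sum]
      rw [Finset.sum_comm]
      refine Finset.sum_le_sum fun i _ => ?_
      simp_rw [← mul_assoc, ← Finset.sum_mul]
      refine mul_le_mul_of_nonneg_right ?_ (by positivity)
      rw [hGsum]
      refine (Finset.abs_sum_le_sum_abs _ _).trans_eq (Finset.sum_congr rfl fun j _ => abs_mul _ _)
    refine (integral_mono_of_nonneg (Eventually.of_forall fun ω => Finset.sum_nonneg fun i _ => by
      positivity) (integrable_finsetSum _ fun j _ => (hX j).const_mul _)
      (Eventually.of_forall h1)).trans ?_
    rw [integral_finsetSum _ fun j _ => (hX j).const_mul _, Finset.sum_mul]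
    refine Finset.sum_le_sum fun j _ => ?_
    rw [integral_const_mul, mul_assoc]
    refine mul_le_mul_of_nonneg_left ?_ (abs_nonneg _)
    refine ((he n).integral_sum_abs_tail_le (hs j n) (hR j n) (hm j n) (hcen j n) hD hA0 (by
      have := hn j
      rwa [abs_div, abs_of_pos hD, div_le_iff₀ hD] at this)).trans ?_
    refine (add_le_add (mul_le_mul_of_nonneg_left (c := (2 * (T * avgVar μ M w) + 2 * B ^ 2) * √n)
      ?_ (by linarith)) le_rfl).trans_eq (by ring)
    rw [div_le_iff₀ hD, mul_assoc, hsq, add_mul]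
    have h3 : ((N n : ℝ) - s j n) * avgVar μ M w ≤ T * n * avgVar μ M w := by
      refine mul_le_mul_of_nonneg_right ?_ hσ
      have : (0 : ℝ) ≤ s j n := Nat.cast_nonneg _
      linarith [hT n]
    have h4 : 2 * B ^ 2 ≤ 2 * B ^ 2 * n := le_mul_of_one_le_right (by positivity) h1n
    nlinarith
  obtain ⟨CH, hCH⟩ := hH
  set D : ℕ+ → ℝ := fun n => 4 * C * (ε n ^ (2 + α) * K ^ (1 + α)) + ε n ^ 4 * K ^ 3 * b ^ 2
    + ε n * κ n + ε n ^ 2 * K * κ n with hD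
  -- Three successive forms of the conditional characteristic function: exact (`Φ`), Gaussian with
  -- random variance (`Ψ`), Gaussian with the limiting variance (`Ξ`).
  set Φ : ℕ+ → Ω → ℂ := fun n ω =>
    ∏ i ∈ gaps (R n), ∫ ω', Complex.exp ((ε n * G n i ω * Y n i ω' : ℝ) * Complex.I) ∂μ
  set Ψ : ℕ+ → Ω → ℂ := fun n ω =>
    Complex.exp ((ρ₀ * L n ω : ℝ) * Complex.I) * (Real.exp (-(v₀ * S n ω / 2)) : ℂ)
  set Ξ : ℕ+ → Ω → ℂ := fun n ω =>
    Complex.exp ((ρ₀ * L n ω : ℝ) * Complex.I) * (Real.exp (-(v₀ * Q₀ / 2)) : ℂ)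
  have hA : ∀ n : ℕ+, ∫ ω, Complex.exp (((n : ℝ) ^ (-(1 / 4) : ℝ) * ∑ j, θ j *
      ∑ i ∈ gaps (R n), tail (R n) (fun x => q n j ω x - dirac (pt j n) x) i * Y n i ω : ℝ)
        * Complex.I) ∂μ = ∫ ω, Φ n ω ∂μ := by
    intro n
    have hGY : IndepFun (fun ω (i : gaps (R n)) => G n i ω) (fun ω (i : gaps (R n)) => Y n i ω) μ := by
      refine indep_of_indep_of_le_left (indep_of_indep_of_le_right (hindep n) ?_) ?_
      · exact measurable_iff_comap_le.1 ((@measurable_pi_iff Ω (gaps (R n)) (fun _ => ℝ)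
          (MeasurableSpace.comap (fun ω i => Y n i ω) MeasurableSpace.pi) _ _).2 fun i =>
            (measurable_pi_apply (i : ℤ)).comp (comap_measurable (fun ω i => Y n i ω)))
      · exact measurable_iff_comap_le.1 ((@measurable_pi_iff Ω (gaps (R n)) (fun _ => ℝ)
          (info (e n) Set.univ) _ _).2 fun i => (hGi n i).meas)
    rw [← integral_cexp_sum_mul_of_indep (gaps (R n)) (fun i => (hGb n i).meas) (hY n) hGY (hind n)]
    refine integral_congr_ae (Eventually.of_forall fun ω => ?_)
    have e1 : (n : ℝ) ^ (-(1 / 4) : ℝ) * ∑ j, θ j *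
        ∑ i ∈ gaps (R n), tail (R n) (fun x => q n j ω x - dirac (pt j n) x) i * Y n i ω
        = ∑ i ∈ gaps (R n), ε n * G n i ω * Y n i ω := by
      simp_rw [hGsum, mul_assoc, Finset.sum_mul, Finset.mul_sum]
      rw [Finset.sum_comm]
      exact Finset.sum_congr rfl fun i _ => Finset.sum_congr rfl fun j _ => by ring
    simp only [e1]
  have hΦm : ∀ n, AEStronglyMeasurable (Φ n) μ := by
    intro n
    refine (Finset.measurable_fun_prod _ fun i _ => ?_).aestronglyMeasurable
    have h1 := (hGb n i).meas
    have h2 := hY n i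
    have h3 : Measurable (Function.uncurry fun ω ω' =>
        Complex.exp ((ε n * G n i ω * Y n i ω' : ℝ) * Complex.I)) := by
      unfold Function.uncurry
      fun_prop
    exact h3.stronglyMeasurable.integral_prod_right.measurable
  have hΦi : ∀ n, Integrable (Φ n) μ := fun n => integrable_of_bound (hΦm n) 1 fun ω => by
    rw [norm_prod]
    refine Finset.prod_le_one (fun _ _ => norm_nonneg _) fun i _ => ?_
    refine (norm_integral_le_integral_norm _).trans ?_
    simp_rw [Complex.norm_exp_ofReal_mul_I]
    simp
  have hexp : ∀ {x : ℝ}, 0 ≤ x → ‖(Real.exp (-(v₀ * x / 2)) : ℂ)‖ ≤ 1 := fun hx => by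
    rw [Complex.norm_real, Real.norm_of_nonneg (Real.exp_pos _).le, Real.exp_le_one_iff]
    have := mul_nonneg hv₀ hx
    linarith
  have hΨi : ∀ n, Integrable (Ψ n) μ := fun n => by
    have h1 := (hLb n).meas
    have h2 := (hSb n).meas
    refine integrable_of_bound (by fun_prop : Measurable (Ψ n)).aestronglyMeasurable 1 fun ω => ?_
    rw [norm_mul, Complex.norm_exp_ofReal_mul_I, one_mul]
    exact hexp (hS0 n ω)
  have hΞi : ∀ n, Integrable (Ξ n) μ := fun n => by
    have h1 := (hLb n).meas
    refine integrable_of_bound (by fun_prop : Measurable (Ξ n)).aestronglyMeasurable 1 fun ω => ?_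
    rw [norm_mul, Complex.norm_exp_ofReal_mul_I, one_mul]
    exact hexp hQ₀
  have hHi : ∀ n, Integrable (fun ω => ∑ i ∈ gaps (R n), |G n i ω| * g n i) μ := fun n =>
    integrable_finsetSum _ fun i _ => (hGb n i).integrable.abs.mul_const _
  have hg1 : ∀ n i, 1 ≤ g n i := fun n i => by
    simp only [g]
    have : 0 ≤ |(i : ℝ) - c n| / √n := by positivity
    linarith
  have hD0 : ∀ n, 0 ≤ D n := fun n => by
    have h1 := hε0 n
    have h2 := hκ n
    have h3 : 0 ≤ C := le_trans (integral_nonneg fun ω => by positivity) (hC 1 0)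
    have h4 : 0 ≤ K := Finset.sum_nonneg fun _ _ => abs_nonneg _
    positivity
  have hΦΨ : ∀ᶠ n : ℕ+ in atTop, ‖∫ ω, Φ n ω ∂μ - ∫ ω, Ψ n ω ∂μ‖ ≤ D n * (CH * √n) := by
    filter_upwards [hCH] with n hn
    rw [← integral_sub (hΦi n) (hΨi n)]
    refine (norm_integral_le_integral_norm _).trans ?_
    refine le_trans ?_ (mul_le_mul_of_nonneg_left hn (hD0 n))
    rw [← integral_const_mul]
    refine integral_mono ((hΦi n).sub (hΨi n)).norm ((hHi n).const_mul _) fun ω => ?_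
    exact norm_prod_charFun_sub_le (hY n) hα.le hα1 (hint n) (hC n) (hmean n) (hvar n) (hb n) hv₀
      (hκ n) (hg1 n) (hρ n) (hv n) (fun i => hGK n i ω) (hε0 n) (gaps (R n))
  have hΨΞ : ∀ n, ‖∫ ω, Ψ n ω ∂μ - ∫ ω, Ξ n ω ∂μ‖ ≤ v₀ / 2 * ∫ ω, |S n ω - Q₀| ∂μ := by
    intro n
    rw [← integral_sub (hΨi n) (hΞi n), ← integral_const_mul]
    refine (norm_integral_le_integral_norm _).trans ?_
    refine integral_mono ((hΨi n).sub (hΞi n)).norm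
      (((hSb n).sub (BddMeas.const _)).integrable.abs.const_mul _) fun ω => ?_
    refine (norm_cexp_mul_exp_sub_le (div_nonneg (mul_nonneg hv₀ (hS0 n ω)) zero_le_two)
      (div_nonneg (mul_nonneg hv₀ hQ₀) zero_le_two)).trans_eq ?_
    rw [sub_self, abs_zero, zero_add, show v₀ * S n ω / 2 - v₀ * Q₀ / 2
      = v₀ / 2 * (S n ω - Q₀) by ring, abs_mul, abs_of_nonneg (by positivity)]
  -- The sum of the tails is the displacement of the quenched mean, a martingale, plus a bounded
  -- deterministic rounding term.
  have hL : ∀ n ω, L n ω = ε n * ∑ j, θ j * (∑ x ∈ box (R n), q n j ω x * x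
      - center V (s j n) (k j n) (N n)) + ε n * ∑ j, θ j *
        (center V (s j n) (k j n) (N n) - pt j n) := by
    intro n ω
    simp only [L, G]
    rw [sum_tail (hν n ω), ← mul_add, ← Finset.sum_add_distrib]
    congr 1
    simp_rw [Finset.sum_mul]
    rw [Finset.sum_comm]
    refine Finset.sum_congr rfl fun j _ => ?_
    simp_rw [mul_assoc, sub_mul]
    rw [← Finset.mul_sum, Finset.sum_sub_distrib, sum_dirac_mul (hm j n)]
    ring
  have hΞ : Tendsto (fun n => ∫ ω, Ξ n ω ∂μ) atTop
      (𝓝 ((Real.exp (-(ρ₀ ^ 2 * Qq / 2)) : ℂ) * (Real.exp (-(v₀ * Q₀ / 2)) : ℂ))) := by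
    have h1 := tendsto_integral_cexp_quenchedMean hspan hell he hs hR hT a ha
      (fun i j => hdiff (hck i) (hck j)) (fun j => ρ₀ * θ j)
    have e1 : ∑ i, ∑ j, ρ₀ * θ i * (ρ₀ * θ j) * GammaQ (kappa μ M w) (avgVar μ M w) (a i) (a j)
        = ρ₀ ^ 2 * Qq := by
      simp only [Qq, Finset.mul_sum]
      exact Finset.sum_congr rfl fun i _ => Finset.sum_congr rfl fun j _ => by ring
    rw [e1] at h1
    have h2 : Tendsto (fun n => Complex.exp ((ρ₀ * (ε n * ∑ j, θ j *
        (center V (s j n) (k j n) (N n) - pt j n)) : ℝ) * Complex.I)) atTop (𝓝 1) := by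
      have h3 : Tendsto (fun n => ρ₀ * (ε n * ∑ j, θ j *
          (center V (s j n) (k j n) (N n) - pt j n))) atTop (𝓝 0) := by
        refine squeeze_zero_norm (a := fun n => |ρ₀| * (ε n * ∑ j, |θ j| * B)) (fun n => ?_) (by
          simpa using (hεlim.mul_const (∑ j, |θ j| * B)).const_mul |ρ₀|)
        rw [norm_mul, norm_mul, Real.norm_of_nonneg (hε0 n), Real.norm_eq_abs]
        refine mul_le_mul_of_nonneg_left (mul_le_mul_of_nonneg_left ((norm_sum_le _ _).trans
          (Finset.sum_le_sum fun j _ => ?_)) (hε0 n)) (abs_nonneg _)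
        rw [Real.norm_eq_abs, abs_mul]
        exact mul_le_mul_of_nonneg_left (hcen j n) (abs_nonneg _)
      have h4 : Continuous fun x : ℝ => Complex.exp (x * Complex.I) := by fun_prop
      have h5 := (h4.tendsto 0).comp h3
      simp only [Complex.ofReal_zero, zero_mul, Complex.exp_zero] at h5
      exact h5
    have h3 := (h2.mul h1).mul_const (Real.exp (-(v₀ * Q₀ / 2)) : ℂ)
    rw [one_mul] at h3
    refine h3.congr fun n => ?_
    simp only [Ξ]
    rw [integral_mul_const, ← integral_const_mul]
    congr 1
    refine integral_congr_ae (Eventually.of_forall fun ω => ?_)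
    simp only [hL]
    rw [← Complex.exp_add]
    congr 1
    simp_rw [mul_assoc ρ₀, ← Finset.mul_sum]
    push_cast
    ring
  -- The term `ε κ √n = n^{1/4} κ` decides the required regularity: its convergence to zero is the
  -- hypothesis on `κ`, met by Hölder exponents above `1/2`. The other terms carry positive powers
  -- of `ε`.
  have hDlim : Tendsto (fun n : ℕ+ => D n * (CH * √n)) atTop (𝓝 0) := by
    have hn0 : ∀ n : ℕ+, (0 : ℝ) < n := fun n => by exact_mod_cast n.pos
    have hεpos : ∀ n, 0 < ε n := fun n => Real.rpow_pos_of_pos (hn0 n) _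
    have hinv : ∀ n : ℕ+, ε n * (n : ℝ) ^ (1 / 4 : ℝ) = 1 := fun n => by
      simp only [ε]
      rw [← Real.rpow_add (hn0 n)]; norm_num
    have hroot : ∀ n : ℕ+, √(n : ℝ) = (n : ℝ) ^ (1 / 4 : ℝ) * (n : ℝ) ^ (1 / 4 : ℝ) := fun n => by
      rw [← Real.rpow_add (hn0 n), Real.sqrt_eq_rpow]; norm_num
    have e1 : ∀ n : ℕ+, D n * (CH * √n) = CH * (4 * C * K ^ (1 + α) * ε n ^ α
        + ε n ^ 2 * (K ^ 3 * b ^ 2) + (n : ℝ) ^ (1 / 4 : ℝ) * κ n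
        + K * (ε n * ((n : ℝ) ^ (1 / 4 : ℝ) * κ n))) := by
      intro n
      have h1 := hinv n
      have h2 : ε n ^ (2 + α) = ε n ^ 2 * ε n ^ α := by
        rw [Real.rpow_add (hεpos n), Real.rpow_two]
      simp only [hD]
      rw [h2, hroot]
      generalize (n : ℝ) ^ (1 / 4 : ℝ) = y at h1 ⊢
      generalize ε n ^ α = z
      have h3 : y = (ε n)⁻¹ := eq_inv_of_mul_eq_one_right h1
      have h4 := (hεpos n).ne'
      rw [h3]
      field_simp
    simp_rw [e1]
    have h2 : Tendsto (fun n => ε n ^ α) atTop (𝓝 0) := by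
      have := hεlim.rpow_const (p := α) (Or.inr hα.le)
      rwa [Real.zero_rpow hα.ne'] at this
    have h3 := (((h2.const_mul (4 * C * K ^ (1 + α))).add
      ((hεlim.pow 2).mul_const (K ^ 3 * b ^ 2))).add hκlim).add
        ((hεlim.mul hκlim).const_mul K)
    simpa using h3.const_mul CH
  have h1 : Tendsto (fun n => ∫ ω, Φ n ω ∂μ - ∫ ω, Ψ n ω ∂μ) atTop (𝓝 0) :=
    squeeze_zero_norm' hΦΨ hDlim
  have h2 : Tendsto (fun n => ∫ ω, Ψ n ω ∂μ - ∫ ω, Ξ n ω ∂μ) atTop (𝓝 0) :=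
    squeeze_zero_norm hΨΞ (by simpa using hS.const_mul (v₀ / 2))
  have h3 := (h1.add h2).add hΞ
  simp only [sub_add_sub_cancel, sub_add_cancel, add_zero, zero_add] at h3
  refine Tendsto.congr (fun n => (hA n).symm) ?_
  convert h3 using 2
  rw [← Complex.ofReal_mul, ← Real.exp_add]
  congr 2
  have e2 : ∑ i, ∑ j, θ i * θ j * (ρ₀ ^ 2 * GammaQ (kappa μ M w) (avgVar μ M w) (a i) (a j)
      + v₀ * Gamma0 (avgVar μ M w) (a i) (a j)) = ρ₀ ^ 2 * Qq + v₀ * Q₀ := by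
    simp only [Qq, Q₀, Finset.mul_sum, ← Finset.sum_add_distrib]
    exact Finset.sum_congr rfl fun i _ => Finset.sum_congr rfl fun j _ => by ring
  rw [e2]
  ring

end HeightsCLT
-- From almost sure to everywhere defined probability vectors.
section Regularization

variable {Ω : Type*} [MeasurableSpace Ω] {μ : Measure Ω} [IsProbabilityMeasure μ] {M : ℕ}

lemma isProbVec_dirac (M : ℕ) : IsProbVec M (dirac 0) where
  nonneg j := by unfold dirac; split_ifs <;> norm_num
  range j hj := by
    rw [dirac, if_neg]
    rintro rfl
    simp only [abs_zero] at hj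
    have : (0 : ℤ) ≤ M := by positivity
    linarith
  sum_eq_one := sum_dirac (by simp)

lemma measurableSet_isProbVec (M : ℕ) : MeasurableSet {q : ℤ → ℝ | IsProbVec M q} := by
  have h : {q : ℤ → ℝ | IsProbVec M q} = (⋂ j, {q | 0 ≤ q j})
      ∩ (⋂ (j : ℤ) (_ : (M : ℤ) < |j|), {q | q j = 0}) ∩ {q | ∑ j ∈ steps M, q j = 1} := by
    ext q
    simp only [Set.mem_ofPred_eq, Set.mem_inter_iff, Set.mem_iInter]
    exact ⟨fun h => ⟨⟨h.nonneg, h.range⟩, h.sum_eq_one⟩, fun h => ⟨h.1.1, h.1.2, h.2⟩⟩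
  rw [h]
  refine ((MeasurableSet.iInter fun j => ?_).inter (MeasurableSet.iInter fun j =>
    MeasurableSet.iInter fun _ => ?_)).inter ?_
  · exact measurableSet_le measurable_const (measurable_pi_apply j)
  · exact measurableSet_eq_fun (measurable_pi_apply j) measurable_const
  · exact measurableSet_eq_fun (Finset.measurable_fun_sum _ fun j _ => measurable_pi_apply j)
      measurable_const

open Classical in
/-- Replace a vector that is not a probability vector by the point mass at `0`. -/
noncomputable def toProbVec (M : ℕ) (q : ℤ → ℝ) : ℤ → ℝ := if IsProbVec M q then q else dirac 0

lemma isProbVec_toProbVec (M : ℕ) (q : ℤ → ℝ) : IsProbVec M (toProbVec M q) := by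
  unfold toProbVec
  split_ifs with h
  exacts [h, isProbVec_dirac M]

lemma toProbVec_of_isProbVec {q : ℤ → ℝ} (h : IsProbVec M q) : toProbVec M q = q := if_pos h

lemma measurable_toProbVec (M : ℕ) : Measurable (toProbVec M) :=
  Measurable.ite (measurableSet_isProbVec M) measurable_id measurable_const

variable {u : ℕ → ℤ → Ω → ℤ → ℝ}

lemma IsEnvironment.ae_toProbVec (hu : IsEnvironment μ M u) :
    ∀ᵐ ω ∂μ, ∀ τ k, toProbVec M (u τ k ω) = u τ k ω := by
  refine ae_all_iff.2 fun τ => ae_all_iff.2 fun k => ?_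
  filter_upwards [hu.nonneg τ k, hu.range τ k, hu.sum_eq_one τ k] with ω h1 h2 h3
  exact toProbVec_of_isProbVec ⟨h1, h2, h3⟩

/-- The time reversal of a regularized environment. -/
lemma IsEnvironment.isEnv (hu : IsEnvironment μ M u) {ρ : ℕ → ℕ} (hρ : Function.Injective ρ) :
    IsEnv μ M (fun ω => toProbVec M (u 0 0 ω)) fun m x ω => toProbVec M (u (ρ m) x ω) where
  base_measurable := (measurable_toProbVec M).comp (hu.measurable 0 0)
  base_isProbVec _ := isProbVec_toProbVec M _
  measurable m x := (measurable_toProbVec M).comp (hu.measurable _ x)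
  isProbVec _ _ _ := isProbVec_toProbVec M _
  indep := by
    have h1 : iIndepFun (fun p : ℕ × ℤ => u (ρ p.1) p.2) μ :=
      hu.indep.precomp (g := fun p : ℕ × ℤ => (ρ p.1, p.2)) fun p p' h => by
        simp only [Prod.mk.injEq] at h
        exact Prod.ext (hρ h.1) h.2
    exact h1.comp (fun _ => toProbVec M) fun _ => measurable_toProbVec M
  identDistrib m x := (hu.identDistrib (ρ m) x).comp (measurable_toProbVec M)

section Congr

variable {w w' : Ω → ℤ → ℝ}

lemma avgProb_congr (h : w =ᵐ[μ] w') : avgProb μ w = avgProb μ w' :=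
  funext fun j => integral_congr_ae (h.mono fun ω hω => by simp only [hω])

lemma meanDrift_congr (h : w =ᵐ[μ] w') : meanDrift μ M w = meanDrift μ M w' :=
  integral_congr_ae (h.mono fun ω hω => by simp only [drift, hω])

lemma driftVar_congr (h : w =ᵐ[μ] w') : driftVar μ M w = driftVar μ M w' := by
  rw [driftVar, meanDrift_congr h]
  exact integral_congr_ae (h.mono fun ω hω => by simp only [drift, hω])

lemma avgVar_congr (h : w =ᵐ[μ] w') : avgVar μ M w = avgVar μ M w' := by
  rw [avgVar, meanDrift_congr h, avgProb_congr h, avgVar]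

lemma beta_congr (h : w =ᵐ[μ] w') : beta μ M w = beta μ M w' := by
  have h1 : lam μ M w = lam μ M w' := funext fun t =>
    integral_congr_ae (h.mono fun ω hω => by simp only [randChar, hω])
  have h2 : lamBar μ M w = lamBar μ M w' := by
    funext t
    rw [lamBar, avgChar, avgProb_congr h, lamBar, avgChar]
  rw [beta, h1, h2, beta]

lemma kappa_congr (h : w =ᵐ[μ] w') : kappa μ M w = kappa μ M w' := by
  rw [kappa, driftVar_congr h, beta_congr h, avgVar_congr h, kappa]

lemma elliptic_congr (h : w =ᵐ[μ] w') : Elliptic μ M w ↔ Elliptic μ M w' := by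
  unfold Elliptic
  rw [measure_congr (h.mono fun ω hω => ?_)]
  change (∀ j ∈ _, w ω j < 1) = (∀ j ∈ _, w' ω j < 1)
  rw [hω]

end Congr

end Regularization

/-! ### Moments of the increments and regularity of the profiles. -/

section Profiles

variable {Ω : Type*} [MeasurableSpace Ω] {μ : Measure Ω} [IsProbabilityMeasure μ]
  {rho v : ℝ → ℝ} {s : ℕ+ → ℤ → Ω → ℝ}

/-- The increments of the initial heights. -/
def increment (s : ℕ+ → ℤ → Ω → ℝ) (n : ℕ+) (i : ℤ) (ω : Ω) : ℝ := s n i ω - s n (i - 1) ω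

lemma abs_sub_rpow_le {y r α α₀ : ℝ} (hα : 0 ≤ α) (hα1 : α ≤ 1) (hαα : α ≤ α₀) :
    |y - r| ^ (2 + α) ≤ 8 * (1 + |y| ^ (2 + α₀) + |r| ^ (2 + α)) := by
  have h1 : |y - r| ≤ 2 * max |y| |r| := by
    have := le_max_left |y| |r|
    have := le_max_right |y| |r|
    linarith [abs_sub y r]
  have h2 : |y - r| ^ (2 + α) ≤ 2 ^ (2 + α) * (max |y| |r|) ^ (2 + α) := by
    rw [← Real.mul_rpow zero_le_two (le_max_of_le_left (abs_nonneg _))]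
    exact Real.rpow_le_rpow (abs_nonneg _) h1 (by linarith)
  have h3 : (2 : ℝ) ^ (2 + α) ≤ 8 := by
    calc (2 : ℝ) ^ (2 + α) ≤ 2 ^ (3 : ℝ) :=
          Real.rpow_le_rpow_of_exponent_le one_le_two (by linarith)
      _ = 8 := by norm_num
  have h4 : |y| ^ (2 + α) ≤ 1 + |y| ^ (2 + α₀) := by
    rcases le_total |y| 1 with h | h
    · have := Real.rpow_le_one (abs_nonneg y) h (by linarith : 0 ≤ 2 + α)
      have : 0 ≤ |y| ^ (2 + α₀) := Real.rpow_nonneg (abs_nonneg _) _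
      linarith
    · have := Real.rpow_le_rpow_of_exponent_le h (by linarith : 2 + α ≤ 2 + α₀)
      linarith
  have h5 : (max |y| |r|) ^ (2 + α) ≤ 1 + |y| ^ (2 + α₀) + |r| ^ (2 + α) := by
    have h6 : 0 ≤ |r| ^ (2 + α) := Real.rpow_nonneg (abs_nonneg _) _
    have h7 : 0 ≤ |y| ^ (2 + α₀) := Real.rpow_nonneg (abs_nonneg _) _
    rcases le_total |y| |r| with h | h
    · rw [max_eq_right h]; linarith
    · rw [max_eq_left h]; linarith
  refine h2.trans (mul_le_mul h3 h5 (by positivity) (by norm_num))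

/-- Uniform bounds on the centered moments of the increments. -/
lemma IsInitialHeights.exists_moment_bound (hs : IsInitialHeights μ rho v s) {K : ℝ}
    (hK : ∀ x, |rho x| ≤ K) : ∃ α C : ℝ, 0 < α ∧ α ≤ 1 ∧
      (∀ n i, Integrable (fun ω => |increment s n i ω - rho (i / n)| ^ (2 + α)) μ) ∧
      ∀ n i, ∫ ω, |increment s n i ω - rho (i / n)| ^ (2 + α) ∂μ ≤ C := by
  obtain ⟨α₀, hα₀, C, hC⟩ := hs.moment
  -- The order is lowered to at most three, the range in which the Taylor remainder bound holds.
  set α := min α₀ 1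
  have hα : 0 < α := lt_min hα₀ one_pos
  have hK0 : 0 ≤ K := (abs_nonneg _).trans (hK 0)
  have hmeas : ∀ n i, Measurable (increment s n i) := fun n i =>
    (hs.measurable n i).sub (hs.measurable n (i - 1))
  have hi : ∀ n i, Integrable (fun ω => |increment s n i ω| ^ (2 + α₀)) μ := by
    intro n i
    refine ⟨((hmeas n i).abs.pow_const _).aestronglyMeasurable, ?_⟩
    rw [hasFiniteIntegral_iff_ofReal (Eventually.of_forall fun ω => by positivity)]
    exact (hC n i).trans_lt ENNReal.coe_lt_top
  have hle : ∀ n i ω, |increment s n i ω - rho (i / n)| ^ (2 + α)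
      ≤ 8 * (1 + |increment s n i ω| ^ (2 + α₀) + K ^ (2 + α)) := by
    intro n i ω
    refine (abs_sub_rpow_le hα.le (min_le_right _ _) (min_le_left _ _)).trans ?_
    have := Real.rpow_le_rpow (abs_nonneg _) (hK (i / n)) (by linarith : 0 ≤ 2 + α)
    linarith
  have hd : ∀ n i, Integrable (fun ω => 8 * (1 + |increment s n i ω| ^ (2 + α₀) + K ^ (2 + α))) μ :=
    fun n i => (((integrable_const _).add (hi n i)).add (integrable_const _)).const_mul 8
  refine ⟨α, 8 * (1 + C + K ^ (2 + α)), hα, min_le_right _ _, fun n i => ?_, fun n i => ?_⟩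
  · refine (hd n i).mono' ((((hmeas n i).sub_const _).abs.pow_const _).aestronglyMeasurable)
      (Eventually.of_forall fun ω => ?_)
    rw [Real.norm_of_nonneg (by positivity)]
    exact hle n i ω
  · refine (integral_mono_of_nonneg (Eventually.of_forall fun ω => by positivity) (hd n i)
      (Eventually.of_forall fun ω => hle n i ω)).trans ?_
    have i1 : Integrable (fun ω => 1 + |increment s n i ω| ^ (2 + α₀)) μ :=
      (integrable_const _).add (hi n i)
    rw [integral_const_mul, integral_add i1 (integrable_const _),
      integral_add (integrable_const _) (hi n i)]
    simp only [integral_const, probReal_univ, one_smul]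
    have h1 : ∫ ω, |increment s n i ω| ^ (2 + α₀) ∂μ ≤ C := by
      rw [integral_eq_lintegral_of_nonneg_ae (Eventually.of_forall fun ω => by positivity)
        ((hmeas n i).abs.pow_const _).aestronglyMeasurable]
      exact ENNReal.toReal_le_coe_of_le_coe (hC n i)
    linarith

/-- The modulus of continuity of the profiles at a point, on the diffusive scale. -/
lemma exists_profile_modulus (hrho : ∃ K : ℝ, ∀ x, |rho x| ≤ K) (hv : ∃ K : ℝ, ∀ x, |v x| ≤ K)
    (hh : LocallyHolder rho v) (y : ℝ) : ∃ κ : ℕ+ → ℝ, (∀ n, 0 ≤ κ n) ∧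
      Tendsto (fun n : ℕ+ => (n : ℝ) ^ (1 / 4 : ℝ) * κ n) atTop (𝓝 0) ∧
      ∀ (n : ℕ+) (i : ℤ), |rho (i / n) - rho y| + |v (i / n) - v y|
        ≤ κ n * (1 + |i - n * y| / √n) := by
  obtain ⟨K, hK⟩ := hrho
  obtain ⟨K', hK'⟩ := hv
  obtain ⟨C, γ₀, hγ₀, hC⟩ := hh (y - 1) (y + 1)
  -- An exponent at most one makes `z^γ ≤ 1 + z` available.
  set γ := min γ₀ 1
  have hγ : 1 / 2 < γ := lt_min hγ₀ (by norm_num)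
  have hγ1 : γ ≤ 1 := min_le_right _ _
  have hK0 : 0 ≤ K := (abs_nonneg _).trans (hK 0)
  have hK0' : 0 ≤ K' := (abs_nonneg _).trans (hK' 0)
  set A := |C| + (2 * K + 2 * K')
  have hA0 : 0 ≤ A := by positivity
  -- Outside the unit window around `y`, boundedness of the profiles takes the place of local
  -- regularity.
  have hA : ∀ x, |rho x - rho y| + |v x - v y| ≤ A * |x - y| ^ γ := by
    intro x
    rcases le_or_gt |x - y| 1 with h | h
    · have h1 := hC x (by rw [abs_le] at h; constructor <;> linarith) y (by constructor <;> linarith)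
      have h2 : |x - y| ^ γ₀ ≤ |x - y| ^ γ :=
        Real.rpow_le_rpow_of_exponent_ge' (abs_nonneg _) h (by linarith) (min_le_left _ _)
      have h3 : 0 ≤ |x - y| ^ γ := by positivity
      calc _ ≤ C * |x - y| ^ γ₀ := h1
        _ ≤ |C| * |x - y| ^ γ₀ := by gcongr; exact le_abs_self C
        _ ≤ |C| * |x - y| ^ γ := by gcongr
        _ ≤ A * |x - y| ^ γ := by gcongr; simp only [A]; linarith
    · have h1 : 1 ≤ |x - y| ^ γ := Real.one_le_rpow h.le (by linarith)
      have h2 := abs_sub (rho x) (rho y)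
      have h3 := abs_sub (v x) (v y)
      have := hK x
      have := hK y
      have := hK' x
      have := hK' y
      calc _ ≤ A := by simp only [A]; linarith [abs_nonneg C]
        _ ≤ _ := le_mul_of_one_le_right hA0 h1
  -- On the scale `√n` the Hölder bound is `A n^{-γ/2} z^γ`, where `z` is the rescaled distance;
  -- `n^{1/4}` times this prefactor vanishes because `γ > 1/2`.
  refine ⟨fun n => A * (n : ℝ) ^ (-(γ / 2)), fun n => by positivity, ?_, fun n i => ?_⟩
  · have e1 : ∀ n : ℕ+, (n : ℝ) ^ (1 / 4 : ℝ) * (A * (n : ℝ) ^ (-(γ / 2)))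
        = A * (n : ℝ) ^ (-(γ / 2 - 1 / 4)) := by
      intro n
      have hn : (0 : ℝ) < n := by exact_mod_cast n.pos
      rw [mul_left_comm, ← Real.rpow_add hn]
      congr 2; ring
    simp_rw [e1]
    have h := (tendsto_rpow_neg_atTop (y := γ / 2 - 1 / 4) (by linarith)).comp tendsto_pnat_cast
    simpa using! h.const_mul A
  · have hn : (0 : ℝ) < n := by exact_mod_cast n.pos
    have hsn := sqrt_pnat_pos n
    refine (hA _).trans ?_
    rw [mul_assoc]
    refine mul_le_mul_of_nonneg_left ?_ hA0
    set z := |i - n * y| / √(n : ℝ) with hz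
    have hz0 : 0 ≤ z := by positivity
    have e1 : |(i : ℝ) / n - y| = (n : ℝ) ^ (-(1 / 2) : ℝ) * z := by
      have : (i : ℝ) / n - y = (i - n * y) / n := by field_simp
      rw [this, abs_div, abs_of_pos hn, hz, Real.rpow_neg hn.le, ← Real.sqrt_eq_rpow]
      have h2 : √(n : ℝ) * √n = n := Real.mul_self_sqrt hn.le
      field_simp
      rw [sq, h2]
      ring
    have e2 : (n : ℝ) ^ (-(γ / 2)) = ((n : ℝ) ^ (-(1 / 2) : ℝ)) ^ γ := by
      rw [← Real.rpow_mul hn.le]; congr 1; ring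
    rw [e1, Real.mul_rpow (by positivity) hz0, e2]
    refine mul_le_mul_of_nonneg_left ?_ (by positivity)
    rcases le_total z 1 with h | h
    · have := Real.rpow_le_one hz0 h (by linarith : 0 ≤ γ)
      linarith
    · have := Real.rpow_le_rpow_of_exponent_le h hγ1
      rw [Real.rpow_one] at this
      linarith

/-- Only the values `v (i/n)` are variances. The lattice points `⌊ny⌋/n` have nonnegative values and
approach `v y`. -/
lemma IsInitialHeights.variance_profile_nonneg (hs : IsInitialHeights μ rho v s) {κ : ℕ+ → ℝ}
    {y : ℝ} (hκ : ∀ n, 0 ≤ κ n)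
    (hκlim : Tendsto (fun n : ℕ+ => (n : ℝ) ^ (1 / 4 : ℝ) * κ n) atTop (𝓝 0))
    (h : ∀ (n : ℕ+) (i : ℤ), |rho (i / n) - rho y| + |v (i / n) - v y|
        ≤ κ n * (1 + |i - n * y| / √n)) : 0 ≤ v y := by
  have h1 : ∀ n : ℕ+, -(2 * ((n : ℝ) ^ (1 / 4 : ℝ) * κ n)) ≤ v y := by
    intro n
    have hn : (1 : ℝ) ≤ n := by exact_mod_cast n.pos
    have h2 := h n ⌊n * y⌋
    have h3 : 0 ≤ v ((⌊n * y⌋ : ℤ) / n) := by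
      rw [← hs.var]; exact variance_nonneg _ _
    have h4 : |(⌊n * y⌋ : ℝ) - n * y| ≤ 1 := by
      rw [abs_le]
      constructor <;> linarith [Int.floor_le ((n : ℝ) * y), Int.lt_floor_add_one ((n : ℝ) * y)]
    have h5 : |(⌊n * y⌋ : ℝ) - n * y| / √n ≤ 1 :=
      (div_le_one (sqrt_pnat_pos n)).2 (h4.trans (Real.one_le_sqrt.2 hn))
    have h6 : κ n ≤ (n : ℝ) ^ (1 / 4 : ℝ) * κ n :=
      le_mul_of_one_le_left (hκ n) (Real.one_le_rpow hn (by norm_num))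
    have h7 : |v ((⌊n * y⌋ : ℤ) / n) - v y| ≤ κ n * 2 :=
      (le_add_of_nonneg_left (abs_nonneg _)).trans
        (h2.trans (mul_le_mul_of_nonneg_left (by linarith) (hκ n)))
    have := (abs_le.1 h7).2
    linarith
  have h8 : Tendsto (fun n : ℕ+ => -(2 * ((n : ℝ) ^ (1 / 4 : ℝ) * κ n))) atTop (𝓝 0) := by
    simpa using (hκlim.const_mul 2).neg
  exact le_of_tendsto' h8 h1

end Profiles
-- The fluctuations along characteristics.
section Fluctuations

variable {Ω : Type*} [MeasurableSpace Ω] {μ : Measure Ω} [IsProbabilityMeasure μ] {M : ℕ}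
  {u : ℕ → ℤ → Ω → ℤ → ℝ} {rho v : ℝ → ℝ} {s : ℕ+ → ℤ → Ω → ℝ}

/-- The covariance of the limiting process. -/
noncomputable def limitCov (μ : Measure Ω) (M : ℕ) (w : Ω → ℤ → ℝ) (ρ₀ v₀ : ℝ)
    (a b : ℝ≥0 × ℝ) : ℝ :=
  ρ₀ ^ 2 * GammaQ (kappa μ M w) (avgVar μ M w) a b + v₀ * Gamma0 (avgVar μ M w) a b

lemma tendsto_nat_floor_mul_div_pnat {t : ℝ} (ht : 0 ≤ t) :
    Tendsto (fun n : ℕ+ => (⌊(n : ℝ) * t⌋₊ : ℝ) / n) atTop (𝓝 t) := by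
  refine ((tendsto_nat_floor_mul_div_atTop ht).comp tendsto_pnat_cast).congr fun n => ?_
  simp only [Function.comp_apply, mul_comm t]

lemma measurable_height {M : ℕ} {w : ℕ → ℤ → Ω → ℤ → ℝ} (hw : ∀ τ k, Measurable (w τ k))
    {σ : ℤ → Ω → ℝ} (hσ : ∀ x, Measurable (σ x)) (τ : ℕ) (k : ℤ) :
    Measurable fun ω => height M (fun τ x => w τ x ω) (fun x => σ x ω) τ k := by
  induction τ generalizing k with
  | zero => exact hσ k
  | succ τ ih =>
    simp only [height]
    exact Finset.measurable_fun_sum _ fun j _ =>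
      ((measurable_pi_apply j).comp (hw _ _)).mul (ih _)

lemma height_congr {M : ℕ} {w w' : ℕ → ℤ → ℤ → ℝ} (h : ∀ τ k, w τ k = w' τ k) (σ : ℤ → ℝ) (τ : ℕ)
    (k : ℤ) : height M w σ τ k = height M w' σ τ k := by
  rw [show w = w' from funext fun τ => funext fun k => h τ k]

/-- The displacement of the height along a characteristic, through the tail sums of the quenched
walk. -/
lemma height_sub_eq_sum_tail {w : ℕ → ℤ → ℤ → ℝ} (hw : ∀ τ k, IsProbVec M (w τ k)) (σ : ℤ → ℝ)
    {N R τ : ℕ} {k m : ℤ} (hτ : τ ≤ N) (hR : |k| + M * N ≤ R) (hm : m ∈ box R) :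
    height M w σ τ k - σ m = ∑ i ∈ gaps R,
      tail R (fun x => mass M (fun m => w (reflectTime N m)) (N - τ) k N x - dirac m x) i
        * (σ i - σ (i - 1)) := by
  rw [height_eq_sum_mass w σ hτ hR, ← sum_mul_eq_sum_tail]
  · simp_rw [sub_mul, Finset.sum_sub_distrib, sum_dirac_mul hm]
  · rw [Finset.sum_sub_distrib, sum_dirac hm, sum_mass (fun m x => hw _ x) hR,
      if_pos (Nat.sub_le _ _), sub_self]

set_option maxHeartbeats 1000000 in
-- The hypotheses of the heights theorem are verified for the regularized environment reflected at a
-- common horizon, which carries the walks of all observation points at once.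
theorem tendsto_integral_cexp_fluct (hu : IsEnvironment μ M u)
    (hell : Elliptic μ M (u 0 0)) (hspan : SpanOne μ (u 0 0))
    (hrho : ∃ K : ℝ, ∀ x, |rho x| ≤ K) (hv : ∃ K : ℝ, ∀ x, |v x| ≤ K)
    (hholder : LocallyHolder rho v) (hs : IsInitialHeights μ rho v s)
    (hindep : IndepFun (fun (ω : Ω) (p : ℕ × ℤ) => u p.1 p.2 ω)
      (fun (ω : Ω) (p : ℕ+ × ℤ) => s p.1 p.2 ω) μ)
    (ybar : ℝ) {J : Type*} [Fintype J] (a : J → ℝ≥0 × ℝ) (θ : J → ℝ) :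
    Tendsto (fun n : ℕ+ => ∫ ω, Complex.exp ((∑ j, θ j *
        fluct M (-meanDrift μ M (u 0 0)) ybar n (fun τ x => u τ x ω) (fun x => s n x ω) (a j) : ℝ)
          * Complex.I) ∂μ) atTop
      (𝓝 (Real.exp (-((∑ i, ∑ j, θ i * θ j
        * limitCov μ M (u 0 0) (rho ybar) (v ybar) (a i) (a j)) / 2)) : ℝ)) := by
  obtain ⟨K, hK⟩ := hrho
  obtain ⟨K', hK'⟩ := hv
  obtain ⟨κ, hκ, hκlim, hmod⟩ := exists_profile_modulus ⟨K, hK⟩ ⟨K', hK'⟩ hholder ybar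
  obtain ⟨α, C, hα, hα1, hint, hC⟩ := hs.exists_moment_bound hK
  have hv₀ := hs.variance_profile_nonneg hκ hκlim hmod
  have hae := hu.ae_toProbVec
  set w : Ω → ℤ → ℝ := fun ω => toProbVec M (u 0 0 ω)
  have hw : w =ᵐ[μ] u 0 0 := hae.mono fun ω h => h 0 0
  set V := meanDrift μ M w
  have hVeq : meanDrift μ M (u 0 0) = V := (meanDrift_congr hw).symm
  -- Any bound on all the times would do; the sum is one even when `J` is empty.
  set T : ℝ := ∑ j, ((a j).1 : ℝ)
  have hT0 : 0 ≤ T := Finset.sum_nonneg fun j _ => (a j).1.2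
  have haT : ∀ j, ((a j).1 : ℝ) ≤ T := fun j =>
    Finset.single_le_sum (f := fun j => ((a j).1 : ℝ)) (fun i _ => (a i).1.2) (Finset.mem_univ j)
  set N : ℕ+ → ℕ := fun n => ⌊(n : ℝ) * T⌋₊
  set τ : J → ℕ+ → ℕ := fun j n => ⌊(n : ℝ) * (a j).1⌋₊
  have hτN : ∀ j n, τ j n ≤ N n := fun j n =>
    Nat.floor_le_floor (mul_le_mul_of_nonneg_left (haT j) (Nat.cast_nonneg _))
  set pt : J → ℕ+ → ℤ := fun j n => ⌊(n : ℝ) * ybar⌋ + ⌊(a j).2 * √(n : ℝ)⌋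
  set k : J → ℕ+ → ℤ := fun j n => pt j n + ⌊(n : ℝ) * (a j).1 * (-V)⌋
  set R : ℕ+ → ℕ := fun n => (∑ j, ((k j n).natAbs + (pt j n).natAbs)) + M * N n
  have hRk : ∀ j n, |k j n| + M * N n ≤ R n ∧ |pt j n| + M * N n ≤ R n := by
    intro j n
    have h := Finset.single_le_sum (f := fun j => (k j n).natAbs + (pt j n).natAbs)
      (fun i _ => Nat.zero_le _) (Finset.mem_univ j)
    simp only [R]
    push_cast
    rw [Int.abs_eq_natAbs, Int.abs_eq_natAbs]
    have h' : ((k j n).natAbs : ℤ) + (pt j n).natAbs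
        ≤ ∑ j, (((k j n).natAbs : ℤ) + (pt j n).natAbs) := by exact_mod_cast h
    have h1 : (0 : ℤ) ≤ (k j n).natAbs := Int.natCast_nonneg _
    have h2 : (0 : ℤ) ≤ (pt j n).natAbs := Int.natCast_nonneg _
    simp only [Int.natCast_natAbs] at h' h1 h2 ⊢
    constructor <;> linarith
  set e : ℕ+ → ℕ → ℤ → Ω → ℤ → ℝ := fun n m x ω => toProbVec M (u (reflectTime (N n) m) x ω)
  have he : ∀ n, IsEnv μ M w (e n) := fun n => hu.isEnv (reflectTime_injective (N n))
  -- The shift along the characteristic, of speed `-V`, cancels the mean drift; only the two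
  -- roundings remain, contributing `1` and `|V|`.
  have hcen : ∀ j n, |center V (N n - τ j n) (k j n) (N n) - pt j n| ≤ 1 + |V| := by
    intro j n
    have hnt : (0 : ℝ) ≤ n * (a j).1 := by positivity
    have h1 : |(⌊(n : ℝ) * (a j).1 * (-V)⌋ : ℝ) - n * (a j).1 * (-V)| ≤ 1 := by
      rw [abs_le]
      constructor <;> linarith [Int.floor_le ((n : ℝ) * (a j).1 * (-V)),
        Int.lt_floor_add_one ((n : ℝ) * (a j).1 * (-V))]
    have h2 : |(τ j n : ℝ) - n * (a j).1| ≤ 1 := by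
      rw [abs_le]
      constructor <;> linarith [Nat.floor_le hnt, Nat.lt_floor_add_one ((n : ℝ) * (a j).1)]
    have h3 : center V (N n - τ j n) (k j n) (N n) - pt j n
        = ((⌊(n : ℝ) * (a j).1 * (-V)⌋ : ℝ) - n * (a j).1 * (-V))
          + ((τ j n : ℝ) - n * (a j).1) * V := by
      simp only [center, k]
      rw [Nat.cast_sub (hτN j n)]
      push_cast
      ring
    rw [h3]
    refine (abs_add_le _ _).trans (add_le_add h1 ?_)
    rw [abs_mul]
    exact mul_le_of_le_one_left (abs_nonneg _) h2
  have hpt : ∀ j, Tendsto (fun n : ℕ+ => ((pt j n : ℝ) - n * ybar) / √n) atTop (𝓝 (a j).2) := by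
    intro j
    rw [tendsto_iff_norm_sub_tendsto_zero]
    refine squeeze_zero (fun n => norm_nonneg _) (g := fun n : ℕ+ => 2 * (√n)⁻¹) (fun n => ?_)
      (by simpa using tendsto_inv_sqrt_pnat.const_mul 2)
    have hsn := sqrt_pnat_pos n
    have h1 : ((pt j n : ℝ) - n * ybar) / √n - (a j).2
        = (((⌊(n : ℝ) * ybar⌋ : ℝ) - n * ybar) + ((⌊(a j).2 * √(n : ℝ)⌋ : ℝ) - (a j).2 * √n))
          / √n := by
      simp only [pt]
      push_cast
      field_simp
      ring
    rw [h1, norm_div, Real.norm_eq_abs, Real.norm_of_nonneg hsn.le, div_eq_mul_inv]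
    refine mul_le_mul_of_nonneg_right ?_ (inv_pos.2 hsn).le
    rw [abs_le]
    constructor <;> linarith [Int.floor_le ((n : ℝ) * ybar), Int.lt_floor_add_one ((n : ℝ) * ybar),
      Int.floor_le ((a j).2 * √(n : ℝ)), Int.lt_floor_add_one ((a j).2 * √(n : ℝ))]
  have hY : ∀ n i, Measurable (increment s n i) := fun n i =>
    (hs.measurable n i).sub (hs.measurable n (i - 1))
  have hind : ∀ n, Indep (info (e n) Set.univ)
      (MeasurableSpace.comap (fun ω i => increment s n i ω) MeasurableSpace.pi) μ := by
    intro n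
    refine indep_of_indep_of_le_left (indep_of_indep_of_le_right hindep ?_) ?_
    · refine measurable_iff_comap_le.1 ((@measurable_pi_iff Ω ℤ (fun _ => ℝ)
        (MeasurableSpace.comap (fun ω (p : ℕ+ × ℤ) => s p.1 p.2 ω) MeasurableSpace.pi) _ _).2
          fun i => ?_)
      have h : ∀ p : ℕ+ × ℤ, Measurable[MeasurableSpace.comap (fun ω (p : ℕ+ × ℤ) => s p.1 p.2 ω)
          MeasurableSpace.pi] (s p.1 p.2) := fun p =>
        (measurable_pi_apply p).comp (comap_measurable (fun ω (p : ℕ+ × ℤ) => s p.1 p.2 ω))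
      exact (h (n, i)).sub (h (n, i - 1))
    · refine iSup₂_le fun p _ => measurable_iff_comap_le.1 ?_
      exact (measurable_toProbVec M).comp ((measurable_pi_apply (reflectTime (N n) p.1, p.2)).comp
        (comap_measurable (fun ω (p : ℕ × ℤ) => u p.1 p.2 ω)))
  have hmain := tendsto_integral_cexp_heights (μ := μ) (M := M) (w := w) (by
      intro h; exact hspan (by rwa [← avgProb_congr hw]))
    ((elliptic_congr hw).2 hell) he (s := fun j n => N n - τ j n) (N := N) (R := R) (k := k)
    (pt := pt) (fun j n => Nat.sub_le _ _) (fun j n => (hRk j n).1) (fun j n => (hRk j n).2)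
    (T := T) (fun n => (Nat.floor_le (by positivity)).trans_eq (mul_comm _ _)) a
    (fun j => by
      refine (tendsto_nat_floor_mul_div_pnat (a j).1.2).congr fun n => ?_
      exact congrArg (fun m : ℕ => (m : ℝ) / n) (Nat.sub_sub_self (hτN j n)).symm)
    (c := fun n => n * ybar) hpt hcen (Y := increment s) hY
    (ρ := fun n i => rho (i / n)) (v := fun n i => v (i / n)) hα hα1 hint hC hs.mean hs.var
    (fun n i => hK' _) (ρ₀ := rho ybar) (v₀ := v ybar) hv₀ hκ hκlim
    (fun n i => (le_add_of_nonneg_right (abs_nonneg _)).trans (hmod n i))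
    (fun n i => (le_add_of_nonneg_left (abs_nonneg _)).trans (hmod n i)) hs.indep hind θ
  rw [kappa_congr hw, avgVar_congr hw] at hmain
  refine Tendsto.congr (fun n => integral_congr_ae ?_) hmain
  filter_upwards [hae] with ω hω
  congr 4
  rw [Finset.mul_sum]
  refine Finset.sum_congr rfl fun j _ => ?_
  rw [fluct, hVeq, height_congr (w' := fun τ x => toProbVec M (u τ x ω)) fun τ k => (hω τ k).symm]
  rw [mul_left_comm]
  congr 2
  have hm : pt j n ∈ box (R n) := mem_box.2 (le_trans
    (le_add_of_nonneg_right (by positivity)) (hRk j n).2)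
  have h := height_sub_eq_sum_tail (M := M) (w := fun τ x => toProbVec M (u τ x ω))
    (fun τ x => isProbVec_toProbVec M _) (fun x => s n x ω) (hτN j n) (hRk j n).1 hm
  refine Eq.trans ?_ h.symm
  rfl

end Fluctuations
-- The limiting process and convergence in distribution.
section LimitProcess

lemma charFun_map_toLp {Ω₀ ι : Type*} [MeasurableSpace Ω₀] [Fintype ι] {m : Measure Ω₀}
    {Y : Ω₀ → ι → ℝ} (hY : AEMeasurable Y m) (t : EuclideanSpace ℝ ι) :
    charFun (m.map fun ω => (WithLp.toLp 2 (Y ω) : EuclideanSpace ℝ ι)) t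
      = ∫ ω, Complex.exp ((∑ i, t i * Y ω i : ℝ) * Complex.I) ∂m := by
  have hm : AEMeasurable (fun ω => WithLp.toLp 2 (Y ω) : Ω₀ → EuclideanSpace ℝ ι) m :=
    (WithLp.measurable_toLp 2 _).comp_aemeasurable hY
  rw [charFun_apply, integral_map hm (by fun_prop)]
  simp only [PiLp.inner_apply, RCLike.inner_apply, conj_trivial]

lemma tendsto_atTop_pnat {α : Type*} {l : Filter α} {f : ℕ+ → α}
    (h : Tendsto (fun n => f (OrderIso.pnatIsoNat.symm n)) atTop l) : Tendsto f atTop l := by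
  rwa [← OrderIso.pnatIsoNat.symm.map_atTop, tendsto_map'_iff]

/-- The Cramér–Wold form of Lévy's continuity theorem for random vectors. -/
lemma tendstoInDistribution_of_tendsto_integral_cexp {Ω Ω' : Type*} [MeasurableSpace Ω]
    [MeasurableSpace Ω'] {μ : Measure Ω} [IsProbabilityMeasure μ] {P : Measure Ω'}
    [IsProbabilityMeasure P] {ι : Type*} [Fintype ι] {X : ℕ+ → Ω → ι → ℝ} {Z : Ω' → ι → ℝ}
    (hX : ∀ n, AEMeasurable (X n) μ) (hZ : AEMeasurable Z P)
    (h : ∀ θ : ι → ℝ, Tendsto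
      (fun n => ∫ ω, Complex.exp ((∑ i, θ i * X n ω i : ℝ) * Complex.I) ∂μ) atTop
      (𝓝 (∫ x, Complex.exp ((∑ i, θ i * Z x i : ℝ) * Complex.I) ∂P))) :
    TendstoInDistribution X atTop Z (fun _ => μ) P := by
  have key : TendstoInDistribution (fun n ω => (WithLp.toLp 2 (X n ω) : EuclideanSpace ℝ ι)) atTop
      (fun x => WithLp.toLp 2 (Z x)) (fun _ => μ) P := by
    refine ⟨fun n => (WithLp.measurable_toLp 2 _).comp_aemeasurable (hX n),
      (WithLp.measurable_toLp 2 _).comp_aemeasurable hZ, ?_⟩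
    refine tendsto_atTop_pnat (ProbabilityMeasure.tendsto_of_tendsto_charFun fun t => ?_)
    have h' := (h t).comp OrderIso.pnatIsoNat.symm.tendsto_atTop
    simp only [Function.comp_def, ProbabilityMeasure.coe_mk] at h' ⊢
    rw [charFun_map_toLp hZ]
    exact h'.congr fun n => (charFun_map_toLp (hX _) t).symm
  exact key.continuous_comp (g := fun x : EuclideanSpace ℝ ι => (fun i => x i : ι → ℝ))
    (by fun_prop)

variable {Ω : Type*} [MeasurableSpace Ω] {μ : Measure Ω} [IsProbabilityMeasure μ] {M : ℕ}
  {u : ℕ → ℤ → Ω → ℤ → ℝ} {rho v : ℝ → ℝ} {s : ℕ+ → ℤ → Ω → ℝ}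

lemma IsEnvironment.avgVar_nonneg (hu : IsEnvironment μ M u) : 0 ≤ avgVar μ M (u 0 0) :=
  Finset.sum_nonneg fun x _ => mul_nonneg (sq_nonneg _)
    (integral_nonneg_of_ae ((hu.nonneg 0 0).mono fun _ h => h x))

lemma limitCov_comm {w : Ω → ℤ → ℝ} (hw : 0 ≤ avgVar μ M w) (ρ₀ v₀ : ℝ) (a b : ℝ≥0 × ℝ) :
    limitCov μ M w ρ₀ v₀ a b = limitCov μ M w ρ₀ v₀ b a := by
  have h : ∀ c : ℝ, gaussAbs (b.2 - a.2) c = gaussAbs (a.2 - b.2) c := fun c => by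
    rw [← gaussAbs_neg, neg_sub]
  rw [limitCov, limitCov, GammaQ_eq _ hw, GammaQ_eq _ hw, Gamma0_eq hw, Gamma0_eq hw]
  simp only [h, abs_sub_comm (b.1 : ℝ), abs_sub_comm b.2, add_comm (b.1 : ℝ)]
  ring

/-- The numbers `exp(-Q/2)` are limits of characteristic functions, of modulus at most one, so the
quadratic form `Q` cannot be negative. -/
lemma limitCov_posSemidef (hu : IsEnvironment μ M u)
    (hell : Elliptic μ M (u 0 0)) (hspan : SpanOne μ (u 0 0))
    (hrho : ∃ K : ℝ, ∀ x, |rho x| ≤ K) (hv : ∃ K : ℝ, ∀ x, |v x| ≤ K)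
    (hholder : LocallyHolder rho v) (hs : IsInitialHeights μ rho v s)
    (hindep : IndepFun (fun (ω : Ω) (p : ℕ × ℤ) => u p.1 p.2 ω)
      (fun (ω : Ω) (p : ℕ+ × ℤ) => s p.1 p.2 ω) μ)
    (ybar : ℝ) (f : ℝ≥0 × ℝ →₀ ℝ) :
    0 ≤ f.sum fun a x => f.sum fun b y =>
      x * y * limitCov μ M (u 0 0) (rho ybar) (v ybar) a b := by
  have h := tendsto_integral_cexp_fluct hu hell hspan hrho hv hholder hs hindep ybar
    (J := f.support) (fun j => j.1) (fun j => f j.1)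
  have h1 := le_of_tendsto' h.norm fun n => (norm_integral_le_of_norm_le_const
    (Eventually.of_forall fun ω => (Complex.norm_exp_ofReal_mul_I _).le)).trans_eq
      (show 1 * μ.real Set.univ = 1 by simp)
  rw [Complex.norm_real, Real.norm_of_nonneg (Real.exp_pos _).le, Real.exp_le_one_iff] at h1
  simp only [Finsupp.sum]
  rw [← Finset.sum_coe_sort]
  simp_rw [← Finset.sum_coe_sort f.support (fun b => _ * f b * _)]
  linarith

lemma measurable_fluct (hu : IsEnvironment μ M u) (hs : IsInitialHeights μ rho v s)
    (b ybar : ℝ) (n : ℕ+) (a : ℝ≥0 × ℝ) : Measurable fun ω =>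
      fluct M b ybar n (fun τ x => u τ x ω) (fun x => s n x ω) a :=
  ((measurable_height hu.measurable (hs.measurable n) _ _).sub (hs.measurable n _)).const_mul _

end LimitProcess
end RAP

/-- The prelimit processes certify positive semidefiniteness of their own limit covariance, so the
Gaussian process exists; its characteristic functions are the limits already computed. -/
theorem mainTheorem1 {Ω : Type*} [MeasurableSpace Ω] (μ : Measure Ω) [IsProbabilityMeasure μ]
    (M : ℕ) (u : ℕ → ℤ → Ω → ℤ → ℝ) (hu : RAP.IsEnvironment μ M u)
    (hell : RAP.Elliptic μ M (u 0 0)) (hspan : RAP.SpanOne μ (u 0 0))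
    (rho v : ℝ → ℝ) (hrho : ∃ K : ℝ, ∀ x, |rho x| ≤ K) (hv : ∃ K : ℝ, ∀ x, |v x| ≤ K)
    (hholder : RAP.LocallyHolder rho v)
    (s : ℕ+ → ℤ → Ω → ℝ) (hs : RAP.IsInitialHeights μ rho v s)
    (hindep : IndepFun (fun (ω : Ω) (p : ℕ × ℤ) => u p.1 p.2 ω)
      (fun (ω : Ω) (p : ℕ+ × ℤ) => s p.1 p.2 ω) μ)
    (ybar : ℝ) :
    ∃ (Ω' : Type) (_ : MeasurableSpace Ω') (P : Measure Ω') (_ : IsProbabilityMeasure P)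
      (z : ℝ≥0 × ℝ → Ω' → ℝ),
      IsGaussianProcess z P ∧
      (∀ a, ∫ x, z a x ∂P = 0) ∧
      (∀ a b, ∫ x, z a x * z b x ∂P =
        rho ybar ^ 2 *
            RAP.GammaQ (RAP.kappa μ M (u 0 0)) (RAP.avgVar μ M (u 0 0)) a b
          + v ybar * RAP.Gamma0 (RAP.avgVar μ M (u 0 0)) a b) ∧
      ∀ (k : ℕ) (a : Fin k → ℝ≥0 × ℝ),
        TendstoInDistribution
          (fun (n : ℕ+) (ω : Ω) (i : Fin k) =>
            RAP.fluct M (-RAP.meanDrift μ M (u 0 0)) ybar n (fun τ x => u τ x ω)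
              (fun x => s n x ω) (a i))
          atTop (fun (x : Ω') (i : Fin k) => z (a i) x) (fun _ => μ) P := by
  obtain ⟨Ω', m', P, hP, z, hz, hmean, hcov, hcf⟩ := RAP.exists_gaussianProcess (ℝ≥0 × ℝ)
    (RAP.limitCov μ M (u 0 0) (rho ybar) (v ybar))
    (fun a b => RAP.limitCov_comm hu.avgVar_nonneg _ _ a b)
    (RAP.limitCov_posSemidef hu hell hspan hrho hv hholder hs hindep ybar)
  refine ⟨Ω', m', P, hP, z, hz, hmean, hcov, fun k a => ?_⟩
  refine RAP.tendstoInDistribution_of_tendsto_integral_cexp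
    (fun n => (measurable_pi_lambda _ fun i =>
      RAP.measurable_fluct hu hs _ ybar n (a i)).aemeasurable)
    (aemeasurable_pi_lambda _ fun i => hz.aemeasurable (a i)) fun θ => ?_
  rw [hcf]
  convert RAP.tendsto_integral_cexp_fluct hu hell hspan hrho hv hholder hs hindep ybar a θ using 2
  push_cast
  rw [neg_div]
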